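/- **Setting.** Let $\mathcal X$ be a complex Banach space. For $\omega>0$ let $S_\omega=\{z\neq0:|\arg z|<\omega\}$. A linear operator $\mathcal A$ on $\mathcal X$ with domain $D(\mathcal A)$ and range $\mathcal R(\mathcal A)$ (not assumed injective or densely defined) is *sectorial* if for some $\omega_0\in[0,\pi)$ its spectrum lies in $\overline{S_{\omega_0}}$ (in $[0,\infty)$ if $\omega_0=0$) and $\sup\{\|zR(z,\mathcal A)\|: z\notin\overline{S_{\omega'}}\}<\infty$ for every $\omega'\in(\omega_0,\pi)$; here $R(z,\mathcal A)=(z-\mathcal A)^{-1}$. The least such $\omega_0$ is the sectoriality angle $\omega_{\mathcal A}$. Let $\omega\in(\omega_{\mathcal A},\pi)$. $H^\infty_0(S_\omega)$ is the set of holomorphic $f$ on $S_\omega$ with $|f(z)|\le C\min(|z|^\alpha,|z|^{-\alpha})$ for some $C,\alpha>0$, and $\mathcal E(S_\omega)=H_0^\infty(S_\omega)\oplus\langle(1+z)^{-1}\rangle\oplus\langle1\rangle$. For $f=g+c(1+z)^{-1}+d$ with $g\in H_0^\infty(S_\omega)$ one sets $f(\mathcal A)=\frac1{2\pi i}\int_{\partial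 S_\delta}g(z)R(z,\mathcal A)\,dz+c(1+\mathcal A)^{-1}+d$, with any $\delta\in(\omega_{\mathcal A},\omega)$. For $p\in[1,\infty]$ and $\mu\in\mathbb R$ let $\Phi=L^p(t^\mu)$ over $(0,\infty)$, with norm $(\int_0^\infty|g(t)|^pt^\mu\,dt)^{1/p}$ if $p<\infty$ and $\operatorname{ess\,sup}_{t>0}t^\mu|g(t)|$ if $p=\infty$. For $\psi\in\mathcal E(S_\omega)$ put $$[x]_{\Phi,\psi}=\big\|\,t\mapsto\|t^{-1}\psi(t\mathcal A)x\|_{\mathcal X}\big\|_\Phi\in[0,\infty],\qquad \mathcal X_{\Phi,\psi}=\{x\in\mathcal X:[x]_{\Phi,\psi}<\infty\}.$$ Two such $[0,\infty]$-valued seminorms $N,M$ are *equivalent on $\mathcal X$* if $N(x)\le C\,M(x)$ and $M(x)\le C\,N(x)$ for some $C\in(0,\infty)$ and all $x\in\mathcal X$. A *bounded holomorphic semigroup* is a family $\mathcal T=(\mathcal T(t))_{t>0}$ of bounded operators with $\mathcal T(t+s)=\mathcal T(t)\mathcal T(s)$, strongly continuous on $(0,\infty)$, bounded for $t\in(0,1)$,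 such that $\mathcal T(t)x=0$ for all $t>0$ implies $x=0$, and which has a bounded holomorphic extension to some sector $S_\delta$, $\delta\in(0,\pi/2]$. Its generator is the operator $-\mathcal A$ with $(\lambda+\mathcal A)^{-1}x=\int_0^\infty e^{-\lambda t}\mathcal T(t)x\,dt$ for all large $\lambda$ and all $x\in\mathcal X$. In that case put $[x]_{\Phi,\mathcal A}=\big\|\,t\mapsto\|\mathcal A\mathcal T(t)x\|_{\mathcal X}\big\|_\Phi$ and $K_\Phi(\mathcal X,D_{\mathcal A})=\{x\in\mathcal X:\ t^{-1}K(t,x)\in\Phi\}$, where $K(t,x)=\inf_{z\in D(\mathcal A)}\big(\|x-z\|+t(\|z\|+\|\mathcal Az\|)\big)$. Finally let $$\psi_1(z)=e^{-z}-1,\quad\psi_2(z)=z(1+z)^{-1},\quad\psi_3(z)=z(1+z)^{-2},\quad\psi(z)=ze^{-z}.$$ **Proposition.** Let $\mathcal A$ be a sectorial operator on $\mathcal X$. (i) Let $p\in[1,\infty]$, $\mu\in\mathbb R$, $\Phi=L^p(t^\mu)$, and let $\theta=1-\frac{\mu+1}p$ if $p<\infty$, $\theta=1-\mu$ if $p=\infty$.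 Let $\omega\in(\omega_{\mathcal A},\pi)$ and let $\psi,\gamma\in\mathcal E(S_\omega)\setminus\{0\}$ be such that $z^{-\theta}\psi,\ z^{-\theta}\gamma\in H^\infty_0(S_\omega)$. If each $\xi\in\{\psi,\gamma\}$ satisfies either $\xi\in H^\infty_0(S_\omega)$, or $$\mathcal X_{\Phi,\xi}\subset\overline{D(\mathcal A)}\quad\text{and}\quad\xi(\mathcal A)\,\overline{D(\mathcal A)}\subset\mathcal R(\mathcal A),$$ then $[\cdot]_{\Phi,\psi}$ and $[\cdot]_{\Phi,\gamma}$ are equivalent on $\mathcal X$. (ii) If, in addition, $-\mathcal A$ generates a bounded holomorphic semigroup $\mathcal T$ on $\mathcal X$ (then $\omega_{\mathcal A}<\pi/2$, and we take any $\omega\in(\omega_{\mathcal A},\pi/2)$), then for every $\theta\in(0,1)$ and for $\Phi=L^p(t^{p(1-\theta)-1})$ with $p\in[1,\infty)$ or $\Phi=L^\infty(t^{1-\theta})$, each $[\cdot]_{\Phi,\psi_j}$, $j=1,2,3$, is equivalent on $\mathcal X$ to $[\cdot]_{\Phi,\mathcal A}$, and $K_\Phi(\mathcal X,D_{\mathcal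 A})=\mathcal X_{\Phi,\psi_j}$ as sets. For $\Phi=L^\infty(t)$ (that is, $\theta=0$), $\mathcal X_{\Phi,\psi_2}=\mathcal X_{\Phi,\psi}=\mathcal X$. (iii) If $-\mathcal A$ generates a bounded holomorphic semigroup $\mathcal T$ on $\mathcal X$ and $\mathcal Ay\ne0$ for some $y\in D(\mathcal A)$, then the equivalences of (ii) fail for $\theta=0$ and every $p\in[1,\infty)$: for $\Phi=L^p(t^{p-1})$ the seminorms $[\cdot]_{\Phi,\psi_3}$ and $[\cdot]_{\Phi,\mathcal A}$ are equivalent on $\mathcal X$, but $[\cdot]_{\Phi,\psi_2}$, and likewise $[\cdot]_{\Phi,\psi_1}$, is equivalent to neither of them. -/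

import Mathlib

open Set Filter Topology MeasureTheory
open scoped ENNReal

noncomputable section

/-! ### Unbounded operators, resolvents, sectoriality -/

/-- `R` is the bounded everywhere defined inverse `(z - A)⁻¹`. -/
def IsOpResolvent {X : Type*} [NormedAddCommGroup X] [NormedSpace ℂ X]
    (A : X →ₗ.[ℂ] X) (z : ℂ) (R : X →L[ℂ] X) : Prop :=
  (∀ x : X, ∃ h : R x ∈ A.domain, z • R x - A ⟨R x, h⟩ = x) ∧
    ∀ x : A.domain, R (z • (x : X) - A x) = x

/-- The resolvent set `ρ(A)`. -/
def opResolventSet {X : Type*} [NormedAddCommGroup X] [NormedSpace ℂ X]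
    (A : X →ₗ.[ℂ] X) : Set ℂ :=
  {z | ∃ R : X →L[ℂ] X, IsOpResolvent A z R}

open Classical in
/-- The resolvent `R(z, A) = (z - A)⁻¹`, with the value `0` outside `ρ(A)`. -/
def opResolvent {X : Type*} [NormedAddCommGroup X] [NormedSpace ℂ X]
    (A : X →ₗ.[ℂ] X) (z : ℂ) : X →L[ℂ] X :=
  if h : ∃ R : X →L[ℂ] X, IsOpResolvent A z R then h.choose else 0

/-- The range `R(A)`. -/
def opRange {X : Type*} [NormedAddCommGroup X] [NormedSpace ℂ X]
    (A : X →ₗ.[ℂ] X) : Set X :=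
  {y | ∃ x : A.domain, A x = y}

/-- The open sector `S_ω`. -/
def openSector (ω : ℝ) : Set ℂ := {z | z ≠ 0 ∧ |z.arg| < ω}

/-- `A` is sectorial of angle `ω₀ ∈ [0, π)`: the spectrum lies in the closed sector of half-angle
`ω₀`, and `z R(z, A)` is bounded outside each larger sector. Neither density of the domain
nor injectivity is required; closedness follows from `ρ(A) ≠ ∅`. -/
def IsSectorialOfAngle {X : Type*} [NormedAddCommGroup X] [NormedSpace ℂ X]
    (A : X →ₗ.[ℂ] X) (ω₀ : ℝ) : Prop :=
  0 ≤ ω₀ ∧ ω₀ < Real.pi ∧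
    (∀ z : ℂ, z ≠ 0 → ω₀ < |z.arg| → z ∈ opResolventSet A) ∧
    ∀ ω' : ℝ, ω₀ < ω' → ω' < Real.pi →
      ∃ M : ℝ, ∀ z : ℂ, z ≠ 0 → ω' < |z.arg| → ‖z • opResolvent A z‖ ≤ M

/-- `A` is sectorial (of some angle). -/
def IsSectorialOp {X : Type*} [NormedAddCommGroup X] [NormedSpace ℂ X]
    (A : X →ₗ.[ℂ] X) : Prop :=
  ∃ ω₀ : ℝ, IsSectorialOfAngle A ω₀

/-- The sectoriality angle `ω_A`. -/
def sectorialityAngle {X : Type*} [NormedAddCommGroup X] [NormedSpace ℂ X]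
    (A : X →ₗ.[ℂ] X) : ℝ :=
  sInf {ω₀ : ℝ | IsSectorialOfAngle A ω₀}

/-! ### The function classes and the functional calculus -/

/-- `f ∈ H^∞_0(S_ω)`. Boundedness of `f` is contained in the estimate. -/
def MemHInftyZero (ω : ℝ) (f : ℂ → ℂ) : Prop :=
  DifferentiableOn ℂ f (openSector ω) ∧
    ∃ C α : ℝ, 0 < C ∧ 0 < α ∧
      ∀ z ∈ openSector ω, ‖f z‖ ≤ C * min (‖z‖ ^ α) (‖z‖ ^ (-α))

/-- `f ∈ 𝓔(S_ω) = H^∞_0(S_ω) ⊕ ⟨(1+z)⁻¹⟩ ⊕ ⟨1⟩`. -/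
def MemElementary (ω : ℝ) (f : ℂ → ℂ) : Prop :=
  ∃ c d : ℂ, MemHInftyZero ω (fun z => f z - c * (1 + z)⁻¹ - d)

/-- `∫ f(z) R(z, A) dz` along the ray `r ↦ r e^{iφ}`, traversed from `0` to `∞`. -/
def rayIntegral {X : Type*} [NormedAddCommGroup X] [NormedSpace ℂ X]
    (A : X →ₗ.[ℂ] X) (f : ℂ → ℂ) (φ : ℝ) : X →L[ℂ] X :=
  ∫ r in Ioi (0 : ℝ),
    (f ((r : ℂ) * Complex.exp (φ * Complex.I)) * Complex.exp (φ * Complex.I)) •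
      opResolvent A ((r : ℂ) * Complex.exp (φ * Complex.I))

/-- The Cauchy integral `(2πi)⁻¹ ∫_{∂S_δ} f(z) R(z, A) dz`, the boundary of the sector `S_δ` being
oriented so that `S_δ` lies to the left. -/
def cauchyCalc {X : Type*} [NormedAddCommGroup X] [NormedSpace ℂ X]
    (A : X →ₗ.[ℂ] X) (δ : ℝ) (f : ℂ → ℂ) : X →L[ℂ] X :=
  (2 * (Real.pi : ℂ) * Complex.I)⁻¹ • (rayIntegral A f (-δ) - rayIntegral A f δ)

/-- The coefficient `d = f(∞)` in `f = g + c (1+z)⁻¹ + d` with `g ∈ H^∞_0`. -/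
def valueAtInfty (f : ℂ → ℂ) : ℂ := limUnder atTop (fun r : ℝ => f (r : ℂ))

/-- The number `f(0) = c + d` for `f = g + c (1+z)⁻¹ + d` with `g ∈ H^∞_0`. -/
def valueAtZero (f : ℂ → ℂ) : ℂ := limUnder (𝓝[>] (0 : ℝ)) (fun r : ℝ => f (r : ℂ))

/-- `f(A)` for `f ∈ 𝓔(S_ω)`: if `f = g + c (1+z)⁻¹ + d` with `g ∈ H^∞_0(S_ω)`, then
`f(A) = g(A) + c (1 + A)⁻¹ + d`, where `g(A)` is the Cauchy integral over `∂S_δ`. The value does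
not depend on the contour angle `δ ∈ (ω_A, ω)`; the midpoint is used. -/
def elementaryCalc {X : Type*} [NormedAddCommGroup X] [NormedSpace ℂ X]
    (A : X →ₗ.[ℂ] X) (ω : ℝ) (f : ℂ → ℂ) : X →L[ℂ] X :=
  cauchyCalc A ((sectorialityAngle A + ω) / 2)
      (fun z => f z - (valueAtZero f - valueAtInfty f) * (1 + z)⁻¹ - valueAtInfty f) +
    (valueAtZero f - valueAtInfty f) • opResolvent (-A) 1 +
    valueAtInfty f • ContinuousLinearMap.id ℂ X

/-! ### Weighted Lebesgue spaces over the half-line and the seminorms -/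

open Classical in
/-- The norm, with value `∞` outside the space, of `Φ = L^p(t^μ)` over `(0, ∞)`:
`(∫ |g(t)|^p t^μ dt)^{1/p}` if `p < ∞`, and `ess sup t^μ |g(t)|` if `p = ∞`. -/
def weightedNorm (p : ℝ≥0∞) (μ : ℝ) (g : ℝ → ℝ) : ℝ≥0∞ :=
  if p = ∞ then eLpNorm (fun t : ℝ => t ^ μ * g t) ∞ (volume.restrict (Ioi 0))
  else eLpNorm g p
    ((volume.restrict (Ioi (0 : ℝ))).withDensity (fun t => ENNReal.ofReal (t ^ μ)))

open Classical in
/-- The number `θ` attached to `L^p(t^μ)`: `1 - (μ+1)/p` if `p < ∞`, and `1 - μ` if `p = ∞`. -/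
def thetaOf (p : ℝ≥0∞) (μ : ℝ) : ℝ :=
  if p = ∞ then 1 - μ else 1 - (μ + 1) / p.toReal

open Classical in
/-- The exponent `μ` for which `L^p(t^μ)` is the parameter of real interpolation with exponent `θ`:
`p(1-θ) - 1` if `p < ∞`, and `1 - θ` if `p = ∞`. -/
def muOf (p : ℝ≥0∞) (θ : ℝ) : ℝ :=
  if p = ∞ then 1 - θ else p.toReal * (1 - θ) - 1

/-- `[x]_{Φ,ψ} = ‖t⁻¹ ψ(tA) x‖_{Φ(X)}` for `Φ = L^p(t^μ)` and `ψ ∈ 𝓔(S_ω)`, as an element of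
`[0, ∞]`. -/
def calcSeminorm {X : Type*} [NormedAddCommGroup X] [NormedSpace ℂ X]
    (A : X →ₗ.[ℂ] X) (ω : ℝ) (p : ℝ≥0∞) (μ : ℝ) (ψ : ℂ → ℂ) (x : X) : ℝ≥0∞ :=
  weightedNorm p μ (fun t => ‖(t : ℂ)⁻¹ • elementaryCalc ((t : ℂ) • A) ω ψ x‖)

/-- The set `X_{Φ,ψ}`. -/
def calcSpace {X : Type*} [NormedAddCommGroup X] [NormedSpace ℂ X]
    (A : X →ₗ.[ℂ] X) (ω : ℝ) (p : ℝ≥0∞) (μ : ℝ) (ψ : ℂ → ℂ) : Set X :=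
  {x | calcSeminorm A ω p μ ψ x < ∞}

/-- Equivalence on `X` of two `[0, ∞]`-valued seminorms; in particular they are finite at the
same points. -/
def EquivSeminorms {X : Type*} (N M : X → ℝ≥0∞) : Prop :=
  ∃ C : NNReal, 0 < C ∧ ∀ x : X, N x ≤ C * M x ∧ M x ≤ C * N x

/-- The range/domain condition: `X_{Φ,ξ} ⊆ closure D(A)` and `ξ(A) (closure D(A)) ⊆ R(A)`. -/
def McIntoshCondition {X : Type*} [NormedAddCommGroup X] [NormedSpace ℂ X]
    (A : X →ₗ.[ℂ] X) (ω : ℝ) (p : ℝ≥0∞) (μ : ℝ) (ξ : ℂ → ℂ) : Prop :=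
  calcSpace A ω p μ ξ ⊆ closure (A.domain : Set X) ∧
    ∀ x ∈ closure (A.domain : Set X), elementaryCalc A ω ξ x ∈ opRange A

/-! ### Bounded holomorphic semigroups -/

/-- `T`, restricted to `(0, ∞)`, is a bounded holomorphic semigroup: a semigroup (strongly
continuous on `(0, ∞)`, bounded near `0`, nondegenerate, not necessarily strongly continuous at
`0`) with a bounded holomorphic extension to some sector. -/
structure IsBoundedHolomorphicSemigroup {X : Type*} [NormedAddCommGroup X] [NormedSpace ℂ X]
    (T : ℝ → X →L[ℂ] X) : Prop where
  add : ∀ s t : ℝ, 0 < s → 0 < t → T (s + t) = (T s).comp (T t)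
  continuousOn : ∀ x : X, ContinuousOn (fun t => T t x) (Ioi 0)
  bounded : ∃ M : ℝ, ∀ t : ℝ, 0 < t → t < 1 → ‖T t‖ ≤ M
  nondegenerate : ∀ x : X, (∀ t : ℝ, 0 < t → T t x = 0) → x = 0
  extension : ∃ (δ : ℝ) (F : ℂ → X →L[ℂ] X), 0 < δ ∧ δ ≤ Real.pi / 2 ∧
    DifferentiableOn ℂ F (openSector δ) ∧ (∃ M : ℝ, ∀ z ∈ openSector δ, ‖F z‖ ≤ M) ∧
    ∀ t : ℝ, 0 < t → F (t : ℂ) = T t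

/-- `B` is the generator of `T`: `R(lam, B) x = ∫_0^∞ e^{-lam t} T(t) x dt` for all large `lam`. -/
def IsGeneratorOf {X : Type*} [NormedAddCommGroup X] [NormedSpace ℂ X]
    (B : X →ₗ.[ℂ] X) (T : ℝ → X →L[ℂ] X) : Prop :=
  ∃ ω : ℝ, ∀ lam : ℝ, ω < lam → (lam : ℂ) ∈ opResolventSet B ∧
    ∀ x : X, opResolvent B (lam : ℂ) x =
      ∫ t in Ioi (0 : ℝ), Complex.exp (-(lam : ℂ) * (t : ℂ)) • T t x

open Classical in
/-- `A x` for `x ∈ D(A)`, and `0` for other `x`. -/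
def applyOp {X : Type*} [NormedAddCommGroup X] [NormedSpace ℂ X]
    (A : X →ₗ.[ℂ] X) (x : X) : X :=
  if h : x ∈ A.domain then A ⟨x, h⟩ else 0

/-- `[x]_{Φ,A} = ‖A T(·) x‖_{Φ(X)}` for `Φ = L^p(t^μ)`. Note that `T(t) x ∈ D(A)` for `t > 0` when
`-A` generates the bounded holomorphic semigroup `T`. -/
def homogeneousSeminorm {X : Type*} [NormedAddCommGroup X] [NormedSpace ℂ X]
    (A : X →ₗ.[ℂ] X) (T : ℝ → X →L[ℂ] X) (p : ℝ≥0∞) (μ : ℝ) (x : X) : ℝ≥0∞ :=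
  weightedNorm p μ (fun t => ‖applyOp A (T t x)‖)

/-! ### The `K`-method for the couple `(X, D_A)` -/

/-- The `K`-functional `K(t, x; X, D_A)`, where `D_A` is `D(A)` with the graph norm. -/
def kFunctional {X : Type*} [NormedAddCommGroup X] [NormedSpace ℂ X]
    (A : X →ₗ.[ℂ] X) (t : ℝ) (x : X) : ℝ :=
  ⨅ z : A.domain, (‖x - (z : X)‖ + t * (‖(z : X)‖ + ‖A z‖))

/-- The set `K_Φ(X, D_A) = {x : t⁻¹ K(t, x) ∈ Φ}` for `Φ = L^p(t^μ)`. -/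
def kSpace {X : Type*} [NormedAddCommGroup X] [NormedSpace ℂ X]
    (A : X →ₗ.[ℂ] X) (p : ℝ≥0∞) (μ : ℝ) : Set X :=
  {x | weightedNorm p μ (fun t => t⁻¹ * kFunctional A t x) < ∞}

/-! ### The special functions -/

/-- `ψ₁(z) = e^{-z} - 1`. -/
def psiOne (z : ℂ) : ℂ := Complex.exp (-z) - 1

/-- `ψ₂(z) = z (1+z)⁻¹`. -/
def psiTwo (z : ℂ) : ℂ := z * (1 + z)⁻¹

/-- `ψ₃(z) = z (1+z)⁻²`. -/
def psiThree (z : ℂ) : ℂ := z * ((1 + z) ^ 2)⁻¹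

/-- `ψ(z) = z e^{-z}`. -/
def psiExp (z : ℂ) : ℂ := z * Complex.exp (-z)

end

/-!
Everything happens in the exponential coordinate `z = e^w`. It turns the sector `S_ω` into the strip
`|Im w| < ω`, the boundary integrals of the calculus into integrals over horizontal lines
(`stripInt`), dilations into translations, and the weighted norm of `t⁻¹ ψ(tA) x` into the
`L^p(du)` norm of `calcOrbit`, `u ↦ e^{-θu} ψ(e^u A) x` (`weightedNorm_eq`). The Cauchy formula for
the strip makes the calculus on `𝓔(S_ω)` well defined, multiplicative (`CalcAngle.calc_mul`) and
compatible with dilations (`CalcAngle.calc_smul`).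

*Comparison of square functions.* Each nonzero `ψ ∈ 𝓔` has a partner `η ∈ H^∞_0`, decaying as fast
as desired, with `∫_0^∞ η(tz) ψ(tz) dt/t = 1` (`MemElementary.exists_reproducing`). Write
`γ_s(z) = γ(sz)`. If `e γ_s ∈ H^∞_0`, then `(e γ_s)(A) x` is the integral of
`e(A) (γ_s η_t)(A) ψ(tA) x dt/t`, and the operators `(γ_s η_t)(A)` decay exponentially in
`|log(s/t)|` even after the weights are put in (`CalcAngle.norm_calc_mul_dilate_le`). Young's
inequality (`eLpNorm_le_of_le_convolution`) then bounds the weighted norm of `s ↦ (e γ_s)(A) x` by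
the one of `ψ`, uniformly for uniformly bounded `e(A)`.
For `γ ∈ H^∞_0` one takes `e = 1`. In general, `γ_s` is approximated by `e γ_s` with two families of
regularizers (`CalcAngle.exists_calcSeminorm_le_of_regularizer`):

* for `θ > 0`, `e(A) = (1 + tA)⁻¹` with `t → 0`, which converges to the identity on the closure of
  the domain; a finite square function forces the point into that closure
  (`CalcAngle.mem_closure_domain`);
* for `θ < 0`, `e(A) = 1 - (1 + tA)⁻¹` with `t → ∞`, where the range condition on `γ` gives the
  convergence (`CalcAngle.tendsto_unitResolvent_calc_atTop`).

For `θ = 0` the decay hypothesis already says `γ ∈ H^∞_0`. This gives `CalcAngle.equivSeminorms`.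

*Semigroups.* Laplace transforms along rotated rays yield resolvent bounds on a sector larger than a
half-plane, so the angle is less than `π/2`
(`IsBoundedHolomorphicSemigroup.sectorialityAngle_lt`). Both `T(t)` and `e^{-tA}`,
defined by the calculus, satisfy the differential equation `u' = -A u` after multiplication by
`J = (1 + A)⁻¹`, and both tend to `J` as `t → 0` after this multiplication, so they agree
(`semigroup_eq_calc`) and the homogeneous seminorm is the one
of `z e^{-z}` (`homogeneousSeminorm_eq`). For `0 < θ < 1` the
functions `ψ₁`, `ψ₂`, `ψ₃` and `z e^{-z}` all have the decay required for the comparison. The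
`K`-functional is equivalent to `‖x - (1 + tA)⁻¹ x‖` up to `min(1, t) ‖x‖`, and the weighted norm of
that last term is finite, so `ψ₂` has the same space (`CalcAngle.kSpace_eq`).

*The case `θ = 0`.* Here `ψ₃` and `z e^{-z}` are in `H^∞_0` and `ψ₁`, `ψ₂` are not. For `p < ∞`, the
seminorm of `ψ₂` is finite only on the kernel of `A` (`CalcAngle.unitResolvent_eq_of_psiTwo`), and
it is dominated by the one of `ψ₁`, the resolvent being an average of the semigroup. The seminorm
of `ψ₃`, however, is finite at all `ψ₃(A) y`, which is not in the kernel when `A y ≠ 0`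
(`CalcAngle.exists_psiThree_lt_top`).
-/

/-! ### Integrals of holomorphic functions along horizontal lines -/

theorem integrable_exp_neg_mul_abs {α : ℝ} (hα : 0 < α) :
    Integrable (fun u : ℝ => Real.exp (-(α * |u|))) := by
  rw [← integrableOn_univ, ← Iic_union_Ioi (a := (0 : ℝ))]
  refine IntegrableOn.union ?_ ?_
  · refine (integrableOn_exp_mul_Iic hα 0).congr_fun (fun u hu => ?_) measurableSet_Iic
    simp [abs_of_nonpos (mem_Iic.1 hu)]
  · refine (integrableOn_exp_mul_Ioi (neg_neg_of_pos hα) 0).congr_fun (fun u hu => ?_)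
      measurableSet_Ioi
    simp [abs_of_pos (mem_Ioi.1 hu)]

/-- The substitution `r = e^u` between the half-line and the real line. -/
theorem integral_comp_exp_univ {E : Type*} [NormedAddCommGroup E] [NormedSpace ℝ E] (g : ℝ → E) :
    ∫ r in Ioi (0 : ℝ), g r = ∫ u : ℝ, Real.exp u • g (Real.exp u) := by
  have h := integral_image_eq_integral_abs_deriv_smul (s := univ) (f := Real.exp)
    MeasurableSet.univ (fun x _ => (Real.hasDerivAt_exp x).hasDerivWithinAt)
    Real.exp_injective.injOn g
  simpa [image_univ, Real.range_exp, abs_of_pos (Real.exp_pos _)] using h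

section Lines

variable {E : Type*} [NormedAddCommGroup E] [NormedSpace ℂ E]

/-- The integral of `H` over the horizontal line `Im w = φ`. -/
noncomputable def lineInt (φ : ℝ) (H : ℂ → E) : E := ∫ u : ℝ, H ((u : ℂ) + (φ : ℂ) * Complex.I)

/-- The Cauchy-type integral over the boundary of the strip `|Im w| < δ`. Under `z = exp w` this is
the integral over the boundary of the sector `S_δ` with respect to `(2πi)⁻¹ dz / z`. -/
noncomputable def stripInt (δ : ℝ) (H : ℂ → E) : E :=
  (2 * (Real.pi : ℂ) * Complex.I)⁻¹ • (lineInt (-δ) H - lineInt δ H)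

theorem norm_two_pi_I_inv_le : ‖(2 * (Real.pi : ℂ) * Complex.I)⁻¹‖ ≤ 1 := by
  rw [norm_inv]
  apply inv_le_one_of_one_le₀
  simp only [Complex.norm_mul, Complex.norm_ofNat, Complex.norm_real, Real.norm_eq_abs,
    Complex.norm_I, mul_one, abs_of_pos Real.pi_pos]
  linarith [Real.pi_gt_three]

theorem line_re (u φ : ℝ) : ((u : ℂ) + (φ : ℂ) * Complex.I).re = u := by simp

theorem line_im (u φ : ℝ) : ((u : ℂ) + (φ : ℂ) * Complex.I).im = φ := by simp

theorem continuous_line {H : ℂ → E} {φ : ℝ}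
    (hd : ∀ w : ℂ, w.im = φ → DifferentiableAt ℂ H w) :
    Continuous (fun u : ℝ => H ((u : ℂ) + (φ : ℂ) * Complex.I)) := by
  rw [continuous_iff_continuousAt]
  intro u
  have h1 : ContinuousAt H ((u : ℂ) + (φ : ℂ) * Complex.I) := (hd _ (line_im u φ)).continuousAt
  exact ContinuousAt.comp (f := fun u : ℝ => (u : ℂ) + (φ : ℂ) * Complex.I) h1 (by fun_prop)

theorem integrable_line {H : ℂ → E} {φ C α N : ℝ} (hα : 0 < α)
    (hd : ∀ w : ℂ, w.im = φ → DifferentiableAt ℂ H w)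
    (hb : ∀ w : ℂ, w.im = φ → N ≤ |w.re| → ‖H w‖ ≤ C * Real.exp (-(α * |w.re|))) :
    Integrable (fun u : ℝ => H ((u : ℂ) + (φ : ℂ) * Complex.I)) := by
  refine (continuous_line hd).locallyIntegrable.integrable_of_isBigO_cocompact
    (g := fun u : ℝ => Real.exp (-(α * |u|))) ?_
    ((integrable_exp_neg_mul_abs hα).integrableAtFilter _)
  refine Asymptotics.IsBigO.of_bound C ?_
  have : ∀ᶠ u : ℝ in cocompact ℝ, N ≤ ‖u‖ := tendsto_norm_cocompact_atTop.eventually_ge_atTop N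
  filter_upwards [this] with u hu
  have := hb _ (line_im u φ) (by simpa using hu)
  rw [line_re] at this
  rwa [Real.norm_of_nonneg (Real.exp_pos _).le]

/-- Cauchy's theorem for a horizontal strip: horizontal line integrals of a holomorphic function
with exponential decay agree. -/
theorem lineInt_eq {H : ℂ → E} {a b C α N : ℝ} (hab : a ≤ b) (hα : 0 < α)
    (hd : ∀ w : ℂ, a ≤ w.im → w.im ≤ b → DifferentiableAt ℂ H w)
    (hb : ∀ w : ℂ, a ≤ w.im → w.im ≤ b → N ≤ |w.re| → ‖H w‖ ≤ C * Real.exp (-(α * |w.re|))) :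
    lineInt a H = lineInt b H := by
  by_cases hE : CompleteSpace E
  swap
  · simp [lineInt, integral, hE]
  have hia : Integrable (fun u : ℝ => H ((u : ℂ) + (a : ℂ) * Complex.I)) :=
    integrable_line hα (fun w hw => hd w hw.ge (hw.le.trans hab))
      (fun w hw => hb w hw.ge (hw.le.trans hab))
  have hib : Integrable (fun u : ℝ => H ((u : ℂ) + (b : ℂ) * Complex.I)) :=
    integrable_line hα (fun w hw => hd w (hab.trans hw.ge) hw.le)
      (fun w hw => hb w (hab.trans hw.ge) hw.le)
  have hta := intervalIntegral_tendsto_integral hia tendsto_neg_atTop_atBot tendsto_id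
  have htb := intervalIntegral_tendsto_integral hib tendsto_neg_atTop_atBot tendsto_id
  have hexp : Tendsto (fun T : ℝ => C * Real.exp (-(α * |T|)) * |b - a|) atTop (𝓝 0) := by
    have h1 : Tendsto (fun T : ℝ => -(α * |T|)) atTop atBot :=
      tendsto_neg_atTop_atBot.comp ((tendsto_abs_atTop_atTop).const_mul_atTop hα)
    simpa using ((Real.tendsto_exp_atBot.comp h1).const_mul C).mul_const |b - a|
  have hvert : ∀ s : ℝ → ℝ, (∀ T, |s T| = |T|) → Tendsto (fun T : ℝ =>
      Complex.I • ∫ y : ℝ in a..b, H ((s T : ℂ) + (y : ℂ) * Complex.I)) atTop (𝓝 0) := by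
    intro s hs
    rw [tendsto_zero_iff_norm_tendsto_zero]
    refine squeeze_zero' (Eventually.of_forall fun _ => norm_nonneg _) ?_ hexp
    filter_upwards [eventually_ge_atTop (max N 0)] with T hT
    rw [norm_smul, Complex.norm_I, one_mul]
    refine intervalIntegral.norm_integral_le_of_norm_le_const (fun y hy => ?_)
    rw [uIoc_of_le hab] at hy
    have := hb ((s T : ℂ) + (y : ℂ) * Complex.I) (by simpa using hy.1.le) (by simpa using hy.2)
      (by rw [line_re, hs]; exact (le_max_left _ _).trans (hT.trans (le_abs_self _)))
    rwa [line_re, hs] at this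
  have hrect : ∀ T : ℝ, (∫ x : ℝ in -T..T, H ((x : ℂ) + (a : ℂ) * Complex.I)) -
      (∫ x : ℝ in -T..T, H ((x : ℂ) + (b : ℂ) * Complex.I)) +
      Complex.I • (∫ y : ℝ in a..b, H ((T : ℂ) + (y : ℂ) * Complex.I)) -
      Complex.I • (∫ y : ℝ in a..b, H (((-T : ℝ) : ℂ) + (y : ℂ) * Complex.I)) = 0 := by
    intro T
    have := Complex.integral_boundary_rect_eq_zero_of_differentiableOn H
      (((-T : ℝ) : ℂ) + (a : ℂ) * Complex.I) ((T : ℂ) + (b : ℂ) * Complex.I) (by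
        intro w hw
        rw [line_im, line_im, line_re, line_re, uIcc_of_le hab] at hw
        exact (hd w hw.2.1 hw.2.2).differentiableWithinAt)
    simpa only [line_re, line_im] using this
  have hlim := ((hta.sub htb).add (hvert (fun T => T) (fun _ => rfl))).sub
    (hvert (fun T => -T) (fun T => abs_neg T))
  have hzero := hlim.congr (fun T => by simpa using hrect T)
  have := tendsto_nhds_unique hzero tendsto_const_nhds
  simp only [add_zero, sub_zero] at this
  exact sub_eq_zero.1 this

theorem stripInt_congr {H K : ℂ → E} {δ : ℝ} (h : ∀ w : ℂ, |w.im| = |δ| → H w = K w) :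
    stripInt δ H = stripInt δ K := by
  unfold stripInt lineInt
  congr 2 <;> refine integral_congr_ae (Eventually.of_forall fun u => ?_) <;>
    exact h _ (by simp)

theorem stripInt_eq_zero_of_inner {H : ℂ → E} {δ C α N : ℝ} (hδ : 0 ≤ δ) (hα : 0 < α)
    (hd : ∀ w : ℂ, |w.im| ≤ δ → DifferentiableAt ℂ H w)
    (hb : ∀ w : ℂ, |w.im| ≤ δ → N ≤ |w.re| → ‖H w‖ ≤ C * Real.exp (-(α * |w.re|))) :
    stripInt δ H = 0 := by
  rw [stripInt, lineInt_eq (a := -δ) (b := δ) (by linarith) hα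
    (fun w h1 h2 => hd w (abs_le.2 ⟨h1, h2⟩)) (fun w h1 h2 => hb w (abs_le.2 ⟨h1, h2⟩))]
  simp

/-- A function holomorphic outside the sector integrates to zero: the two boundary rays can be
rotated into each other across the negative half-axis. -/
theorem stripInt_eq_zero_of_outer {H : ℂ → E} {δ C α N : ℝ} (hδ : δ ≤ Real.pi) (hα : 0 < α)
    (hper : ∀ w : ℂ, H (w + 2 * Real.pi * Complex.I) = H w)
    (hd : ∀ w : ℂ, δ ≤ w.im → w.im ≤ 2 * Real.pi - δ → DifferentiableAt ℂ H w)
    (hb : ∀ w : ℂ, δ ≤ w.im → w.im ≤ 2 * Real.pi - δ → N ≤ |w.re| →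
      ‖H w‖ ≤ C * Real.exp (-(α * |w.re|))) :
    stripInt δ H = 0 := by
  have h1 : lineInt (2 * Real.pi - δ) H = lineInt (-δ) H := by
    unfold lineInt
    congr 1
    ext u
    rw [← hper ((u : ℂ) + ((-δ : ℝ) : ℂ) * Complex.I)]
    congr 1
    push_cast
    ring
  rw [stripInt, lineInt_eq (a := δ) (b := 2 * Real.pi - δ) (by linarith) hα hd hb, h1]
  simp

/-- The contour may be moved through a region in which the integrand is holomorphic. -/
theorem stripInt_indep {H : ℂ → E} {δ₁ δ₂ C α N : ℝ} (hδ₁ : 0 ≤ δ₁) (hδ : δ₁ ≤ δ₂) (hα : 0 < α)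
    (hd : ∀ w : ℂ, δ₁ ≤ |w.im| → |w.im| ≤ δ₂ → DifferentiableAt ℂ H w)
    (hb : ∀ w : ℂ, δ₁ ≤ |w.im| → |w.im| ≤ δ₂ → N ≤ |w.re| →
      ‖H w‖ ≤ C * Real.exp (-(α * |w.re|))) :
    stripInt δ₁ H = stripInt δ₂ H := by
  have e1 : lineInt δ₁ H = lineInt δ₂ H :=
    lineInt_eq hδ hα (fun w h1 h2 => by
      have : |w.im| = w.im := abs_of_nonneg (hδ₁.trans h1)
      exact hd w (by rwa [this]) (by rwa [this])) (fun w h1 h2 => by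
      have : |w.im| = w.im := abs_of_nonneg (hδ₁.trans h1)
      exact hb w (by rwa [this]) (by rwa [this]))
  have e2 : lineInt (-δ₂) H = lineInt (-δ₁) H :=
    lineInt_eq (neg_le_neg hδ) hα (fun w h1 h2 => by
      have : |w.im| = -w.im := abs_of_nonpos (by linarith)
      exact hd w (by rw [this]; linarith) (by rw [this]; linarith)) (fun w h1 h2 => by
      have : |w.im| = -w.im := abs_of_nonpos (by linarith)
      exact hb w (by rw [this]; linarith) (by rw [this]; linarith))
  rw [stripInt, stripInt, e1, e2]

theorem stripInt_add {H K : ℂ → E} {δ : ℝ}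
    (hH : ∀ φ : ℝ, |φ| = |δ| → Integrable (fun u : ℝ => H ((u : ℂ) + (φ : ℂ) * Complex.I)))
    (hK : ∀ φ : ℝ, |φ| = |δ| → Integrable (fun u : ℝ => K ((u : ℂ) + (φ : ℂ) * Complex.I))) :
    stripInt δ (fun w => H w + K w) = stripInt δ H + stripInt δ K := by
  simp only [stripInt, lineInt]
  rw [integral_add (hH _ (abs_neg δ)) (hK _ (abs_neg δ)), integral_add (hH _ rfl) (hK _ rfl),
    ← smul_add]
  congr 1
  abel

theorem stripInt_smul (c : ℂ) (H : ℂ → E) (δ : ℝ) :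
    stripInt δ (fun w => c • H w) = c • stripInt δ H := by
  simp only [stripInt, lineInt, integral_smul, ← smul_sub]
  rw [smul_comm]

theorem stripInt_clm {F : Type*} [NormedAddCommGroup F] [NormedSpace ℂ F] [CompleteSpace E]
    [CompleteSpace F] (L : E →L[ℂ] F) {H : ℂ → E} {δ : ℝ}
    (hH : ∀ φ : ℝ, |φ| = |δ| → Integrable (fun u : ℝ => H ((u : ℂ) + (φ : ℂ) * Complex.I))) :
    stripInt δ (fun w => L (H w)) = L (stripInt δ H) := by
  simp only [stripInt, lineInt]
  rw [L.integral_comp_comm (hH _ (abs_neg δ)), L.integral_comp_comm (hH _ rfl), map_smul, map_sub]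

theorem norm_stripInt_le {H : ℂ → E} {δ B : ℝ} {k : ℝ → ℝ} (hk : Integrable k)
    (hB : ∫ u, k u ≤ B)
    (hb : ∀ w : ℂ, |w.im| = |δ| → ‖H w‖ ≤ k w.re) : ‖stripInt δ H‖ ≤ 2 * B := by
  have key : ∀ φ : ℝ, |φ| = |δ| → ‖lineInt φ H‖ ≤ B := fun φ hφ =>
    (norm_integral_le_of_norm_le hk (Eventually.of_forall fun u => by
      simpa [line_re] using hb ((u : ℂ) + (φ : ℂ) * Complex.I) (by simpa using hφ))).trans hB
  rw [stripInt, norm_smul]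
  have h1 := key (-δ) (abs_neg δ)
  have h2 := key δ rfl
  have h3 := norm_sub_le (lineInt (-δ) H) (lineInt δ H)
  calc _ ≤ 1 * ‖lineInt (-δ) H - lineInt δ H‖ := by
        gcongr; exact norm_two_pi_I_inv_le
    _ ≤ 2 * B := by linarith

end Lines

/-! ### The Cauchy formula in exponential coordinates -/

theorem exp_add_two_pi_I (w : ℂ) :
    Complex.exp (w + 2 * Real.pi * Complex.I) = Complex.exp w := by
  rw [Complex.exp_add, Complex.exp_two_pi_mul_I, mul_one]

theorem exp_ne_exp_of_im {a b : ℂ} (h1 : a.im ≠ b.im) (h2 : |a.im - b.im| < 2 * Real.pi) :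
    Complex.exp a ≠ Complex.exp b := by
  intro h
  obtain ⟨n, hn⟩ := Complex.exp_eq_exp_iff_exists_int.1 h
  have him : a.im - b.im = n * (2 * Real.pi) := by simp [hn]
  rw [him, abs_mul, abs_of_pos Real.two_pi_pos] at h2
  have h3 : |(n : ℝ)| < 1 := by
    by_contra! hc
    nlinarith [Real.two_pi_pos]
  have h4 : n = 0 := by
    have : |n| < 1 := by exact_mod_cast h3
    exact Int.abs_lt_one_iff.1 this
  rw [h4] at him
  exact h1 (by simpa [sub_eq_zero] using him)

theorem exp_ne_exp_of_ne {a b : ℂ} (h1 : a ≠ b) (ha : |a.im| < Real.pi) (hb : |b.im| < Real.pi) :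
    Complex.exp a ≠ Complex.exp b := by
  intro h
  apply h1
  rw [abs_lt] at ha hb
  rw [← Complex.log_exp ha.1 ha.2.le, ← Complex.log_exp hb.1 hb.2.le, h]

/-- If the moduli of `e^a` and `e^b` differ at least by the factor `e`, neither of the two is
much larger than their distance; the companion lemma treats `e^b`. -/
theorem norm_exp_sub_exp_ge {a b : ℂ} (h : 1 ≤ |a.re - b.re|) :
    Real.exp a.re ≤ 2 * ‖Complex.exp a - Complex.exp b‖ := by
  have h1 := norm_sub_norm_le (Complex.exp a) (Complex.exp b)
  have h2 := norm_sub_norm_le (Complex.exp b) (Complex.exp a)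
  rw [norm_sub_rev] at h2
  rw [Complex.norm_exp, Complex.norm_exp] at h1 h2
  have key : ∀ x y : ℝ, x + 1 ≤ y → 2 * Real.exp x ≤ Real.exp y := fun x y hxy => by
    have : Real.exp y = Real.exp x * Real.exp (y - x) := by rw [← Real.exp_add]; ring_nf
    nlinarith [Real.add_one_le_exp (y - x), Real.exp_pos x]
  rcases le_abs.1 h with h | h
  · linarith [key b.re a.re (by linarith), Real.exp_pos b.re]
  · linarith [key a.re b.re (by linarith), Real.exp_pos b.re]

theorem norm_exp_sub_exp_ge' {a b : ℂ} (h : 1 ≤ |a.re - b.re|) :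
    Real.exp b.re ≤ 2 * ‖Complex.exp a - Complex.exp b‖ := by
  rw [norm_sub_rev]
  exact norm_exp_sub_exp_ge (by rwa [abs_sub_comm])

/-- Decay at both ends of `e^b / ((e^b - e^a) (e^b - e^c))`. -/
theorem norm_exp_div_mul_le {a b c : ℂ} (ha : 1 ≤ |b.re - a.re|) (hc : 1 ≤ |b.re - c.re|) :
    ‖Complex.exp b / ((Complex.exp b - Complex.exp a) * (Complex.exp b - Complex.exp c))‖ ≤
      4 * (1 + Real.exp (-a.re) * Real.exp (-c.re)) * Real.exp (-(1 * |b.re|)) := by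
  have h1 := norm_exp_sub_exp_ge ha
  have h2 := norm_exp_sub_exp_ge' ha
  have h3 := norm_exp_sub_exp_ge hc
  have h4 := norm_exp_sub_exp_ge' hc
  have pa := Real.exp_pos a.re
  have pb := Real.exp_pos b.re
  have pc := Real.exp_pos c.re
  rw [norm_div, norm_mul, Complex.norm_exp, one_mul]
  set p := ‖Complex.exp b - Complex.exp a‖
  set q := ‖Complex.exp b - Complex.exp c‖
  have pp : 0 < p := by linarith
  have pq : 0 < q := by linarith
  rw [div_le_iff₀ (by positivity)]
  rcases le_total 0 b.re with hb | hb
  · rw [abs_of_nonneg hb]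
    have e : Real.exp b.re * Real.exp b.re ≤ 4 * (p * q) := by
      nlinarith [mul_le_mul h1 h3 pb.le (by positivity)]
    have : Real.exp b.re = Real.exp (-b.re) * (Real.exp b.re * Real.exp b.re) := by
      rw [← Real.exp_add, ← Real.exp_add]; ring_nf
    have h5 : 0 ≤ Real.exp (-a.re) * Real.exp (-c.re) * Real.exp (-b.re) * (p * q) := by positivity
    calc Real.exp b.re = Real.exp (-b.re) * (Real.exp b.re * Real.exp b.re) := this
      _ ≤ Real.exp (-b.re) * (4 * (p * q)) := by gcongr
      _ ≤ _ := by nlinarith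
  · rw [abs_of_nonpos hb, neg_neg]
    have e : Real.exp a.re * Real.exp c.re ≤ 4 * (p * q) := by
      nlinarith [mul_le_mul h2 h4 pc.le (by positivity)]
    have h6 : Real.exp (-a.re) * Real.exp (-c.re) * (Real.exp a.re * Real.exp c.re) = 1 := by
      rw [← Real.exp_add, ← Real.exp_add, ← Real.exp_add, ← Real.exp_zero]; ring_nf
    have h7 : 1 ≤ Real.exp (-a.re) * Real.exp (-c.re) * (4 * (p * q)) := by
      rw [← h6]; gcongr
    have h8 : 0 ≤ Real.exp b.re * (p * q) := by positivity
    nlinarith [mul_le_mul_of_nonneg_left h7 pb.le]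

theorem integral_sech_half :
    ∫ u : ℝ, Real.exp u / (1 + Real.exp u ^ 2) = Real.pi / 2 := by
  have h := integral_comp_exp_univ (fun r : ℝ => (1 + r ^ 2)⁻¹)
  rw [integral_Ioi_inv_one_add_sq] at h
  simp only [smul_eq_mul, ← div_eq_mul_inv, Real.arctan_zero, sub_zero] at h
  exact h.symm

/-- The kernel `1/(z-1) - 1/(z+1)` has residue one at its pole `z = 1` in the sector. The
integral is computed over the imaginary axis, where it becomes that of `1 / cosh`. -/
theorem stripInt_kernel_zero {δ : ℝ} (hδ : 0 < δ) (hδ' : δ < Real.pi) :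
    stripInt δ (fun b => Complex.exp b / (Complex.exp b - Complex.exp 0) -
      Complex.exp b / (Complex.exp b - Complex.exp (Real.pi * Complex.I))) = 1 := by
  have hpi := Real.pi_pos
  have hne : ∀ w : ℂ, 0 < |w.im| → |w.im| < Real.pi → Complex.exp w - Complex.exp 0 ≠ 0 ∧
      Complex.exp w - Complex.exp (Real.pi * Complex.I) ≠ 0 := by
    intro w h0 h1
    constructor
    · refine sub_ne_zero.2 (exp_ne_exp_of_im ?_ ?_)
      · simpa using (abs_pos.1 h0)
      · simp; linarith
    · refine sub_ne_zero.2 (exp_ne_exp_of_im ?_ ?_)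
      · have := (abs_lt.1 h1).2
        simpa using this.ne
      · rw [abs_lt] at *
        simp
        constructor <;> linarith
  have hform : ∀ w : ℂ, 0 < |w.im| → |w.im| < Real.pi →
      Complex.exp w / (Complex.exp w - Complex.exp 0) -
      Complex.exp w / (Complex.exp w - Complex.exp (Real.pi * Complex.I)) =
      2 * (Complex.exp w / ((Complex.exp w - Complex.exp 0) *
        (Complex.exp w - Complex.exp (Real.pi * Complex.I)))) := by
    intro w h0 h1
    obtain ⟨n1, n2⟩ := hne w h0 h1
    rw [Complex.exp_pi_mul_I, Complex.exp_zero] at *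
    field_simp
    ring
  have hd : ∀ w : ℂ, 0 < |w.im| → |w.im| < Real.pi → DifferentiableAt ℂ (fun b =>
      Complex.exp b / (Complex.exp b - Complex.exp 0) -
      Complex.exp b / (Complex.exp b - Complex.exp (Real.pi * Complex.I))) w := by
    intro w h0 h1
    obtain ⟨n1, n2⟩ := hne w h0 h1
    fun_prop (disch := assumption)
  have hb : ∀ w : ℂ, 0 < |w.im| → |w.im| < Real.pi → 1 ≤ |w.re| →
      ‖Complex.exp w / (Complex.exp w - Complex.exp 0) -
      Complex.exp w / (Complex.exp w - Complex.exp (Real.pi * Complex.I))‖ ≤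
        16 * Real.exp (-(1 * |w.re|)) := by
    intro w h0 h1 h2
    rw [hform w h0 h1, norm_mul]
    have := norm_exp_div_mul_le (a := 0) (b := w) (c := Real.pi * Complex.I) (by simpa using h2)
      (by simpa using h2)
    simp at this ⊢
    linarith
  have hhalf : stripInt (Real.pi / 2) (fun b => Complex.exp b / (Complex.exp b - Complex.exp 0) -
      Complex.exp b / (Complex.exp b - Complex.exp (Real.pi * Complex.I))) = 1 := by
    have hl : ∀ ε : ℝ, (ε = 1 ∨ ε = -1) → lineInt (ε * (Real.pi / 2)) (fun b =>
        Complex.exp b / (Complex.exp b - Complex.exp 0) -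
        Complex.exp b / (Complex.exp b - Complex.exp (Real.pi * Complex.I))) =
        -ε * (Real.pi * Complex.I) := by
      intro ε hε
      have hε2 : (ε : ℂ) ^ 2 = 1 := by rcases hε with rfl | rfl <;> norm_num
      have habs : |ε * (Real.pi / 2)| = Real.pi / 2 := by
        rw [abs_mul]; rcases hε with rfl | rfl <;> simp <;> positivity
      have hexp : ∀ u : ℝ, Complex.exp ((u : ℂ) + ((ε * (Real.pi / 2) : ℝ) : ℂ) * Complex.I) =
          (Real.exp u : ℂ) * (ε * Complex.I) := by
        intro u
        rw [Complex.exp_add, Complex.ofReal_exp]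
        congr 1
        rcases hε with rfl | rfl
        · push_cast
          rw [one_mul, one_mul, Complex.exp_pi_div_two_mul_I]
        · push_cast
          rw [show (-1 : ℂ) * (Real.pi / 2) * Complex.I = -(Real.pi / 2 * Complex.I) by ring,
            Complex.exp_neg, Complex.exp_pi_div_two_mul_I]
          simp
      unfold lineInt
      have : ∀ u : ℝ, (fun b => Complex.exp b / (Complex.exp b - Complex.exp 0) -
        Complex.exp b / (Complex.exp b - Complex.exp (Real.pi * Complex.I)))
          ((u : ℂ) + ((ε * (Real.pi / 2) : ℝ) : ℂ) * Complex.I) =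
          (-ε * (2 * Complex.I)) * ((Real.exp u / (1 + Real.exp u ^ 2) : ℝ) : ℂ) := by
        intro u
        have hpos : (1 : ℂ) + (Real.exp u : ℂ) ^ 2 ≠ 0 := by
          have : (1 : ℝ) + Real.exp u ^ 2 ≠ 0 := by positivity
          exact_mod_cast this
        beta_reduce
        rw [hform _ (by rw [line_im, habs]; positivity) (by rw [line_im, habs]; linarith), hexp,
          Complex.exp_zero, Complex.exp_pi_mul_I]
        push_cast at hpos ⊢
        have : (Complex.exp u * (ε * Complex.I) - 1) * (Complex.exp u * (ε * Complex.I) - -1) =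
            -(1 + Complex.exp u ^ 2) := by
          linear_combination (Complex.exp u ^ 2 * ε ^ 2) * Complex.I_sq - Complex.exp u ^ 2 * hε2
        rw [this]
        field_simp
      simp_rw [this]
      rw [integral_const_mul, integral_complex_ofReal, integral_sech_half]
      push_cast
      ring
    have h1 := hl 1 (Or.inl rfl)
    have h2 := hl (-1) (Or.inr rfl)
    rw [one_mul] at h1
    rw [neg_one_mul] at h2
    rw [stripInt, h1, h2]
    have : (2 * (Real.pi : ℂ) * Complex.I) ≠ 0 := Complex.two_pi_I_ne_zero
    rw [smul_eq_mul, inv_mul_eq_iff_eq_mul₀ this]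
    push_cast
    ring
  rw [← hhalf]
  rcases le_total δ (Real.pi / 2) with h | h
  · exact stripInt_indep hδ.le h one_pos (fun w h1 h2 => hd w (by linarith) (by linarith))
      (fun w h1 h2 => hb w (by linarith) (by linarith))
  · exact (stripInt_indep (by linarith) h one_pos
      (fun w h1 h2 => hd w (by linarith) (by linarith))
      (fun w h1 h2 => hb w (by linarith) (by linarith))).symm

/-- The kernel `1/(z-e^a) - 1/(z+1)` has residue one at its pole in the sector and, unlike its two
terms, decays fast enough to be integrated. It differs from the kernel with `a = 0` by a function
whose two poles lie in the sector, so that the contour can be moved to the negative half-axis. -/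
theorem stripInt_kernel {δ : ℝ} {a : ℂ} (ha : |a.im| < δ) (hδ' : δ < Real.pi) :
    stripInt δ (fun b => Complex.exp b / (Complex.exp b - Complex.exp a) -
      Complex.exp b / (Complex.exp b - Complex.exp (Real.pi * Complex.I))) = 1 := by
  have hδ : 0 < δ := (abs_nonneg _).trans_lt ha
  have hne : ∀ c : ℂ, |c.im| < δ → ∀ w : ℂ, δ ≤ w.im → w.im ≤ 2 * Real.pi - δ →
      Complex.exp w - Complex.exp c ≠ 0 := by
    intro c hc w h1 h2
    rw [abs_lt] at hc
    refine sub_ne_zero.2 (exp_ne_exp_of_im (by linarith) ?_)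
    rw [abs_lt]; constructor <;> linarith
  have h0 : |(0 : ℂ).im| < δ := by simpa using hδ
  set N := |a.re| + 1
  have hN : ∀ w : ℂ, N ≤ |w.re| → 1 ≤ |w.re - a.re| ∧ 1 ≤ |w.re - (0 : ℂ).re| := by
    intro w hw
    refine ⟨?_, ?_⟩
    · linarith [abs_sub_abs_le_abs_sub w.re a.re]
    · simp; linarith [abs_nonneg a.re]
  have hdiff : stripInt δ (fun b => (Complex.exp a - Complex.exp 0) * (Complex.exp b /
      ((Complex.exp b - Complex.exp a) * (Complex.exp b - Complex.exp 0)))) = 0 := by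
    refine stripInt_eq_zero_of_outer (N := N)
      (C := ‖Complex.exp a - Complex.exp 0‖ * (4 * (1 + Real.exp (-a.re) * Real.exp (-(0 : ℂ).re))))
      hδ'.le one_pos ?_ ?_ ?_
    · intro w; simp only [exp_add_two_pi_I]
    · intro w h1 h2
      have n1 := hne a ha w h1 h2
      have n2 := hne 0 h0 w h1 h2
      have n3 := mul_ne_zero n1 n2
      fun_prop (disch := assumption)
    · intro w h1 h2 h3
      obtain ⟨h4, h5⟩ := hN w h3
      rw [norm_mul, mul_assoc]
      gcongr
      exact norm_exp_div_mul_le h4 h5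
  have hnel : ∀ c : ℂ, |c.im| < δ → ∀ w : ℂ, |w.im| = δ → Complex.exp w - Complex.exp c ≠ 0 := by
    intro c hc w hw
    refine sub_ne_zero.2 (exp_ne_exp_of_im (fun h => ?_) ?_)
    · rw [← h] at hc; linarith
    · have := abs_sub w.im c.im
      linarith
  have hnepi : ∀ w : ℂ, |w.im| = δ → Complex.exp w - Complex.exp (Real.pi * Complex.I) ≠ 0 := by
    intro w hw
    rw [← hw, abs_lt] at hδ'
    have := Real.pi_pos
    refine sub_ne_zero.2 (exp_ne_exp_of_im ?_ ?_)
    · simpa using hδ'.2.ne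
    · simp; rw [abs_lt]; constructor <;> linarith
  have hsum : stripInt δ (fun b => Complex.exp b / (Complex.exp b - Complex.exp a) -
      Complex.exp b / (Complex.exp b - Complex.exp (Real.pi * Complex.I))) =
      stripInt δ (fun b => (Complex.exp a - Complex.exp 0) * (Complex.exp b /
      ((Complex.exp b - Complex.exp a) * (Complex.exp b - Complex.exp 0))) +
      (Complex.exp b / (Complex.exp b - Complex.exp 0) -
      Complex.exp b / (Complex.exp b - Complex.exp (Real.pi * Complex.I)))) := by
    refine stripInt_congr fun w hw => ?_
    rw [abs_of_pos hδ] at hw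
    have n1 := hnel a ha w hw
    have n2 := hnel 0 h0 w hw
    have n3 := hnepi w hw
    field_simp
    ring
  rw [hsum, stripInt_add, hdiff, stripInt_kernel_zero hδ hδ', zero_add]
  · intro φ hφ
    rw [abs_of_pos hδ] at hφ
    refine integrable_line (H := fun b : ℂ => (Complex.exp a - Complex.exp 0) * (Complex.exp b /
      ((Complex.exp b - Complex.exp a) * (Complex.exp b - Complex.exp 0))))
      (N := N) (C := ‖Complex.exp a - Complex.exp 0‖ *
      (4 * (1 + Real.exp (-a.re) * Real.exp (-(0 : ℂ).re)))) one_pos ?_ ?_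
    · intro w hw
      have n1 := hnel a ha w (by rw [hw, hφ])
      have n2 := hnel 0 h0 w (by rw [hw, hφ])
      have n3 := mul_ne_zero n1 n2
      fun_prop (disch := assumption)
    · intro w hw h3
      obtain ⟨h4, h5⟩ := hN w h3
      rw [norm_mul, mul_assoc]
      gcongr
      exact norm_exp_div_mul_le h4 h5
  · intro φ hφ
    rw [abs_of_pos hδ] at hφ
    have hform : ∀ w : ℂ, w.im = φ → Complex.exp w / (Complex.exp w - Complex.exp 0) -
      Complex.exp w / (Complex.exp w - Complex.exp (Real.pi * Complex.I)) =
      2 * (Complex.exp w / ((Complex.exp w - Complex.exp 0) *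
        (Complex.exp w - Complex.exp (Real.pi * Complex.I)))) := by
      intro w hw
      have n2 := hnel 0 h0 w (by rw [hw, hφ])
      have n3 := hnepi w (by rw [hw, hφ])
      rw [Complex.exp_pi_mul_I, Complex.exp_zero] at *
      field_simp
      ring
    refine integrable_line (H := fun b : ℂ => Complex.exp b / (Complex.exp b - Complex.exp 0) -
      Complex.exp b / (Complex.exp b - Complex.exp (Real.pi * Complex.I)))
      (N := 1) (C := 16) one_pos ?_ ?_
    · intro w hw
      have n2 := hnel 0 h0 w (by rw [hw, hφ])
      have n3 := hnepi w (by rw [hw, hφ])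
      fun_prop (disch := assumption)
    · intro w hw h2
      rw [hform w hw, norm_mul]
      have := norm_exp_div_mul_le (a := 0) (b := w) (c := Real.pi * Complex.I) (by simpa using h2)
        (by simpa using h2)
      simp at this ⊢
      linarith

/-- Cauchy's integral formula for a strip, in the coordinate `z = exp b` of the sector. The kernel
`e^b / (e^b - e^a)` itself does not decay, so the pole is split off with the help of the decaying
kernel of `stripInt_kernel`; the remainder is holomorphic across `a`. -/
theorem stripInt_cauchy {g : ℂ → ℂ} {δ ω C α : ℝ} (hδω : δ < ω) (hω : ω ≤ Real.pi) (hα : 0 < α)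
    (hd : ∀ w : ℂ, |w.im| < ω → DifferentiableAt ℂ g w)
    (hb : ∀ w : ℂ, |w.im| < ω → ‖g w‖ ≤ C * Real.exp (-(α * |w.re|)))
    {a : ℂ} (ha : |a.im| < δ) :
    stripInt δ (fun b => (Complex.exp b / (Complex.exp b - Complex.exp a)) * g b) = g a := by
  have hδ : 0 < δ := (abs_nonneg _).trans_lt ha
  have hpi := Real.pi_pos
  set e := Complex.exp (Real.pi * Complex.I) with he
  have he1 : e = -1 := Complex.exp_pi_mul_I
  -- `P` vanishes at `a`, so that `P(b) e^b / (e^b - e^a)` extends holomorphically to `K`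
  set P : ℂ → ℂ := fun b => g b - g a * ((Complex.exp a - e) / (Complex.exp b - e)) with hP
  set S : Set ℂ := {w : ℂ | |w.im| < ω} with hS
  have hSo : IsOpen S := isOpen_lt (by fun_prop) continuous_const
  have haS : S ∈ 𝓝 a := hSo.mem_nhds (ha.trans hδω)
  have hnepi : ∀ w ∈ S, Complex.exp w - e ≠ 0 := by
    intro w hw
    have hw' := abs_lt.1 ((show |w.im| < ω from hw).trans_le hω)
    refine sub_ne_zero.2 (exp_ne_exp_of_im ?_ ?_)
    · simpa using hw'.2.ne
    · simp; rw [abs_lt]; constructor <;> linarith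
  have hPd : DifferentiableOn ℂ P S := by
    intro w hw
    have h1 := hd w hw
    have h2 := hnepi w hw
    have : DifferentiableAt ℂ P w := by
      simp only [hP]
      fun_prop (disch := assumption)
    exact this.differentiableWithinAt
  have hDP : DifferentiableOn ℂ (dslope P a) S := (Complex.differentiableOn_dslope haS).2 hPd
  have hDE : DifferentiableOn ℂ (dslope Complex.exp a) S :=
    (Complex.differentiableOn_dslope haS).2 Complex.differentiable_exp.differentiableOn
  have hsub : ∀ w ∈ S, w ≠ a → Complex.exp w - Complex.exp a ≠ 0 := fun w hw hwa =>
    sub_ne_zero.2 (exp_ne_exp_of_ne hwa ((show |w.im| < ω from hw).trans_le hω)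
      ((ha.trans hδω).trans_le hω))
  have hDEne : ∀ w ∈ S, dslope Complex.exp a w ≠ 0 := by
    intro w hw
    by_cases hwa : w = a
    · subst hwa
      rw [dslope_same, (Complex.hasDerivAt_exp w).deriv]
      exact Complex.exp_ne_zero _
    · rw [dslope_of_ne _ hwa, slope_def_field]
      exact div_ne_zero (hsub w hw hwa) (sub_ne_zero.2 hwa)
  have hPa : P a = 0 := by
    simp only [hP]
    rw [div_self (hnepi a (ha.trans hδω))]
    ring
  set K : ℂ → ℂ := fun b => Complex.exp b * dslope P a b / dslope Complex.exp a b with hK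
  have hKeq : ∀ w ∈ S, w ≠ a →
      K w = Complex.exp w / (Complex.exp w - Complex.exp a) * P w := by
    intro w hw hwa
    simp only [hK]
    rw [dslope_of_ne _ hwa, dslope_of_ne _ hwa, slope_def_field, slope_def_field, hPa]
    have h1 := hsub w hw hwa
    have h2 := sub_ne_zero.2 hwa
    field_simp
    ring
  have hKd : ∀ w : ℂ, |w.im| ≤ δ → DifferentiableAt ℂ K w := by
    intro w hw
    have hwS : w ∈ S := hw.trans_lt hδω
    have h1 := hDP.differentiableAt (hSo.mem_nhds hwS)
    have h2 := hDE.differentiableAt (hSo.mem_nhds hwS)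
    have h3 := hDEne w hwS
    simp only [hK]
    fun_prop (disch := assumption)
  set N := |a.re| + 1
  have hN : ∀ w : ℂ, N ≤ |w.re| → 1 ≤ |w.re - a.re| ∧
      1 ≤ |w.re - (Real.pi * Complex.I : ℂ).re| := by
    intro w hw
    refine ⟨?_, ?_⟩
    · linarith [abs_sub_abs_le_abs_sub w.re a.re]
    · simp; linarith [abs_nonneg a.re]
  set β := min α 1
  have hβ : 0 < β := lt_min hα one_pos
  have hβα : ∀ x : ℝ, Real.exp (-(α * |x|)) ≤ Real.exp (-(β * |x|)) := fun x => by
    have : β * |x| ≤ α * |x| := mul_le_mul_of_nonneg_right (min_le_left _ _) (abs_nonneg _)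
    exact Real.exp_le_exp.2 (by linarith)
  have hβ1 : ∀ x : ℝ, Real.exp (-(1 * |x|)) ≤ Real.exp (-(β * |x|)) := fun x => by
    have : β * |x| ≤ 1 * |x| := mul_le_mul_of_nonneg_right (min_le_right _ _) (abs_nonneg _)
    exact Real.exp_le_exp.2 (by linarith)
  have hC : 0 ≤ C := by
    have := (norm_nonneg _).trans (hb 0 (by simpa using hδ.trans hδω))
    simpa using this
  set D := 4 * (1 + Real.exp (-a.re) * Real.exp (-(Real.pi * Complex.I : ℂ).re))
  set B := 2 * C + ‖g a‖ * ‖Complex.exp a - e‖ * D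
  have hfac : ∀ w : ℂ, N ≤ |w.re| →
      ‖Complex.exp w / (Complex.exp w - Complex.exp a)‖ ≤ 2 := by
    intro w hw
    obtain ⟨h4, h5⟩ := hN w hw
    have h6 := norm_exp_sub_exp_ge h4
    rw [norm_div, Complex.norm_exp]
    exact div_le_of_le_mul₀ (norm_nonneg _) zero_le_two h6
  have hKb : ∀ w : ℂ, |w.im| ≤ δ → N ≤ |w.re| → ‖K w‖ ≤ B * Real.exp (-(β * |w.re|)) := by
    intro w hw hw2
    have hwS : w ∈ S := hw.trans_lt hδω
    have hwa : w ≠ a := by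
      rintro rfl
      linarith [(le_refl N : |w.re| + 1 ≤ N)]
    obtain ⟨h4, h5⟩ := hN w hw2
    have h7 := norm_exp_div_mul_le h4 h5
    rw [hKeq w hwS hwa]
    have hn1 := hsub w hwS hwa
    have hn2 := hnepi w hwS
    have hsplit : Complex.exp w / (Complex.exp w - Complex.exp a) * P w =
        Complex.exp w / (Complex.exp w - Complex.exp a) * g w - g a * (Complex.exp a - e) *
          (Complex.exp w / ((Complex.exp w - Complex.exp a) * (Complex.exp w - e))) := by
      simp only [hP]
      field_simp
    rw [hsplit]
    refine (norm_sub_le _ _).trans ?_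
    rw [norm_mul, norm_mul, norm_mul]
    have t1 : ‖Complex.exp w / (Complex.exp w - Complex.exp a)‖ * ‖g w‖ ≤
        2 * (C * Real.exp (-(β * |w.re|))) := by
      refine mul_le_mul (hfac w hw2) ((hb w hwS).trans ?_) (norm_nonneg _) zero_le_two
      exact mul_le_mul_of_nonneg_left (hβα _) hC
    have t2 : ‖g a‖ * ‖Complex.exp a - e‖ *
        ‖Complex.exp w / ((Complex.exp w - Complex.exp a) * (Complex.exp w - e))‖ ≤
        ‖g a‖ * ‖Complex.exp a - e‖ * (D * Real.exp (-(β * |w.re|))) := by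
      refine mul_le_mul_of_nonneg_left (h7.trans ?_) (by positivity)
      exact mul_le_mul_of_nonneg_left (hβ1 _) (by positivity)
    calc _ ≤ _ := add_le_add t1 t2
      _ = _ := by ring
  have hKzero : stripInt δ K = 0 := stripInt_eq_zero_of_inner hδ.le hβ hKd hKb
  have hlne : ∀ w : ℂ, |w.im| = δ → w ≠ a := by
    rintro w hw rfl
    exact ha.ne hw
  have hKi : ∀ φ : ℝ, |φ| = |δ| → Integrable (fun u : ℝ => K ((u : ℂ) + (φ : ℂ) * Complex.I)) := by
    intro φ hφ
    rw [abs_of_pos hδ] at hφ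
    exact integrable_line hβ (fun w hw => hKd w (by rw [hw, hφ]))
      (fun w hw h => hKb w (by rw [hw, hφ]) h)
  -- the part that carries the pole, a multiple of the kernel of `stripInt_kernel`
  set Q : ℂ → ℂ := fun b => g a • (Complex.exp b / (Complex.exp b - Complex.exp a) -
    Complex.exp b / (Complex.exp b - e)) with hQ
  have hQform : ∀ w ∈ S, w ≠ a → Q w = g a * (Complex.exp a - e) *
      (Complex.exp w / ((Complex.exp w - Complex.exp a) * (Complex.exp w - e))) := by
    intro w hw hwa
    have hn1 := hsub w hw hwa
    have hn2 := hnepi w hw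
    simp only [hQ, smul_eq_mul]
    field_simp
    ring
  have hQi : ∀ φ : ℝ, |φ| = |δ| → Integrable (fun u : ℝ => Q ((u : ℂ) + (φ : ℂ) * Complex.I)) := by
    intro φ hφ
    rw [abs_of_pos hδ] at hφ
    refine integrable_line (C := ‖g a * (Complex.exp a - e)‖ * D) (N := N) one_pos ?_ ?_
    · intro w hw
      have hw' : |w.im| = δ := by rw [hw, hφ]
      have hwS : w ∈ S := hw'.trans_lt hδω
      have n1 := hsub w hwS (hlne w hw')
      have n2 := hnepi w hwS
      simp only [hQ]
      fun_prop (disch := assumption)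
    · intro w hw h
      have hw' : |w.im| = δ := by rw [hw, hφ]
      obtain ⟨h4, h5⟩ := hN w h
      rw [hQform w (hw'.trans_lt hδω) (hlne w hw'), norm_mul, mul_assoc]
      gcongr
      exact norm_exp_div_mul_le h4 h5
  have hsum : stripInt δ (fun b => (Complex.exp b / (Complex.exp b - Complex.exp a)) * g b) =
      stripInt δ (fun b => K b + Q b) := by
    refine stripInt_congr fun w hw => ?_
    rw [abs_of_pos hδ] at hw
    have hwS : w ∈ S := hw.trans_lt hδω
    rw [hKeq w hwS (hlne w hw)]
    have hn1 := hsub w hwS (hlne w hw)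
    have hn2 := hnepi w hwS
    simp only [hQ, hP, smul_eq_mul]
    field_simp
    ring
  rw [hsum, stripInt_add hKi hQi, hKzero, zero_add]
  simp only [hQ]
  rw [stripInt_smul, stripInt_kernel ha (hδω.trans_le hω), smul_eq_mul, mul_one]

/-! ### Resolvents of unbounded operators -/

section Resolvent

variable {X : Type*} [NormedAddCommGroup X] [NormedSpace ℂ X] {A : X →ₗ.[ℂ] X}

theorem IsOpResolvent.unique {z : ℂ} {R R' : X →L[ℂ] X} (h : IsOpResolvent A z R)
    (h' : IsOpResolvent A z R') : R = R' := by
  ext x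
  obtain ⟨hx, e⟩ := h.1 x
  have := h'.2 ⟨R x, hx⟩
  rw [e] at this
  exact this.symm

theorem opResolvent_spec {z : ℂ} (h : z ∈ opResolventSet A) :
    IsOpResolvent A z (opResolvent A z) := by
  have h' : ∃ R : X →L[ℂ] X, IsOpResolvent A z R := h
  rw [opResolvent, dif_pos h']
  exact h'.choose_spec

theorem IsOpResolvent.eq {z : ℂ} {R : X →L[ℂ] X} (h : IsOpResolvent A z R) :
    opResolvent A z = R :=
  (opResolvent_spec ⟨R, h⟩).unique h

theorem opResolvent_mem {z : ℂ} (h : z ∈ opResolventSet A) (x : X) :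
    opResolvent A z x ∈ A.domain := ((opResolvent_spec h).1 x).1

theorem apply_opResolvent {z : ℂ} (h : z ∈ opResolventSet A) (x : X) :
    A ⟨opResolvent A z x, opResolvent_mem h x⟩ = z • opResolvent A z x - x := by
  obtain ⟨_, e⟩ := (opResolvent_spec h).1 x
  rw [eq_sub_iff_add_eq, ← eq_sub_iff_add_eq', e]

theorem opResolvent_apply_sub {z : ℂ} (h : z ∈ opResolventSet A) (x : A.domain) :
    opResolvent A z (z • (x : X) - A x) = x := (opResolvent_spec h).2 x

theorem opResolvent_injective {z : ℂ} (h : z ∈ opResolventSet A) {x : X}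
    (hx : opResolvent A z x = 0) : x = 0 := by
  obtain ⟨hm, e⟩ := (opResolvent_spec h).1 x
  have h0 : (⟨opResolvent A z x, hm⟩ : A.domain) = 0 := Subtype.ext hx
  rw [← e, h0, LinearPMap.map_zero, hx, smul_zero, sub_zero]

/-- The resolvent identity. -/
theorem opResolvent_sub {z w : ℂ} (hz : z ∈ opResolventSet A) (hw : w ∈ opResolventSet A) :
    opResolvent A z - opResolvent A w = (w - z) • (opResolvent A z * opResolvent A w) := by
  ext x
  set y : A.domain := ⟨opResolvent A w x, opResolvent_mem hw x⟩ with hy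
  have hyx : x = (z • (y : X) - A y) + (w - z) • (y : X) := by
    rw [hy, apply_opResolvent hw x]
    simp only [sub_smul]
    abel
  have h1 : opResolvent A z x = y + (w - z) • opResolvent A z y := by
    conv_lhs => rw [hyx]
    rw [map_add, opResolvent_apply_sub hz y, map_smul]
  simp only [sub_apply, smul_apply,
    mul_apply_eq_comp]
  rw [h1]
  simp [hy]

theorem opResolvent_comm {z w : ℂ} (hz : z ∈ opResolventSet A) (hw : w ∈ opResolventSet A) :
    opResolvent A z * opResolvent A w = opResolvent A w * opResolvent A z := by
  by_cases h : z = w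
  · rw [h]
  · have h1 := opResolvent_sub hz hw
    have h2 := opResolvent_sub hw hz
    have h3 : (w - z) • (opResolvent A z * opResolvent A w) =
        (w - z) • (opResolvent A w * opResolvent A z) := by
      rw [← h1, ← neg_sub, h2, ← neg_smul, neg_sub]
    exact smul_right_injective _ (sub_ne_zero.2 (Ne.symm h)) h3

/-- `R(z, tA) = t⁻¹ R(z/t, A)`. -/
theorem isOpResolvent_smul {t z : ℂ} (ht : t ≠ 0) {R : X →L[ℂ] X}
    (h : IsOpResolvent A (z / t) R) : IsOpResolvent (t • A) z (t⁻¹ • R) := by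
  constructor
  · intro x
    obtain ⟨hm, e⟩ := h.1 x
    have hm' : (t⁻¹ • R) x ∈ A.domain := A.domain.smul_mem _ hm
    refine ⟨hm', ?_⟩
    have e1 : (t • A) ⟨(t⁻¹ • R) x, hm'⟩ = t • A ⟨(t⁻¹ • R) x, hm'⟩ := LinearPMap.smul_apply _ _ _
    have e2 : A ⟨(t⁻¹ • R) x, hm'⟩ = t⁻¹ • A ⟨R x, hm⟩ := by
      rw [← LinearPMap.map_smul]; rfl
    rw [e1, e2, smul_smul, mul_inv_cancel₀ ht, one_smul, smul_apply, smul_smul,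
      ← div_eq_mul_inv]
    exact e
  · intro x
    have e1 : (t • A) x = t • A x := LinearPMap.smul_apply _ _ _
    have := h.2 x
    rw [e1, smul_apply, ← map_smul, smul_sub, smul_smul, smul_smul,
      inv_mul_cancel₀ ht, one_smul, mul_comm, ← div_eq_mul_inv]
    exact this

theorem isOpResolvent_neg {z : ℂ} {R : X →L[ℂ] X} (h : IsOpResolvent A (-z) R) :
    IsOpResolvent (-A) z (-R) := by
  constructor
  · intro x
    obtain ⟨hm, e⟩ := h.1 x
    have hm' : (-R) x ∈ A.domain := A.domain.neg_mem hm
    refine ⟨hm', ?_⟩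
    have e1 : (-A) ⟨(-R) x, hm'⟩ = -A ⟨(-R) x, hm'⟩ := LinearPMap.neg_apply _ _
    have e2 : A ⟨(-R) x, hm'⟩ = -A ⟨R x, hm⟩ := by
      rw [← LinearPMap.map_neg]; rfl
    rw [e1, e2, neg_neg, neg_apply, smul_neg, ← neg_smul]
    exact e
  · intro x
    have e1 : (-A) x = -A x := LinearPMap.neg_apply _ _
    have := h.2 x
    rw [e1, neg_apply, ← map_neg, neg_sub, sub_eq_add_neg, neg_add_eq_sub,
      ← neg_sub, sub_neg_eq_add, neg_add, ← neg_smul, neg_add_eq_sub]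
    exact this

theorem mem_opResolventSet_neg {z : ℂ} : z ∈ opResolventSet (-A) ↔ -z ∈ opResolventSet A := by
  constructor
  · rintro ⟨R, hR⟩
    refine ⟨-R, ?_⟩
    have := isOpResolvent_neg (A := -A) (z := -z) (R := R) (by rwa [neg_neg])
    rwa [neg_neg] at this
  · rintro ⟨R, hR⟩
    exact ⟨-R, isOpResolvent_neg hR⟩

theorem opResolvent_neg {z : ℂ} (h : -z ∈ opResolventSet A) :
    opResolvent (-A) z = -opResolvent A (-z) :=
  (isOpResolvent_neg (opResolvent_spec h)).eq

theorem opResolvent_smul {t z : ℂ} (ht : t ≠ 0) (h : z / t ∈ opResolventSet A) :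
    opResolvent (t • A) z = t⁻¹ • opResolvent A (z / t) :=
  (isOpResolvent_smul ht (opResolvent_spec h)).eq

/-- Local boundedness of the resolvent suffices for its holomorphy, by the resolvent identity. The
openness of the resolvent set in general is not needed. -/
theorem hasDerivAt_opResolvent {z : ℂ} {U : Set ℂ} (hU : U ∈ 𝓝 z) (hρ : U ⊆ opResolventSet A)
    {K : ℝ} (hK : ∀ w ∈ U, ‖opResolvent A w‖ ≤ K) :
    HasDerivAt (opResolvent A) (-(opResolvent A z * opResolvent A z)) z := by
  have hz := hρ (mem_of_mem_nhds hU)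
  have hcont : ContinuousAt (opResolvent A) z := by
    rw [ContinuousAt, tendsto_iff_norm_sub_tendsto_zero]
    have hlim : Tendsto (fun w => ‖z - w‖ * (K * ‖opResolvent A z‖)) (𝓝 z) (𝓝 0) := by
      have : Continuous (fun w => ‖z - w‖ * (K * ‖opResolvent A z‖)) := by fun_prop
      simpa using this.tendsto z
    refine squeeze_zero' (Eventually.of_forall fun _ => norm_nonneg _) ?_ hlim
    filter_upwards [hU] with w hw
    rw [opResolvent_sub (hρ hw) hz, norm_smul]
    gcongr
    exact (norm_mul_le _ _).trans (by gcongr; exact hK w hw)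
  rw [hasDerivAt_iff_tendsto_slope]
  have h1 : Tendsto (fun w => -(opResolvent A w * opResolvent A z)) (𝓝[≠] z)
      (𝓝 (-(opResolvent A z * opResolvent A z))) := by
    exact ((hcont.tendsto.mono_left nhdsWithin_le_nhds).mul_const _).neg
  refine h1.congr' ?_
  filter_upwards [nhdsWithin_le_nhds hU, self_mem_nhdsWithin] with w hw hne
  have hne' : w - z ≠ 0 := sub_ne_zero.2 hne
  rw [slope_def_module, opResolvent_sub (hρ hw) hz, smul_smul, ← neg_sub w z, mul_neg,
    inv_mul_cancel₀ hne', neg_smul, one_smul]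

/-! ### Sectorial operators -/

theorem abs_arg_lt_iff_cos {z : ℂ} (hz : z ≠ 0) {ω : ℝ} (h0 : 0 ≤ ω) (hω : ω ≤ Real.pi) :
    ω < |z.arg| ↔ z.re < ‖z‖ * Real.cos ω := by
  have h1 : z.re = ‖z‖ * Real.cos |z.arg| := by
    rw [Real.cos_abs, Complex.norm_mul_cos_arg]
  have hn : 0 < ‖z‖ := norm_pos_iff.2 hz
  rw [h1, mul_lt_mul_iff_right₀ hn]
  exact (Real.strictAntiOn_cos.lt_iff_gt ⟨abs_nonneg _, Complex.abs_arg_le_pi z⟩ ⟨h0, hω⟩).symm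

theorem abs_arg_exp {w : ℂ} (h : |w.im| ≤ Real.pi) : |(Complex.exp w).arg| = |w.im| := by
  rcases eq_or_lt_of_le (abs_le.1 h).1 with h1 | h1
  · have : Complex.exp w = -(Real.exp w.re : ℂ) := by
      conv_lhs => rw [← Complex.re_add_im w, ← h1]
      rw [Complex.exp_add]
      push_cast
      rw [neg_mul, Complex.exp_neg, Complex.exp_pi_mul_I]
      norm_num
    rw [this, ← h1, ← Complex.ofReal_neg,
      Complex.arg_ofReal_of_neg (neg_neg_of_pos (Real.exp_pos _)), abs_neg]
  · have e := Complex.log_exp h1 (abs_le.1 h).2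
    rw [← Complex.log_im, e]

/-- On the second half of a period the argument of `e^w` has to be reduced by `2π`. -/
theorem abs_arg_exp' {w : ℂ} (h1 : Real.pi ≤ w.im) (h2 : w.im ≤ 2 * Real.pi) :
    |(Complex.exp w).arg| = 2 * Real.pi - w.im := by
  have h := abs_arg_exp (w := w - 2 * Real.pi * Complex.I) (by
    simp; rw [abs_le]; constructor <;> linarith [Real.pi_pos])
  rw [← exp_add_two_pi_I, sub_add_cancel] at h
  rw [h]
  simp
  rw [abs_of_nonpos (by linarith)]
  ring

/-- The resolvent in the exponential coordinate, `e^w R(e^w, A)`. -/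
noncomputable def resLog (A : X →ₗ.[ℂ] X) (w : ℂ) : X →L[ℂ] X :=
  Complex.exp w • opResolvent A (Complex.exp w)

theorem resLog_periodic (w : ℂ) : resLog A (w + 2 * Real.pi * Complex.I) = resLog A w := by
  rw [resLog, exp_add_two_pi_I, resLog]

section Angle

variable {ω₀ : ℝ}

theorem IsSectorialOfAngle.mem (h : IsSectorialOfAngle A ω₀) {z : ℂ} (hz : z ≠ 0)
    (ha : ω₀ < |z.arg|) : z ∈ opResolventSet A := h.2.2.1 z hz ha

theorem IsSectorialOfAngle.neg_mem (h : IsSectorialOfAngle A ω₀) {t : ℝ} (ht : 0 < t) :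
    -(t : ℂ) ∈ opResolventSet A := by
  refine h.mem (by simpa using ht.ne') ?_
  rw [← Complex.ofReal_neg, Complex.arg_ofReal_of_neg (neg_neg_of_pos ht),
    abs_of_pos Real.pi_pos]
  exact h.2.1

theorem IsSectorialOfAngle.hasDerivAt (h : IsSectorialOfAngle A ω₀) {z : ℂ} (hz : z ≠ 0)
    (ha : ω₀ < |z.arg|) :
    HasDerivAt (opResolvent A) (-(opResolvent A z * opResolvent A z)) z := by
  obtain ⟨ω', h1, h2⟩ := exists_between ha
  have h0 : 0 ≤ ω' := h.1.trans h1.le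
  have hπ : ω' < Real.pi := h2.trans_le (Complex.abs_arg_le_pi z)
  obtain ⟨M, hM⟩ := h.2.2.2 ω' h1 hπ
  have hn : 0 < ‖z‖ := norm_pos_iff.2 hz
  have hmem : {w : ℂ | w.re < ‖w‖ * Real.cos ω'} ∩ {w : ℂ | ‖z‖ / 2 < ‖w‖} ∈ 𝓝 z := by
    refine ((isOpen_lt (by fun_prop) (by fun_prop)).inter
      (isOpen_lt (by fun_prop) (by fun_prop))).mem_nhds ⟨?_, ?_⟩
    · exact (abs_arg_lt_iff_cos hz h0 hπ.le).1 h2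
    · simp only [mem_ofPred_eq]; linarith
  refine hasDerivAt_opResolvent (K := |M| / (‖z‖ / 2)) hmem ?_ ?_
  · rintro w ⟨hw1, hw2⟩
    have hw0 : w ≠ 0 := norm_pos_iff.1 (lt_trans (by positivity) hw2)
    exact h.mem hw0 (h1.trans ((abs_arg_lt_iff_cos hw0 h0 hπ.le).2 hw1))
  · rintro w ⟨hw1, hw2⟩
    have hw0 : w ≠ 0 := norm_pos_iff.1 (lt_trans (by positivity) hw2)
    have h3 := hM w hw0 ((abs_arg_lt_iff_cos hw0 h0 hπ.le).2 hw1)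
    rw [norm_smul] at h3
    rw [le_div_iff₀ (by positivity)]
    have h4 : ‖z‖ / 2 ≤ ‖w‖ := le_of_lt hw2
    nlinarith [norm_nonneg (opResolvent A w), le_abs_self M]

theorem IsSectorialOfAngle.differentiableAt_resLog (h : IsSectorialOfAngle A ω₀) {w : ℂ}
    (hw : ω₀ < |(Complex.exp w).arg|) : DifferentiableAt ℂ (resLog A) w := by
  have h1 : DifferentiableAt ℂ (fun w : ℂ => opResolvent A (Complex.exp w)) w :=
    (h.hasDerivAt (Complex.exp_ne_zero w) hw).differentiableAt.comp w
      Complex.differentiableAt_exp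
  exact Complex.differentiableAt_exp.smul h1

theorem IsSectorialOfAngle.resLog_bound (h : IsSectorialOfAngle A ω₀) {ω' : ℝ} (h1 : ω₀ < ω')
    (h2 : ω' < Real.pi) :
    ∃ M : ℝ, 0 < M ∧ ∀ w : ℂ, ω' < |(Complex.exp w).arg| → ‖resLog A w‖ ≤ M := by
  obtain ⟨M, hM⟩ := h.2.2.2 ω' h1 h2
  exact ⟨|M| + 1, by positivity, fun w hw => (hM _ (Complex.exp_ne_zero w) hw).trans
    ((le_abs_self M).trans (by linarith))⟩

theorem IsSectorialOfAngle.smul (h : IsSectorialOfAngle A ω₀) {t : ℝ} (ht : 0 < t) :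
    IsSectorialOfAngle ((t : ℂ) • A) ω₀ := by
  have ht' : (t : ℂ) ≠ 0 := by exact_mod_cast ht.ne'
  have harg : ∀ z : ℂ, (z / t).arg = z.arg := fun _ => by
    rw [div_eq_inv_mul, ← Complex.ofReal_inv, Complex.arg_real_mul _ (inv_pos.2 ht)]
  refine ⟨h.1, h.2.1, fun _ hz ha => ⟨_, isOpResolvent_smul ht' (opResolvent_spec
    (h.mem (div_ne_zero hz ht') (by rwa [harg])))⟩, fun ω' h1 h2 => ?_⟩
  obtain ⟨M, hM⟩ := h.2.2.2 ω' h1 h2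
  refine ⟨M, fun z hz ha => ?_⟩
  have ha' : ω' < |(z / (t : ℂ)).arg| := by rwa [harg]
  have := hM (z / t) (div_ne_zero hz ht') ha'
  rwa [opResolvent_smul ht' (h.mem (div_ne_zero hz ht') (h1.trans ha')), smul_smul,
    ← div_eq_mul_inv]

end Angle

theorem smul_inv_smul_linearPMap {t : ℝ} (ht : 0 < t) :
    ((t⁻¹ : ℝ) : ℂ) • ((t : ℂ) • A) = A := by
  rw [smul_smul]
  have : ((t⁻¹ : ℝ) : ℂ) * (t : ℂ) = 1 := by
    rw [← Complex.ofReal_mul, inv_mul_cancel₀ ht.ne', Complex.ofReal_one]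
  rw [this, one_smul]

theorem sectorialityAngle_smul {t : ℝ} (ht : 0 < t) :
    sectorialityAngle ((t : ℂ) • A) = sectorialityAngle A := by
  have : {ω₀ : ℝ | IsSectorialOfAngle ((t : ℂ) • A) ω₀} = {ω₀ : ℝ | IsSectorialOfAngle A ω₀} := by
    ext ω₀
    refine ⟨fun h => ?_, fun h => IsSectorialOfAngle.smul h ht⟩
    have := IsSectorialOfAngle.smul (show IsSectorialOfAngle ((t : ℂ) • A) ω₀ from h)
      (inv_pos.2 ht)
    rwa [smul_inv_smul_linearPMap ht] at this
  rw [sectorialityAngle, this, sectorialityAngle]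

theorem sectorialityAngle_nonneg : 0 ≤ sectorialityAngle A :=
  Real.sInf_nonneg fun _ h => h.1

/-- `A` is sectorial of angles arbitrarily close to `ω_A`; the infimum itself is not needed. -/
theorem IsSectorialOp.exists_angle (hA : IsSectorialOp A) {ω : ℝ} (h : sectorialityAngle A < ω) :
    ∃ ω₀ : ℝ, ω₀ < ω ∧ IsSectorialOfAngle A ω₀ := by
  obtain ⟨ω₀, h1, h2⟩ := exists_lt_of_csInf_lt hA h
  exact ⟨ω₀, h2, h1⟩

theorem IsSectorialOp.smul (hA : IsSectorialOp A) {t : ℝ} (ht : 0 < t) :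
    IsSectorialOp ((t : ℂ) • A) := by
  obtain ⟨ω₀, h⟩ := hA
  exact ⟨ω₀, h.smul ht⟩

end Resolvent

/-! ### The class `H^∞_0` in the exponential coordinate -/

section HInftyZero

variable {ω : ℝ} {f g : ℂ → ℂ}

theorem exp_mem_openSector {w : ℂ} (hω : ω ≤ Real.pi) (hw : |w.im| < ω) :
    Complex.exp w ∈ openSector ω :=
  ⟨Complex.exp_ne_zero w, by rwa [abs_arg_exp (hw.le.trans hω)]⟩

/-- The exponential maps the strip `|Im w| < ω` onto the sector. -/
theorem exists_exp_of_mem_openSector {z : ℂ} (hz : z ∈ openSector ω) :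
    ∃ w : ℂ, |w.im| < ω ∧ Complex.exp w = z :=
  ⟨Complex.log z, by rw [Complex.log_im]; exact hz.2, Complex.exp_log hz.1⟩

theorem openSector_subset_slitPlane (hω : ω ≤ Real.pi) : openSector ω ⊆ Complex.slitPlane := by
  intro z hz
  rw [Complex.mem_slitPlane_iff_arg]
  refine ⟨fun h => ?_, hz.1⟩
  have := hz.2
  rw [h, abs_of_pos Real.pi_pos] at this
  linarith

theorem isOpen_openSector (hω : ω ≤ Real.pi) : IsOpen (openSector ω) := by
  have h1 : openSector ω = Complex.slitPlane ∩ Complex.arg ⁻¹' {x : ℝ | |x| < ω} := by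
    ext z
    exact ⟨fun h => ⟨openSector_subset_slitPlane hω h, h.2⟩,
      fun h => ⟨Complex.slitPlane_ne_zero h.1, h.2⟩⟩
  rw [h1]
  exact ContinuousOn.isOpen_inter_preimage
    (fun z hz => (Complex.continuousAt_arg hz).continuousWithinAt) Complex.isOpen_slitPlane
    (isOpen_lt (by fun_prop) (by fun_prop))

theorem ofReal_mem_openSector (hω : 0 < ω) {t : ℝ} (ht : 0 < t) : (t : ℂ) ∈ openSector ω :=
  ⟨by exact_mod_cast ht.ne', by rwa [Complex.arg_ofReal_of_nonneg ht.le, abs_zero]⟩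

theorem mul_mem_openSector {t : ℝ} (ht : 0 < t) {z : ℂ} (hz : z ∈ openSector ω) :
    (t : ℂ) * z ∈ openSector ω :=
  ⟨mul_ne_zero (by exact_mod_cast ht.ne') hz.1, by
    rw [Complex.arg_real_mul _ ht]; exact hz.2⟩

theorem one_add_ne_zero_of_mem (hω : ω ≤ Real.pi) {z : ℂ} (hz : z ∈ openSector ω) :
    1 + z ≠ 0 := by
  intro h
  have hz' : z = ((-1 : ℝ) : ℂ) := by push_cast; linear_combination h
  have := hz.2
  rw [hz', Complex.arg_ofReal_of_neg (by norm_num), abs_of_pos Real.pi_pos] at this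
  linarith

/-- With `z = e^w`, the weight `min(|z|^α, |z|^{-α})` is `e^{-α |Re w|}`. -/
theorem min_rpow_norm_exp (α : ℝ) (hα : 0 < α) (w : ℂ) :
    min (‖Complex.exp w‖ ^ α) (‖Complex.exp w‖ ^ (-α)) = Real.exp (-(α * |w.re|)) := by
  rw [Complex.norm_exp, ← Real.exp_mul, ← Real.exp_mul]
  rcases le_total 0 w.re with h | h
  · rw [abs_of_nonneg h, min_eq_right]
    · ring_nf
    · rw [Real.exp_le_exp]; nlinarith
  · rw [abs_of_nonpos h, min_eq_left]
    · ring_nf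
    · rw [Real.exp_le_exp]; nlinarith

theorem MemHInftyZero.exp_bound (h : MemHInftyZero ω f) (hω : ω ≤ Real.pi) :
    ∃ C α : ℝ, 0 < C ∧ 0 < α ∧
      ∀ w : ℂ, |w.im| < ω → ‖f (Complex.exp w)‖ ≤ C * Real.exp (-(α * |w.re|)) := by
  obtain ⟨_, C, α, hC, hα, hb⟩ := h
  refine ⟨C, α, hC, hα, fun w hw => ?_⟩
  have := hb _ (exp_mem_openSector hω hw)
  rwa [min_rpow_norm_exp α hα] at this

theorem differentiableAt_comp_exp (h : DifferentiableOn ℂ f (openSector ω)) (hω : ω ≤ Real.pi)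
    {w : ℂ} (hw : |w.im| < ω) : DifferentiableAt ℂ (fun w => f (Complex.exp w)) w := by
  have h1 := h.differentiableAt ((isOpen_openSector hω).mem_nhds (exp_mem_openSector hω hw))
  exact h1.comp w Complex.differentiableAt_exp

theorem memHInftyZero_of_exp_bound (hd : DifferentiableOn ℂ f (openSector ω)) {C α : ℝ}
    (hα : 0 < α)
    (hb : ∀ w : ℂ, |w.im| < ω → ‖f (Complex.exp w)‖ ≤ C * Real.exp (-(α * |w.re|))) :
    MemHInftyZero ω f := by
  refine ⟨hd, |C| + 1, α, by positivity, hα, fun z hz => ?_⟩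
  obtain ⟨w, hw, rfl⟩ := exists_exp_of_mem_openSector hz
  rw [min_rpow_norm_exp α hα]
  exact (hb w hw).trans (by gcongr; linarith [le_abs_self C])

/-- Separate power bounds near `0` and near `∞` give membership in `H^∞_0`. -/
theorem memHInftyZero_of_bounds (hd : DifferentiableOn ℂ f (openSector ω)) {C D α β : ℝ}
    (hα : 0 < α) (hβ : 0 < β) (hC : 0 ≤ C) (hD : 0 ≤ D)
    (h0 : ∀ z ∈ openSector ω, ‖z‖ ≤ 1 → ‖f z‖ ≤ C * ‖z‖ ^ α)
    (h1 : ∀ z ∈ openSector ω, 1 ≤ ‖z‖ → ‖f z‖ ≤ D * ‖z‖ ^ (-β)) : MemHInftyZero ω f := by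
  have hm : 0 < min α β := lt_min hα hβ
  refine ⟨hd, C + D + 1, min α β, by positivity, hm, fun z hz => ?_⟩
  have hz0 : 0 < ‖z‖ := norm_pos_iff.2 hz.1
  rcases le_total ‖z‖ 1 with h | h
  · have e1 : ‖z‖ ^ α ≤ ‖z‖ ^ (min α β) :=
      Real.rpow_le_rpow_of_exponent_ge hz0 h (min_le_left _ _)
    have e2 : ‖z‖ ^ (min α β) ≤ ‖z‖ ^ (-(min α β)) :=
      Real.rpow_le_rpow_of_exponent_ge hz0 h (by linarith)
    rw [min_eq_left e2]
    refine (h0 z hz h).trans ?_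
    gcongr
    linarith
  · have e1 : ‖z‖ ^ (-β) ≤ ‖z‖ ^ (-(min α β)) :=
      Real.rpow_le_rpow_of_exponent_le h (by linarith [min_le_right α β])
    have e2 : ‖z‖ ^ (-(min α β)) ≤ ‖z‖ ^ (min α β) :=
      Real.rpow_le_rpow_of_exponent_le h (by linarith)
    rw [min_eq_right e2]
    refine (h1 z hz h).trans ?_
    gcongr
    linarith

theorem MemHInftyZero.congr (h : MemHInftyZero ω f) (hfg : ∀ z ∈ openSector ω, g z = f z) :
    MemHInftyZero ω g := by
  obtain ⟨hd, C, α, hC, hα, hb⟩ := h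
  exact ⟨hd.congr hfg, C, α, hC, hα, fun z hz => by rw [hfg z hz]; exact hb z hz⟩

theorem MemHInftyZero.bounded (h : MemHInftyZero ω f) :
    ∃ C : ℝ, 0 < C ∧ ∀ z ∈ openSector ω, ‖f z‖ ≤ C := by
  obtain ⟨hd, C, α, hC, hα, hb⟩ := h
  refine ⟨C, hC, fun z hz => (hb z hz).trans ?_⟩
  obtain ⟨w, hw, rfl⟩ := exists_exp_of_mem_openSector hz
  rw [min_rpow_norm_exp α hα]
  have : Real.exp (-(α * |w.re|)) ≤ 1 := Real.exp_le_one_iff.2 (by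
    have := mul_nonneg hα.le (abs_nonneg w.re); linarith)
  nlinarith

theorem MemHInftyZero.mul_bounded (h : MemHInftyZero ω f)
    (hd : DifferentiableOn ℂ g (openSector ω)) {K : ℝ} (hK : ∀ z ∈ openSector ω, ‖g z‖ ≤ K) :
    MemHInftyZero ω (fun z => f z * g z) := by
  obtain ⟨hfd, C, α, hC, hα, hb⟩ := h
  refine ⟨hfd.mul hd, C * (|K| + 1), α, by positivity, hα, fun z hz => ?_⟩
  rw [norm_mul]
  have h1 := hb z hz
  have h2 := (hK z hz).trans ((le_abs_self K).trans (by linarith : |K| ≤ |K| + 1))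
  calc _ ≤ _ := mul_le_mul h1 h2 (norm_nonneg _) ((norm_nonneg _).trans h1)
    _ = _ := by ring

theorem MemHInftyZero.mul (h : MemHInftyZero ω f) (h' : MemHInftyZero ω g) :
    MemHInftyZero ω (fun z => f z * g z) := by
  obtain ⟨K, _, hK⟩ := h'.bounded
  exact h.mul_bounded h'.1 hK

theorem MemHInftyZero.const_mul (h : MemHInftyZero ω f) (c : ℂ) :
    MemHInftyZero ω (fun z => c * f z) :=
  (h.mul_bounded (g := fun _ => c) (by fun_prop) (fun _ _ => le_rfl)).congr
    (fun z _ => mul_comm _ _)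

theorem MemHInftyZero.add (h : MemHInftyZero ω f) (h' : MemHInftyZero ω g) :
    MemHInftyZero ω (fun z => f z + g z) := by
  obtain ⟨hfd, C, α, hC, hα, hb⟩ := h
  obtain ⟨hgd, D, β, hD, hβ, hb'⟩ := h'
  have hm : 0 < min α β := lt_min hα hβ
  refine memHInftyZero_of_exp_bound (C := C + D) (hfd.add hgd) hm ?_
  intro w hw
  by_cases hω : ω ≤ Real.pi
  · have h1 := hb _ (exp_mem_openSector hω hw)
    have h2 := hb' _ (exp_mem_openSector hω hw)
    rw [min_rpow_norm_exp _ hα] at h1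
    rw [min_rpow_norm_exp _ hβ] at h2
    refine (norm_add_le _ _).trans ((add_le_add h1 h2).trans ?_)
    rw [add_mul]
    gcongr
    · exact min_le_left _ _
    · exact min_le_right _ _
  · have hmem : Complex.exp w ∈ openSector ω :=
      ⟨Complex.exp_ne_zero w, (Complex.abs_arg_le_pi _).trans_lt (not_le.1 hω)⟩
    have h1 := hb _ hmem
    have h2 := hb' _ hmem
    rw [min_rpow_norm_exp _ hα] at h1
    rw [min_rpow_norm_exp _ hβ] at h2
    refine (norm_add_le _ _).trans ((add_le_add h1 h2).trans ?_)
    rw [add_mul]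
    gcongr
    · exact min_le_left _ _
    · exact min_le_right _ _

theorem memHInftyZero_zero : MemHInftyZero ω (fun _ => 0) :=
  ⟨by fun_prop, 1, 1, one_pos, one_pos, fun z _ => by
    rw [norm_zero, one_mul]; exact le_min (by positivity) (by positivity)⟩

theorem differentiableOn_dilate (hd : DifferentiableOn ℂ f (openSector ω)) {t : ℝ} (ht : 0 < t) :
    DifferentiableOn ℂ (fun z => f (t * z)) (openSector ω) :=
  hd.comp (f := fun z : ℂ => (t : ℂ) * z) (by fun_prop) (fun _ hz => mul_mem_openSector ht hz)

theorem MemHInftyZero.dilate (h : MemHInftyZero ω f) {t : ℝ} (ht : 0 < t) :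
    MemHInftyZero ω (fun z => f (t * z)) := by
  obtain ⟨hd, C, α, hC, hα, hb⟩ := h
  refine ⟨differentiableOn_dilate hd ht, C * (t ^ α + t ^ (-α)), α, by positivity, hα,
    fun z hz => ?_⟩
  refine (hb _ (mul_mem_openSector ht hz)).trans ?_
  have e : ‖(t : ℂ) * z‖ = t * ‖z‖ := by rw [norm_mul, Complex.norm_real, Real.norm_of_nonneg ht.le]
  rw [e, Real.mul_rpow ht.le (norm_nonneg _), Real.mul_rpow ht.le (norm_nonneg _), mul_assoc]
  gcongr
  have p1 : 0 < t ^ α := by positivity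
  have p2 : 0 < t ^ (-α) := by positivity
  have p3 : 0 ≤ ‖z‖ ^ α := by positivity
  have p4 : 0 ≤ ‖z‖ ^ (-α) := by positivity
  rw [mul_min_of_nonneg _ _ (by positivity)]
  refine le_min ((min_le_left _ _).trans ?_) ((min_le_right _ _).trans ?_) <;> nlinarith

theorem differentiableOn_one_add_inv (hω : ω ≤ Real.pi) :
    DifferentiableOn ℂ (fun z => (1 + z)⁻¹) (openSector ω) := by
  intro z hz
  have := one_add_ne_zero_of_mem hω hz
  have h : DifferentiableAt ℂ (fun z : ℂ => (1 + z)⁻¹) z := by fun_prop (disch := assumption)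
  exact h.differentiableWithinAt

/-- On a proper sector `|1 + z|` is comparable to `1 + |z|`. -/
theorem exists_le_norm_one_add (hω : ω < Real.pi) :
    ∃ c : ℝ, 0 < c ∧ ∀ z ∈ openSector ω, 1 + ‖z‖ ≤ c * ‖1 + z‖ := by
  by_cases hω0 : 0 < ω
  swap
  · exact ⟨1, one_pos, fun z hz => absurd (lt_of_le_of_lt (abs_nonneg _) hz.2) hω0⟩
  set κ := Real.cos ω with hκ
  have hκ1 : -1 < κ := by
    rw [← Real.cos_pi]
    exact Real.strictAntiOn_cos ⟨hω0.le, hω.le⟩ ⟨Real.pi_pos.le, le_rfl⟩ hω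
  have hκ2 : κ ≤ 1 := Real.cos_le_one _
  set c := 2 / (1 + κ)
  have hc : 1 ≤ c := by rw [le_div_iff₀ (by linarith)]; linarith
  have hcκ : c * (1 + κ) = 2 := div_mul_cancel₀ _ (by linarith)
  refine ⟨c, by linarith, fun z hz => ?_⟩
  have hre : ‖z‖ * κ ≤ z.re := by
    by_contra! hlt
    exact absurd ((abs_arg_lt_iff_cos hz.1 hω0.le hω.le).2 hlt) (not_lt.2 hz.2.le)
  have hsq : ‖1 + z‖ ^ 2 = 1 + 2 * z.re + ‖z‖ ^ 2 := by
    rw [Complex.sq_norm, Complex.sq_norm, Complex.normSq_apply, Complex.normSq_apply]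
    simp
    ring
  have h1 : (1 + ‖z‖) ^ 2 ≤ c * ‖1 + z‖ ^ 2 := by
    rw [hsq]
    have hz0 := norm_nonneg z
    nlinarith [mul_le_mul_of_nonneg_left hre (by linarith : 0 ≤ c), sq_nonneg (1 - ‖z‖),
      mul_nonneg (by linarith : 0 ≤ c - 1) (sq_nonneg (1 - ‖z‖))]
  refine abs_le_of_sq_le_sq' ?_ (by positivity) |>.2
  calc (1 + ‖z‖) ^ 2 ≤ c * ‖1 + z‖ ^ 2 := h1
    _ ≤ c ^ 2 * ‖1 + z‖ ^ 2 := by gcongr; nlinarith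
    _ = _ := by ring

theorem exists_norm_one_add_inv_le (hω : ω < Real.pi) :
    ∃ c : ℝ, 0 < c ∧ ∀ z ∈ openSector ω, ‖(1 + z)⁻¹‖ ≤ c / (1 + ‖z‖) := by
  obtain ⟨c, hc, h⟩ := exists_le_norm_one_add hω
  refine ⟨c, hc, fun z hz => ?_⟩
  have h1 : 0 < ‖1 + z‖ := norm_pos_iff.2 (one_add_ne_zero_of_mem hω.le hz)
  rw [norm_inv, inv_eq_one_div, div_le_div_iff₀ h1 (by positivity), one_mul]
  exact h z hz

theorem memHInftyZero_psiThree (hω : ω < Real.pi) : MemHInftyZero ω psiThree := by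
  obtain ⟨c, hc, h⟩ := exists_norm_one_add_inv_le hω
  have hd : DifferentiableOn ℂ psiThree (openSector ω) := by
    have h1 := differentiableOn_one_add_inv hω.le
    have : DifferentiableOn ℂ (fun z => z * ((1 + z)⁻¹ * (1 + z)⁻¹)) (openSector ω) :=
      differentiableOn_id.mul (h1.mul h1)
    exact this.congr (fun z _ => by simp only [psiThree]; rw [sq, mul_inv])
  have hn : ∀ z ∈ openSector ω, ‖psiThree z‖ ≤ ‖z‖ * (c / (1 + ‖z‖)) ^ 2 := by
    intro z hz
    rw [psiThree, norm_mul, ← inv_pow, norm_pow]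
    gcongr
    exact h z hz
  refine memHInftyZero_of_bounds (C := c ^ 2) (D := c ^ 2) hd one_pos one_pos (by positivity)
    (by positivity) ?_ ?_
  · intro z hz h1
    refine (hn z hz).trans ?_
    have : (c / (1 + ‖z‖)) ^ 2 ≤ c ^ 2 := by
      gcongr
      exact div_le_self hc.le (by linarith [norm_nonneg z])
    rw [Real.rpow_one]
    nlinarith [norm_nonneg z]
  · intro z hz h1
    refine (hn z hz).trans ?_
    have hz0 : 0 < ‖z‖ := by linarith
    have : (c / (1 + ‖z‖)) ^ 2 ≤ (c / ‖z‖) ^ 2 := by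
      gcongr
      linarith
    calc ‖z‖ * (c / (1 + ‖z‖)) ^ 2 ≤ ‖z‖ * (c / ‖z‖) ^ 2 := by gcongr
      _ = _ := by
        rw [Real.rpow_neg_one]
        field_simp

end HInftyZero

/-! ### The Cauchy integral on `H^∞_0` -/

/-- The law of cosines for `e^a` and `e^b`. -/
theorem norm_exp_sub_exp_sq (a b : ℂ) :
    ‖Complex.exp b - Complex.exp a‖ ^ 2 = Real.exp b.re ^ 2 + Real.exp a.re ^ 2 -
      2 * (Real.exp b.re * Real.exp a.re * Real.cos (b.im - a.im)) := by
  rw [Complex.sq_norm, Complex.normSq_apply, Real.cos_sub]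
  simp only [Complex.sub_re, Complex.sub_im, Complex.exp_re, Complex.exp_im]
  linear_combination Real.exp b.re ^ 2 * (Real.sin_sq_add_cos_sq b.im) +
    Real.exp a.re ^ 2 * (Real.sin_sq_add_cos_sq a.im)

/-- On two different rays, `|z|` is at most a constant times `|z - ζ|`. -/
theorem exists_exp_le_norm_sub {c : ℝ} (hc : Real.cos c < 1) :
    ∃ K : ℝ, 0 < K ∧ ∀ a b : ℂ, b.im - a.im = c →
      Real.exp b.re ≤ K * ‖Complex.exp b - Complex.exp a‖ := by
  set κ := max (Real.cos c) 0 with hκ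
  have hκ1 : κ < 1 := max_lt hc one_pos
  have hκ0 : 0 ≤ κ := le_max_right _ _
  set K := 1 / (1 - κ)
  have hK : 1 ≤ K := by rw [le_div_iff₀ (by linarith)]; linarith
  have hKκ : K * (1 - κ) = 1 := div_mul_cancel₀ _ (by linarith)
  refine ⟨K, by linarith, fun a b h => ?_⟩
  have h1 := norm_exp_sub_exp_sq a b
  rw [h] at h1
  have pa := Real.exp_pos a.re
  have pb := Real.exp_pos b.re
  have h2 : (1 - κ) * Real.exp b.re ^ 2 ≤ ‖Complex.exp b - Complex.exp a‖ ^ 2 := by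
    rw [h1]
    have : Real.exp b.re * Real.exp a.re * Real.cos c ≤ Real.exp b.re * Real.exp a.re * κ := by
      gcongr; exact le_max_left _ _
    nlinarith [mul_nonneg hκ0 (sq_nonneg (Real.exp b.re - Real.exp a.re)),
      mul_nonneg (by linarith : 0 ≤ 1 - κ) (sq_nonneg (Real.exp a.re))]
  refine (abs_le_of_sq_le_sq' ?_ (by positivity)).2
  calc Real.exp b.re ^ 2 = K * ((1 - κ) * Real.exp b.re ^ 2) := by
        rw [← mul_assoc, hKκ, one_mul]
    _ ≤ K * ‖Complex.exp b - Complex.exp a‖ ^ 2 := by gcongr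
    _ ≤ K ^ 2 * ‖Complex.exp b - Complex.exp a‖ ^ 2 := by gcongr; nlinarith
    _ = _ := by ring

theorem cos_lt_one_of_abs {c : ℝ} (h0 : c ≠ 0) (h1 : |c| < 2 * Real.pi) : Real.cos c < 1 := by
  refine lt_of_le_of_ne (Real.cos_le_one c) fun h => h0 ?_
  rw [abs_lt] at h1
  exact (Real.cos_eq_one_iff_of_lt_of_lt h1.1 h1.2).1 h

section Calculus

variable {X : Type*} [NormedAddCommGroup X] [NormedSpace ℂ X] {A : X →ₗ.[ℂ] X}

/-- The Cauchy integral of `f` against the resolvent in the exponential coordinate. -/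
noncomputable def hCalc (A : X →ₗ.[ℂ] X) (δ : ℝ) (f : ℂ → ℂ) : X →L[ℂ] X :=
  stripInt δ (fun w => f (Complex.exp w) • resLog A w)

theorem cauchyCalc_eq_hCalc (δ : ℝ) (f : ℂ → ℂ) : cauchyCalc A δ f = hCalc A δ f := by
  have key : ∀ φ : ℝ, rayIntegral A f φ = lineInt φ (fun w => f (Complex.exp w) • resLog A w) := by
    intro φ
    rw [rayIntegral, integral_comp_exp_univ, lineInt]
    congr 1
    ext1 u
    have h1 : Complex.exp ((u : ℂ) + (φ : ℂ) * Complex.I) =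
        (Real.exp u : ℂ) * Complex.exp (φ * Complex.I) := by
      rw [Complex.exp_add, Complex.ofReal_exp]
    rw [resLog, h1, smul_smul, ← Complex.coe_smul, smul_smul]
    congr 1
    ring
  rw [cauchyCalc, key, key, hCalc, stripInt]

theorem hCalc_congr {δ ω : ℝ} (hδ : 0 ≤ δ) (hδω : δ < ω) (hω : ω ≤ Real.pi) {f g : ℂ → ℂ}
    (h : ∀ z ∈ openSector ω, f z = g z) : hCalc A δ f = hCalc A δ g := by
  refine stripInt_congr fun w hw => ?_
  rw [abs_of_nonneg hδ] at hw
  rw [h _ (exp_mem_openSector hω (hw.trans_lt hδω))]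

/-- The resolvent identity in the exponential coordinate. -/
theorem resLog_mul_resLog {a b : ℂ} (ha : Complex.exp a ∈ opResolventSet A)
    (hb : Complex.exp b ∈ opResolventSet A) (hne : Complex.exp b - Complex.exp a ≠ 0) :
    resLog A a * resLog A b =
      (Complex.exp b / (Complex.exp b - Complex.exp a)) • resLog A a -
      (Complex.exp a / (Complex.exp b - Complex.exp a)) • resLog A b := by
  have h := opResolvent_sub ha hb
  have h2 : opResolvent A (Complex.exp a) * opResolvent A (Complex.exp b) =
      (Complex.exp b - Complex.exp a)⁻¹ •
        (opResolvent A (Complex.exp a) - opResolvent A (Complex.exp b)) := by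
    rw [h, smul_smul, inv_mul_cancel₀ hne, one_smul]
  simp only [resLog]
  rw [smul_mul_smul_comm, h2, smul_smul, smul_sub, smul_smul, smul_smul]
  congr 2 <;> field_simp

variable {ω₀ δ ω : ℝ}

theorem IsSectorialOfAngle.resLog_bound_strip (h : IsSectorialOfAngle A ω₀) (h1 : ω₀ < δ)
    (h2 : δ ≤ Real.pi) :
    ∃ M : ℝ, 0 < M ∧ ∀ w : ℂ, δ ≤ |w.im| → |w.im| ≤ Real.pi → ‖resLog A w‖ ≤ M := by
  obtain ⟨ω', h3, h4⟩ := exists_between h1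
  obtain ⟨M, hM, hb⟩ := h.resLog_bound h3 (h4.trans_le h2)
  exact ⟨M, hM, fun w hw1 hw2 => hb w (by rw [abs_arg_exp hw2]; linarith)⟩

theorem IsSectorialOfAngle.differentiableAt_resLog_strip (h : IsSectorialOfAngle A ω₀) {w : ℂ}
    (h1 : ω₀ < |w.im|) (h2 : |w.im| ≤ Real.pi) : DifferentiableAt ℂ (resLog A) w :=
  h.differentiableAt_resLog (by rwa [abs_arg_exp h2])

theorem IsSectorialOfAngle.exp_mem (h : IsSectorialOfAngle A ω₀) {w : ℂ}
    (h1 : ω₀ < |w.im|) (h2 : |w.im| ≤ Real.pi) : Complex.exp w ∈ opResolventSet A :=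
  h.mem (Complex.exp_ne_zero w) (by rwa [abs_arg_exp h2])

theorem MemHInftyZero.integrable_smul_resLog {f : ℂ → ℂ} (hf : MemHInftyZero ω f)
    (h : IsSectorialOfAngle A ω₀) (h1 : ω₀ < δ) (h2 : δ < ω) (h3 : ω ≤ Real.pi) {φ : ℝ}
    (hφ : |φ| = |δ|) : Integrable (fun u : ℝ =>
      f (Complex.exp ((u : ℂ) + (φ : ℂ) * Complex.I)) •
        resLog A ((u : ℂ) + (φ : ℂ) * Complex.I)) := by
  obtain ⟨C, α, hC, hα, hb⟩ := hf.exp_bound h3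
  obtain ⟨M, hM, hR⟩ := h.resLog_bound_strip h1 (h2.le.trans h3)
  rw [abs_of_pos (h.1.trans_lt h1)] at hφ
  refine integrable_line (H := fun w => f (Complex.exp w) • resLog A w) (C := C * M) (N := 0) hα
    (fun w hw => ?_) (fun w hw _ => ?_)
  · exact (differentiableAt_comp_exp hf.1 h3 (by rw [hw, hφ]; exact h2)).smul
      (h.differentiableAt_resLog_strip (by rw [hw, hφ]; exact h1) (by rw [hw, hφ]; linarith))
  · rw [norm_smul]
    have e1 := hb w (by rw [hw, hφ]; exact h2)
    have e2 := hR w (by rw [hw, hφ]) (by rw [hw, hφ]; linarith)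
    calc _ ≤ _ := mul_le_mul e1 e2 (norm_nonneg _) ((norm_nonneg _).trans e1)
      _ = _ := by ring

/-- Independence of the contour angle. -/
theorem hCalc_indep {f : ℂ → ℂ} (hf : MemHInftyZero ω f)
    (h : IsSectorialOfAngle A ω₀) {δ₁ δ₂ : ℝ} (h1 : ω₀ < δ₁) (h12 : δ₁ ≤ δ₂) (h2 : δ₂ < ω)
    (h3 : ω ≤ Real.pi) : hCalc A δ₁ f = hCalc A δ₂ f := by
  obtain ⟨C, α, hC, hα, hb⟩ := hf.exp_bound h3
  obtain ⟨M, hM, hR⟩ := h.resLog_bound_strip h1 ((h12.trans h2.le).trans h3)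
  refine stripInt_indep (C := C * M) (N := 0) (h.1.trans h1.le) h12 hα (fun w hw1 hw2 => ?_)
    (fun w hw1 hw2 _ => ?_)
  · exact (differentiableAt_comp_exp hf.1 h3 (hw2.trans_lt h2)).smul
      (h.differentiableAt_resLog_strip (h1.trans_le hw1) (by linarith))
  · rw [norm_smul]
    have e1 := hb w (hw2.trans_lt h2)
    have e2 := hR w hw1 (by linarith)
    calc _ ≤ _ := mul_le_mul e1 e2 (norm_nonneg _) ((norm_nonneg _).trans e1)
      _ = _ := by ring

/-- The basic norm estimate: `‖f(A)‖` is controlled by `∫ |f(z)| |dz| / |z|`. -/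
theorem IsSectorialOfAngle.norm_hCalc_le (h : IsSectorialOfAngle A ω₀) (h1 : ω₀ < δ)
    (h2 : δ ≤ Real.pi) : ∃ M : ℝ, 0 < M ∧ ∀ (f : ℂ → ℂ) (k : ℝ → ℝ), Integrable k →
      (∀ w : ℂ, |w.im| = δ → ‖f (Complex.exp w)‖ ≤ k w.re) → ‖hCalc A δ f‖ ≤ M * ∫ u, k u := by
  obtain ⟨M, hM, hR⟩ := h.resLog_bound_strip h1 h2
  have hδ : 0 < δ := h.1.trans_lt h1
  refine ⟨2 * M, by positivity, fun f k hk hb => ?_⟩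
  refine (norm_stripInt_le (B := M * ∫ u, k u) (k := fun u => M * k u) (hk.const_mul M)
    (integral_const_mul _ _).le ?_).trans_eq (by ring)
  intro w hw
  rw [abs_of_pos hδ] at hw
  rw [norm_smul, mul_comm]
  exact mul_le_mul (hR w hw.ge (by linarith)) (hb w hw) (norm_nonneg _) hM.le

theorem hCalc_add {f g : ℂ → ℂ} (hf : MemHInftyZero ω f) (hg : MemHInftyZero ω g)
    (h : IsSectorialOfAngle A ω₀) (h1 : ω₀ < δ) (h2 : δ < ω) (h3 : ω ≤ Real.pi) :
    hCalc A δ (fun z => f z + g z) = hCalc A δ f + hCalc A δ g := by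
  unfold hCalc
  rw [← stripInt_add (fun φ hφ => hf.integrable_smul_resLog h h1 h2 h3 hφ)
    (fun φ hφ => hg.integrable_smul_resLog h h1 h2 h3 hφ)]
  congr 1
  ext1 w
  rw [add_smul]

theorem hCalc_const_mul (c : ℂ) (f : ℂ → ℂ) :
    hCalc A δ (fun z => c * f z) = c • hCalc A δ f := by
  unfold hCalc
  rw [← stripInt_smul]
  congr 1
  ext1 w
  rw [mul_smul]

variable [CompleteSpace X]

/-- The product of `f(A)` with a resolvent at a point outside the contour. The resolvent identity
yields two terms; the one with the fixed resolvent vanishes by Cauchy's theorem. -/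
theorem hCalc_mul_resLog {f : ℂ → ℂ} (hf : MemHInftyZero ω f)
    (h : IsSectorialOfAngle A ω₀) (h1 : ω₀ < δ) (h2 : δ < ω) (h3 : ω ≤ Real.pi)
    {b : ℂ} (hb1 : δ < |b.im|) (hb2 : |b.im| ≤ Real.pi) :
    hCalc A δ f * resLog A b = stripInt δ (fun a =>
      (f (Complex.exp a) * (Complex.exp b / (Complex.exp b - Complex.exp a))) • resLog A a) := by
  have hδ : 0 < δ := h.1.trans_lt h1
  obtain ⟨C, α, hC, hα, hb⟩ := hf.exp_bound h3
  obtain ⟨M, hM, hR⟩ := h.resLog_bound_strip h1 (h2.le.trans h3)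
  have hint := fun φ hφ => hf.integrable_smul_resLog (φ := φ) h h1 h2 h3 hφ
  have hne : ∀ a : ℂ, |a.im| ≤ δ → Complex.exp b - Complex.exp a ≠ 0 := by
    intro a ha
    refine sub_ne_zero.2 (exp_ne_exp_of_im (fun e => ?_) ?_)
    · rw [e] at hb1; linarith
    · have := abs_sub b.im a.im
      linarith
  set N := |b.re| + 1
  have hN : ∀ w : ℂ, N ≤ |w.re| → 1 ≤ |b.re - w.re| := by
    intro w hw
    rw [abs_sub_comm]
    linarith [abs_sub_abs_le_abs_sub w.re b.re]
  have hfac : ∀ a : ℂ, N ≤ |a.re| →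
      ‖Complex.exp b / (Complex.exp b - Complex.exp a)‖ ≤ 2 ∧
      ‖Complex.exp a / (Complex.exp b - Complex.exp a)‖ ≤ 2 := by
    intro a ha
    rw [norm_div, norm_div, Complex.norm_exp, Complex.norm_exp]
    exact ⟨div_le_of_le_mul₀ (norm_nonneg _) zero_le_two (norm_exp_sub_exp_ge (hN a ha)),
      div_le_of_le_mul₀ (norm_nonneg _) zero_le_two (norm_exp_sub_exp_ge' (hN a ha))⟩
  set L : (X →L[ℂ] X) →L[ℂ] (X →L[ℂ] X) := (ContinuousLinearMap.mul ℂ (X →L[ℂ] X)).flip (resLog A b)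
  have hL : ∀ V, L V = V * resLog A b := fun V => rfl
  have e1 : hCalc A δ f * resLog A b =
      stripInt δ (fun a => L (f (Complex.exp a) • resLog A a)) := by
    rw [stripInt_clm L hint, hL, hCalc]
  set s : ℂ → ℂ := fun a => f (Complex.exp a) * (Complex.exp a / (Complex.exp b - Complex.exp a))
  have hsd : ∀ a : ℂ, |a.im| ≤ δ → DifferentiableAt ℂ s a := by
    intro a ha
    have n1 := hne a ha
    have d1 := differentiableAt_comp_exp hf.1 h3 (ha.trans_lt h2)
    exact d1.mul (by fun_prop (disch := assumption))
  have hsb : ∀ a : ℂ, |a.im| ≤ δ → N ≤ |a.re| → ‖s a‖ ≤ (2 * C) * Real.exp (-(α * |a.re|)) := by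
    intro a ha haN
    have e1 := hb a (ha.trans_lt h2)
    simp only [s]
    rw [norm_mul]
    calc _ ≤ _ := mul_le_mul e1 (hfac a haN).2 (norm_nonneg _) ((norm_nonneg _).trans e1)
      _ = _ := by ring
  have e2 : stripInt δ (fun a => L (f (Complex.exp a) • resLog A a)) = stripInt δ (fun a =>
      (f (Complex.exp a) * (Complex.exp b / (Complex.exp b - Complex.exp a))) • resLog A a +
      (ContinuousLinearMap.toSpanSingleton ℂ (-resLog A b)) (s a)) := by
    refine stripInt_congr fun a ha => ?_
    rw [abs_of_pos hδ] at ha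
    rw [hL, smul_mul_assoc, resLog_mul_resLog (h.exp_mem (by rw [ha]; exact h1) (by linarith))
      (h.exp_mem (h1.trans hb1) hb2) (hne a ha.le), smul_sub, smul_smul, smul_smul,
      ContinuousLinearMap.toSpanSingleton_apply, smul_neg, ← sub_eq_add_neg]
  have i2 : ∀ φ : ℝ, |φ| = |δ| →
      Integrable (fun u : ℝ => s ((u : ℂ) + (φ : ℂ) * Complex.I)) := by
    intro φ hφ
    rw [abs_of_pos hδ] at hφ
    exact integrable_line hα (fun w hw => hsd w (by rw [hw, hφ]))
      (fun w hw hN => hsb w (by rw [hw, hφ]) hN)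
  have i1 : ∀ φ : ℝ, |φ| = |δ| → Integrable (fun u : ℝ => (fun a =>
      (f (Complex.exp a) * (Complex.exp b / (Complex.exp b - Complex.exp a))) • resLog A a)
      ((u : ℂ) + (φ : ℂ) * Complex.I)) := by
    intro φ hφ
    rw [abs_of_pos hδ] at hφ
    refine integrable_line (H := fun a =>
      (f (Complex.exp a) * (Complex.exp b / (Complex.exp b - Complex.exp a))) • resLog A a)
      (N := N) (C := 2 * C * M) hα (fun w hw => ?_) (fun w hw hwN => ?_)
    · have n1 := hne w (by rw [hw, hφ])
      have d1 := differentiableAt_comp_exp hf.1 h3 (w := w) (by rw [hw, hφ]; exact h2)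
      refine (d1.mul (by fun_prop (disch := assumption))).smul
        (h.differentiableAt_resLog_strip (by rw [hw, hφ]; exact h1) (by rw [hw, hφ]; linarith))
    · have e1 := hb w (by rw [hw, hφ]; exact h2)
      have e2 := hR w (by rw [hw, hφ]) (by rw [hw, hφ]; linarith)
      rw [norm_smul, norm_mul]
      have e3 := mul_le_mul e1 (hfac w hwN).1 (norm_nonneg _) ((norm_nonneg _).trans e1)
      calc _ ≤ _ := mul_le_mul e3 e2 (norm_nonneg _)
            ((mul_nonneg (norm_nonneg _) (norm_nonneg _)).trans e3)
        _ = _ := by ring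
  rw [e1, e2, stripInt_add i1, stripInt_clm _ i2, stripInt_eq_zero_of_inner hδ.le hα hsd hsb,
    map_zero, add_zero]
  intro φ hφ
  exact (ContinuousLinearMap.toSpanSingleton ℂ (-resLog A b)).integrable_comp (i2 φ hφ)

theorem stripInt_swap {E : Type*} [NormedAddCommGroup E] [NormedSpace ℂ E] {δ₁ δ₂ : ℝ}
    {K : ℂ → ℂ → E}
    (hK : ∀ φ₁ φ₂ : ℝ, |φ₁| = |δ₁| → |φ₂| = |δ₂| → Integrable (fun p : ℝ × ℝ =>
      K ((p.1 : ℂ) + (φ₁ : ℂ) * Complex.I) ((p.2 : ℂ) + (φ₂ : ℂ) * Complex.I))) :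
    stripInt δ₁ (fun a => stripInt δ₂ (fun b => K a b)) =
      stripInt δ₂ (fun b => stripInt δ₁ (fun a => K a b)) := by
  have hl := fun (φ₁ φ₂ : ℝ) h1 h2 => integral_integral_swap (f := fun u v : ℝ =>
    K ((u : ℂ) + (φ₁ : ℂ) * Complex.I) ((v : ℂ) + (φ₂ : ℂ) * Complex.I)) (hK φ₁ φ₂ h1 h2)
  have hi := fun (φ₁ φ₂ : ℝ) h1 h2 => (hK φ₁ φ₂ h1 h2).integral_prod_left
  have hi' := fun (φ₁ φ₂ : ℝ) h1 h2 => (hK φ₁ φ₂ h1 h2).integral_prod_right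
  simp only [stripInt, lineInt, integral_smul]
  have n1 := abs_neg δ₁
  have n2 := abs_neg δ₂
  rw [integral_sub (hi _ _ n1 n2) (hi _ _ n1 rfl), integral_sub (hi _ _ rfl n2) (hi _ _ rfl rfl),
    integral_sub (hi' _ _ n1 n2) (hi' _ _ rfl n2), integral_sub (hi' _ _ n1 rfl) (hi' _ _ rfl rfl),
    ← hl _ _ n1 n2, ← hl _ _ n1 rfl, ← hl _ _ rfl n2, ← hl _ _ rfl rfl]
  congr 1
  rw [← smul_sub, ← smul_sub]
  congr 1
  abel

/-- Multiplicativity of the Cauchy integral on `H^∞_0`: the two factors are written with different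
contours, the integrals are interchanged, and the inner one is evaluated by Cauchy's formula. -/
theorem hCalc_mul {f g : ℂ → ℂ} (hf : MemHInftyZero ω f) (hg : MemHInftyZero ω g)
    (h : IsSectorialOfAngle A ω₀) (h1 : ω₀ < δ) (h2 : δ < ω) (h3 : ω ≤ Real.pi) :
    hCalc A δ f * hCalc A δ g = hCalc A δ (fun z => f z * g z) := by
  have hδ : 0 < δ := h.1.trans_lt h1
  obtain ⟨δ₂, h4, h5⟩ := exists_between h2
  have hδ₂ : 0 < δ₂ := hδ.trans h4
  obtain ⟨C, α, hC, hα, hb⟩ := hf.exp_bound h3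
  obtain ⟨D, β, hD, hβ, hb'⟩ := hg.exp_bound h3
  obtain ⟨M, hM, hR⟩ := h.resLog_bound_strip h1 (h2.le.trans h3)
  have hintg := fun φ hφ => hg.integrable_smul_resLog (φ := φ) h (h1.trans h4) h5 h3 hφ
  set L : (X →L[ℂ] X) →L[ℂ] (X →L[ℂ] X) := ContinuousLinearMap.mul ℂ (X →L[ℂ] X) (hCalc A δ f)
  have hL : ∀ V, L V = hCalc A δ f * V := fun V => rfl
  have hne : ∀ a b : ℂ, |a.im| = δ → |b.im| = δ₂ → Complex.exp b - Complex.exp a ≠ 0 := by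
    intro a b ha hb
    refine sub_ne_zero.2 (exp_ne_exp_of_im (fun e => ?_) ?_)
    · rw [e, ha] at hb; linarith
    · have := abs_sub b.im a.im
      linarith
  set K : ℂ → ℂ → (X →L[ℂ] X) := fun b a =>
    (g (Complex.exp b) * (f (Complex.exp a) *
      (Complex.exp b / (Complex.exp b - Complex.exp a)))) • resLog A a
  have e1 : hCalc A δ f * hCalc A δ g = stripInt δ₂ (fun b => stripInt δ (fun a => K b a)) := by
    rw [hCalc_indep hg h h1 h4.le h5 h3, ← hL]
    conv_lhs => rw [hCalc]
    rw [← stripInt_clm L hintg]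
    refine stripInt_congr fun b hb => ?_
    rw [abs_of_pos hδ₂] at hb
    rw [map_smul, hL, hCalc_mul_resLog hf h h1 h2 h3 (by rw [hb]; exact h4)
      (by rw [hb]; linarith), ← stripInt_smul]
    congr 1
    ext1 a
    simp only [K, smul_smul]
  have hKint : ∀ φ₁ φ₂ : ℝ, |φ₁| = |δ₂| → |φ₂| = |δ| → Integrable (fun p : ℝ × ℝ =>
      K ((p.1 : ℂ) + (φ₁ : ℂ) * Complex.I) ((p.2 : ℂ) + (φ₂ : ℂ) * Complex.I)) := by
    intro φ₁ φ₂ hφ₁ hφ₂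
    rw [abs_of_pos hδ₂] at hφ₁
    rw [abs_of_pos hδ] at hφ₂
    have hcos : Real.cos (φ₁ - φ₂) < 1 := by
      refine cos_lt_one_of_abs (fun e => ?_) ?_
      · rw [sub_eq_zero] at e
        rw [e] at hφ₁; linarith
      · have := abs_sub φ₁ φ₂
        linarith
    obtain ⟨κ, hκ, hκb⟩ := exists_exp_le_norm_sub hcos
    have cf : Continuous (fun u : ℝ => f (Complex.exp ((u : ℂ) + (φ₂ : ℂ) * Complex.I))) :=
      continuous_line (H := fun w => f (Complex.exp w)) fun w hw =>
        differentiableAt_comp_exp hf.1 h3 (by rw [hw, hφ₂]; exact h2)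
    have cg : Continuous (fun u : ℝ => g (Complex.exp ((u : ℂ) + (φ₁ : ℂ) * Complex.I))) :=
      continuous_line (H := fun w => g (Complex.exp w)) fun w hw =>
        differentiableAt_comp_exp hg.1 h3 (by rw [hw, hφ₁]; exact h5)
    have cR : Continuous (fun u : ℝ => resLog A ((u : ℂ) + (φ₂ : ℂ) * Complex.I)) :=
      continuous_line fun w hw =>
        h.differentiableAt_resLog_strip (by rw [hw, hφ₂]; exact h1) (by rw [hw, hφ₂]; linarith)
    have hcont : Continuous (fun p : ℝ × ℝ =>
        K ((p.1 : ℂ) + (φ₁ : ℂ) * Complex.I) ((p.2 : ℂ) + (φ₂ : ℂ) * Complex.I)) := by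
      refine ((cg.comp continuous_fst).mul ((cf.comp continuous_snd).mul
        (Continuous.div (by fun_prop) (by fun_prop) ?_))).smul (cR.comp continuous_snd)
      intro p
      exact hne _ _ (by rw [line_im, hφ₂]) (by rw [line_im, hφ₁])
    refine Integrable.mono' (((integrable_exp_neg_mul_abs hβ).const_mul (D * κ)).mul_prod
      ((integrable_exp_neg_mul_abs hα).const_mul (C * M))) hcont.aestronglyMeasurable
      (Eventually.of_forall fun p => ?_)
    set b : ℂ := (p.1 : ℂ) + (φ₁ : ℂ) * Complex.I with hbdef
    set a : ℂ := (p.2 : ℂ) + (φ₂ : ℂ) * Complex.I with hadef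
    have eb : b.re = p.1 := line_re _ _
    have ea : a.re = p.2 := line_re _ _
    have ib : |b.im| = δ₂ := by rw [hbdef, line_im, hφ₁]
    have ia : |a.im| = δ := by rw [hadef, line_im, hφ₂]
    have t1 := hb' b (by rw [ib]; exact h5)
    have t2 := hb a (by rw [ia]; exact h2)
    have t3 := hR a ia.ge (by rw [ia]; linarith)
    have t4 : ‖Complex.exp b / (Complex.exp b - Complex.exp a)‖ ≤ κ := by
      rw [norm_div, Complex.norm_exp]
      exact div_le_of_le_mul₀ (norm_nonneg _) hκ.le
        (hκb a b (by rw [hbdef, hadef, line_im, line_im]))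
    rw [eb] at t1
    rw [ea] at t2
    simp only [K]
    rw [norm_smul, norm_mul, norm_mul]
    calc _ ≤ (D * Real.exp (-(β * |p.1|)) * ((C * Real.exp (-(α * |p.2|))) * κ)) * M := by
          gcongr
      _ = _ := by ring
  rw [e1, stripInt_swap hKint, hCalc]
  refine stripInt_congr fun a ha => ?_
  rw [abs_of_pos hδ] at ha
  have e2 : (fun b => K b a) = fun b => ContinuousLinearMap.toSpanSingleton ℂ
      (f (Complex.exp a) • resLog A a)
      (Complex.exp b / (Complex.exp b - Complex.exp a) * g (Complex.exp b)) := by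
    ext1 b
    rw [ContinuousLinearMap.toSpanSingleton_apply, smul_smul]
    simp only [K]
    congr 1
    ring
  rw [e2, stripInt_clm, stripInt_cauchy h5 h3 hβ
    (fun w hw => differentiableAt_comp_exp hg.1 h3 hw) hb' (by rw [ha]; exact h4),
    ContinuousLinearMap.toSpanSingleton_apply, smul_smul, mul_comm]
  intro φ hφ
  rw [abs_of_pos hδ₂] at hφ
  refine integrable_line (H := fun b =>
    Complex.exp b / (Complex.exp b - Complex.exp a) * g (Complex.exp b)) (N := |a.re| + 1)
    (C := 2 * D) hβ (fun w hw => ?_) (fun w hw hN => ?_)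
  · have n1 := hne a w ha (by rw [hw, hφ])
    have d1 := differentiableAt_comp_exp hg.1 h3 (w := w) (by rw [hw, hφ]; exact h5)
    exact DifferentiableAt.mul (by fun_prop (disch := assumption)) d1
  · have t1 := hb' w (by rw [hw, hφ]; exact h5)
    have t2 : 1 ≤ |w.re - a.re| := by linarith [abs_sub_abs_le_abs_sub w.re a.re]
    rw [norm_mul, mul_assoc]
    refine mul_le_mul ?_ t1 (norm_nonneg _) zero_le_two
    rw [norm_div, Complex.norm_exp]
    exact div_le_of_le_mul₀ (norm_nonneg _) zero_le_two (norm_exp_sub_exp_ge t2)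

end Calculus

/-! ### The resolvent at `-1` and the rational functions of the calculus -/

theorem stripInt_smul_const {E : Type*} [NormedAddCommGroup E] [NormedSpace ℂ E] [CompleteSpace E]
    (k : ℂ → ℂ) (v : E) (δ : ℝ) : stripInt δ (fun w => k w • v) = stripInt δ k • v := by
  simp only [stripInt, lineInt]
  rw [integral_smul_const, integral_smul_const, ← sub_smul, smul_assoc]

section ResolventAtMinusOne

variable {X : Type*} [NormedAddCommGroup X] [NormedSpace ℂ X] {A : X →ₗ.[ℂ] X} {ω₀ δ ω : ℝ}

/-- The operator `(1 + A)⁻¹`. -/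
noncomputable def unitResolvent (A : X →ₗ.[ℂ] X) : X →L[ℂ] X := opResolvent (-A) 1

theorem IsSectorialOfAngle.one_mem_neg (h : IsSectorialOfAngle A ω₀) :
    (1 : ℂ) ∈ opResolventSet (-A) :=
  mem_opResolventSet_neg.2 (by simpa using h.neg_mem one_pos)

theorem IsSectorialOfAngle.resLog_pi (h : IsSectorialOfAngle A ω₀) :
    resLog A (Real.pi * Complex.I) = unitResolvent A := by
  have h1 : -(1 : ℂ) ∈ opResolventSet A := by simpa using h.neg_mem one_pos
  rw [unitResolvent, opResolvent_neg h1, resLog, Complex.exp_pi_mul_I, neg_smul, one_smul]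

theorem exp_pi_sub (a : ℂ) :
    Complex.exp (Real.pi * Complex.I) - Complex.exp a = -(1 + Complex.exp a) := by
  rw [Complex.exp_pi_mul_I]; ring

theorem IsSectorialOfAngle.resLog_mul_unitResolvent (h : IsSectorialOfAngle A ω₀) {a : ℂ}
    (ha : Complex.exp a ∈ opResolventSet A) (hne : 1 + Complex.exp a ≠ 0) :
    resLog A a * unitResolvent A = (1 + Complex.exp a)⁻¹ • resLog A a +
      (Complex.exp a * (1 + Complex.exp a)⁻¹) • unitResolvent A := by
  have hpi : Complex.exp (Real.pi * Complex.I) ∈ opResolventSet A := by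
    rw [Complex.exp_pi_mul_I]; simpa using h.neg_mem one_pos
  rw [← h.resLog_pi, resLog_mul_resLog ha hpi (by rw [exp_pi_sub]; exact neg_ne_zero.2 hne),
    exp_pi_sub, Complex.exp_pi_mul_I, neg_div_neg_eq, one_div, div_neg, div_eq_mul_inv, neg_smul,
    sub_neg_eq_add]

variable [CompleteSpace X]

theorem hCalc_mul_unitResolvent {f : ℂ → ℂ} (hf : MemHInftyZero ω f)
    (h : IsSectorialOfAngle A ω₀) (h1 : ω₀ < δ) (h2 : δ < ω) (h3 : ω ≤ Real.pi) :
    hCalc A δ f * unitResolvent A = hCalc A δ (fun z => f z * (1 + z)⁻¹) := by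
  have him : |((Real.pi : ℂ) * Complex.I).im| = Real.pi := by simp [Real.pi_pos.le]
  rw [← h.resLog_pi, hCalc_mul_resLog hf h h1 h2 h3 (by rw [him]; linarith) him.le, hCalc]
  congr 1
  ext1 a
  rw [exp_pi_sub, Complex.exp_pi_mul_I, neg_div_neg_eq, one_div]

/-- The Cauchy integral of `z (1 + z)⁻²` is `A (1 + A)⁻²`. The contour integral is split into a part
that is holomorphic outside the sector, a multiple of the scalar kernel, and a part that is
holomorphic inside the sector. -/
theorem hCalc_psiThree (h : IsSectorialOfAngle A ω₀) (h1 : ω₀ < δ) (h2 : δ < Real.pi) :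
    hCalc A δ psiThree = unitResolvent A - unitResolvent A * unitResolvent A := by
  have hδ : 0 < δ := h.1.trans_lt h1
  obtain ⟨ω', h3, h4⟩ := exists_between h1
  obtain ⟨M, hM, hR⟩ := h.resLog_bound h3 (h4.trans h2)
  obtain ⟨ω₁, h5, h6⟩ := exists_between h2
  have hψ : MemHInftyZero ω₁ psiThree := memHInftyZero_psiThree h6
  set J := unitResolvent A with hJ
  set D := J - J * J with hD
  set G₁ : ℂ → (X →L[ℂ] X) := fun a =>
    (resLog A a - (Complex.exp a / (Complex.exp a - Complex.exp 0)) • 1) * D with hG₁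
  set G₃ : ℂ → (X →L[ℂ] X) := fun a => psiThree (Complex.exp a) • J with hG₃
  have harg : ∀ w : ℂ, δ ≤ w.im → w.im ≤ 2 * Real.pi - δ → ω' < |(Complex.exp w).arg| := by
    intro w hw1 hw2
    rcases le_total w.im Real.pi with hw | hw
    · rw [abs_arg_exp (by rw [abs_of_nonneg (by linarith)]; exact hw), abs_of_nonneg (by linarith)]
      linarith
    · rw [abs_arg_exp' hw (by linarith)]; linarith
  have hmem : ∀ w : ℂ, δ ≤ w.im → w.im ≤ 2 * Real.pi - δ → Complex.exp w ∈ opResolventSet A :=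
    fun w hw1 hw2 => h.mem (Complex.exp_ne_zero w) (h3.trans (harg w hw1 hw2))
  have hG₁d : ∀ w : ℂ, δ ≤ w.im → w.im ≤ 2 * Real.pi - δ → DifferentiableAt ℂ G₁ w := by
    intro w hw1 hw2
    have d1 := h.differentiableAt_resLog (h3.trans (harg w hw1 hw2))
    have n1 : Complex.exp w - Complex.exp 0 ≠ 0 := by
      refine sub_ne_zero.2 (exp_ne_exp_of_im (by simp; linarith) ?_)
      simp
      rw [abs_lt]; constructor <;> linarith
    have d2 : DifferentiableAt ℂ (fun a => Complex.exp a / (Complex.exp a - Complex.exp 0)) w := by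
      fun_prop (disch := assumption)
    exact (d1.sub (d2.smul_const _)).mul_const _
  set B := 2 * ((M + ‖J‖) * ‖J‖) + 2 * ((M + ‖J‖) * ‖1 - J‖) + 2 * ‖D‖ with hB
  have hG₁b : ∀ w : ℂ, δ ≤ w.im → w.im ≤ 2 * Real.pi - δ → 1 ≤ |w.re| →
      ‖G₁ w‖ ≤ B * Real.exp (-(1 * |w.re|)) := by
    intro w hw1 hw2 hw3
    have hS := hR w (harg w hw1 hw2)
    have hSJ : ‖resLog A w - J‖ ≤ M + ‖J‖ := (norm_sub_le _ _).trans (by gcongr)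
    have q1 : ‖Complex.exp w - Complex.exp (Real.pi * Complex.I)‖ = ‖1 + Complex.exp w‖ := by
      rw [← norm_neg, neg_sub, exp_pi_sub, norm_neg]
    have b1 := norm_exp_sub_exp_ge (a := w) (b := Real.pi * Complex.I) (by simpa using hw3)
    have b2 := norm_exp_sub_exp_ge' (a := w) (b := Real.pi * Complex.I) (by simpa using hw3)
    have b3 := norm_exp_sub_exp_ge (a := w) (b := 0) (by simpa using hw3)
    have b4 := norm_exp_sub_exp_ge' (a := w) (b := 0) (by simpa using hw3)
    rw [q1] at b1 b2
    simp only [Complex.mul_re, Complex.ofReal_re, Complex.I_re, mul_zero, Complex.ofReal_im,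
      Complex.I_im, mul_one, sub_self, Real.exp_zero, Complex.zero_re] at b2 b4
    have pn : 0 < ‖1 + Complex.exp w‖ := by linarith
    have pm : 0 < ‖Complex.exp w - Complex.exp 0‖ := by linarith
    have hne : 1 + Complex.exp w ≠ 0 := norm_pos_iff.1 pn
    have hne0 : Complex.exp w - Complex.exp 0 ≠ 0 := norm_pos_iff.1 pm
    have hSJ' := h.resLog_mul_unitResolvent (hmem w hw1 hw2) hne
    rw [← hJ] at hSJ'
    set ρ := (1 + Complex.exp w)⁻¹ with hρ
    have hρ1 : Complex.exp w * ρ = 1 - ρ := by rw [hρ]; field_simp; ring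
    have hD1 : D = J * (1 - J) := by rw [hD, mul_sub, mul_one]
    have hD2 : D = (1 - J) * J := by rw [hD, sub_mul, one_mul]
    have pe := Real.exp_pos w.re
    -- `D = J(1 - J)` with `J = (1 + A)⁻¹`; the factor `J` gives decay at infinity, after the limit
    -- has been subtracted, and the factor `1 - J = A J` gives decay at the origin
    rcases le_total 0 w.re with hre | hre
    · have hform : G₁ w = ρ • ((resLog A w - J) * (1 - J)) -
          (Complex.exp w - Complex.exp 0)⁻¹ • D := by
        have k0 : Complex.exp w / (Complex.exp w - Complex.exp 0) =
            1 + (Complex.exp w - Complex.exp 0)⁻¹ := by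
          rw [Complex.exp_zero] at *
          field_simp
          ring
        have e1 : resLog A w * D = D + ρ • ((resLog A w - J) * (1 - J)) := by
          rw [hD1, ← mul_assoc, hSJ', hρ1, sub_smul, one_smul, ← smul_mul_assoc, ← add_mul,
            smul_sub]
          congr 1
          abel
        simp only [hG₁]
        rw [sub_mul, e1, k0, add_smul, one_smul, add_mul, one_mul, smul_mul_assoc, one_mul]
        abel
      rw [hform, one_mul, abs_of_nonneg hre, Real.exp_neg]
      have r1 : ‖ρ‖ ≤ 2 * (Real.exp w.re)⁻¹ := by
        rw [hρ, norm_inv, ← div_eq_mul_inv, inv_eq_one_div, div_le_div_iff₀ pn pe]; linarith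
      have r2 : ‖(Complex.exp w - Complex.exp 0)⁻¹‖ ≤ 2 * (Real.exp w.re)⁻¹ := by
        rw [norm_inv, ← div_eq_mul_inv, inv_eq_one_div, div_le_div_iff₀ pm pe]; linarith
      refine (norm_sub_le _ _).trans ?_
      rw [norm_smul, norm_smul]
      calc _ ≤ (2 * (Real.exp w.re)⁻¹) * ((M + ‖J‖) * ‖1 - J‖) +
            (2 * (Real.exp w.re)⁻¹) * ‖D‖ := by
            gcongr
            exact (norm_mul_le _ _).trans (by gcongr)
        _ ≤ B * (Real.exp w.re)⁻¹ := by
            have : 0 ≤ 2 * ((M + ‖J‖) * ‖J‖) * (Real.exp w.re)⁻¹ := by positivity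
            rw [hB]; linarith
    · have hform : G₁ w = (Complex.exp w * ρ) • ((resLog A w - J) * J) -
          (Complex.exp w / (Complex.exp w - Complex.exp 0)) • D := by
        have e1 : resLog A w * D = (Complex.exp w * ρ) • ((resLog A w - J) * J) := by
          rw [hD2, ← mul_assoc, mul_sub, mul_one, hSJ', ← smul_mul_assoc]
          congr 1
          rw [hρ1, smul_sub, sub_smul, sub_smul, one_smul, one_smul]
          abel
        simp only [hG₁]
        rw [sub_mul, e1, smul_mul_assoc, one_mul]
      rw [hform, one_mul, abs_of_nonpos hre, neg_neg]
      have r1 : ‖Complex.exp w * ρ‖ ≤ 2 * Real.exp w.re := by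
        rw [norm_mul, Complex.norm_exp, mul_comm, hρ, norm_inv]
        gcongr
        rw [inv_le_comm₀ pn two_pos]; linarith
      have r2 : ‖Complex.exp w / (Complex.exp w - Complex.exp 0)‖ ≤ 2 * Real.exp w.re := by
        rw [norm_div, Complex.norm_exp, div_le_iff₀ pm]
        nlinarith
      refine (norm_sub_le _ _).trans ?_
      rw [norm_smul, norm_smul]
      calc _ ≤ (2 * Real.exp w.re) * ((M + ‖J‖) * ‖J‖) + (2 * Real.exp w.re) * ‖D‖ := by
            gcongr
            exact (norm_mul_le _ _).trans (by gcongr)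
        _ ≤ B * Real.exp w.re := by
            have : 0 ≤ 2 * ((M + ‖J‖) * ‖1 - J‖) * Real.exp w.re := by positivity
            rw [hB]; linarith
  have hper : ∀ w : ℂ, G₁ (w + 2 * Real.pi * Complex.I) = G₁ w := by
    intro w
    simp only [hG₁]
    rw [resLog_periodic, exp_add_two_pi_I]
  have hG₁0 : stripInt δ G₁ = 0 :=
    stripInt_eq_zero_of_outer h2.le one_pos hper hG₁d hG₁b
  have hG₁i : ∀ φ : ℝ, |φ| = |δ| →
      Integrable (fun u : ℝ => G₁ ((u : ℂ) + (φ : ℂ) * Complex.I)) := by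
    intro φ hφ
    rw [abs_of_pos hδ] at hφ
    rcases abs_eq hδ.le |>.1 hφ with rfl | rfl
    · exact integrable_line one_pos (fun w hw => hG₁d w hw.ge (by linarith))
        (fun w hw hN => hG₁b w hw.ge (by linarith) hN)
    · have := integrable_line (φ := 2 * Real.pi - δ) one_pos
        (fun w hw => hG₁d w (by linarith) hw.le) (fun w hw hN => hG₁b w (by linarith) hw.le hN)
      refine this.congr (Eventually.of_forall fun u => ?_)
      beta_reduce
      rw [← hper ((u : ℂ) + ((-δ : ℝ) : ℂ) * Complex.I)]
      congr 1
      push_cast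
      ring
  obtain ⟨C, α, hC, hα, hb⟩ := hψ.exp_bound h6.le
  have hψd : ∀ w : ℂ, |w.im| ≤ δ → DifferentiableAt ℂ (fun w => psiThree (Complex.exp w)) w :=
    fun w hw => differentiableAt_comp_exp hψ.1 h6.le (hw.trans_lt h5)
  have hG₃0 : stripInt δ G₃ = 0 := by
    simp only [hG₃]
    rw [stripInt_smul_const, stripInt_eq_zero_of_inner (N := 0) hδ.le hα hψd
      (fun w hw _ => hb w (hw.trans_lt h5)), zero_smul]
  have hG₃i : ∀ φ : ℝ, |φ| = |δ| →
      Integrable (fun u : ℝ => G₃ ((u : ℂ) + (φ : ℂ) * Complex.I)) := by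
    intro φ hφ
    rw [abs_of_pos hδ] at hφ
    refine Integrable.smul_const (f := fun u : ℝ =>
      psiThree (Complex.exp ((u : ℂ) + (φ : ℂ) * Complex.I))) ?_ J
    exact integrable_line (H := fun w => psiThree (Complex.exp w)) (N := 0) hα
      (fun w hw => hψd w (by rw [hw, hφ]))
      (fun w hw _ => hb w (by rw [hw, hφ]; exact h5))
  have hkernel : stripInt δ (fun b => (Complex.exp b / (Complex.exp b - Complex.exp 0) -
      Complex.exp b / (Complex.exp b - Complex.exp (Real.pi * Complex.I))) • D) = D := by
    rw [stripInt_smul_const, stripInt_kernel (by simpa using hδ) h2, one_smul]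
  have hsplit : stripInt δ (fun b => (Complex.exp b / (Complex.exp b - Complex.exp 0) -
      Complex.exp b / (Complex.exp b - Complex.exp (Real.pi * Complex.I))) • D) =
      stripInt δ (fun b => psiThree (Complex.exp b) • resLog A b +
        (-1 : ℂ) • (G₁ b + G₃ b)) := by
    refine stripInt_congr fun w hw => ?_
    rw [abs_of_pos hδ] at hw
    have hne : 1 + Complex.exp w ≠ 0 :=
      one_add_ne_zero_of_mem h6.le (exp_mem_openSector h6.le (hw.trans_lt h5))
    have hSJ' := h.resLog_mul_unitResolvent (h.exp_mem (by rw [hw]; exact h1)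
      (by rw [hw]; exact h2.le)) hne
    rw [← hJ] at hSJ'
    have kpi : Complex.exp w / (Complex.exp w - Complex.exp (Real.pi * Complex.I)) =
        Complex.exp w * (1 + Complex.exp w)⁻¹ := by
      rw [Complex.exp_pi_mul_I, sub_neg_eq_add, add_comm, div_eq_mul_inv]
    have hψρ : psiThree (Complex.exp w) =
        Complex.exp w * (1 + Complex.exp w)⁻¹ * (1 + Complex.exp w)⁻¹ := by
      rw [psiThree, sq, mul_inv, mul_assoc]
    simp only [hG₁, hG₃]
    rw [kpi, hψρ]
    set ρ := (1 + Complex.exp w)⁻¹ with hρ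
    have hρ1 : Complex.exp w * ρ = 1 - ρ := by rw [hρ]; field_simp; ring
    have e1 : resLog A w * D = (ρ - ρ * ρ) • resLog A w + (1 - ρ) • D - (ρ - ρ * ρ) • J := by
      have e2 : resLog A w * (J * J) = (ρ * ρ) • resLog A w + (ρ * (1 - ρ)) • J +
          (1 - ρ) • (J * J) := by
        rw [← mul_assoc, hSJ', hρ1, add_mul, smul_mul_assoc, smul_mul_assoc, hSJ', hρ1, smul_add,
          smul_smul, smul_smul]
      rw [hD, mul_sub, e2, hSJ', hρ1]
      module
    rw [sub_mul, e1, smul_mul_assoc, one_mul, hρ1]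
    module
  have hfin : stripInt δ (fun b => psiThree (Complex.exp b) • resLog A b) = D := by
    rw [hkernel, stripInt_add, stripInt_smul, stripInt_add hG₁i hG₃i, hG₁0, hG₃0] at hsplit
    · rw [hsplit]; simp
    · exact fun φ hφ => hψ.integrable_smul_resLog h h1 h5 h6.le hφ
    · exact fun φ hφ => ((hG₁i φ hφ).add (hG₃i φ hφ)).smul (-1 : ℂ)
  exact hfin

end ResolventAtMinusOne

/-! ### The elementary calculus -/

section Elementary

variable {ω : ℝ} {f g : ℂ → ℂ}

theorem MemHInftyZero.tendsto_atTop (h : MemHInftyZero ω f) (hω : 0 < ω) :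
    Tendsto (fun r : ℝ => f (r : ℂ)) atTop (𝓝 0) := by
  obtain ⟨_, C, α, hC, hα, hb⟩ := h
  refine squeeze_zero_norm' (a := fun r : ℝ => C * r ^ (-α)) ?_ ?_
  · filter_upwards [eventually_gt_atTop 0] with r hr
    have := hb _ (ofReal_mem_openSector hω hr)
    rw [Complex.norm_real, Real.norm_of_nonneg hr.le] at this
    exact this.trans (by gcongr; exact min_le_right _ _)
  · simpa using (tendsto_rpow_neg_atTop hα).const_mul C

theorem MemHInftyZero.tendsto_zero (h : MemHInftyZero ω f) (hω : 0 < ω) :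
    Tendsto (fun r : ℝ => f (r : ℂ)) (𝓝[>] 0) (𝓝 0) := by
  obtain ⟨_, C, α, hC, hα, hb⟩ := h
  refine squeeze_zero_norm' (a := fun r : ℝ => C * r ^ α) ?_ ?_
  · filter_upwards [self_mem_nhdsWithin] with r hr
    have hr : 0 < r := hr
    have := hb _ (ofReal_mem_openSector hω hr)
    rw [Complex.norm_real, Real.norm_of_nonneg hr.le] at this
    exact this.trans (by gcongr; exact min_le_left _ _)
  · have : Tendsto (fun r : ℝ => C * r ^ α) (𝓝 0) (𝓝 (C * 0 ^ α)) :=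
      ((Real.continuousAt_rpow_const 0 α (Or.inr hα.le)).tendsto).const_mul C
    rw [Real.zero_rpow hα.ne', mul_zero] at this
    exact this.mono_left nhdsWithin_le_nhds

/-- The junk-valued limit in `valueAtInfty` is the coefficient `d` of any decomposition. -/
theorem valueAtInfty_eq {c d : ℂ} (hω : 0 < ω)
    (h : MemHInftyZero ω (fun z => f z - c * (1 + z)⁻¹ - d)) : valueAtInfty f = d := by
  refine Tendsto.limUnder_eq ?_
  have h1 := h.tendsto_atTop hω
  have h2 : Tendsto (fun r : ℝ => c * (1 + (r : ℂ))⁻¹ + d) atTop (𝓝 (c * 0 + d)) := by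
    refine Tendsto.add_const d (Tendsto.const_mul c ?_)
    have : Tendsto (fun r : ℝ => (((1 + r)⁻¹ : ℝ) : ℂ)) atTop (𝓝 ((0 : ℝ) : ℂ)) :=
      (Complex.continuous_ofReal.tendsto 0).comp
        (tendsto_inv_atTop_zero.comp (tendsto_atTop_add_const_left _ _ tendsto_id))
    simpa using this
  have h3 := h1.add h2
  simp only [mul_zero, zero_add] at h3
  exact h3.congr (fun r => by ring)

theorem valueAtZero_eq {c d : ℂ} (hω : 0 < ω)
    (h : MemHInftyZero ω (fun z => f z - c * (1 + z)⁻¹ - d)) : valueAtZero f = c + d := by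
  refine Tendsto.limUnder_eq ?_
  have h1 := h.tendsto_zero hω
  have h2 : Tendsto (fun r : ℝ => c * (1 + (r : ℂ))⁻¹ + d) (𝓝[>] 0) (𝓝 (c * 1 + d)) := by
    have hc : ContinuousAt (fun r : ℝ => c * (1 + (r : ℂ))⁻¹ + d) 0 := by
      have : (1 : ℂ) + ((0 : ℝ) : ℂ) ≠ 0 := by simp
      fun_prop (disch := assumption)
    have := hc.tendsto.mono_left (nhdsWithin_le_nhds (s := Ioi 0))
    simpa using this
  have h3 := h1.add h2
  simp only [mul_one, zero_add] at h3
  exact h3.congr (fun r => by ring)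

theorem MemElementary.differentiableOn (h : MemElementary ω f) (hω : ω ≤ Real.pi) :
    DifferentiableOn ℂ f (openSector ω) := by
  obtain ⟨c, d, hd, _⟩ := h
  have h1 := differentiableOn_one_add_inv hω
  have h2 := (hd.add (h1.const_mul c)).add_const d
  exact h2.congr (fun z _ => by simp only [Pi.add_apply]; ring)

theorem MemElementary.bounded (h : MemElementary ω f) (hω : ω < Real.pi) :
    ∃ C : ℝ, 0 < C ∧ ∀ z ∈ openSector ω, ‖f z‖ ≤ C := by
  obtain ⟨c, d, h⟩ := h
  obtain ⟨C, hC, hb⟩ := h.bounded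
  obtain ⟨K, hK, hb'⟩ := exists_norm_one_add_inv_le hω
  refine ⟨C + ‖c‖ * K + ‖d‖, by positivity, fun z hz => ?_⟩
  have h1 : ‖(1 + z)⁻¹‖ ≤ K := (hb' z hz).trans (div_le_self hK.le (by linarith [norm_nonneg z]))
  have : f z = (f z - c * (1 + z)⁻¹ - d) + c * (1 + z)⁻¹ + d := by ring
  rw [this]
  refine (norm_add₃_le).trans ?_
  rw [norm_mul]
  gcongr
  exact hb z hz

theorem MemHInftyZero.memElementary (h : MemHInftyZero ω f) : MemElementary ω f :=
  ⟨0, 0, h.congr (fun z _ => by ring)⟩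

theorem memElementary_one_add_inv : MemElementary ω (fun z => (1 + z)⁻¹) :=
  ⟨1, 0, memHInftyZero_zero.congr (fun z _ => by ring)⟩

theorem memElementary_const (c : ℂ) : MemElementary ω (fun _ => c) :=
  ⟨0, c, memHInftyZero_zero.congr (fun z _ => by ring)⟩

theorem MemElementary.congr (h : MemElementary ω f) (hfg : ∀ z ∈ openSector ω, g z = f z) :
    MemElementary ω g := by
  obtain ⟨c, d, h⟩ := h
  exact ⟨c, d, h.congr (fun z hz => by rw [hfg z hz])⟩

theorem MemElementary.add (h : MemElementary ω f) (h' : MemElementary ω g) :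
    MemElementary ω (fun z => f z + g z) := by
  obtain ⟨c, d, h⟩ := h
  obtain ⟨c', d', h'⟩ := h'
  exact ⟨c + c', d + d', (h.add h').congr (fun z _ => by ring)⟩

theorem MemElementary.const_mul (h : MemElementary ω f) (a : ℂ) :
    MemElementary ω (fun z => a * f z) := by
  obtain ⟨c, d, h⟩ := h
  exact ⟨a * c, a * d, (h.const_mul a).congr (fun z _ => by ring)⟩

theorem MemElementary.sub (h : MemElementary ω f) (h' : MemElementary ω g) :
    MemElementary ω (fun z => f z - g z) :=
  (h.add (h'.const_mul (-1))).congr (fun z _ => by ring)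

theorem MemElementary.mul_memHInftyZero (h : MemElementary ω f) (h' : MemHInftyZero ω g)
    (hω : ω < Real.pi) : MemHInftyZero ω (fun z => f z * g z) := by
  obtain ⟨K, _, hK⟩ := h.bounded hω
  exact (h'.mul_bounded (h.differentiableOn hω.le) hK).congr (fun z _ => mul_comm _ _)

theorem psiThree_eq {z : ℂ} (hz : 1 + z ≠ 0) :
    psiThree z = (1 + z)⁻¹ - (1 + z)⁻¹ * (1 + z)⁻¹ := by
  rw [psiThree]
  field_simp
  ring

theorem memElementary_one_add_inv_sq (hω : ω < Real.pi) :
    MemElementary ω (fun z => (1 + z)⁻¹ * (1 + z)⁻¹) :=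
  (memElementary_one_add_inv.sub (memHInftyZero_psiThree hω).memElementary).congr (fun z hz => by
    rw [psiThree_eq (one_add_ne_zero_of_mem hω.le hz)]; ring)

/-- Products stay in the class because `(1 + z)⁻²` and `(1 + z)⁻¹` differ by `ψ₃ ∈ H^∞_0`. -/
theorem MemElementary.mul (h : MemElementary ω f) (h' : MemElementary ω g) (hω : ω < Real.pi) :
    MemElementary ω (fun z => f z * g z) := by
  obtain ⟨c, d, hf⟩ := id h
  have e1 := (h'.mul_memHInftyZero hf hω).memElementary
  obtain ⟨c', d', hg⟩ := id h'
  have e2 := (memElementary_one_add_inv.mul_memHInftyZero hg hω).memElementary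
  have e3 := ((e1.add (e2.const_mul c)).add
    ((memElementary_one_add_inv_sq hω).const_mul (c * c'))).add
    ((memElementary_one_add_inv.const_mul (c * d')).add (h'.const_mul d))
  exact e3.congr (fun z _ => by ring)

theorem memHInftyZero_dilate_inv_sub (hω : ω < Real.pi) {t : ℝ} (ht : 0 < t) :
    MemHInftyZero ω (fun z => (1 + t * z)⁻¹ - (1 + z)⁻¹) := by
  obtain ⟨c, hc, h⟩ := exists_norm_one_add_inv_le hω
  have hd1 := differentiableOn_one_add_inv hω.le
  have hd := (differentiableOn_dilate hd1 ht).sub hd1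
  have hn : ∀ z ∈ openSector ω, ‖(1 + t * z)⁻¹ - (1 + z)⁻¹‖ ≤
      |1 - t| * ‖z‖ * ((c / (1 + t * ‖z‖)) * (c / (1 + ‖z‖))) := by
    intro z hz
    have hz2 := mul_mem_openSector ht hz
    have n1 := one_add_ne_zero_of_mem hω.le hz
    have n2 := one_add_ne_zero_of_mem hω.le hz2
    have e : (1 + t * z)⁻¹ - (1 + z)⁻¹ = ((1 - t : ℝ) : ℂ) * z * ((1 + t * z)⁻¹ * (1 + z)⁻¹) := by
      push_cast
      field_simp
      ring
    have b1 := h z hz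
    have b2 := h _ hz2
    have e2 : ‖(t : ℂ) * z‖ = t * ‖z‖ := by
      rw [norm_mul, Complex.norm_real, Real.norm_of_nonneg ht.le]
    rw [e2] at b2
    rw [e, norm_mul, norm_mul, norm_mul, Complex.norm_real, Real.norm_eq_abs]
    gcongr
  refine memHInftyZero_of_bounds (C := |1 - t| * (c * c)) (D := |1 - t| * (c / t * c)) hd one_pos
    one_pos (by positivity) (by positivity) ?_ ?_
  · intro z hz _
    refine (hn z hz).trans ?_
    have t1 : c / (1 + t * ‖z‖) ≤ c := div_le_self hc.le (by
      have := mul_nonneg ht.le (norm_nonneg z); linarith)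
    have t2 : c / (1 + ‖z‖) ≤ c := div_le_self hc.le (by linarith [norm_nonneg z])
    calc _ ≤ |1 - t| * ‖z‖ * (c * c) := by gcongr
      _ = _ := by rw [Real.rpow_one]; ring
  · intro z hz h1
    refine (hn z hz).trans ?_
    have hz0 : 0 < ‖z‖ := by linarith
    have t1 : c / (1 + t * ‖z‖) ≤ c / (t * ‖z‖) := by gcongr; linarith
    have t2 : c / (1 + ‖z‖) ≤ c / ‖z‖ := by gcongr; linarith
    calc _ ≤ |1 - t| * ‖z‖ * ((c / (t * ‖z‖)) * (c / ‖z‖)) := by gcongr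
      _ = _ := by rw [Real.rpow_neg_one]; field_simp

theorem memElementary_dilate_inv (hω : ω < Real.pi) {t : ℝ} (ht : 0 < t) :
    MemElementary ω (fun z => (1 + t * z)⁻¹) :=
  ((memHInftyZero_dilate_inv_sub hω ht).memElementary.add memElementary_one_add_inv).congr
    (fun z _ => by ring)

theorem MemElementary.dilate (h : MemElementary ω f) (hω : ω < Real.pi) {t : ℝ} (ht : 0 < t) :
    MemElementary ω (fun z => f (t * z)) := by
  obtain ⟨c, d, h⟩ := h
  exact (((h.dilate ht).memElementary.add ((memElementary_dilate_inv hω ht).const_mul c)).add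
    (memElementary_const d)).congr (fun z _ => by ring)

end Elementary

/-- The standing assumptions on the angle under which the elementary calculus is used. -/
structure CalcAngle {X : Type*} [NormedAddCommGroup X] [NormedSpace ℂ X] (A : X →ₗ.[ℂ] X)
    (ω : ℝ) : Prop where
  sectorial : IsSectorialOp A
  lt : sectorialityAngle A < ω
  lt_pi : ω < Real.pi

section ElementaryCalc

variable {X : Type*} [NormedAddCommGroup X] [NormedSpace ℂ X] {A : X →ₗ.[ℂ] X} {ω : ℝ}
  {f g : ℂ → ℂ}

/-- The angle of the contour used by `elementaryCalc`. -/
noncomputable def midAngle (A : X →ₗ.[ℂ] X) (ω : ℝ) : ℝ := (sectorialityAngle A + ω) / 2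

namespace CalcAngle

theorem pos (H : CalcAngle A ω) : 0 < ω := sectorialityAngle_nonneg.trans_lt H.lt

theorem mid_lt (H : CalcAngle A ω) : midAngle A ω < ω := by
  have := H.lt
  unfold midAngle; linarith

theorem mid_pos (H : CalcAngle A ω) : 0 < midAngle A ω := by
  have := H.pos
  have := sectorialityAngle_nonneg (A := A)
  unfold midAngle; linarith

theorem exists_angle (H : CalcAngle A ω) :
    ∃ ω₀ : ℝ, ω₀ < midAngle A ω ∧ IsSectorialOfAngle A ω₀ :=
  H.sectorial.exists_angle (by have := H.lt; unfold midAngle; linarith)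

theorem smul (H : CalcAngle A ω) {t : ℝ} (ht : 0 < t) : CalcAngle ((t : ℂ) • A) ω :=
  ⟨H.sectorial.smul ht, by rw [sectorialityAngle_smul ht]; exact H.lt, H.lt_pi⟩

theorem one_mem_neg (H : CalcAngle A ω) : (1 : ℂ) ∈ opResolventSet (-A) := by
  obtain ⟨ω₀, _, h⟩ := H.exists_angle
  exact h.one_mem_neg

theorem unitResolvent_mem (H : CalcAngle A ω) (x : X) : unitResolvent A x ∈ A.domain :=
  opResolvent_mem H.one_mem_neg x

theorem apply_unitResolvent (H : CalcAngle A ω) (x : X) :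
    A ⟨unitResolvent A x, H.unitResolvent_mem x⟩ = x - unitResolvent A x := by
  have h := apply_opResolvent H.one_mem_neg x
  have e : (-A) ⟨opResolvent (-A) 1 x, opResolvent_mem H.one_mem_neg x⟩ =
    -A ⟨unitResolvent A x, H.unitResolvent_mem x⟩ := LinearPMap.neg_apply _ _
  rw [e, one_smul] at h
  rw [neg_eq_iff_eq_neg.1 h, neg_sub]
  rfl

theorem unitResolvent_apply (H : CalcAngle A ω) (x : A.domain) :
    unitResolvent A ((x : X) + A x) = x := by
  have h := opResolvent_apply_sub H.one_mem_neg x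
  have e : (-A) x = -A x := LinearPMap.neg_apply _ _
  rw [e, one_smul, sub_neg_eq_add] at h
  exact h

theorem unitResolvent_injective (H : CalcAngle A ω) {x : X} (hx : unitResolvent A x = 0) : x = 0 :=
  opResolvent_injective H.one_mem_neg hx

/-- The calculus may be evaluated with any decomposition `f = g + c (1 + z)⁻¹ + d`. -/
theorem elementaryCalc_eq (H : CalcAngle A ω) {c d : ℂ}
    (h : MemHInftyZero ω (fun z => f z - c * (1 + z)⁻¹ - d)) :
    elementaryCalc A ω f = hCalc A (midAngle A ω) (fun z => f z - c * (1 + z)⁻¹ - d) +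
      c • unitResolvent A + d • (1 : X →L[ℂ] X) := by
  rw [elementaryCalc, valueAtInfty_eq H.pos h, valueAtZero_eq H.pos h, cauchyCalc_eq_hCalc,
    add_sub_cancel_right]
  rfl

theorem hCalc_congr' (H : CalcAngle A ω) (h : ∀ z ∈ openSector ω, f z = g z) :
    hCalc A (midAngle A ω) f = hCalc A (midAngle A ω) g :=
  hCalc_congr H.mid_pos.le H.mid_lt H.lt_pi.le h

theorem calc_of_memHInftyZero (H : CalcAngle A ω) (h : MemHInftyZero ω f) :
    elementaryCalc A ω f = hCalc A (midAngle A ω) f := by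
  rw [H.elementaryCalc_eq (c := 0) (d := 0) (h.congr (fun z _ => by ring)), zero_smul, zero_smul,
    add_zero, add_zero]
  exact H.hCalc_congr' (fun z _ => by ring)

theorem calc_congr (H : CalcAngle A ω) (hf : MemElementary ω f)
    (h : ∀ z ∈ openSector ω, f z = g z) : elementaryCalc A ω f = elementaryCalc A ω g := by
  obtain ⟨c, d, hf⟩ := hf
  have hg : MemHInftyZero ω (fun z => g z - c * (1 + z)⁻¹ - d) :=
    hf.congr (fun z hz => by rw [h z hz])
  rw [H.elementaryCalc_eq hf, H.elementaryCalc_eq hg,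
    H.hCalc_congr' (fun z hz => by rw [h z hz])]

theorem calc_add (H : CalcAngle A ω) (hf : MemElementary ω f) (hg : MemElementary ω g) :
    elementaryCalc A ω (fun z => f z + g z) = elementaryCalc A ω f + elementaryCalc A ω g := by
  obtain ⟨c, d, hf⟩ := hf
  obtain ⟨c', d', hg⟩ := hg
  obtain ⟨ω₀, h1, h⟩ := H.exists_angle
  have hs : MemHInftyZero ω (fun z => (f z + g z) - (c + c') * (1 + z)⁻¹ - (d + d')) :=
    (hf.add hg).congr (fun z _ => by ring)
  rw [H.elementaryCalc_eq hf, H.elementaryCalc_eq hg, H.elementaryCalc_eq hs,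
    H.hCalc_congr' (g := fun z => (f z - c * (1 + z)⁻¹ - d) + (g z - c' * (1 + z)⁻¹ - d'))
    (fun z _ => by ring), hCalc_add hf hg h h1 H.mid_lt H.lt_pi.le, add_smul, add_smul]
  abel

theorem calc_const_mul (H : CalcAngle A ω) (hf : MemElementary ω f) (a : ℂ) :
    elementaryCalc A ω (fun z => a * f z) = a • elementaryCalc A ω f := by
  obtain ⟨c, d, hf⟩ := hf
  have hs : MemHInftyZero ω (fun z => a * f z - (a * c) * (1 + z)⁻¹ - (a * d)) :=
    (hf.const_mul a).congr (fun z _ => by ring)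
  rw [H.elementaryCalc_eq hf, H.elementaryCalc_eq hs,
    H.hCalc_congr' (g := fun z => a * (f z - c * (1 + z)⁻¹ - d)) (fun z _ => by ring),
    hCalc_const_mul, smul_add, smul_add, smul_smul, smul_smul]

theorem calc_sub (H : CalcAngle A ω) (hf : MemElementary ω f) (hg : MemElementary ω g) :
    elementaryCalc A ω (fun z => f z - g z) = elementaryCalc A ω f - elementaryCalc A ω g := by
  have h1 := H.calc_add hf (hg.const_mul (-1))
  rw [H.calc_const_mul hg, neg_one_smul, ← sub_eq_add_neg] at h1
  rw [← h1]
  exact H.calc_congr (hf.sub hg) (fun z _ => by ring)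

theorem calc_const (H : CalcAngle A ω) (c : ℂ) :
    elementaryCalc A ω (fun _ => c) = c • (1 : X →L[ℂ] X) := by
  have h0 : MemHInftyZero ω (fun z : ℂ => c - 0 * (1 + z)⁻¹ - c) :=
    memHInftyZero_zero.congr (fun z _ => by ring)
  rw [H.elementaryCalc_eq h0, zero_smul, add_zero]
  have : hCalc A (midAngle A ω) (fun z : ℂ => c - 0 * (1 + z)⁻¹ - c) = 0 := by
    rw [H.hCalc_congr' (g := fun z => (0 : ℂ) * 0) (fun z _ => by ring), hCalc_const_mul, zero_smul]
  rw [this, zero_add]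

theorem calc_one_add_inv (H : CalcAngle A ω) :
    elementaryCalc A ω (fun z => (1 + z)⁻¹) = unitResolvent A := by
  have h0 : MemHInftyZero ω (fun z : ℂ => (1 + z)⁻¹ - 1 * (1 + z)⁻¹ - 0) :=
    memHInftyZero_zero.congr (fun z _ => by ring)
  rw [H.elementaryCalc_eq h0, one_smul, zero_smul, add_zero]
  have : hCalc A (midAngle A ω) (fun z : ℂ => (1 + z)⁻¹ - 1 * (1 + z)⁻¹ - 0) = 0 := by
    rw [H.hCalc_congr' (g := fun z => (0 : ℂ) * 0) (fun z _ => by ring), hCalc_const_mul, zero_smul]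
  rw [this, zero_add]

theorem calc_mul_comm (f g : ℂ → ℂ) :
    elementaryCalc A ω (fun z => f z * g z) = elementaryCalc A ω (fun z => g z * f z) := by
  congr 1; ext1 z; ring

theorem resLog_smul {t : ℝ} (ht : 0 < t) (h : IsSectorialOp A) (hω : sectorialityAngle A < ω)
    {w : ℂ} (hw1 : ω ≤ |w.im|) (hw2 : |w.im| ≤ Real.pi) :
    resLog ((t : ℂ) • A) w = resLog A (w - Real.log t) := by
  have ht' : (t : ℂ) ≠ 0 := by exact_mod_cast ht.ne'
  obtain ⟨ω₀, h1, h2⟩ := h.exists_angle hω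
  have e : Complex.exp (w - Real.log t) = Complex.exp w / t := by
    rw [Complex.exp_sub, ← Complex.ofReal_exp, Real.exp_log ht]
  have him : (w - Real.log t : ℂ).im = w.im := by simp
  have hm : Complex.exp w / t ∈ opResolventSet A := by
    rw [← e]
    exact h2.exp_mem (by rw [him]; linarith) (by rw [him]; exact hw2)
  rw [resLog, resLog, e, opResolvent_smul ht' hm, smul_smul, ← div_eq_mul_inv]

theorem midAngle_smul {t : ℝ} (ht : 0 < t) : midAngle ((t : ℂ) • A) ω = midAngle A ω := by
  rw [midAngle, sectorialityAngle_smul ht, midAngle]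

/-- Scaling of the Cauchy integral: the substitution is a translation of the line. -/
theorem hCalc_smul (H : CalcAngle A ω) {t : ℝ} (ht : 0 < t) (f : ℂ → ℂ) :
    hCalc ((t : ℂ) • A) (midAngle A ω) f = hCalc A (midAngle A ω) (fun z => f (t * z)) := by
  have hl : ∀ φ : ℝ, |φ| = midAngle A ω →
      lineInt φ (fun w => f (Complex.exp w) • resLog ((t : ℂ) • A) w) =
      lineInt φ (fun w => f (t * Complex.exp w) • resLog A w) := by
    intro φ hφ
    unfold lineInt
    rw [← integral_sub_right_eq_self (fun u : ℝ =>
      f (t * Complex.exp ((u : ℂ) + (φ : ℂ) * Complex.I)) •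
        resLog A ((u : ℂ) + (φ : ℂ) * Complex.I))
      (Real.log t)]
    congr 1
    ext1 u
    have e1 : ((u - Real.log t : ℝ) : ℂ) + (φ : ℂ) * Complex.I =
        ((u : ℂ) + (φ : ℂ) * Complex.I) - Real.log t := by push_cast; ring
    have ht' : (t : ℂ) ≠ 0 := by exact_mod_cast ht.ne'
    beta_reduce
    rw [e1, Complex.exp_sub, ← Complex.ofReal_exp, Real.exp_log ht, mul_div_cancel₀ _ ht',
      resLog_smul (w := (u : ℂ) + (φ : ℂ) * Complex.I) ht H.sectorial (ω := midAngle A ω)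
      (by have := H.lt; unfold midAngle; linarith) (by rw [line_im, hφ])
      (by rw [line_im, hφ]; exact (H.mid_lt.trans H.lt_pi).le)]
  rw [hCalc, hCalc, stripInt, stripInt, hl _ (by rw [abs_neg, abs_of_pos H.mid_pos]),
    hl _ (abs_of_pos H.mid_pos)]

variable [CompleteSpace X]

theorem calc_mul_of_memHInftyZero (H : CalcAngle A ω) (hf : MemHInftyZero ω f)
    (hg : MemHInftyZero ω g) :
    elementaryCalc A ω (fun z => f z * g z) = elementaryCalc A ω f * elementaryCalc A ω g := by
  obtain ⟨ω₀, h1, h⟩ := H.exists_angle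
  rw [H.calc_of_memHInftyZero hf, H.calc_of_memHInftyZero hg, H.calc_of_memHInftyZero (hf.mul hg),
    hCalc_mul hf hg h h1 H.mid_lt H.lt_pi.le]

theorem calc_mul_one_add_inv (H : CalcAngle A ω) (hf : MemHInftyZero ω f) :
    elementaryCalc A ω (fun z => f z * (1 + z)⁻¹) = elementaryCalc A ω f * unitResolvent A := by
  obtain ⟨ω₀, h1, h⟩ := H.exists_angle
  have hm : MemHInftyZero ω (fun z => f z * (1 + z)⁻¹) :=
    (memElementary_one_add_inv.mul_memHInftyZero hf H.lt_pi).congr (fun z _ => mul_comm _ _)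
  rw [H.calc_of_memHInftyZero hf, H.calc_of_memHInftyZero hm,
    hCalc_mul_unitResolvent hf h h1 H.mid_lt H.lt_pi.le]

theorem calc_psiThree (H : CalcAngle A ω) :
    elementaryCalc A ω psiThree = unitResolvent A - unitResolvent A * unitResolvent A := by
  obtain ⟨ω₀, h1, h⟩ := H.exists_angle
  rw [H.calc_of_memHInftyZero (memHInftyZero_psiThree H.lt_pi),
    hCalc_psiThree h h1 (H.mid_lt.trans H.lt_pi)]

/-- Together with the evaluation of `ψ₃(A)`, this settles the product of the two functions
`(1 + z)⁻¹` of the calculus. -/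
theorem calc_one_add_inv_sq (H : CalcAngle A ω) :
    elementaryCalc A ω (fun z => (1 + z)⁻¹ * (1 + z)⁻¹) = unitResolvent A * unitResolvent A := by
  have h1 := H.calc_sub memElementary_one_add_inv (memHInftyZero_psiThree H.lt_pi).memElementary
  rw [H.calc_psiThree, H.calc_one_add_inv, sub_sub_cancel] at h1
  rw [← h1]
  exact H.calc_congr (memElementary_one_add_inv_sq H.lt_pi)
    (fun z hz => by rw [psiThree_eq (one_add_ne_zero_of_mem H.lt_pi.le hz)]; ring)

/-- The Cauchy integrals commute with `(1 + A)⁻¹`. -/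
theorem calc_comm_unitResolvent (H : CalcAngle A ω) (hf : MemHInftyZero ω f) :
    elementaryCalc A ω f * unitResolvent A = unitResolvent A * elementaryCalc A ω f := by
  obtain ⟨ω₀, h1, h⟩ := H.exists_angle
  rw [H.calc_of_memHInftyZero hf, hCalc]
  have hint := fun φ hφ => hf.integrable_smul_resLog (φ := φ) h h1 H.mid_lt H.lt_pi.le hφ
  set L₁ : (X →L[ℂ] X) →L[ℂ] (X →L[ℂ] X) :=
    (ContinuousLinearMap.mul ℂ (X →L[ℂ] X)).flip (unitResolvent A)
  set L₂ : (X →L[ℂ] X) →L[ℂ] (X →L[ℂ] X) :=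
    ContinuousLinearMap.mul ℂ (X →L[ℂ] X) (unitResolvent A)
  have e1 : ∀ V, V * unitResolvent A = L₁ V := fun V => rfl
  have e2 : ∀ V, unitResolvent A * V = L₂ V := fun V => rfl
  rw [e1, e2, ← stripInt_clm L₁ hint, ← stripInt_clm L₂ hint]
  refine stripInt_congr fun w hw => ?_
  rw [abs_of_pos H.mid_pos] at hw
  rw [← e1, ← e2, smul_mul_assoc, mul_smul_comm]
  congr 1
  have hw1 := h.exp_mem (w := w) (by rw [hw]; exact h1)
    (by rw [hw]; exact (H.mid_lt.trans H.lt_pi).le)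
  have h1' : -(1 : ℂ) ∈ opResolventSet A := by simpa using h.neg_mem one_pos
  rw [resLog, unitResolvent, opResolvent_neg h1', smul_mul_assoc, mul_smul_comm, mul_neg, neg_mul,
    opResolvent_comm hw1 h1']

/-- The elementary calculus is multiplicative. -/
theorem calc_mul (H : CalcAngle A ω) (hf : MemElementary ω f) (hg : MemElementary ω g) :
    elementaryCalc A ω (fun z => f z * g z) = elementaryCalc A ω f * elementaryCalc A ω g := by
  have hπ := H.lt_pi
  -- multiplication by an arbitrary `F ∈ H^∞_0`, from either side
  have key : ∀ F G : ℂ → ℂ, MemHInftyZero ω F → MemElementary ω G →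
      elementaryCalc A ω (fun z => F z * G z) = elementaryCalc A ω F * elementaryCalc A ω G ∧
      elementaryCalc A ω (fun z => F z * G z) = elementaryCalc A ω G * elementaryCalc A ω F := by
    intro F G hF hG
    obtain ⟨c, d, hg0⟩ := hG
    set g₀ : ℂ → ℂ := fun z => G z - c * (1 + z)⁻¹ - d with hg₀
    have hFρ : MemHInftyZero ω (fun z => F z * (1 + z)⁻¹) :=
      (memElementary_one_add_inv.mul_memHInftyZero hF hπ).congr (fun z _ => mul_comm _ _)
    have eG : elementaryCalc A ω G = elementaryCalc A ω g₀ + c • unitResolvent A +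
        d • (1 : X →L[ℂ] X) := by
      rw [H.elementaryCalc_eq hg0, H.calc_of_memHInftyZero hg0]
    have eFG : elementaryCalc A ω (fun z => F z * G z) =
        elementaryCalc A ω F * elementaryCalc A ω g₀ +
        c • (elementaryCalc A ω F * unitResolvent A) + d • elementaryCalc A ω F := by
      have m1 := (hF.mul hg0).memElementary
      have m2 := hFρ.memElementary.const_mul c
      have m3 := hF.memElementary.const_mul d
      rw [← H.calc_mul_of_memHInftyZero hF hg0, ← H.calc_mul_one_add_inv hF,
        ← H.calc_const_mul hFρ.memElementary, ← H.calc_const_mul hF.memElementary,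
        ← H.calc_add m1 m2, ← H.calc_add (m1.add m2) m3]
      refine (H.calc_congr ((m1.add m2).add m3) (fun z _ => ?_)).symm
      simp only [hg₀]
      ring
    have hcomm : elementaryCalc A ω F * elementaryCalc A ω g₀ =
        elementaryCalc A ω g₀ * elementaryCalc A ω F := by
      rw [← H.calc_mul_of_memHInftyZero hF hg0, ← H.calc_mul_of_memHInftyZero hg0 hF,
        calc_mul_comm]
    constructor
    · rw [eFG, eG, mul_add, mul_add, mul_smul_comm, mul_smul_comm, mul_one]
    · rw [eFG, eG, add_mul, add_mul, smul_mul_assoc, smul_mul_assoc, one_mul, hcomm,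
        H.calc_comm_unitResolvent hF]
  obtain ⟨c, d, hf0⟩ := id hf
  obtain ⟨c', d', hg0⟩ := id hg
  set f₀ : ℂ → ℂ := fun z => f z - c * (1 + z)⁻¹ - d with hf₀
  set g₀ : ℂ → ℂ := fun z => g z - c' * (1 + z)⁻¹ - d' with hg₀
  have eF : elementaryCalc A ω f = elementaryCalc A ω f₀ + c • unitResolvent A +
      d • (1 : X →L[ℂ] X) := by
    rw [H.elementaryCalc_eq hf0, H.calc_of_memHInftyZero hf0]
  have eG : elementaryCalc A ω g = elementaryCalc A ω g₀ + c' • unitResolvent A +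
      d' • (1 : X →L[ℂ] X) := by
    rw [H.elementaryCalc_eq hg0, H.calc_of_memHInftyZero hg0]
  have hρ := memElementary_one_add_inv (ω := ω)
  have m1 : MemElementary ω (fun z => f₀ z * g z) :=
    ((hg.mul_memHInftyZero hf0 hπ).congr (fun z _ => mul_comm _ _)).memElementary
  have m2 : MemElementary ω (fun z => c * (g₀ z * (1 + z)⁻¹)) :=
    ((hρ.mul_memHInftyZero hg0 hπ).congr (fun z _ => mul_comm _ _)).memElementary.const_mul c
  have m3 := (memElementary_one_add_inv_sq hπ).const_mul (c * c')
  have m4 := hρ.const_mul (c * d')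
  have m5 := hg.const_mul d
  have e : elementaryCalc A ω (fun z => f z * g z) = elementaryCalc A ω f₀ * elementaryCalc A ω g +
      c • (unitResolvent A * elementaryCalc A ω g₀) +
      (c * c') • (unitResolvent A * unitResolvent A) + (c * d') • unitResolvent A +
      d • elementaryCalc A ω g := by
    rw [← (key f₀ g hf0 hg).1, ← H.calc_comm_unitResolvent hg0, ← H.calc_mul_one_add_inv hg0,
      ← H.calc_one_add_inv_sq, ← H.calc_const_mul hg, ← H.calc_one_add_inv, ← H.calc_const_mul hρ,
      ← H.calc_const_mul (memElementary_one_add_inv_sq hπ), ← H.calc_const_mul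
      ((hρ.mul_memHInftyZero hg0 hπ).congr (fun z _ => mul_comm _ _)).memElementary,
      ← H.calc_add m1 m2, ← H.calc_add (m1.add m2) m3, ← H.calc_add ((m1.add m2).add m3) m4,
      ← H.calc_add (((m1.add m2).add m3).add m4) m5]
    refine (H.calc_congr ((((m1.add m2).add m3).add m4).add m5) (fun z _ => ?_)).symm
    simp only [hf₀, hg₀]
    ring
  rw [e, eF, add_mul, add_mul, smul_mul_assoc, smul_mul_assoc, one_mul]
  congr 1
  rw [add_assoc, add_assoc]
  congr 1
  rw [eG, mul_add, mul_add, smul_add, smul_add, mul_smul_comm, mul_smul_comm, mul_one, smul_smul,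
    smul_smul, add_assoc]

theorem calc_comm (H : CalcAngle A ω) (hf : MemElementary ω f) (hg : MemElementary ω g) :
    elementaryCalc A ω f * elementaryCalc A ω g = elementaryCalc A ω g * elementaryCalc A ω f := by
  rw [← H.calc_mul hf hg, ← H.calc_mul hg hf, calc_mul_comm]

/-- If `f` and `z f` are elementary, `f(A)` maps into the domain and `A f(A) = (z f)(A)`. -/
theorem apply_calc (H : CalcAngle A ω) (hf : MemElementary ω f)
    (hzf : MemElementary ω (fun z => z * f z)) (x : X) :
    ∃ h : elementaryCalc A ω f x ∈ A.domain,
      A ⟨elementaryCalc A ω f x, h⟩ = elementaryCalc A ω (fun z => z * f z) x := by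
  have e : elementaryCalc A ω f = unitResolvent A *
      (elementaryCalc A ω f + elementaryCalc A ω (fun z => z * f z)) := by
    rw [← H.calc_one_add_inv, ← H.calc_add hf hzf, ← H.calc_mul memElementary_one_add_inv
      (hf.add hzf)]
    refine H.calc_congr hf (fun z hz => ?_)
    have := one_add_ne_zero_of_mem H.lt_pi.le hz
    field_simp
  have ex : elementaryCalc A ω f x = unitResolvent A
      (elementaryCalc A ω f x + elementaryCalc A ω (fun z => z * f z) x) := by
    conv_lhs => rw [e]
    rfl
  have hm : elementaryCalc A ω f x ∈ A.domain := by
    rw [ex]; exact H.unitResolvent_mem _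
  refine ⟨hm, ?_⟩
  have := H.apply_unitResolvent (elementaryCalc A ω f x + elementaryCalc A ω (fun z => z * f z) x)
  have e2 : (⟨elementaryCalc A ω f x, hm⟩ : A.domain) = ⟨_, H.unitResolvent_mem
      (elementaryCalc A ω f x + elementaryCalc A ω (fun z => z * f z) x)⟩ := Subtype.ext ex
  rw [e2, this, ← ex, add_sub_cancel_left]

/-- `(1 + tz)⁻¹(A)` is the resolvent `(1 + tA)⁻¹`. -/
theorem calc_dilate_inv (H : CalcAngle A ω) {t : ℝ} (ht : 0 < t) :
    elementaryCalc A ω (fun z => (1 + t * z)⁻¹) = unitResolvent ((t : ℂ) • A) := by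
  have hρt := memElementary_dilate_inv H.lt_pi ht
  have hρ := memElementary_one_add_inv (ω := ω)
  have hne : ∀ z ∈ openSector ω, 1 + (t : ℂ) * z ≠ 0 := fun z hz =>
    one_add_ne_zero_of_mem H.lt_pi.le (mul_mem_openSector ht hz)
  have ht' : (t : ℂ) ≠ 0 := by exact_mod_cast ht.ne'
  have hzf : MemElementary ω (fun z => z * (1 + (t : ℂ) * z)⁻¹) := by
    refine (((memElementary_const 1).sub hρt).const_mul (t : ℂ)⁻¹).congr (fun z hz => ?_)
    have h3 := mul_inv_cancel₀ (hne z hz)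
    rw [eq_inv_mul_iff_mul_eq₀ ht']
    linear_combination h3
  have hsum : elementaryCalc A ω (fun z => (1 + (t : ℂ) * z)⁻¹) +
      (t : ℂ) • elementaryCalc A ω (fun z => z * (1 + (t : ℂ) * z)⁻¹) = 1 := by
    rw [← H.calc_const_mul hzf, ← H.calc_add hρt (hzf.const_mul _), ← one_smul ℂ (1 : X →L[ℂ] X),
      ← H.calc_const]
    refine H.calc_congr (hρt.add (hzf.const_mul _)) (fun z hz => ?_)
    have := hne z hz
    field_simp
  refine (IsOpResolvent.eq ⟨fun x => ?_, fun x => ?_⟩).symm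
  · obtain ⟨hm, e⟩ := H.apply_calc hρt hzf x
    refine ⟨hm, ?_⟩
    have e1 : (-((t : ℂ) • A)) ⟨_, hm⟩ = -((t : ℂ) • A ⟨_, hm⟩) := rfl
    have h1 := congrArg (fun V : X →L[ℂ] X => V x) hsum
    rw [e1, e, one_smul, sub_neg_eq_add]
    exact h1
  · have e1 : (-((t : ℂ) • A)) x = -((t : ℂ) • A x) := rfl
    rw [e1, one_smul, sub_neg_eq_add]
    -- write `x = (1 + A)⁻¹ y`
    set y : X := (x : X) + A x with hy
    have hxy : (x : X) = unitResolvent A y := (H.unitResolvent_apply x).symm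
    have hAx : A x = y - unitResolvent A y := by rw [← hxy, hy]; abel
    have m : MemElementary ω (fun z => (1 + z)⁻¹ + (t : ℂ) * (1 - (1 + z)⁻¹)) :=
      hρ.add (((memElementary_const 1).sub hρ).const_mul _)
    have e2 : (x : X) + (t : ℂ) • A x =
        elementaryCalc A ω (fun z => (1 + z)⁻¹ + (t : ℂ) * (1 - (1 + z)⁻¹)) y := by
      rw [H.calc_add hρ (((memElementary_const 1).sub hρ).const_mul _),
        H.calc_const_mul ((memElementary_const 1).sub hρ), H.calc_sub (memElementary_const 1) hρ,
        H.calc_const, H.calc_one_add_inv, hAx, one_smul]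
      conv_lhs => rw [hxy]
      rfl
    rw [e2]
    change (elementaryCalc A ω _ * elementaryCalc A ω _) y = x
    rw [← H.calc_mul hρt m, hxy, ← H.calc_one_add_inv]
    congr 1
    refine H.calc_congr (hρt.mul m H.lt_pi) (fun z hz => ?_)
    have n1 := hne z hz
    have n2 := one_add_ne_zero_of_mem H.lt_pi.le hz
    field_simp
    ring

theorem calc_dilate_eq (H : CalcAngle A ω) {c d : ℂ}
    (h : MemHInftyZero ω (fun z => f z - c * (1 + z)⁻¹ - d)) {t : ℝ} (ht : 0 < t) :
    elementaryCalc A ω (fun z => f (t * z)) =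
      hCalc A (midAngle A ω) (fun z => f (t * z) - c * (1 + t * z)⁻¹ - d) +
        c • unitResolvent ((t : ℂ) • A) + d • (1 : X →L[ℂ] X) := by
  have hρt := memElementary_dilate_inv H.lt_pi ht
  have hg := h.dilate ht
  rw [← H.calc_of_memHInftyZero hg, ← H.calc_dilate_inv ht, ← H.calc_const_mul hρt,
    ← H.calc_const, ← H.calc_add hg.memElementary (hρt.const_mul c),
    ← H.calc_add (hg.memElementary.add (hρt.const_mul c)) (memElementary_const d)]
  exact (H.calc_congr ((hg.memElementary.add (hρt.const_mul c)).add (memElementary_const d))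
    (fun z _ => by ring)).symm

/-- Scaling of the calculus: `f(tA) = f(t ·)(A)`. -/
theorem calc_smul (H : CalcAngle A ω) (hf : MemElementary ω f) {t : ℝ} (ht : 0 < t) :
    elementaryCalc ((t : ℂ) • A) ω f = elementaryCalc A ω (fun z => f (t * z)) := by
  obtain ⟨c, d, h⟩ := hf
  rw [(H.smul ht).elementaryCalc_eq h, midAngle_smul ht, H.hCalc_smul ht, H.calc_dilate_eq h ht]

end CalcAngle

end ElementaryCalc

/-! ### Parameter integrals and convergence in the calculus -/

/-- Interchange of a parameter integral with a contour integral. -/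
theorem integral_stripInt {E : Type*} [NormedAddCommGroup E] [NormedSpace ℂ E] {δ : ℝ}
    {K : ℝ → ℂ → E}
    (hK : ∀ φ : ℝ, |φ| = |δ| → Integrable (fun p : ℝ × ℝ =>
      K p.1 ((p.2 : ℂ) + (φ : ℂ) * Complex.I)) (volume.prod volume)) :
    Integrable (fun v => stripInt δ (K v)) ∧
      ∫ v, stripInt δ (K v) = stripInt δ (fun w => ∫ v, K v w) := by
  have hl := fun (φ : ℝ) h1 => integral_integral_swap (f := fun u v : ℝ =>
    K u ((v : ℂ) + (φ : ℂ) * Complex.I)) (hK φ h1)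
  have hi := fun (φ : ℝ) h1 => (hK φ h1).integral_prod_left
  have n1 := abs_neg δ
  simp only [stripInt, lineInt, integral_smul]
  refine ⟨((hi _ n1).sub (hi _ rfl)).smul _, ?_⟩
  rw [integral_sub (hi _ n1) (hi _ rfl), hl _ n1, hl _ rfl]

theorem abs_add_abs_add_ge (x v : ℝ) : |v| / 2 + |x| / 2 ≤ |x| + |v + x| := by
  have h1 := abs_sub (v + x) x
  rw [add_sub_cancel_right] at h1
  have := abs_nonneg (v + x)
  linarith

theorem abs_add_add_abs_add_ge (u v x : ℝ) : |u - v| / 2 + |v + x| / 2 ≤ |u + x| + |v + x| := by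
  have h1 := abs_sub (u + x) (v + x)
  rw [add_sub_add_right_eq_sub] at h1
  have := abs_nonneg (u + x)
  linarith

section Convergence

variable {X : Type*} [NormedAddCommGroup X] [NormedSpace ℂ X] {A : X →ₗ.[ℂ] X} {ω : ℝ}
  {f g : ℂ → ℂ}

namespace CalcAngle

theorem norm_hCalc_le (H : CalcAngle A ω) :
    ∃ M : ℝ, 0 < M ∧ ∀ (f : ℂ → ℂ) (k : ℝ → ℝ), Integrable k →
      (∀ w : ℂ, |w.im| < ω → ‖f (Complex.exp w)‖ ≤ k w.re) →
        ‖hCalc A (midAngle A ω) f‖ ≤ M * ∫ u, k u := by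
  obtain ⟨ω₀, h1, h⟩ := H.exists_angle
  obtain ⟨M, hM, hb⟩ := h.norm_hCalc_le h1 (H.mid_lt.trans H.lt_pi).le
  exact ⟨M, hM, fun f k hk hfk => hb f k hk (fun w hw => hfk w (by rw [hw]; exact H.mid_lt))⟩

/-- Dominated convergence for the Cauchy integral, in operator norm. -/
theorem tendsto_hCalc (H : CalcAngle A ω) {ι : Type*} {l : Filter ι} [l.IsCountablyGenerated]
    {F : ι → ℂ → ℂ} {k : ℝ → ℝ} (hk : Integrable k)
    (hd : ∀ᶠ i in l, DifferentiableOn ℂ (F i) (openSector ω))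
    (hb : ∀ᶠ i in l, ∀ w : ℂ, |w.im| < ω → ‖F i (Complex.exp w)‖ ≤ k w.re)
    (hlim : ∀ z ∈ openSector ω, Tendsto (fun i => F i z) l (𝓝 (f z))) :
    Tendsto (fun i => hCalc A (midAngle A ω) (F i)) l (𝓝 (hCalc A (midAngle A ω) f)) := by
  obtain ⟨ω₀, h1, h⟩ := H.exists_angle
  have hπ := H.lt_pi
  have hmid := H.mid_lt
  obtain ⟨M, hM, hR⟩ := h.resLog_bound_strip h1 (hmid.trans hπ).le
  have hl : ∀ φ : ℝ, |φ| = midAngle A ω → Tendsto (fun i => lineInt φ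
      (fun w => F i (Complex.exp w) • resLog A w)) l
      (𝓝 (lineInt φ (fun w => f (Complex.exp w) • resLog A w))) := by
    intro φ hφ
    unfold lineInt
    refine tendsto_integral_filter_of_dominated_convergence (fun u => k u * M) ?_ ?_
      (hk.mul_const M) ?_
    · filter_upwards [hd] with i hi
      exact (continuous_line (H := fun w => F i (Complex.exp w) • resLog A w) fun w hw =>
        (differentiableAt_comp_exp hi hπ.le (by rw [hw, hφ]; exact hmid)).smul
        (h.differentiableAt_resLog_strip (by rw [hw, hφ]; exact h1)
          (by rw [hw, hφ]; linarith))).aestronglyMeasurable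
    · filter_upwards [hb] with i hi
      refine Eventually.of_forall fun u => ?_
      have e1 := hi ((u : ℂ) + (φ : ℂ) * Complex.I) (by rw [line_im, hφ]; exact hmid)
      rw [line_re] at e1
      rw [norm_smul]
      refine mul_le_mul e1 (hR _ (by rw [line_im, hφ]) (by rw [line_im, hφ]; linarith))
        (norm_nonneg _) ((norm_nonneg _).trans e1)
    · refine Eventually.of_forall fun u => ?_
      exact (hlim _ (exp_mem_openSector hπ.le (by rw [line_im, hφ]; exact hmid))).smul_const _
  unfold hCalc stripInt
  exact ((hl _ (by rw [abs_neg, abs_of_pos H.mid_pos])).sub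
    (hl _ (abs_of_pos H.mid_pos))).const_smul _

theorem unitResolvent_smul (H : CalcAngle A ω) (v : ℝ) :
    unitResolvent ((Real.exp v : ℂ) • A) = resLog A (Real.pi * Complex.I - v) := by
  have h1 := (H.smul (Real.exp_pos v)).exists_angle
  obtain ⟨ω₀, _, h⟩ := h1
  have him : |((Real.pi : ℂ) * Complex.I).im| = Real.pi := by simp [Real.pi_pos.le]
  have h2 := resLog_smul (w := Real.pi * Complex.I) (Real.exp_pos v) H.sectorial H.lt
    (by rw [him]; exact H.lt_pi.le) him.le
  rw [Real.log_exp] at h2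
  rw [← h.resLog_pi, h2]

theorem pi_sub_im (v : ℝ) : |((Real.pi : ℂ) * Complex.I - v).im| = Real.pi := by
  simp [Real.pi_pos.le]

theorem continuous_unitResolvent (H : CalcAngle A ω) :
    Continuous (fun v : ℝ => unitResolvent ((Real.exp v : ℂ) • A)) := by
  obtain ⟨ω₀, h1, h⟩ := H.exists_angle
  simp only [H.unitResolvent_smul]
  rw [continuous_iff_continuousAt]
  intro v
  have hd := h.differentiableAt_resLog_strip (w := Real.pi * Complex.I - v)
    (by rw [pi_sub_im]; exact h.2.1) (pi_sub_im v).le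
  exact ContinuousAt.comp (f := fun v : ℝ => (Real.pi : ℂ) * Complex.I - (v : ℂ)) hd.continuousAt
    (by fun_prop)

theorem norm_unitResolvent_le (H : CalcAngle A ω) :
    ∃ M : ℝ, 0 < M ∧ ∀ v : ℝ, ‖unitResolvent ((Real.exp v : ℂ) • A)‖ ≤ M := by
  obtain ⟨ω₀, h1, h⟩ := H.exists_angle
  obtain ⟨M, hM, hb⟩ := h.resLog_bound_strip h.2.1 le_rfl
  refine ⟨M, hM, fun v => ?_⟩
  rw [H.unitResolvent_smul]
  exact hb _ (pi_sub_im v).ge (pi_sub_im v).le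

theorem exp_mul_exp (v : ℝ) (w : ℂ) :
    ((Real.exp v : ℝ) : ℂ) * Complex.exp w = Complex.exp (v + w) := by
  rw [Complex.exp_add, Complex.ofReal_exp]

theorem dilate_exp_bound {C α : ℝ} (hb : ∀ w : ℂ, |w.im| < ω →
    ‖f (Complex.exp w)‖ ≤ C * Real.exp (-(α * |w.re|))) (v : ℝ) (w : ℂ) (hw : |w.im| < ω) :
    ‖f ((Real.exp v : ℝ) * Complex.exp w)‖ ≤ C * Real.exp (-(α * |v + w.re|)) := by
  rw [exp_mul_exp]
  have := hb (v + w) (by simpa using hw)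
  simpa using this

theorem continuous_hCalc_dilate (H : CalcAngle A ω) (hf : MemHInftyZero ω f) :
    Continuous (fun v : ℝ => hCalc A (midAngle A ω) (fun z => f ((Real.exp v : ℝ) * z))) := by
  obtain ⟨C, α, hC, hα, hb⟩ := hf.exp_bound H.lt_pi.le
  rw [continuous_iff_continuousAt]
  intro v₀
  refine H.tendsto_hCalc (k := fun u => (C * Real.exp (α * (|v₀| + 1))) * Real.exp (-(α * |u|)))
    ((integrable_exp_neg_mul_abs hα).const_mul _)
    (Eventually.of_forall fun v => differentiableOn_dilate hf.1 (Real.exp_pos v)) ?_ ?_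
  · filter_upwards [Metric.ball_mem_nhds v₀ one_pos] with v hv w hw
    refine (dilate_exp_bound hb v w hw).trans ?_
    rw [mul_assoc, ← Real.exp_add]
    gcongr
    have h1 : |v| ≤ |v₀| + 1 := by
      have := abs_sub_abs_le_abs_sub v v₀
      rw [Metric.mem_ball, Real.dist_eq] at hv
      linarith
    have h2 : |w.re| ≤ |v + w.re| + |v| := by
      have := abs_sub (v + w.re) v
      rwa [add_sub_cancel_left] at this
    nlinarith
  · intro z hz
    have hz' := mul_mem_openSector (Real.exp_pos v₀) hz
    have hc := (hf.1.differentiableAt ((isOpen_openSector H.lt_pi.le).mem_nhds hz')).continuousAt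
    exact ContinuousAt.comp (f := fun v : ℝ => ((Real.exp v : ℝ) : ℂ) * z) hc (by fun_prop)

theorem exists_norm_hCalc_dilate_le (H : CalcAngle A ω) (hf : MemHInftyZero ω f) :
    ∃ K : ℝ, 0 < K ∧
      ∀ v : ℝ, ‖hCalc A (midAngle A ω) (fun z => f ((Real.exp v : ℝ) * z))‖ ≤ K := by
  obtain ⟨C, α, hC, hα, hb⟩ := hf.exp_bound H.lt_pi.le
  obtain ⟨M, hM, hN⟩ := H.norm_hCalc_le
  have hi := (integrable_exp_neg_mul_abs hα).const_mul C
  refine ⟨M * (|∫ u, C * Real.exp (-(α * |u|))| + 1), by positivity, fun v => ?_⟩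
  refine (hN _ (fun u => C * Real.exp (-(α * |v + u|))) (hi.comp_add_left v)
    (fun w hw => dilate_exp_bound hb v w hw)).trans ?_
  rw [integral_add_left_eq_self (fun u => C * Real.exp (-(α * |u|)))]
  gcongr
  linarith [le_abs_self (∫ u, C * Real.exp (-(α * |u|)))]

/-- The almost orthogonality estimate: if `|F(z)| ≤ C |z|^θ min(|z|^α, |z|^{-α})` and
`|G(z)| ≤ D |z|^{-θ} min(|z|^α, |z|^{-α})`, then `F(sA) G(tA)` has norm at most a constant times
`(s/t)^θ min(s/t, t/s)^{α/2}`. -/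
theorem norm_calc_mul_dilate_le (H : CalcAngle A ω) {θ C D α : ℝ} (hα : 0 < α) (hC : 0 ≤ C)
    (hf : MemElementary ω f) (hg : MemHInftyZero ω g)
    (hfb : ∀ w : ℂ, |w.im| < ω →
      ‖f (Complex.exp w)‖ ≤ C * Real.exp (θ * w.re) * Real.exp (-(α * |w.re|)))
    (hgb : ∀ w : ℂ, |w.im| < ω →
      ‖g (Complex.exp w)‖ ≤ D * Real.exp (-(θ * w.re)) * Real.exp (-(α * |w.re|))) :
    ∃ K : ℝ, 0 < K ∧ ∀ u v : ℝ,
      ‖elementaryCalc A ω (fun z => f ((Real.exp u : ℝ) * z) * g ((Real.exp v : ℝ) * z))‖ ≤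
        K * Real.exp (θ * (u - v)) * Real.exp (-(α / 2 * |u - v|)) := by
  obtain ⟨M, hM, hN⟩ := H.norm_hCalc_le
  have hi := integrable_exp_neg_mul_abs (half_pos hα)
  set I := ∫ x : ℝ, Real.exp (-(α / 2 * |x|))
  have hI : 0 ≤ I := integral_nonneg fun x => (Real.exp_pos _).le
  have hD : 0 ≤ D := by
    have := (norm_nonneg _).trans (hgb 0 (by simpa using H.pos))
    simpa using this
  refine ⟨M * (C * D * I) + 1, by positivity, fun u v => ?_⟩
  have hmem : MemHInftyZero ω (fun z => f ((Real.exp u : ℝ) * z) * g ((Real.exp v : ℝ) * z)) :=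
    (hf.dilate H.lt_pi (Real.exp_pos u)).mul_memHInftyZero (hg.dilate (Real.exp_pos v)) H.lt_pi
  rw [H.calc_of_memHInftyZero hmem]
  set c := C * D * Real.exp (θ * (u - v)) * Real.exp (-(α / 2 * |u - v|))
  refine (hN _ (fun x => c * Real.exp (-(α / 2 * |v + x|))) ((hi.comp_add_left v).const_mul c)
    ?_).trans ?_
  · intro w hw
    rw [exp_mul_exp, exp_mul_exp, norm_mul]
    have t1 := hfb (u + w) (by simpa using hw)
    have t2 := hgb (v + w) (by simpa using hw)
    simp only [Complex.add_re, Complex.ofReal_re] at t1 t2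
    refine (mul_le_mul t1 t2 (norm_nonneg _) ((norm_nonneg _).trans t1)).trans ?_
    have t3 : Real.exp (θ * (u + w.re)) * Real.exp (-(θ * (v + w.re))) =
        Real.exp (θ * (u - v)) := by
      rw [← Real.exp_add]; ring_nf
    have t4 : Real.exp (-(α * |u + w.re|)) * Real.exp (-(α * |v + w.re|)) ≤
        Real.exp (-(α / 2 * |u - v|)) * Real.exp (-(α / 2 * |v + w.re|)) := by
      rw [← Real.exp_add, ← Real.exp_add, Real.exp_le_exp]
      nlinarith [abs_add_add_abs_add_ge u v w.re]
    calc _ = C * D * (Real.exp (θ * (u + w.re)) * Real.exp (-(θ * (v + w.re)))) *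
          (Real.exp (-(α * |u + w.re|)) * Real.exp (-(α * |v + w.re|))) := by ring
      _ ≤ C * D * (Real.exp (θ * (u + w.re)) * Real.exp (-(θ * (v + w.re)))) *
          (Real.exp (-(α / 2 * |u - v|)) * Real.exp (-(α / 2 * |v + w.re|))) := by gcongr
      _ = _ := by rw [t3]; ring
  · rw [integral_const_mul, integral_add_left_eq_self (fun x => Real.exp (-(α / 2 * |x|)))]
    have : 0 ≤ Real.exp (θ * (u - v)) * Real.exp (-(α / 2 * |u - v|)) := by positivity
    calc _ = (M * (C * D * I)) * (Real.exp (θ * (u - v)) * Real.exp (-(α / 2 * |u - v|))) := by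
          simp only [c]; ring
      _ ≤ (M * (C * D * I) + 1) * (Real.exp (θ * (u - v)) * Real.exp (-(α / 2 * |u - v|))) := by
          gcongr; linarith
      _ = _ := by ring

variable [CompleteSpace X]

theorem continuous_calc_dilate (H : CalcAngle A ω) (hf : MemElementary ω f) :
    Continuous (fun v : ℝ => elementaryCalc A ω (fun z => f ((Real.exp v : ℝ) * z))) := by
  obtain ⟨c, d, h⟩ := hf
  simp only [fun v => H.calc_dilate_eq h (Real.exp_pos v)]
  have h1 := H.continuous_hCalc_dilate h
  have h2 := H.continuous_unitResolvent
  exact (h1.add (h2.const_smul c)).add continuous_const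

theorem exists_norm_calc_dilate_le (H : CalcAngle A ω) (hf : MemElementary ω f) :
    ∃ K : ℝ, 0 < K ∧
      ∀ v : ℝ, ‖elementaryCalc A ω (fun z => f ((Real.exp v : ℝ) * z))‖ ≤ K := by
  obtain ⟨c, d, h⟩ := hf
  obtain ⟨K, hK, hb⟩ := H.exists_norm_hCalc_dilate_le h
  obtain ⟨M, hM, hb'⟩ := H.norm_unitResolvent_le
  refine ⟨K + ‖c‖ * M + ‖d‖ * ‖(1 : X →L[ℂ] X)‖, by positivity, fun v => ?_⟩
  rw [H.calc_dilate_eq h (Real.exp_pos v)]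
  refine norm_add₃_le.trans ?_
  rw [norm_smul, norm_smul]
  gcongr
  · exact hb v
  · exact hb' v

/-- If `∫_0^∞ g(tz) dt/t = c` on the sector, then `∫_0^∞ f(A) g(tA) dt/t = c f(A)`, as an operator
valued integral. The factor `f ∈ H^∞_0` makes Fubini's theorem applicable. -/
theorem integral_calc_mul_dilate (H : CalcAngle A ω) (hf : MemHInftyZero ω f)
    (hg : MemHInftyZero ω g) {c : ℂ}
    (hc : ∀ z ∈ openSector ω, ∫ v : ℝ, g ((Real.exp v : ℝ) * z) = c) :
    Integrable (fun v : ℝ => elementaryCalc A ω (fun z => f z * g ((Real.exp v : ℝ) * z))) ∧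
      ∫ v : ℝ, elementaryCalc A ω (fun z => f z * g ((Real.exp v : ℝ) * z)) =
        c • elementaryCalc A ω f := by
  obtain ⟨ω₀, h1, h⟩ := H.exists_angle
  have hπ := H.lt_pi
  have hmid := H.mid_lt
  obtain ⟨M, hM, hR⟩ := h.resLog_bound_strip h1 (hmid.trans hπ).le
  obtain ⟨C, α, hC, hα, hb⟩ := hf.exp_bound hπ.le
  obtain ⟨D, β, hD, hβ, hb'⟩ := hg.exp_bound hπ.le
  have hm : 0 < min α β / 2 := half_pos (lt_min hα hβ)
  have e : ∀ v : ℝ, elementaryCalc A ω (fun z => f z * g ((Real.exp v : ℝ) * z)) =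
      stripInt (midAngle A ω) (fun w => (f (Complex.exp w) *
        g ((Real.exp v : ℝ) * Complex.exp w)) • resLog A w) := fun v =>
    H.calc_of_memHInftyZero (hf.mul (hg.dilate (Real.exp_pos v)))
  set K : ℝ → ℂ → (X →L[ℂ] X) := fun v w =>
    (f (Complex.exp w) * g ((Real.exp v : ℝ) * Complex.exp w)) • resLog A w with hKdef
  have hK : ∀ φ : ℝ, |φ| = |midAngle A ω| → Integrable (fun p : ℝ × ℝ =>
      K p.1 ((p.2 : ℂ) + (φ : ℂ) * Complex.I)) (volume.prod volume) := by
    intro φ hφ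
    rw [abs_of_pos H.mid_pos] at hφ
    have cf : Continuous (fun u : ℝ => f (Complex.exp ((u : ℂ) + (φ : ℂ) * Complex.I))) :=
      continuous_line (H := fun w => f (Complex.exp w)) fun w hw =>
        differentiableAt_comp_exp hf.1 hπ.le (by rw [hw, hφ]; exact hmid)
    have cg : Continuous (fun u : ℝ => g (Complex.exp ((u : ℂ) + (φ : ℂ) * Complex.I))) :=
      continuous_line (H := fun w => g (Complex.exp w)) fun w hw =>
        differentiableAt_comp_exp hg.1 hπ.le (by rw [hw, hφ]; exact hmid)
    have cR : Continuous (fun u : ℝ => resLog A ((u : ℂ) + (φ : ℂ) * Complex.I)) :=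
      continuous_line fun w hw =>
        h.differentiableAt_resLog_strip (by rw [hw, hφ]; exact h1) (by rw [hw, hφ]; linarith)
    have hcont : Continuous (fun p : ℝ × ℝ => K p.1 ((p.2 : ℂ) + (φ : ℂ) * Complex.I)) := by
      have : Continuous (fun p : ℝ × ℝ => g (((Real.exp p.1 : ℝ) : ℂ) *
          Complex.exp ((p.2 : ℂ) + (φ : ℂ) * Complex.I))) := by
        have c2 := cg.comp
          (continuous_fst.add continuous_snd : Continuous fun p : ℝ × ℝ => p.1 + p.2)
        refine c2.congr fun p => ?_
        rw [exp_mul_exp]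
        simp only [Function.comp_apply, Pi.add_apply]
        push_cast
        rw [add_assoc]
      exact ((cf.comp continuous_snd).mul this).smul (cR.comp continuous_snd)
    refine Integrable.mono' (((integrable_exp_neg_mul_abs hm).const_mul (C * D)).mul_prod
      ((integrable_exp_neg_mul_abs hm).const_mul M)) hcont.aestronglyMeasurable
      (Eventually.of_forall fun p => ?_)
    have t1 := hb ((p.2 : ℂ) + (φ : ℂ) * Complex.I) (by rw [line_im, hφ]; exact hmid)
    have t2 := dilate_exp_bound hb' p.1 ((p.2 : ℂ) + (φ : ℂ) * Complex.I)
      (by rw [line_im, hφ]; exact hmid)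
    have t3 := hR ((p.2 : ℂ) + (φ : ℂ) * Complex.I) (by rw [line_im, hφ])
      (by rw [line_im, hφ]; linarith)
    rw [line_re] at t1 t2
    simp only [hKdef]
    rw [norm_smul, norm_mul]
    have t4 : Real.exp (-(α * |p.2|)) * Real.exp (-(β * |p.1 + p.2|)) ≤
        Real.exp (-(min α β / 2 * |p.1|)) * Real.exp (-(min α β / 2 * |p.2|)) := by
      rw [← Real.exp_add, ← Real.exp_add, Real.exp_le_exp]
      have k1 := abs_add_abs_add_ge p.2 p.1
      have k2 : min α β * |p.2| ≤ α * |p.2| := by gcongr; exact min_le_left _ _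
      have k3 : min α β * |p.1 + p.2| ≤ β * |p.1 + p.2| := by gcongr; exact min_le_right _ _
      nlinarith
    calc _ ≤ C * Real.exp (-(α * |p.2|)) * (D * Real.exp (-(β * |p.1 + p.2|))) * M := by gcongr
      _ = C * D * M * (Real.exp (-(α * |p.2|)) * Real.exp (-(β * |p.1 + p.2|))) := by ring
      _ ≤ C * D * M * (Real.exp (-(min α β / 2 * |p.1|)) * Real.exp (-(min α β / 2 * |p.2|))) := by
          gcongr
      _ = _ := by ring
  obtain ⟨i1, i2⟩ := integral_stripInt hK
  simp only [e]
  refine ⟨i1, i2.trans ?_⟩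
  rw [H.calc_of_memHInftyZero hf, hCalc, ← stripInt_smul]
  refine stripInt_congr fun w hw => ?_
  rw [abs_of_pos H.mid_pos] at hw
  rw [integral_smul_const, integral_const_mul,
    hc _ (exp_mem_openSector hπ.le (by rw [hw]; exact hmid)), smul_smul, mul_comm]

end CalcAngle

end Convergence

/-! ### Weighted Lebesgue norms in the exponential coordinate -/

theorem restrict_Ioi_eq_map_exp : (volume.restrict (Ioi (0 : ℝ))) =
    Measure.map Real.exp (volume.withDensity (fun u : ℝ => ENNReal.ofReal (Real.exp u))) := by
  have h := map_withDensity_abs_det_fderiv_eq_addHaar (μ := (volume : Measure ℝ)) (s := univ)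
    (f := Real.exp) (f' := fun u => ContinuousLinearMap.toSpanSingleton ℝ (Real.exp u))
    nullMeasurableSet_univ (fun u _ => (Real.hasDerivAt_exp u).hasDerivWithinAt.hasFDerivWithinAt)
    Real.exp_injective.injOn
  rw [image_univ, Real.range_exp, Measure.restrict_univ] at h
  rw [← h]
  simp

theorem lintegral_Ioi_eq_exp (g : ℝ → ℝ≥0∞) :
    ∫⁻ t in Ioi (0 : ℝ), g t = ∫⁻ u : ℝ, ENNReal.ofReal (Real.exp u) * g (Real.exp u) := by
  rw [restrict_Ioi_eq_map_exp, Real.isOpenEmbedding_exp.measurableEmbedding.lintegral_map,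
    lintegral_withDensity_eq_lintegral_mul_non_measurable _ (by fun_prop)
      (Eventually.of_forall fun u => ENNReal.ofReal_lt_top)]
  rfl

theorem eLpNorm_top_Ioi_eq_exp (g : ℝ → ℝ) :
    eLpNorm g ∞ (volume.restrict (Ioi (0 : ℝ))) = eLpNorm (fun u => g (Real.exp u)) ∞ volume := by
  rw [restrict_Ioi_eq_map_exp, Real.isOpenEmbedding_exp.measurableEmbedding.eLpNorm_map_measure]
  refine le_antisymm (eLpNormEssSup_mono_measure _ (withDensity_absolutelyContinuous _ _))
    (eLpNormEssSup_mono_measure _ (withDensity_absolutelyContinuous' (by fun_prop) ?_))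
  exact Eventually.of_forall fun u => by simp [Real.exp_pos]

/-- In the coordinate `t = e^u` the weighted norm is the unweighted `L^p`-norm over the real line of
`e^{(1-θ)u} g(e^u)`, for all `p` at once. -/
theorem weightedNorm_eq {p : ℝ≥0∞} (hp : 1 ≤ p) (μ : ℝ) (g : ℝ → ℝ) :
    weightedNorm p μ g =
      eLpNorm (fun u : ℝ => Real.exp ((1 - thetaOf p μ) * u) * g (Real.exp u)) p volume := by
  unfold weightedNorm thetaOf
  by_cases hpt : p = ∞
  · subst hpt
    simp only [if_true]
    rw [eLpNorm_top_Ioi_eq_exp]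
    congr 1
    ext u
    rw [← Real.exp_mul]
    ring_nf
  · have h0 : p ≠ 0 := (zero_lt_one.trans_le hp).ne'
    have hpos : 0 < p.toReal := ENNReal.toReal_pos h0 hpt
    simp only [hpt, if_false]
    rw [eLpNorm_eq_lintegral_rpow_enorm_toReal h0 hpt,
      eLpNorm_eq_lintegral_rpow_enorm_toReal h0 hpt,
      lintegral_withDensity_eq_lintegral_mul_non_measurable _ (by fun_prop)
      (Eventually.of_forall fun u => ENNReal.ofReal_lt_top), lintegral_Ioi_eq_exp]
    congr 1
    refine lintegral_congr fun u => ?_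
    simp only [Pi.mul_apply]
    rw [enorm_mul, ENNReal.mul_rpow_of_nonneg _ _ hpos.le, ← mul_assoc,
      Real.enorm_eq_ofReal (Real.exp_pos _).le, ENNReal.ofReal_rpow_of_pos (Real.exp_pos _),
      ← ENNReal.ofReal_mul (Real.exp_pos _).le, ← Real.exp_mul, ← Real.exp_mul, ← Real.exp_add]
    congr 3
    field_simp
    ring

theorem weightedNorm_congr {p : ℝ≥0∞} (hp : 1 ≤ p) (μ : ℝ) {g h : ℝ → ℝ}
    (hgh : ∀ t, 0 < t → g t = h t) : weightedNorm p μ g = weightedNorm p μ h := by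
  simp only [weightedNorm_eq hp, hgh _ (Real.exp_pos _)]

theorem thetaOf_muOf {p : ℝ≥0∞} (hp : 1 ≤ p) (θ : ℝ) : thetaOf p (muOf p θ) = θ := by
  unfold thetaOf muOf
  split_ifs with h
  · ring
  · have hpos : 0 < p.toReal := ENNReal.toReal_pos (zero_lt_one.trans_le hp).ne' h
    field_simp
    ring

theorem thetaOf_sub_one {p : ℝ≥0∞} (hp : 1 ≤ p) (h : p ≠ ∞) : thetaOf p (p.toReal - 1) = 0 := by
  have hpos : 0 < p.toReal := ENNReal.toReal_pos (zero_lt_one.trans_le hp).ne' h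
  simp [thetaOf, h, hpos.ne']

theorem thetaOf_top_one : thetaOf ∞ 1 = 0 := by simp [thetaOf]

/-- Hölder's inequality for the weight `k`, in the form of Jensen's inequality. -/
theorem lintegral_mul_rpow_le {α : Type*} [MeasurableSpace α] {μ : Measure α} {k G : α → ℝ≥0∞}
    (hk : AEMeasurable k μ) (hG : AEMeasurable G μ) (hkt : ∀ a, k a ≠ ∞) {p : ℝ} (hp : 1 ≤ p) :
    (∫⁻ a, k a * G a ∂μ) ^ p ≤ (∫⁻ a, k a ∂μ) ^ (p - 1) * ∫⁻ a, k a * G a ^ p ∂μ := by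
  have hp0 : 0 < p := by linarith
  have h := ENNReal.lintegral_mul_norm_pow_le (μ := μ) hk (hk.mul (hG.pow_const p))
    (p := 1 - 1 / p) (q := 1 / p) (by rw [sub_nonneg, div_le_one hp0]; exact hp) (by positivity)
    (by ring)
  have e : ∀ a, k a ^ (1 - 1 / p) * (k * fun x => G x ^ p) a ^ (1 / p) = k a * G a := by
    intro a
    rw [Pi.mul_apply, ENNReal.mul_rpow_of_nonneg _ _ (by positivity), ← ENNReal.rpow_mul,
      mul_one_div_cancel hp0.ne', ENNReal.rpow_one, ← mul_assoc]
    congr 1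
    by_cases h0 : k a = 0
    · rw [h0, ENNReal.zero_rpow_of_pos (show (0:ℝ) < 1 / p by positivity), mul_zero]
    · rw [← ENNReal.rpow_add _ _ h0 (hkt a)]
      simp
  simp only [e] at h
  refine (ENNReal.rpow_le_rpow h hp0.le).trans_eq ?_
  rw [ENNReal.mul_rpow_of_nonneg _ _ hp0.le, ← ENNReal.rpow_mul, ← ENNReal.rpow_mul,
    one_div_mul_cancel hp0.ne', ENNReal.rpow_one, sub_mul, one_mul, one_div_mul_cancel hp0.ne']
  rfl

/-- Young's inequality for the convolution with an integrable kernel, on the real line. -/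
theorem eLpNorm_le_of_le_convolution {E F : Type*} [NormedAddCommGroup E] [NormedAddCommGroup F]
    {p : ℝ≥0∞} (hp : 1 ≤ p) {f : ℝ → E} {g : ℝ → F} {k : ℝ → ℝ≥0∞} (hk : Measurable k)
    (hkt : ∀ u, k u ≠ ∞) (hg : Measurable (fun v => ‖g v‖ₑ))
    (h : ∀ u, ‖f u‖ₑ ≤ ∫⁻ v, k (u - v) * ‖g v‖ₑ) :
    eLpNorm f p volume ≤ (∫⁻ u, k u) * eLpNorm g p volume := by
  have hsub : ∀ u, ∫⁻ v, k (u - v) = ∫⁻ v, k v := fun u =>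
    lintegral_sub_left_eq_self k u
  by_cases hpt : p = ∞
  · subst hpt
    simp only [eLpNorm_exponent_top]
    refine essSup_le_of_ae_le _ (Eventually.of_forall fun u => ?_)
    refine (h u).trans ?_
    calc ∫⁻ v, k (u - v) * ‖g v‖ₑ ≤ ∫⁻ v, k (u - v) * eLpNormEssSup g volume := by
          refine lintegral_mono_ae ?_
          filter_upwards [ae_le_eLpNormEssSup (f := g) (μ := volume)] with v hv
          gcongr
      _ = _ := by rw [lintegral_mul_const _ (by fun_prop), hsub]
  · have h0 : p ≠ 0 := (zero_lt_one.trans_le hp).ne'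
    have hp1 : 1 ≤ p.toReal := by
      rw [← ENNReal.toReal_one]; exact ENNReal.toReal_mono hpt hp
    have hpos : 0 < p.toReal := by linarith
    rw [eLpNorm_eq_lintegral_rpow_enorm_toReal h0 hpt,
      eLpNorm_eq_lintegral_rpow_enorm_toReal h0 hpt]
    set q := p.toReal
    have key : ∫⁻ u, ‖f u‖ₑ ^ q ≤ (∫⁻ u, k u) ^ q * ∫⁻ v, ‖g v‖ₑ ^ q := by
      calc ∫⁻ u, ‖f u‖ₑ ^ q
          ≤ ∫⁻ u, (∫⁻ v, k v) ^ (q - 1) * ∫⁻ v, k (u - v) * ‖g v‖ₑ ^ q := by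
            refine lintegral_mono fun u => (ENNReal.rpow_le_rpow (h u) hpos.le).trans ?_
            rw [← hsub u]
            exact lintegral_mul_rpow_le (by fun_prop) hg.aemeasurable (fun v => hkt _) hp1
        _ = (∫⁻ v, k v) ^ (q - 1) * ∫⁻ u, ∫⁻ v, k (u - v) * ‖g v‖ₑ ^ q := by
            refine lintegral_const_mul _ ?_
            exact Measurable.lintegral_prod_right'
              (f := fun x : ℝ × ℝ => k (x.1 - x.2) * ‖g x.2‖ₑ ^ q)
              (by
                have : Measurable (fun x : ℝ × ℝ => ‖g x.2‖ₑ) := hg.comp measurable_snd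
                fun_prop)
        _ = (∫⁻ v, k v) ^ (q - 1) * ((∫⁻ u, k u) * ∫⁻ v, ‖g v‖ₑ ^ q) := by
            congr 1
            rw [lintegral_lintegral_swap]
            · rw [← lintegral_const_mul _ (hg.pow_const q)]
              refine lintegral_congr fun v => ?_
              rw [lintegral_mul_const _ (by fun_prop), lintegral_sub_right_eq_self k v]
            · have : Measurable (fun x : ℝ × ℝ => ‖g x.2‖ₑ) := hg.comp measurable_snd
              refine Measurable.aemeasurable ?_
              simp only [Function.uncurry_def]
              fun_prop
        _ = _ := by
            rw [← mul_assoc]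
            congr 1
            nth_rewrite 2 [← ENNReal.rpow_one (∫⁻ u, k u)]
            rw [← ENNReal.rpow_add_of_nonneg _ _ (by linarith) zero_le_one, sub_add_cancel]
    refine (ENNReal.rpow_le_rpow key (by positivity)).trans_eq ?_
    rw [ENNReal.mul_rpow_of_nonneg _ _ (by positivity), ← ENNReal.rpow_mul,
      mul_one_div_cancel hpos.ne', ENNReal.rpow_one]

/-- The seminorm as an unweighted `L^p`-norm over the real line. -/
theorem CalcAngle.calcSeminorm_eq {X : Type*} [NormedAddCommGroup X] [NormedSpace ℂ X]
    [CompleteSpace X] {A : X →ₗ.[ℂ] X} {ω : ℝ} (H : CalcAngle A ω) {p : ℝ≥0∞} (hp : 1 ≤ p) (μ : ℝ)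
    {ψ : ℂ → ℂ} (hψ : MemElementary ω ψ) (x : X) :
    calcSeminorm A ω p μ ψ x = eLpNorm (fun u : ℝ => (Real.exp (-(thetaOf p μ * u)) : ℂ) •
      elementaryCalc A ω (fun z => ψ ((Real.exp u : ℝ) * z)) x) p volume := by
  rw [calcSeminorm, weightedNorm_eq hp]
  refine eLpNorm_congr_norm_ae (Eventually.of_forall fun u => ?_)
  rw [norm_mul, norm_norm, norm_smul, norm_smul, H.calc_smul hψ (Real.exp_pos u), ← mul_assoc]
  congr 1
  simp only [norm_inv, Complex.norm_real, Real.norm_eq_abs, Real.abs_exp]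
  rw [← Real.exp_neg, ← Real.exp_add]
  ring_nf

/-! ### Reproducing pairs -/

section Reproducing

variable {ω : ℝ} {f ψ : ℂ → ℂ}

theorem isPreconnected_openSector (hω : ω ≤ Real.pi) : IsPreconnected (openSector ω) := by
  have h : openSector ω = Complex.exp '' (Complex.im ⁻¹' Ioo (-ω) ω) := by
    ext z
    constructor
    · intro hz
      obtain ⟨w, hw, rfl⟩ := exists_exp_of_mem_openSector hz
      exact ⟨w, abs_lt.1 hw, rfl⟩
    · rintro ⟨w, hw, rfl⟩
      exact exp_mem_openSector hω (abs_lt.2 hw)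
  rw [h]
  refine IsPreconnected.image ?_ _ Complex.continuous_exp.continuousOn
  exact ((convex_Ioo (-ω) ω).linear_preimage Complex.imLm).isPreconnected

/-- The identity theorem: holomorphic functions on a sector that agree on the half-line agree. -/
theorem eqOn_openSector_of_eqOn_pos {E : Type*} [NormedAddCommGroup E] [NormedSpace ℂ E]
    [CompleteSpace E] {f g : ℂ → E} (hω0 : 0 < ω) (hω : ω ≤ Real.pi)
    (hf : DifferentiableOn ℂ f (openSector ω)) (hg : DifferentiableOn ℂ g (openSector ω))
    (h : ∀ t : ℝ, 0 < t → f (t : ℂ) = g (t : ℂ)) : EqOn f g (openSector ω) := by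
  have ho := isOpen_openSector hω
  have h1 : (1 : ℂ) ∈ openSector ω := by simpa using ofReal_mem_openSector hω0 one_pos
  refine (hf.analyticOnNhd ho).eqOn_of_preconnected_of_frequently_eq (hg.analyticOnNhd ho)
    (isPreconnected_openSector hω) h1 ?_
  have ht : Tendsto (fun n : ℕ => (((1 + 1 / ((n : ℝ) + 1) : ℝ)) : ℂ)) atTop (𝓝[≠] (1 : ℂ)) := by
    refine tendsto_nhdsWithin_iff.2 ⟨?_, Eventually.of_forall fun n => ?_⟩
    · have := (tendsto_one_div_add_atTop_nhds_zero_nat (𝕜 := ℝ)).const_add 1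
      rw [add_zero] at this
      exact (Complex.continuous_ofReal.tendsto _).comp this
    · have : (0 : ℝ) < 1 / ((n : ℝ) + 1) := by positivity
      simp only [mem_compl_iff, mem_singleton_iff, Complex.ofReal_eq_one]
      linarith
  exact ht.frequently (Frequently.of_forall fun n => h _ (by positivity))

theorem conj_mem_openSector {z : ℂ} (hω : ω ≤ Real.pi) (hz : z ∈ openSector ω) :
    (starRingEnd ℂ) z ∈ openSector ω := by
  obtain ⟨w, hw, rfl⟩ := exists_exp_of_mem_openSector hz
  rw [← Complex.exp_conj]
  exact exp_mem_openSector hω (by simpa using hw)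

theorem psiThree_ofReal (t : ℝ) : psiThree (t : ℂ) = ((t / (1 + t) ^ 2 : ℝ) : ℂ) := by
  simp [psiThree, div_eq_mul_inv]

/-- The integral `∫_0^∞ f(tz) dt/t` does not depend on `z`. -/
theorem MemHInftyZero.integral_dilate_eq (hω : ω ≤ Real.pi) (hf : MemHInftyZero ω f)
    {z : ℂ} (hz : z ∈ openSector ω) :
    ∫ v : ℝ, f ((Real.exp v : ℝ) * z) = ∫ v : ℝ, f (Real.exp v : ℝ) := by
  obtain ⟨w, hw, rfl⟩ := exists_exp_of_mem_openSector hz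
  obtain ⟨C, α, hC, hα, hb⟩ := hf.exp_bound hω
  have hpos : 0 < ω := (abs_nonneg _).trans_lt hw
  have key : ∀ a b : ℝ, a ≤ b → |a| < ω → |b| < ω →
      lineInt a (fun w => f (Complex.exp w)) = lineInt b (fun w => f (Complex.exp w)) := by
    intro a b hab ha hb'
    rw [abs_lt] at ha hb'
    have hs : ∀ w : ℂ, a ≤ w.im → w.im ≤ b → |w.im| < ω := fun w h1 h2 =>
      abs_lt.2 ⟨by linarith, by linarith⟩
    exact lineInt_eq (N := 0) hab hα (fun w h1 h2 => differentiableAt_comp_exp hf.1 hω (hs w h1 h2))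
      (fun w h1 h2 _ => hb w (hs w h1 h2))
  have e0 : lineInt 0 (fun w => f (Complex.exp w)) = ∫ v : ℝ, f (Real.exp v : ℝ) := by
    simp [lineInt]
  have e1 : lineInt w.im (fun w => f (Complex.exp w)) =
      ∫ v : ℝ, f ((Real.exp v : ℝ) * Complex.exp w) := by
    rw [lineInt, ← integral_add_right_eq_self _ w.re]
    refine integral_congr_ae (Eventually.of_forall fun v => ?_)
    simp only []
    rw [CalcAngle.exp_mul_exp]
    congr 2
    nth_rewrite 3 [← Complex.re_add_im w]
    push_cast
    ring
  rw [← e0, ← e1]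
  rcases le_total 0 w.im with h | h
  · exact (key _ _ h (by simpa using hpos) hw).symm
  · exact key _ _ h hw (by simpa using hpos)

theorem exp_neg_mul_abs_pow_le {C α θ r : ℝ} (hC : 0 ≤ C) {N : ℕ} (hN : |θ| + 1 ≤ N * α) :
    (C * Real.exp (-(α * |r|))) ^ N ≤ C ^ N * (Real.exp (-(θ * r)) * Real.exp (-(1 * |r|))) := by
  rw [mul_pow, ← Real.exp_nat_mul, ← Real.exp_add]
  gcongr
  have h1 : θ * r ≤ |θ| * |r| := (le_abs_self _).trans (abs_mul _ _).le
  nlinarith [abs_nonneg r]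

/-- For each nonzero `ψ ∈ 𝓔` there is a reproducing partner: `η ∈ H^∞_0`, decaying as fast as
prescribed, with `∫_0^∞ η(tz) ψ(tz) dt/t = 1`. It is a normalized `ψ₃(z)^N` times the reflection
of `ψ` in the real axis, which makes the integrand nonnegative on the half-line. -/
theorem MemElementary.exists_reproducing (hω0 : 0 < ω) (hω : ω < Real.pi)
    (hψ : MemElementary ω ψ) (hne : ∃ z ∈ openSector ω, ψ z ≠ 0) (θ : ℝ) :
    ∃ (η : ℂ → ℂ) (D : ℝ), MemHInftyZero ω η ∧
      (∀ w : ℂ, |w.im| < ω →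
        ‖η (Complex.exp w)‖ ≤ D * Real.exp (-(θ * w.re)) * Real.exp (-(1 * |w.re|))) ∧
      ∀ z ∈ openSector ω, ∫ v : ℝ, η ((Real.exp v : ℝ) * z) * ψ ((Real.exp v : ℝ) * z) = 1 := by
  obtain ⟨C, α, hC, hα, hb⟩ := (memHInftyZero_psiThree hω).exp_bound hω.le
  obtain ⟨B, hB, hψb⟩ := hψ.bounded hω
  have hψd := hψ.differentiableOn hω.le
  have hψ3 := memHInftyZero_psiThree hω
  obtain ⟨n, hn⟩ := exists_nat_ge ((|θ| + 1) / α)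
  rw [div_le_iff₀ hα] at hn
  have hn0 : n ≠ 0 := by
    rintro rfl
    have := abs_nonneg θ
    simp at hn
    linarith
  -- the reflection of `ψ`; on the half-line its product with `ψ` is `|ψ|²`
  set ψ' : ℂ → ℂ := fun z => (starRingEnd ℂ) (ψ ((starRingEnd ℂ) z)) with hψ'
  have hψ'b : ∀ z ∈ openSector ω, ‖ψ' z‖ ≤ B := fun z hz => by
    simp only [hψ', RCLike.norm_conj]
    exact hψb _ (conj_mem_openSector hω.le hz)
  have hψ'd : DifferentiableOn ℂ ψ' (openSector ω) := fun z hz => by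
    have h := (hψd.differentiableAt
      ((isOpen_openSector hω.le).mem_nhds (conj_mem_openSector hω.le hz)))
    have := h.star_star
    exact (by simpa [Function.comp_def] using this : DifferentiableAt ℂ ψ' z).differentiableWithinAt
  have hpow : ∀ m : ℕ, m ≠ 0 → MemHInftyZero ω (fun z => psiThree z ^ m) := by
    intro m hm
    induction m with
    | zero => exact absurd rfl hm
    | succ k ih =>
      rcases eq_or_ne k 0 with rfl | hk
      · simpa using hψ3
      · exact ((ih hk).mul hψ3).congr fun z _ => pow_succ _ _
  set η₀ : ℂ → ℂ := fun z => psiThree z ^ n * ψ' z with hη₀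
  have hη₀m : MemHInftyZero ω η₀ := (hpow n hn0).mul_bounded hψ'd hψ'b
  have hprod : MemHInftyZero ω (fun z => η₀ z * ψ z) := hη₀m.mul_bounded hψd hψb
  set q : ℝ → ℝ := fun v => (Real.exp v / (1 + Real.exp v) ^ 2) ^ n * ‖ψ (Real.exp v : ℝ)‖ ^ 2
  have hq : ∀ v : ℝ, η₀ (Real.exp v : ℝ) * ψ (Real.exp v : ℝ) = (q v : ℂ) := by
    intro v
    simp only [hη₀, hψ', psiThree_ofReal, Complex.conj_ofReal, q]
    rw [mul_assoc, Complex.conj_mul']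
    push_cast
    rfl
  have hint : Integrable (fun v : ℝ => η₀ (Real.exp v : ℝ) * ψ (Real.exp v : ℝ)) := by
    obtain ⟨C', α', hC', hα', hb'⟩ := hprod.exp_bound hω.le
    have := integrable_line (H := fun w => η₀ (Complex.exp w) * ψ (Complex.exp w)) (φ := 0) (N := 0)
      (C := C') hα' (fun w hw => differentiableAt_comp_exp hprod.1 hω.le
        (by rw [hw]; simpa using hω0))
      (fun w hw _ => hb' w (by rw [hw]; simpa using hω0))
    simpa using this
  have hqi : Integrable q := by
    have := hint.re
    simp only [hq] at this
    simpa using this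
  have hqc : Continuous q := by
    have h1 : Continuous (fun v : ℝ => ψ (Real.exp v : ℝ)) := by
      have := continuous_line (H := fun w => ψ (Complex.exp w)) (φ := 0) (fun w hw =>
        differentiableAt_comp_exp hψd hω.le
        (by rw [hw]; simpa using hω0))
      simpa using this
    have h2 : ∀ v : ℝ, (1 + Real.exp v) ^ 2 ≠ 0 := fun v => by positivity
    exact (((Real.continuous_exp).div (by fun_prop) h2).pow n).mul (h1.norm.pow 2)
  have hq0 : 0 ≤ q := fun v => by
    simp only [Pi.zero_apply, q]
    positivity
  -- a holomorphic function that vanishes on the half-line vanishes on the sector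
  obtain ⟨v₀, hv₀⟩ : ∃ v : ℝ, ψ (Real.exp v : ℝ) ≠ 0 := by
    by_contra! hz
    obtain ⟨z, hz1, hz2⟩ := hne
    refine hz2 (eqOn_openSector_of_eqOn_pos hω0 hω.le hψd (differentiableOn_const 0) ?_ hz1)
    intro t ht
    have := hz (Real.log t)
    rwa [Real.exp_log ht] at this
  have hqpos : 0 < ∫ v, q v := by
    rw [integral_pos_iff_support_of_nonneg hq0 hqi]
    refine hqc.isOpen_support.measure_pos _ ⟨v₀, ?_⟩
    have : 0 < ‖ψ (Real.exp v₀ : ℝ)‖ := norm_pos_iff.2 hv₀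
    have h2 : 0 < q v₀ := by simp only [q]; positivity
    exact h2.ne'
  set c : ℂ := ((∫ v, q v : ℝ) : ℂ)
  have hc : c ≠ 0 := Complex.ofReal_ne_zero.2 hqpos.ne'
  refine ⟨fun z => c⁻¹ * η₀ z, ‖c⁻¹‖ * (C ^ n * B), hη₀m.const_mul _, fun w hw => ?_,
    fun z hz => ?_⟩
  · have hz := exp_mem_openSector hω.le hw
    rw [norm_mul, hη₀, norm_mul, norm_pow]
    have e1 := pow_le_pow_left₀ (norm_nonneg _) (hb w hw) n
    have e2 := e1.trans (exp_neg_mul_abs_pow_le (r := w.re) hC.le hn)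
    have e3 := mul_le_mul e2 (hψ'b _ hz) (norm_nonneg _) (by positivity)
    refine (mul_le_mul_of_nonneg_left e3 (norm_nonneg _)).trans_eq ?_
    ring
  · simp only [mul_assoc]
    rw [integral_const_mul, hprod.integral_dilate_eq hω.le hz]
    simp only [hq]
    have hr : ∫ v, (q v : ℂ) = c := integral_ofReal (𝕜 := ℂ)
    rw [hr]
    exact inv_mul_cancel₀ hc

end Reproducing

/-! ### Domination of one square function by another -/

section PowerWeights

variable {ω : ℝ} {f : ℂ → ℂ}

theorem norm_cpow_ofReal {z : ℂ} (hz : z ≠ 0) (s : ℝ) : ‖z ^ (s : ℂ)‖ = ‖z‖ ^ s := by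
  rw [Complex.norm_cpow_of_ne_zero hz]
  simp

theorem MemHInftyZero.cpow_exp_bound {θ : ℝ}
    (h : MemHInftyZero ω (fun z => z ^ (-(θ : ℂ)) * f z)) (hω : ω ≤ Real.pi) :
    ∃ C α : ℝ, 0 < C ∧ 0 < α ∧ ∀ w : ℂ, |w.im| < ω →
      ‖f (Complex.exp w)‖ ≤ C * Real.exp (θ * w.re) * Real.exp (-(α * |w.re|)) := by
  obtain ⟨C, α, hC, hα, hb⟩ := h.exp_bound hω
  refine ⟨C, α, hC, hα, fun w hw => ?_⟩
  have h1 := hb w hw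
  rw [norm_mul, ← Complex.ofReal_neg, norm_cpow_ofReal (Complex.exp_ne_zero w),
    Complex.norm_exp, ← Real.exp_mul] at h1
  have h2 := mul_le_mul_of_nonneg_left h1 (Real.exp_pos (θ * w.re)).le
  rw [← mul_assoc, ← Real.exp_add, show θ * w.re + w.re * -θ = 0 by ring, Real.exp_zero,
    one_mul] at h2
  linarith

theorem memHInftyZero_cpow_mul (hω : ω ≤ Real.pi) (hd : DifferentiableOn ℂ f (openSector ω))
    {θ a b C D : ℝ} (ha : θ < a) (hb : b < θ) (hC : 0 ≤ C) (hD : 0 ≤ D)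
    (h0 : ∀ z ∈ openSector ω, ‖z‖ ≤ 1 → ‖f z‖ ≤ C * ‖z‖ ^ a)
    (h1 : ∀ z ∈ openSector ω, 1 ≤ ‖z‖ → ‖f z‖ ≤ D * ‖z‖ ^ b) :
    MemHInftyZero ω (fun z => z ^ (-(θ : ℂ)) * f z) := by
  have key : ∀ z ∈ openSector ω, ∀ K s : ℝ, ‖f z‖ ≤ K * ‖z‖ ^ s →
      ‖z ^ (-(θ : ℂ)) * f z‖ ≤ K * ‖z‖ ^ (s - θ) := by
    intro z hz K s hs
    rw [norm_mul, ← Complex.ofReal_neg, norm_cpow_ofReal hz.1, sub_eq_add_neg,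
      Real.rpow_add (norm_pos_iff.2 hz.1)]
    have := mul_le_mul_of_nonneg_left hs (Real.rpow_nonneg (norm_nonneg z) (-θ))
    linarith
  refine memHInftyZero_of_bounds ?_ (sub_pos.2 ha) (sub_pos.2 hb) hC hD
    (fun z hz hz1 => key z hz _ _ (h0 z hz hz1)) (fun z hz hz1 => ?_)
  · refine DifferentiableOn.mul (fun z hz => ?_) hd
    exact (differentiableAt_id.cpow_const
      (openSector_subset_slitPlane hω hz)).differentiableWithinAt
  · have := key z hz _ _ (h1 z hz hz1)
    rwa [neg_sub]

end PowerWeights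

section Domination

variable {X : Type*} [NormedAddCommGroup X] [NormedSpace ℂ X]
  {A : X →ₗ.[ℂ] X} {ω : ℝ} {ψ γ e : ℂ → ℂ} {θ : ℝ} {p : ℝ≥0∞}

/-- The function `u ↦ e^{-θu} ψ(e^u A) x`, whose `L^p`-norm is the seminorm of `x`. -/
noncomputable def calcOrbit (A : X →ₗ.[ℂ] X) (ω θ : ℝ) (ψ : ℂ → ℂ) (x : X) (u : ℝ) : X :=
  (Real.exp (-(θ * u)) : ℂ) • elementaryCalc A ω (fun z => ψ ((Real.exp u : ℝ) * z)) x

theorem lintegral_kernel_ne_top {K β : ℝ} (hβ : 0 < β) :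
    ∫⁻ u : ℝ, ENNReal.ofReal (K * Real.exp (-(β * |u|))) ≠ ∞ :=
  ((integrable_exp_neg_mul_abs hβ).const_mul K).lintegral_lt_top.ne

/-- The convolution of a bounded integrable kernel with an `L^p`-function is bounded. -/
theorem lintegral_convolution_bounded {F : Type*} [NormedAddCommGroup F] (hp : 1 ≤ p)
    {g : ℝ → F} {k : ℝ → ℝ≥0∞} (hk : Measurable k) {B : ℝ≥0∞} (hB : B ≠ ∞) (hkB : ∀ u, k u ≤ B)
    (hki : ∫⁻ u, k u ≠ ∞) (hg : Measurable (fun v => ‖g v‖ₑ)) (hgp : eLpNorm g p volume ≠ ∞) :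
    ∃ M : ℝ≥0∞, M ≠ ∞ ∧ ∀ u, ∫⁻ v, k (u - v) * ‖g v‖ₑ ≤ M := by
  have hsub : ∀ u, ∫⁻ v, k (u - v) = ∫⁻ v, k v := fun u => lintegral_sub_left_eq_self k u
  by_cases hpt : p = ∞
  · subst hpt
    rw [eLpNorm_exponent_top] at hgp
    refine ⟨(∫⁻ v, k v) * eLpNormEssSup g volume, ENNReal.mul_ne_top hki hgp, fun u => ?_⟩
    rw [← hsub u, ← lintegral_mul_const _ (by fun_prop)]
    refine lintegral_mono_ae ?_
    filter_upwards [ae_le_eLpNormEssSup (f := g) (μ := volume)] with v hv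
    gcongr
  · have h0 : p ≠ 0 := (zero_lt_one.trans_le hp).ne'
    have hp1 : 1 ≤ p.toReal := by
      rw [← ENNReal.toReal_one]; exact ENNReal.toReal_mono hpt hp
    have hpos : 0 < p.toReal := by linarith
    rw [eLpNorm_eq_lintegral_rpow_enorm_toReal h0 hpt] at hgp
    set q := p.toReal
    have hgq : ∫⁻ v, ‖g v‖ₑ ^ q ≠ ∞ := fun h => hgp (by
      rw [h]; exact ENNReal.top_rpow_of_pos (by positivity))
    refine ⟨((∫⁻ v, k v) ^ (q - 1) * (B * ∫⁻ v, ‖g v‖ₑ ^ q)) ^ (1 / q), ?_, fun u => ?_⟩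
    · exact ENNReal.rpow_ne_top_of_nonneg (by positivity) (ENNReal.mul_ne_top
        (ENNReal.rpow_ne_top_of_nonneg (by linarith) hki) (ENNReal.mul_ne_top hB hgq))
    · rw [one_div, ENNReal.le_rpow_inv_iff hpos]
      refine (lintegral_mul_rpow_le (by fun_prop) hg.aemeasurable
        (fun v => ((hkB _).trans_lt hB.lt_top).ne) hp1).trans ?_
      rw [hsub, ← lintegral_const_mul _ (hg.pow_const q)]
      gcongr
      exact hkB _

namespace CalcAngle

variable [CompleteSpace X]

theorem continuous_calcOrbit (H : CalcAngle A ω) (hψ : MemElementary ω ψ) (θ : ℝ) (x : X) :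
    Continuous (calcOrbit A ω θ ψ x) := by
  have h1 := (H.continuous_calc_dilate hψ).clm_apply (continuous_const (y := x))
  unfold calcOrbit
  exact Continuous.smul (by fun_prop) h1

theorem measurable_enorm_calcOrbit (H : CalcAngle A ω) (hψ : MemElementary ω ψ) (θ : ℝ) (x : X) :
    Measurable (fun u => ‖calcOrbit A ω θ ψ x u‖ₑ) :=
  (H.continuous_calcOrbit hψ θ x).enorm.measurable

theorem calcSeminorm_eq_calcOrbit (H : CalcAngle A ω) (hp : 1 ≤ p) (μ : ℝ)
    (hψ : MemElementary ω ψ) (x : X) :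
    calcSeminorm A ω p μ ψ x = eLpNorm (calcOrbit A ω (thetaOf p μ) ψ x) p volume :=
  H.calcSeminorm_eq hp μ hψ x

/-- Each orbit of `γ`, regularized by a function `e` with `e γ ∈ H^∞_0`, is dominated by a
convolution of the orbit of `ψ` with a kernel that depends neither on the point nor on the
regularizer. -/
theorem exists_enorm_calc_calcOrbit_le (H : CalcAngle A ω) (hψ : MemElementary ω ψ)
    (hne : ∃ z ∈ openSector ω, ψ z ≠ 0) (hγ : MemElementary ω γ)
    (hγθ : MemHInftyZero ω (fun z => z ^ (-(θ : ℂ)) * γ z)) :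
    ∃ K β : ℝ, 0 < K ∧ 0 < β ∧ ∀ e : ℂ → ℂ, MemElementary ω e →
      (∀ u : ℝ, MemHInftyZero ω (fun z => e z * γ ((Real.exp u : ℝ) * z))) → ∀ (x : X) (u : ℝ),
      ‖elementaryCalc A ω e (calcOrbit A ω θ γ x u)‖ₑ ≤ ‖elementaryCalc A ω e‖ₑ *
        ∫⁻ v, ENNReal.ofReal (K * Real.exp (-(β * |u - v|))) * ‖calcOrbit A ω θ ψ x v‖ₑ := by
  obtain ⟨C, α, hC, hα, hb⟩ := hγθ.cpow_exp_bound H.lt_pi.le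
  obtain ⟨η, D, hη, hηb, hηψ⟩ := hψ.exists_reproducing H.pos H.lt_pi hne θ
  have hm : 0 < min α 1 := lt_min hα one_pos
  have hD : 0 ≤ D := by
    have := (norm_nonneg _).trans (hηb 0 (by simpa using H.pos))
    simpa using this
  obtain ⟨K, hK, hker⟩ := H.norm_calc_mul_dilate_le (θ := θ) (C := C) (D := D) hm hC.le hγ hη
    (fun w hw => (hb w hw).trans (by gcongr; exact min_le_left _ _))
    (fun w hw => (hηb w hw).trans (by gcongr; exact min_le_right _ _))
  refine ⟨K, min α 1 / 2, hK, half_pos hm, fun e he heγ x u => ?_⟩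
  obtain ⟨B, _, hψb⟩ := hψ.bounded H.lt_pi
  have hηψm : MemHInftyZero ω (fun z => η z * ψ z) :=
    hη.mul_bounded (hψ.differentiableOn H.lt_pi.le) hψb
  obtain ⟨hi, hint⟩ := H.integral_calc_mul_dilate (heγ u) hηψm (c := 1) hηψ
  have hγu := hγ.dilate H.lt_pi (Real.exp_pos u)
  -- multiplicativity moves the small factor `γ(e^u A) η(e^v A)` in front of `ψ(e^v A) x`
  have hfac : ∀ v : ℝ, elementaryCalc A ω (fun z => e z * γ ((Real.exp u : ℝ) * z) *
      (η ((Real.exp v : ℝ) * z) * ψ ((Real.exp v : ℝ) * z))) =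
      elementaryCalc A ω e * (elementaryCalc A ω
        (fun z => γ ((Real.exp u : ℝ) * z) * η ((Real.exp v : ℝ) * z)) *
        elementaryCalc A ω (fun z => ψ ((Real.exp v : ℝ) * z))) := by
    intro v
    have hηv := hη.memElementary.dilate H.lt_pi (Real.exp_pos v)
    have hψv := hψ.dilate H.lt_pi (Real.exp_pos v)
    have h1 := hγu.mul hηv H.lt_pi
    rw [← H.calc_mul h1 hψv, ← H.calc_mul he (h1.mul hψv H.lt_pi)]
    congr 1
    ext1 z
    ring
  rw [one_smul, H.calc_mul he hγu] at hint
  have hx : ∫ v, elementaryCalc A ω (fun z => e z * γ ((Real.exp u : ℝ) * z) *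
      (η ((Real.exp v : ℝ) * z) * ψ ((Real.exp v : ℝ) * z))) x =
      elementaryCalc A ω e (elementaryCalc A ω (fun z => γ ((Real.exp u : ℝ) * z)) x) := by
    rw [← ContinuousLinearMap.integral_apply hi, hint]
    rfl
  have hnorm : ∀ y : X, ∀ s : ℝ, ‖(Real.exp s : ℂ) • y‖ₑ = ENNReal.ofReal (Real.exp s) * ‖y‖ₑ := by
    intro y s
    rw [enorm_smul]
    congr 1
    rw [← ofReal_norm, Complex.norm_real, Real.norm_of_nonneg (Real.exp_pos _).le]
  rw [calcOrbit, map_smul, hnorm, ← hx]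
  calc _ ≤ ENNReal.ofReal (Real.exp (-(θ * u))) * ∫⁻ v, ‖elementaryCalc A ω
        (fun z => e z * γ ((Real.exp u : ℝ) * z) *
        (η ((Real.exp v : ℝ) * z) * ψ ((Real.exp v : ℝ) * z))) x‖ₑ := by
        gcongr
        exact enorm_integral_le_lintegral_enorm _
    _ = ∫⁻ v, ENNReal.ofReal (Real.exp (-(θ * u))) * ‖elementaryCalc A ω
        (fun z => e z * γ ((Real.exp u : ℝ) * z) *
        (η ((Real.exp v : ℝ) * z) * ψ ((Real.exp v : ℝ) * z))) x‖ₑ := by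
        rw [lintegral_const_mul']
        exact ENNReal.ofReal_ne_top
    _ ≤ ∫⁻ v, ‖elementaryCalc A ω e‖ₑ * (ENNReal.ofReal (K * Real.exp (-(min α 1 / 2 * |u - v|))) *
        ‖calcOrbit A ω θ ψ x v‖ₑ) := by
        refine lintegral_mono fun v => ?_
        simp only [hfac, mul_apply_eq_comp]
        have t1 := (elementaryCalc A ω e).le_opENorm (elementaryCalc A ω
          (fun z => γ ((Real.exp u : ℝ) * z) * η ((Real.exp v : ℝ) * z))
          (elementaryCalc A ω (fun z => ψ ((Real.exp v : ℝ) * z)) x))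
        have t2 := (elementaryCalc A ω (fun z => γ ((Real.exp u : ℝ) * z) *
          η ((Real.exp v : ℝ) * z))).le_opENorm
          (elementaryCalc A ω (fun z => ψ ((Real.exp v : ℝ) * z)) x)
        have t3 : ‖elementaryCalc A ω (fun z => γ ((Real.exp u : ℝ) * z) *
          η ((Real.exp v : ℝ) * z))‖ₑ ≤ ENNReal.ofReal (K * Real.exp (θ * (u - v)) *
            Real.exp (-(min α 1 / 2 * |u - v|))) := by
          rw [← ofReal_norm]
          exact ENNReal.ofReal_le_ofReal (hker u v)
        rw [calcOrbit, hnorm]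
        calc _ ≤ ENNReal.ofReal (Real.exp (-(θ * u))) * (‖elementaryCalc A ω e‖ₑ *
              (ENNReal.ofReal (K * Real.exp (θ * (u - v)) *
              Real.exp (-(min α 1 / 2 * |u - v|))) *
              ‖elementaryCalc A ω (fun z => ψ ((Real.exp v : ℝ) * z)) x‖ₑ)) := by
              gcongr
              exact t1.trans (by gcongr; exact t2.trans (by gcongr))
          _ = ‖elementaryCalc A ω e‖ₑ * ((ENNReal.ofReal (Real.exp (-(θ * u))) *
              ENNReal.ofReal (K * Real.exp (θ * (u - v)) *
              Real.exp (-(min α 1 / 2 * |u - v|)))) *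
              ‖elementaryCalc A ω (fun z => ψ ((Real.exp v : ℝ) * z)) x‖ₑ) := by ring
          _ = ‖elementaryCalc A ω e‖ₑ * ((ENNReal.ofReal (K *
              Real.exp (-(min α 1 / 2 * |u - v|))) * ENNReal.ofReal (Real.exp (-(θ * v)))) *
              ‖elementaryCalc A ω (fun z => ψ ((Real.exp v : ℝ) * z)) x‖ₑ) := by
              congr 2
              rw [← ENNReal.ofReal_mul (Real.exp_pos _).le, ← ENNReal.ofReal_mul (by positivity)]
              congr 1
              have : Real.exp (-(θ * v)) = Real.exp (-(θ * u)) * Real.exp (θ * (u - v)) := by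
                rw [← Real.exp_add]; ring_nf
              rw [this]
              ring
          _ = _ := by ring
    _ = _ := by
        rw [lintegral_const_mul]
        have := H.measurable_enorm_calcOrbit hψ θ x
        fun_prop

end CalcAngle

end Domination

/-! ### Regularization and the comparison of square functions -/

section Comparison

theorem tendsto_apply_of_mem_closure {X ι : Type*} [NormedAddCommGroup X] [NormedSpace ℂ X]
    {l : Filter ι} {T : ι → X →L[ℂ] X} {S : X →L[ℂ] X} {M : ℝ} (hM : ∀ i, ‖T i‖ ≤ M) {D : Set X}
    (hD : ∀ x ∈ D, Tendsto (fun i => T i x) l (𝓝 (S x))) {x : X} (hx : x ∈ closure D) :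
    Tendsto (fun i => T i x) l (𝓝 (S x)) := by
  rw [Metric.tendsto_nhds]
  intro ε hε
  have hK : 0 < |M| + ‖S‖ + 1 := by positivity
  obtain ⟨y, hy, hxy⟩ := Metric.mem_closure_iff.1 hx (ε / (2 * (|M| + ‖S‖ + 1))) (by positivity)
  filter_upwards [(Metric.tendsto_nhds.1 (hD y hy)) (ε / 2) (half_pos hε)] with i hi
  rw [dist_eq_norm] at hi hxy ⊢
  have e : T i x - S x = T i (x - y) + (T i y - S y) + S (y - x) := by
    simp only [map_sub]; abel
  rw [e]
  have h1 : ‖T i (x - y)‖ ≤ |M| * ‖x - y‖ :=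
    (T i).le_of_opNorm_le ((hM i).trans (le_abs_self M)) _
  have h2 : ‖S (y - x)‖ ≤ ‖S‖ * ‖x - y‖ := by
    rw [norm_sub_rev x y]; exact S.le_opNorm _
  have h3 : ‖x - y‖ * (|M| + ‖S‖ + 1) < ε / 2 := by
    rw [lt_div_iff₀ (by positivity)] at hxy
    linarith
  have := norm_add₃_le (a := T i (x - y)) (b := T i y - S y) (c := S (y - x))
  have h4 := norm_nonneg (x - y)
  nlinarith

variable {X : Type*} [NormedAddCommGroup X] [NormedSpace ℂ X]
  {A : X →ₗ.[ℂ] X} {ω : ℝ} {f ψ γ : ℂ → ℂ} {θ : ℝ} {p : ℝ≥0∞}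

theorem exists_norm_dilate_inv_le (hω : ω < Real.pi) :
    ∃ c : ℝ, 0 < c ∧ ∀ t : ℝ, 0 < t → ∀ z ∈ openSector ω,
      ‖(1 + (t : ℂ) * z)⁻¹‖ ≤ c / (1 + t * ‖z‖) := by
  obtain ⟨c, hc, h⟩ := exists_norm_one_add_inv_le hω
  refine ⟨c, hc, fun t ht z hz => ?_⟩
  have := h _ (mul_mem_openSector ht hz)
  rwa [norm_mul, Complex.norm_real, Real.norm_of_nonneg ht.le] at this

/-- If `γ` vanishes at the origin, the factor `(1 + tz)⁻¹` regularizes it. -/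
theorem MemElementary.dilate_inv_mul_memHInftyZero (hf : MemElementary ω f) (hω : ω < Real.pi)
    {t C a : ℝ} (ht : 0 < t) (ha : 0 < a) (hC : 0 ≤ C)
    (h0 : ∀ z ∈ openSector ω, ‖f z‖ ≤ C * ‖z‖ ^ a) :
    MemHInftyZero ω (fun z => (1 + t * z)⁻¹ * f z) := by
  obtain ⟨c, hc, hρ⟩ := exists_norm_dilate_inv_le hω
  obtain ⟨B, hB, hfB⟩ := hf.bounded hω
  refine memHInftyZero_of_bounds (C := c * C) (D := c / t * B) (α := a) (β := 1)
    (((memElementary_dilate_inv hω ht).mul hf hω).differentiableOn hω.le) ha one_pos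
    (by positivity) (by positivity) (fun z hz _ => ?_) (fun z hz h1 => ?_)
  · rw [norm_mul, mul_assoc]
    have h2 : ‖(1 + (t : ℂ) * z)⁻¹‖ ≤ c :=
      (hρ t ht z hz).trans (div_le_self hc.le (by nlinarith [norm_nonneg z]))
    exact mul_le_mul h2 (h0 z hz) (norm_nonneg _) hc.le
  · have hz0 : 0 < ‖z‖ := by linarith
    rw [norm_mul, Real.rpow_neg_one]
    have h2 : ‖(1 + (t : ℂ) * z)⁻¹‖ ≤ c / t * ‖z‖⁻¹ := by
      refine (hρ t ht z hz).trans ?_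
      rw [div_mul_eq_mul_div, ← div_eq_mul_inv, div_div]
      gcongr
      linarith
    refine (mul_le_mul h2 (hfB z hz) (norm_nonneg _) (by positivity)).trans_eq ?_
    ring

/-- If `γ` vanishes at infinity, the factor `1 - (1 + tz)⁻¹` regularizes it. -/
theorem MemElementary.one_sub_dilate_inv_mul_memHInftyZero (hf : MemElementary ω f)
    (hω : ω < Real.pi) {t C a : ℝ} (ht : 0 < t) (ha : a < 0) (hC : 0 ≤ C)
    (h0 : ∀ z ∈ openSector ω, ‖f z‖ ≤ C * ‖z‖ ^ a) :
    MemHInftyZero ω (fun z => (1 - (1 + t * z)⁻¹) * f z) := by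
  obtain ⟨c, hc, hρ⟩ := exists_norm_dilate_inv_le hω
  obtain ⟨B, hB, hfB⟩ := hf.bounded hω
  have hρ' : ∀ z ∈ openSector ω, ‖(1 + (t : ℂ) * z)⁻¹‖ ≤ c := fun z hz =>
    (hρ t ht z hz).trans (div_le_self hc.le (by nlinarith [norm_nonneg z]))
  have he := (memElementary_const (ω := ω) 1).sub (memElementary_dilate_inv hω ht)
  refine memHInftyZero_of_bounds (C := t * c * B) (D := (1 + c) * C) (α := 1) (β := -a)
    ((he.mul hf hω).differentiableOn hω.le) one_pos (by linarith)
    (by positivity) (by positivity) (fun z hz _ => ?_) (fun z hz h1 => ?_)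
  · have hne : 1 + (t : ℂ) * z ≠ 0 := one_add_ne_zero_of_mem hω.le (mul_mem_openSector ht hz)
    have e : 1 - (1 + (t : ℂ) * z)⁻¹ = t * z * (1 + (t : ℂ) * z)⁻¹ := by
      field_simp
      ring
    rw [e, norm_mul, norm_mul, norm_mul, Complex.norm_real, Real.norm_of_nonneg ht.le,
      Real.rpow_one]
    have h2 := hρ' z hz
    have h3 := hfB z hz
    calc _ ≤ t * ‖z‖ * c * B := by gcongr
      _ = _ := by ring
  · rw [norm_mul, neg_neg, mul_assoc]
    have h2 : ‖1 - (1 + (t : ℂ) * z)⁻¹‖ ≤ 1 + c := by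
      refine (norm_sub_le _ _).trans ?_
      rw [norm_one]
      have := hρ' z hz
      linarith
    exact mul_le_mul h2 (h0 z hz) (norm_nonneg _) (by positivity)

/-- A function `γ` with `z^{-θ} γ ∈ H^∞_0` is `O(|z|^θ)`, and so are its dilates. -/
theorem MemHInftyZero.exists_norm_dilate_le
    (h : MemHInftyZero ω (fun z => z ^ (-(θ : ℂ)) * γ z)) (s : ℝ) (hs : 0 < s) :
    ∃ C : ℝ, 0 ≤ C ∧ ∀ z ∈ openSector ω, ‖γ (s * z)‖ ≤ C * ‖z‖ ^ θ := by
  obtain ⟨B, hB, hb⟩ := h.bounded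
  refine ⟨B * s ^ θ, by positivity, fun z hz => ?_⟩
  have hz' := mul_mem_openSector hs hz
  have h1 := hb _ hz'
  rw [norm_mul, ← Complex.ofReal_neg, norm_cpow_ofReal hz'.1] at h1
  have hn : ‖(s : ℂ) * z‖ = s * ‖z‖ := by
    rw [norm_mul, Complex.norm_real, Real.norm_of_nonneg hs.le]
  have hp : 0 < ‖(s : ℂ) * z‖ := norm_pos_iff.2 hz'.1
  rw [Real.rpow_neg hp.le, inv_mul_le_iff₀ (Real.rpow_pos_of_pos hp θ)] at h1
  rw [hn, Real.mul_rpow hs.le (norm_nonneg z)] at h1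
  linarith

theorem psiTwo_eq {z : ℂ} (hz : 1 + z ≠ 0) : psiTwo z = 1 - (1 + z)⁻¹ := by
  rw [psiTwo]
  field_simp
  ring

namespace CalcAngle

theorem dilate_unitResolvent_mem (H : CalcAngle A ω) (v : ℝ) (x : X) :
    unitResolvent ((Real.exp v : ℂ) • A) x ∈ A.domain :=
  (H.smul (Real.exp_pos v)).unitResolvent_mem x

/-- `t A (1 + tA)⁻¹ x = x - (1 + tA)⁻¹ x` on the domain. -/
theorem dilate_unitResolvent_sub (H : CalcAngle A ω) (v : ℝ) (x : A.domain) :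
    (Real.exp v : ℂ) • unitResolvent ((Real.exp v : ℂ) • A) (A x) =
      (x : X) - unitResolvent ((Real.exp v : ℂ) • A) x := by
  have h := (H.smul (Real.exp_pos v)).unitResolvent_apply x
  have e : ((Real.exp v : ℂ) • A) x = (Real.exp v : ℂ) • A x := rfl
  rw [e, map_add, map_smul] at h
  rw [eq_sub_iff_add_eq, add_comm]
  exact h

theorem tendsto_unitResolvent_atBot (H : CalcAngle A ω) {x : X}
    (hx : x ∈ closure (A.domain : Set X)) :
    Tendsto (fun v : ℝ => unitResolvent ((Real.exp v : ℂ) • A) x) atBot (𝓝 x) := by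
  obtain ⟨M, hM, hb⟩ := H.norm_unitResolvent_le
  refine tendsto_apply_of_mem_closure (S := ContinuousLinearMap.id ℂ X) hb (fun y hy => ?_) hx
  have e : ∀ v : ℝ, unitResolvent ((Real.exp v : ℂ) • A) y =
      y - (Real.exp v : ℂ) • unitResolvent ((Real.exp v : ℂ) • A) (A ⟨y, hy⟩) := fun v => by
    rw [H.dilate_unitResolvent_sub v ⟨y, hy⟩]; simp
  simp only [e]
  have h0 : Tendsto (fun v : ℝ => (Real.exp v : ℂ) •
      unitResolvent ((Real.exp v : ℂ) • A) (A ⟨y, hy⟩)) atBot (𝓝 0) := by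
    refine squeeze_zero_norm (a := fun v => Real.exp v * (M * ‖A ⟨y, hy⟩‖)) (fun v => ?_) ?_
    · rw [norm_smul, Complex.norm_real, Real.norm_of_nonneg (Real.exp_pos v).le]
      gcongr
      exact (unitResolvent ((Real.exp v : ℂ) • A)).le_of_opNorm_le (hb v) _
    · simpa using Real.tendsto_exp_atBot.mul_const (M * ‖A ⟨y, hy⟩‖)
  simpa using h0.const_sub y

theorem tendsto_unitResolvent_atTop_of_mem_range (H : CalcAngle A ω) {x : X}
    (hx : x ∈ opRange A) :
    Tendsto (fun v : ℝ => unitResolvent ((Real.exp v : ℂ) • A) x) atTop (𝓝 0) := by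
  obtain ⟨M, hM, hb⟩ := H.norm_unitResolvent_le
  obtain ⟨y, rfl⟩ := hx
  have e : ∀ v : ℝ, unitResolvent ((Real.exp v : ℂ) • A) (A y) =
      (Real.exp (-v) : ℂ) • ((y : X) - unitResolvent ((Real.exp v : ℂ) • A) y) := fun v => by
    rw [← H.dilate_unitResolvent_sub v y, smul_smul, ← Complex.ofReal_mul, ← Real.exp_add]
    simp
  simp only [e]
  refine squeeze_zero_norm (a := fun v => Real.exp (-v) * (‖(y : X)‖ + M * ‖(y : X)‖))
    (fun v => ?_) ?_
  · rw [norm_smul, Complex.norm_real, Real.norm_of_nonneg (Real.exp_pos _).le]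
    gcongr
    refine (norm_sub_le _ _).trans ?_
    gcongr
    exact (unitResolvent ((Real.exp v : ℂ) • A)).le_of_opNorm_le (hb v) _
  · simpa using (Real.tendsto_exp_neg_atTop_nhds_zero).mul_const (‖(y : X)‖ + M * ‖(y : X)‖)

variable [CompleteSpace X]

theorem tendsto_unitResolvent_mul_atTop (H : CalcAngle A ω) (hf : MemHInftyZero ω f) (x : X) :
    Tendsto (fun v : ℝ => unitResolvent ((Real.exp v : ℂ) • A) (elementaryCalc A ω f x)) atTop
      (𝓝 0) := by
  obtain ⟨c, hc, hρ⟩ := exists_norm_dilate_inv_le H.lt_pi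
  obtain ⟨C, α, hC, hα, hb⟩ := hf.exp_bound H.lt_pi.le
  have hm := fun v : ℝ => (memElementary_dilate_inv H.lt_pi (Real.exp_pos v)).mul_memHInftyZero hf
    H.lt_pi
  have hlim := H.tendsto_hCalc (l := atTop)
    (F := fun (v : ℝ) z => (1 + (Real.exp v : ℝ) * z)⁻¹ * f z) (f := fun _ => 0)
    (k := fun u => (c * C) * Real.exp (-(α * |u|))) ((integrable_exp_neg_mul_abs hα).const_mul _)
    (Eventually.of_forall fun v => (hm v).1)
    (Eventually.of_forall fun v w hw => by
      rw [norm_mul, mul_assoc]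
      exact mul_le_mul ((hρ _ (Real.exp_pos v) _ (exp_mem_openSector H.lt_pi.le hw)).trans
        (div_le_self hc.le (le_add_of_nonneg_right (by positivity)))) (hb w hw) (norm_nonneg _)
        hc.le)
    (fun z hz => by
      rw [← zero_mul (f z)]
      refine Tendsto.mul_const _ (squeeze_zero_norm (fun v => hρ _ (Real.exp_pos v) z hz) ?_)
      refine Tendsto.const_div_atTop ?_ c
      exact tendsto_atTop_add_const_left _ _
        (Real.tendsto_exp_atTop.atTop_mul_const (norm_pos_iff.2 hz.1)))
  have h0 : hCalc A (midAngle A ω) (fun _ => 0) = 0 := by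
    rw [H.hCalc_congr' (g := fun z => (0 : ℂ) * 0) (fun z _ => by ring), hCalc_const_mul, zero_smul]
  rw [h0] at hlim
  have h2 := ((ContinuousLinearMap.apply ℂ X x).continuous.tendsto _).comp hlim
  simp only [map_zero] at h2
  refine h2.congr fun v => ?_
  simp only [Function.comp_apply, ContinuousLinearMap.apply_apply]
  rw [← H.calc_of_memHInftyZero (hm v), H.calc_mul (memElementary_dilate_inv H.lt_pi
    (Real.exp_pos v)) hf.memElementary, H.calc_dilate_inv (Real.exp_pos v)]
  rfl

/-- The square function of `γ` is dominated by that of `ψ` at each point at which the functions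
`γ(uA) x` can be approximated by regularized ones. -/
theorem exists_calcSeminorm_le_of_regularizer (H : CalcAngle A ω) (hp : 1 ≤ p) (μ : ℝ)
    (hψ : MemElementary ω ψ) (hne : ∃ z ∈ openSector ω, ψ z ≠ 0) (hγ : MemElementary ω γ)
    (hγθ : MemHInftyZero ω (fun z => z ^ (-(thetaOf p μ : ℂ)) * γ z)) (M : ℝ) :
    ∃ C : NNReal, 0 < C ∧ ∀ x : X, (∃ e : ℕ → ℂ → ℂ, (∀ n, MemElementary ω (e n)) ∧
      (∀ n (u : ℝ), MemHInftyZero ω (fun z => e n z * γ ((Real.exp u : ℝ) * z))) ∧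
      (∀ n, ‖elementaryCalc A ω (e n)‖ ≤ M) ∧
      ∀ u : ℝ, Tendsto (fun n => elementaryCalc A ω (e n)
        (elementaryCalc A ω (fun z => γ ((Real.exp u : ℝ) * z)) x)) atTop
        (𝓝 (elementaryCalc A ω (fun z => γ ((Real.exp u : ℝ) * z)) x))) →
      calcSeminorm A ω p μ γ x ≤ C * calcSeminorm A ω p μ ψ x := by
  obtain ⟨K, β, hK, hβ, hker⟩ := H.exists_enorm_calc_calcOrbit_le hψ hne hγ hγθ
  set k : ℝ → ℝ≥0∞ := fun u => ENNReal.ofReal M * ENNReal.ofReal (K * Real.exp (-(β * |u|)))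
  have hki : ∫⁻ u, k u ≠ ∞ := by
    rw [lintegral_const_mul _ (by fun_prop)]
    exact ENNReal.mul_ne_top ENNReal.ofReal_ne_top (lintegral_kernel_ne_top hβ)
  refine ⟨(∫⁻ u, k u).toNNReal + 1, by positivity, fun x ⟨e, he, heγ, heM, hlim⟩ => ?_⟩
  rw [H.calcSeminorm_eq_calcOrbit hp μ hγ, H.calcSeminorm_eq_calcOrbit hp μ hψ]
  have hkm : Measurable k := by fun_prop
  refine (eLpNorm_le_of_le_convolution hp hkm
    (fun u => ENNReal.mul_ne_top ENNReal.ofReal_ne_top ENNReal.ofReal_ne_top)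
    (H.measurable_enorm_calcOrbit hψ (thetaOf p μ) x) (fun u => ?_)).trans ?_
  · have hl : Tendsto (fun n => elementaryCalc A ω (e n) (calcOrbit A ω (thetaOf p μ) γ x u)) atTop
        (𝓝 (calcOrbit A ω (thetaOf p μ) γ x u)) := by
      simp only [calcOrbit, map_smul]
      exact (hlim u).const_smul _
    refine le_of_tendsto hl.enorm (Eventually.of_forall fun n => ?_)
    refine (hker (e n) (he n) (heγ n) x u).trans ?_
    simp only [k, mul_assoc]
    rw [lintegral_const_mul' _ _ ENNReal.ofReal_ne_top]
    gcongr
    rw [← ofReal_norm]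
    exact ENNReal.ofReal_le_ofReal (heM n)
  · gcongr
    push_cast
    rw [ENNReal.coe_toNNReal hki]
    exact le_self_add

end CalcAngle

end Comparison

/-! ### The equivalence of square functions -/

section Equivalence

variable {X : Type*} [NormedAddCommGroup X] [NormedSpace ℂ X]
  {A : X →ₗ.[ℂ] X} {ω : ℝ} {f ψ γ : ℂ → ℂ} {θ : ℝ} {p : ℝ≥0∞}

theorem MemElementary.pow (hf : MemElementary ω f) (hω : ω < Real.pi) (n : ℕ) :
    MemElementary ω (fun z => f z ^ n) := by
  induction n with
  | zero => simpa using memElementary_const (ω := ω) 1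
  | succ k ih => exact (ih.mul hf hω).congr fun z _ => pow_succ _ _

theorem memElementary_one_sub_inv : MemElementary ω (fun z => 1 - (1 + z)⁻¹) :=
  (memElementary_const 1).sub memElementary_one_add_inv

/-- The function `(z (1+z)⁻¹)^n` is `O(|z|^n)` at the origin and bounded. -/
theorem memHInftyZero_cpow_mul_one_sub_inv_pow (hω : ω < Real.pi) {n : ℕ} (hθ : 0 < θ)
    (hn : θ < n) : MemHInftyZero ω (fun z => z ^ (-(θ : ℂ)) * (1 - (1 + z)⁻¹) ^ n) := by
  obtain ⟨c, hc, hρ⟩ := exists_norm_one_add_inv_le hω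
  have hρ' : ∀ z ∈ openSector ω, ‖(1 + z)⁻¹‖ ≤ c := fun z hz =>
    (hρ z hz).trans (div_le_self hc.le (le_add_of_nonneg_right (norm_nonneg z)))
  refine memHInftyZero_cpow_mul hω.le
    ((memElementary_one_sub_inv.pow hω n).differentiableOn hω.le) hn hθ (C := c ^ n)
    (D := (1 + c) ^ n) (by positivity) (by positivity) (fun z hz _ => ?_) (fun z hz _ => ?_)
  · have hne := one_add_ne_zero_of_mem hω.le hz
    have e : 1 - (1 + z)⁻¹ = z * (1 + z)⁻¹ := by
      field_simp
      ring
    rw [e, norm_pow, norm_mul, Real.rpow_natCast, ← mul_pow, mul_comm]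
    gcongr
    exact hρ' z hz
  · rw [Real.rpow_zero, mul_one, norm_pow]
    gcongr
    refine (norm_sub_le _ _).trans ?_
    rw [norm_one]
    have := hρ' z hz
    linarith

namespace CalcAngle

theorem sub_one_sub_pow_mem (H : CalcAngle A ω) (v : ℝ) (n : ℕ) (x : X) :
    x - ((1 - unitResolvent ((Real.exp v : ℂ) • A)) ^ n) x ∈ A.domain := by
  induction n with
  | zero => simp
  | succ k ih =>
    have h1 := A.domain.add_mem ih (H.dilate_unitResolvent_mem v
      (((1 - unitResolvent ((Real.exp v : ℂ) • A)) ^ k) x))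
    have e : x - ((1 - unitResolvent ((Real.exp v : ℂ) • A)) ^ (k + 1)) x =
        x - ((1 - unitResolvent ((Real.exp v : ℂ) • A)) ^ k) x +
          unitResolvent ((Real.exp v : ℂ) • A)
            (((1 - unitResolvent ((Real.exp v : ℂ) • A)) ^ k) x) := by
      rw [pow_succ', mul_apply_eq_comp, sub_apply]
      simp only [one_apply_eq_self]
      abel
    rw [e]
    exact h1

variable [CompleteSpace X]

theorem calc_one_sub_inv_pow (H : CalcAngle A ω) (u : ℝ) (n : ℕ) :
    elementaryCalc A ω (fun z => (1 - (1 + (Real.exp u : ℝ) * z)⁻¹) ^ n) =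
      (1 - unitResolvent ((Real.exp u : ℂ) • A)) ^ n := by
  have hρ := memElementary_dilate_inv H.lt_pi (Real.exp_pos u)
  have h1 := (memElementary_const (ω := ω) 1).sub hρ
  induction n with
  | zero => simpa using H.calc_const 1
  | succ k ih =>
    simp only [pow_succ]
    rw [H.calc_mul (h1.pow H.lt_pi k) h1, ih, H.calc_sub (memElementary_const 1) hρ,
      H.calc_const, one_smul, H.calc_dilate_inv (Real.exp_pos u)]

/-- If `θ > 0`, the points with a finite square function lie in the closure of the domain: the
almost orthogonality estimate makes `J_v (x - d)` small, uniformly in `v`, for a suitable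
`d ∈ D(A)`, where `J_v = (1 + e^v A)⁻¹`. Hence `J_v x` converges as `v → -∞`, and the injective
operator `(1 + A)⁻¹` identifies the limit as `x`. -/
theorem mem_closure_domain (H : CalcAngle A ω) (hp : 1 ≤ p) {μ : ℝ} (hψ : MemElementary ω ψ)
    (hne : ∃ z ∈ openSector ω, ψ z ≠ 0) (hθ : 0 < thetaOf p μ) {x : X}
    (hx : calcSeminorm A ω p μ ψ x ≠ ∞) : x ∈ closure (A.domain : Set X) := by
  set θ := thetaOf p μ with hθd
  obtain ⟨N, hN⟩ := exists_nat_gt θ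
  obtain ⟨M, hM, hJ⟩ := H.norm_unitResolvent_le
  have hγ : MemElementary ω (fun z => (1 - (1 + z)⁻¹) ^ N) :=
    memElementary_one_sub_inv.pow H.lt_pi N
  have hγθ := memHInftyZero_cpow_mul_one_sub_inv_pow H.lt_pi hθ hN
  obtain ⟨K, β, hK, hβ, hker⟩ := H.exists_enorm_calc_calcOrbit_le hψ hne hγ hγθ
  rw [H.calcSeminorm_eq_calcOrbit hp μ hψ] at hx
  obtain ⟨B, hB, hBk⟩ := lintegral_convolution_bounded hp
    (k := fun u => ENNReal.ofReal (K * Real.exp (-(β * |u|)))) (by fun_prop)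
    (B := ENNReal.ofReal K) ENNReal.ofReal_ne_top
    (fun u => ENNReal.ofReal_le_ofReal (mul_le_of_le_one_right hK.le (by
      rw [Real.exp_le_one_iff]; have := abs_nonneg u; nlinarith)))
    (lintegral_kernel_ne_top hβ) (H.measurable_enorm_calcOrbit hψ θ x) hx
  -- the regularizer `J_v` enters the estimate only through its norm, and the weight
  -- `e^{-θu}` of the orbit is turned into a decay as `u → -∞`
  have hbound : ∀ u v : ℝ, ‖unitResolvent ((Real.exp v : ℂ) • A)
      (((1 - unitResolvent ((Real.exp u : ℂ) • A)) ^ N) x)‖ ≤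
        Real.exp (θ * u) * (M * B.toReal) := by
    intro u v
    have h1 := hker (fun z => (1 + (Real.exp v : ℝ) * z)⁻¹)
      (memElementary_dilate_inv H.lt_pi (Real.exp_pos v)) (fun s => by
        obtain ⟨C, hC, hb⟩ := hγθ.exists_norm_dilate_le (γ := fun z => (1 - (1 + z)⁻¹) ^ N)
          _ (Real.exp_pos s)
        exact (hγ.dilate H.lt_pi (Real.exp_pos s)).dilate_inv_mul_memHInftyZero H.lt_pi
          (Real.exp_pos v) hθ hC hb) x u
    rw [H.calc_dilate_inv (Real.exp_pos v)] at h1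
    have h2 : ‖unitResolvent ((Real.exp v : ℂ) • A)
        (calcOrbit A ω θ (fun z => (1 - (1 + z)⁻¹) ^ N) x u)‖ₑ ≤
        ENNReal.ofReal M * B := by
      refine h1.trans (mul_le_mul' ?_ (hBk u))
      rw [← ofReal_norm]
      exact ENNReal.ofReal_le_ofReal (hJ v)
    have h3 := ENNReal.toReal_mono (ENNReal.mul_ne_top ENNReal.ofReal_ne_top hB) h2
    rw [toReal_enorm, ENNReal.toReal_mul, ENNReal.toReal_ofReal hM.le, calcOrbit, map_smul,
      H.calc_one_sub_inv_pow, norm_smul, Complex.norm_real, Real.norm_of_nonneg (Real.exp_pos _).le,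
      Real.exp_neg, inv_mul_le_iff₀ (Real.exp_pos _)] at h3
    exact h3
  have happrox : ∀ ε : ℝ, 0 < ε → ∃ d ∈ A.domain, ∀ v : ℝ,
      ‖unitResolvent ((Real.exp v : ℂ) • A) (x - d)‖ < ε := by
    intro ε hε
    have hl : Tendsto (fun u : ℝ => Real.exp (θ * u) * (M * B.toReal)) atBot (𝓝 0) := by
      have := (Real.tendsto_exp_atBot.comp (tendsto_id.const_mul_atBot hθ)).mul_const
        (M * B.toReal)
      simpa using this
    obtain ⟨u, hu⟩ := (hl.eventually (gt_mem_nhds hε)).exists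
    refine ⟨_, H.sub_one_sub_pow_mem u N x, fun v => ?_⟩
    rw [sub_sub_cancel]
    exact (hbound u v).trans_lt hu
  set a : ℕ → X := fun n => unitResolvent ((Real.exp (-(n : ℝ)) : ℂ) • A) x
  have htop : Tendsto (fun n : ℕ => -(n : ℝ)) atTop atBot :=
    tendsto_neg_atTop_atBot.comp tendsto_natCast_atTop_atTop
  -- `J_v d → d` on the domain, and `J_v (x - d)` is small uniformly in `v`
  have hcau : CauchySeq a := by
    rw [Metric.cauchySeq_iff']
    intro ε hε
    obtain ⟨d, hd, hdv⟩ := happrox (ε / 4) (by positivity)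
    have hl := (H.tendsto_unitResolvent_atBot (subset_closure hd)).comp htop
    obtain ⟨n₀, hn₀⟩ := (Metric.tendsto_atTop.1 hl) (ε / 4) (by positivity)
    refine ⟨n₀, fun n hn => ?_⟩
    have e1 := hn₀ n hn
    have e2 := hn₀ n₀ le_rfl
    have e3 := hdv (-(n : ℝ))
    have e4 := hdv (-(n₀ : ℝ))
    simp only [Function.comp_apply] at e1 e2
    rw [map_sub, ← dist_eq_norm] at e3 e4
    rw [dist_comm] at e4
    calc dist (a n) (a n₀) ≤ _ := dist_triangle4 _ _ _ _
      _ < ε / 4 + (ε / 4 + ε / 4) + ε / 4 :=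
        add_lt_add (add_lt_add_of_lt_of_le e3 ((dist_triangle_right _ _ d).trans
          (add_le_add e1.le e2.le))) e4
      _ = ε := by ring
  obtain ⟨y, hy⟩ := cauchySeq_tendsto_of_complete hcau
  have hyc : y ∈ closure (A.domain : Set X) :=
    mem_closure_of_tendsto hy (Eventually.of_forall fun n => H.dilate_unitResolvent_mem _ x)
  have h1 := ((unitResolvent A).continuous.tendsto y).comp hy
  have h2 := (H.tendsto_unitResolvent_atBot (subset_closure (H.unitResolvent_mem x))).comp htop
  have h3 : unitResolvent A y = unitResolvent A x := by
    refine tendsto_nhds_unique h1 (h2.congr fun n => ?_)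
    have := H.calc_comm (memElementary_dilate_inv H.lt_pi (Real.exp_pos (-(n : ℝ))))
      memElementary_one_add_inv
    rw [H.calc_dilate_inv (Real.exp_pos _), H.calc_one_add_inv] at this
    exact congrArg (fun T : X →L[ℂ] X => T x) this
  have h4 : y = x := sub_eq_zero.1 (H.unitResolvent_injective (by rw [map_sub, h3, sub_self]))
  rwa [← h4]

/-- For `θ < 0` the complementary regularizers `1 - J_v` converge to the identity on the range of
`γ(e^u A)` as `v → ∞`. Since `γ = g + c (1 + z)⁻¹` with `c ≠ 0`, the range condition on `γ(A)` is
a condition on the domain: it forces `J_v y → 0` for `y ∈ D(A)`. -/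
theorem tendsto_unitResolvent_calc_atTop (H : CalcAngle A ω) (hγ : MemElementary ω γ)
    (hγ0 : ¬ MemHInftyZero ω γ) (hθ : θ < 0)
    (hγθ : MemHInftyZero ω (fun z => z ^ (-(θ : ℂ)) * γ z))
    (hR : ∀ x ∈ closure (A.domain : Set X), elementaryCalc A ω γ x ∈ opRange A) (u : ℝ) (x : X) :
    Tendsto (fun v : ℝ => unitResolvent ((Real.exp v : ℂ) • A)
      (elementaryCalc A ω (fun z => γ ((Real.exp u : ℝ) * z)) x)) atTop (𝓝 0) := by
  obtain ⟨c, d, hg⟩ := id hγ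
  -- the value at infinity vanishes by the decay of `γ`
  have hd : d = 0 := by
    obtain ⟨C, hC, hb⟩ := hγθ.exists_norm_dilate_le 1 one_pos
    have h1 := hg.tendsto_atTop H.pos
    have h2 : Tendsto (fun r : ℝ => γ (r : ℂ)) atTop (𝓝 0) := by
      refine squeeze_zero_norm' (a := fun r => C * r ^ θ) ?_ ?_
      · filter_upwards [eventually_gt_atTop 0] with r hr
        have := hb r (ofReal_mem_openSector H.pos hr)
        rwa [Complex.ofReal_one, one_mul, Complex.norm_real, Real.norm_of_nonneg hr.le] at this
      · have := (tendsto_rpow_neg_atTop (neg_pos.2 hθ)).const_mul C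
        simpa using this
    have h3 : Tendsto (fun r : ℝ => (1 + (r : ℂ))⁻¹) atTop (𝓝 0) := by
      refine tendsto_inv₀_cobounded.comp ?_
      rw [← tendsto_norm_atTop_iff_cobounded]
      refine tendsto_atTop_mono' _ ?_ tendsto_id
      filter_upwards [eventually_gt_atTop 0] with r hr
      rw [← Complex.ofReal_one, ← Complex.ofReal_add, Complex.norm_real,
        Real.norm_of_nonneg (by positivity)]
      simp
    have h4 := (h2.sub (h3.const_mul c)).sub_const d
    have := tendsto_nhds_unique h1 h4
    simpa using this
  subst hd
  have hc : c ≠ 0 := by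
    rintro rfl
    exact hγ0 (hg.congr fun z _ => by ring)
  have hE := H.calc_dilate_eq hg (Real.exp_pos u)
  have hgu := hg.dilate (Real.exp_pos u)
  rw [← H.calc_of_memHInftyZero hgu, zero_smul, add_zero] at hE
  rw [hE]
  simp only [add_apply, map_add, smul_apply, map_smul]
  -- `J_v` tends to zero on `(1 + A)⁻¹ D(A)`, as `γ(A)` maps the domain into the range
  have hJ1 : ∀ y ∈ A.domain, Tendsto (fun v : ℝ => unitResolvent ((Real.exp v : ℂ) • A)
      (unitResolvent A y)) atTop (𝓝 0) := by
    intro y hy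
    have h1 := H.tendsto_unitResolvent_atTop_of_mem_range (hR y (subset_closure hy))
    have h2 := H.tendsto_unitResolvent_mul_atTop hg y
    have e : elementaryCalc A ω γ = elementaryCalc A ω (fun z => γ z - c * (1 + z)⁻¹ - 0) +
        c • unitResolvent A := by
      rw [H.elementaryCalc_eq hg, H.calc_of_memHInftyZero hg, zero_smul, add_zero]
    have h3 := (h1.sub h2).const_smul c⁻¹
    simp only [e, add_apply, map_add, smul_apply, map_smul, sub_zero, smul_zero,
      add_sub_cancel_left, smul_smul, inv_mul_cancel₀ hc, one_smul] at h3
    simpa using h3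
  have hJ2 : ∀ y ∈ A.domain, Tendsto (fun v : ℝ => unitResolvent ((Real.exp v : ℂ) • A) y)
      atTop (𝓝 0) := by
    intro y hy
    have h1 := hJ1 y hy
    have h2 := H.tendsto_unitResolvent_atTop_of_mem_range
      (x := y - unitResolvent A y) ⟨_, H.apply_unitResolvent y⟩
    have h3 := h1.add h2
    rw [add_zero] at h3
    refine h3.congr fun v => ?_
    rw [map_sub]
    abel
  have h1 := hJ2 _ (H.dilate_unitResolvent_mem u x)
  have h2 := H.tendsto_unitResolvent_mul_atTop hgu x
  simpa using h2.add (h1.const_smul c)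

/-- One half of the equivalence of square functions. -/
theorem exists_calcSeminorm_le (H : CalcAngle A ω) (hp : 1 ≤ p) (μ : ℝ)
    (hψ : MemElementary ω ψ) (hne : ∃ z ∈ openSector ω, ψ z ≠ 0) (hγ : MemElementary ω γ)
    (hγθ : MemHInftyZero ω (fun z => z ^ (-(thetaOf p μ : ℂ)) * γ z))
    (hcase : MemHInftyZero ω γ ∨ 0 < thetaOf p μ ∨ (thetaOf p μ < 0 ∧
      ∀ x ∈ closure (A.domain : Set X), elementaryCalc A ω γ x ∈ opRange A)) :
    ∃ C : NNReal, 0 < C ∧ ∀ x : X,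
      calcSeminorm A ω p μ γ x ≤ C * calcSeminorm A ω p μ ψ x := by
  obtain ⟨M, hM, hJ⟩ := H.norm_unitResolvent_le
  obtain ⟨C, hC, hle⟩ := H.exists_calcSeminorm_le_of_regularizer hp μ hψ hne hγ hγθ
    (M + ‖(1 : X →L[ℂ] X)‖)
  refine ⟨C, hC, fun x => ?_⟩
  -- no regularization is needed for functions in `H^∞_0`
  by_cases h0 : MemHInftyZero ω γ
  · refine hle x ⟨fun _ _ => 1, fun n => memElementary_const 1, fun n u => ?_, fun n => ?_,
      fun u => ?_⟩
    · exact (h0.dilate (Real.exp_pos u)).congr fun z _ => one_mul _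
    · rw [H.calc_const, one_smul]
      linarith
    · simp only [H.calc_const, one_smul, one_apply_eq_self]
      exact tendsto_const_nhds
  rcases hcase with h | hθ | ⟨hθ, hR⟩
  · exact absurd h h0
  · by_cases hx : calcSeminorm A ω p μ ψ x = ∞
    · rw [hx, ENNReal.mul_top (by exact_mod_cast hC.ne')]
      exact le_top
    have hxc := H.mem_closure_domain hp hψ hne hθ hx
    refine hle x ⟨fun n z => (1 + (Real.exp (-(n : ℝ)) : ℝ) * z)⁻¹,
      fun n => memElementary_dilate_inv H.lt_pi (Real.exp_pos _), fun n u => ?_, fun n => ?_,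
      fun u => ?_⟩
    · obtain ⟨C', hC', hb⟩ := hγθ.exists_norm_dilate_le _ (Real.exp_pos u)
      exact (hγ.dilate H.lt_pi (Real.exp_pos u)).dilate_inv_mul_memHInftyZero H.lt_pi
        (Real.exp_pos _) hθ hC' hb
    · rw [H.calc_dilate_inv (Real.exp_pos _)]
      exact (hJ _).trans (le_add_of_nonneg_right (norm_nonneg _))
    · have h1 := (H.tendsto_unitResolvent_atBot hxc).comp
        (tendsto_neg_atTop_atBot.comp (tendsto_natCast_atTop_atTop (R := ℝ)))
      have h2 := ((elementaryCalc A ω (fun z => γ ((Real.exp u : ℝ) * z))).continuous.tendsto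
        x).comp h1
      refine h2.congr fun n => ?_
      have h3 := H.calc_comm (memElementary_dilate_inv H.lt_pi (Real.exp_pos (-(n : ℝ))))
        (hγ.dilate H.lt_pi (Real.exp_pos u))
      rw [H.calc_dilate_inv (Real.exp_pos _)] at h3
      rw [H.calc_dilate_inv (Real.exp_pos _)]
      exact (congrArg (fun T : X →L[ℂ] X => T x) h3).symm
  · have he : ∀ n : ℕ, elementaryCalc A ω (fun z => 1 - (1 + (Real.exp (n : ℝ) : ℝ) * z)⁻¹) =
        1 - unitResolvent ((Real.exp (n : ℝ) : ℂ) • A) := fun n => by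
      simpa using H.calc_one_sub_inv_pow (n : ℝ) 1
    refine hle x ⟨fun n z => 1 - (1 + (Real.exp (n : ℝ) : ℝ) * z)⁻¹,
      fun n => (memElementary_const 1).sub (memElementary_dilate_inv H.lt_pi (Real.exp_pos _)),
      fun n u => ?_, fun n => ?_, fun u => ?_⟩
    · obtain ⟨C', hC', hb⟩ := hγθ.exists_norm_dilate_le _ (Real.exp_pos u)
      exact (hγ.dilate H.lt_pi (Real.exp_pos u)).one_sub_dilate_inv_mul_memHInftyZero H.lt_pi
        (Real.exp_pos _) hθ hC' hb
    · rw [he]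
      refine (norm_sub_le _ _).trans ?_
      have := hJ n
      linarith
    · simp only [he, sub_apply, one_apply_eq_self]
      have h1 := (H.tendsto_unitResolvent_calc_atTop hγ h0 hθ hγθ hR u x).comp
        (tendsto_natCast_atTop_atTop (R := ℝ))
      simpa using h1.const_sub (elementaryCalc A ω (fun z => γ ((Real.exp u : ℝ) * z)) x)

/-- The equivalence of square functions, under the decay conditions and the range and domain
conditions for those functions that do not belong to `H^∞_0`. -/
theorem equivSeminorms (H : CalcAngle A ω) (hp : 1 ≤ p) (μ : ℝ)
    (hψ : MemElementary ω ψ) (hγ : MemElementary ω γ)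
    (hψ0 : ∃ z ∈ openSector ω, ψ z ≠ 0) (hγ0 : ∃ z ∈ openSector ω, γ z ≠ 0)
    (hψθ : MemHInftyZero ω (fun z => z ^ (-(thetaOf p μ : ℂ)) * ψ z))
    (hγθ : MemHInftyZero ω (fun z => z ^ (-(thetaOf p μ : ℂ)) * γ z))
    (hψc : MemHInftyZero ω ψ ∨ 0 < thetaOf p μ ∨ (thetaOf p μ < 0 ∧
      ∀ x ∈ closure (A.domain : Set X), elementaryCalc A ω ψ x ∈ opRange A))
    (hγc : MemHInftyZero ω γ ∨ 0 < thetaOf p μ ∨ (thetaOf p μ < 0 ∧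
      ∀ x ∈ closure (A.domain : Set X), elementaryCalc A ω γ x ∈ opRange A)) :
    EquivSeminorms (calcSeminorm A ω p μ ψ) (calcSeminorm A ω p μ γ) := by
  obtain ⟨C₁, hC₁, h1⟩ := H.exists_calcSeminorm_le hp μ hψ hψ0 hγ hγθ hγc
  obtain ⟨C₂, hC₂, h2⟩ := H.exists_calcSeminorm_le hp μ hγ hγ0 hψ hψθ hψc
  refine ⟨C₁ + C₂, by positivity, fun x => ⟨(h2 x).trans ?_, (h1 x).trans ?_⟩⟩
  · push_cast
    gcongr
    exact le_add_self
  · push_cast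
    gcongr
    exact le_self_add

end CalcAngle

/-- What the range and domain condition amounts to for `ψ ∉ H^∞_0`. It is vacuous for `θ > 0`, and
for `θ = 0` the decay condition says that `ψ ∈ H^∞_0`. -/
theorem McIntoshCondition.trichotomy {μ : ℝ}
    (hψθ : MemHInftyZero ω (fun z => z ^ (-(thetaOf p μ : ℂ)) * ψ z))
    (h : MemHInftyZero ω ψ ∨ McIntoshCondition A ω p μ ψ) :
    MemHInftyZero ω ψ ∨ 0 < thetaOf p μ ∨ (thetaOf p μ < 0 ∧
      ∀ x ∈ closure (A.domain : Set X), elementaryCalc A ω ψ x ∈ opRange A) := by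
  rcases h with h | h
  · exact Or.inl h
  · rcases lt_trichotomy (thetaOf p μ) 0 with h1 | h1 | h1
    · exact Or.inr (Or.inr ⟨h1, h.2⟩)
    · left
      rw [h1] at hψθ
      exact hψθ.congr fun z _ => by simp
    · exact Or.inr (Or.inl h1)

end Equivalence

/-! ### The special functions -/

section SpecialFunctions

variable {ω θ : ℝ}

theorem cos_mul_norm_le_re (hω : ω ≤ Real.pi / 2) {z : ℂ} (hz : z ∈ openSector ω) :
    Real.cos ω * ‖z‖ ≤ z.re := by
  rw [← Complex.norm_mul_cos_arg z, mul_comm]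
  refine mul_le_mul_of_nonneg_left ?_ (norm_nonneg z)
  rw [← Real.cos_abs z.arg]
  exact Real.cos_le_cos_of_nonneg_of_le_pi (abs_nonneg _) (by linarith [Real.pi_pos]) hz.2.le

theorem norm_exp_neg_le (hω : ω ≤ Real.pi / 2) {z : ℂ} (hz : z ∈ openSector ω) :
    ‖Complex.exp (-z)‖ ≤ Real.exp (-(Real.cos ω * ‖z‖)) := by
  rw [Complex.norm_exp, Complex.neg_re, Real.exp_le_exp]
  linarith [cos_mul_norm_le_re hω hz]

theorem cos_pos_of_mem (hω : ω < Real.pi / 2) {z : ℂ} (hz : z ∈ openSector ω) :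
    0 < Real.cos ω :=
  Real.cos_pos_of_mem_Ioo ⟨by linarith [hz.2, abs_nonneg z.arg, Real.pi_pos], hω⟩

theorem norm_exp_neg_le_one (hω : ω < Real.pi / 2) {z : ℂ} (hz : z ∈ openSector ω) :
    ‖Complex.exp (-z)‖ ≤ 1 := by
  refine (norm_exp_neg_le hω.le hz).trans ?_
  rw [Real.exp_le_one_iff]
  have := mul_nonneg (cos_pos_of_mem hω hz).le (norm_nonneg z)
  linarith

/-- The exponential decay beats the first two powers of `|z|`. -/
theorem norm_exp_neg_mul_le (hω : ω < Real.pi / 2) {z : ℂ} (hz : z ∈ openSector ω) :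
    ‖Complex.exp (-z)‖ * ‖z‖ ≤ (Real.cos ω)⁻¹ ∧
      ‖Complex.exp (-z)‖ * ‖z‖ ^ 2 ≤ 2 * (Real.cos ω)⁻¹ ^ 2 := by
  have hκ := cos_pos_of_mem hω hz
  have h0 := norm_nonneg z
  set x := Real.cos ω * ‖z‖ with hx
  have hx0 : 0 ≤ x := by positivity
  have e : ‖z‖ = (Real.cos ω)⁻¹ * x := by rw [hx]; field_simp
  have h1 := norm_exp_neg_le hω.le hz
  have h2 : Real.exp (-x) * x ≤ 1 := by
    rw [Real.exp_neg, inv_mul_le_iff₀ (Real.exp_pos x), mul_one]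
    linarith [Real.add_one_le_exp x]
  have h3 : Real.exp (-x) * x ^ 2 ≤ 2 := by
    rw [Real.exp_neg, inv_mul_le_iff₀ (Real.exp_pos x)]
    linarith [Real.quadratic_le_exp_of_nonneg hx0]
  rw [e]
  constructor
  · calc _ ≤ Real.exp (-x) * ((Real.cos ω)⁻¹ * x) := by gcongr
      _ = (Real.cos ω)⁻¹ * (Real.exp (-x) * x) := by ring
      _ ≤ (Real.cos ω)⁻¹ * 1 := by gcongr
      _ = _ := mul_one _
  · calc _ ≤ Real.exp (-x) * ((Real.cos ω)⁻¹ * x) ^ 2 := by gcongr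
      _ = (Real.cos ω)⁻¹ ^ 2 * (Real.exp (-x) * x ^ 2) := by ring
      _ ≤ (Real.cos ω)⁻¹ ^ 2 * 2 := by gcongr
      _ = _ := mul_comm _ _

theorem norm_exp_neg_sub_le (hω : ω < Real.pi / 2) {z : ℂ} (hz : z ∈ openSector ω) :
    ‖Complex.exp (-z) - 1‖ ≤ 2 ∧ ‖Complex.exp (-z) - 1‖ ≤ 2 * ‖z‖ := by
  have h2 : ‖Complex.exp (-z) - 1‖ ≤ 2 := by
    refine (norm_sub_le _ _).trans ?_
    rw [norm_one]
    linarith [norm_exp_neg_le_one hω hz]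
  refine ⟨h2, ?_⟩
  rcases le_total ‖z‖ 1 with h | h
  · have := Complex.norm_exp_sub_one_le (x := -z) (by rwa [norm_neg])
    rwa [norm_neg] at this
  · linarith

theorem memHInftyZero_psiExp (hω : ω < Real.pi / 2) : MemHInftyZero ω psiExp := by
  refine memHInftyZero_of_bounds (C := 1) (D := 2 * (Real.cos ω)⁻¹ ^ 2) ?_ one_pos one_pos
    zero_le_one (by positivity) (fun z hz _ => ?_) (fun z hz h1 => ?_)
  · unfold psiExp; fun_prop
  · rw [psiExp, norm_mul, Real.rpow_one, one_mul]
    exact mul_le_of_le_one_right (norm_nonneg z) (norm_exp_neg_le_one hω hz)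
  · have h2 := (norm_exp_neg_mul_le hω hz).2
    have h0 : 0 < ‖z‖ := by linarith
    rw [psiExp, norm_mul, Real.rpow_neg_one, ← div_eq_mul_inv, le_div_iff₀ h0]
    linarith

theorem memElementary_exp_neg (hω : ω < Real.pi / 2) :
    MemElementary ω (fun z => Complex.exp (-z)) := by
  have hπ : ω < Real.pi := by linarith [Real.pi_pos]
  obtain ⟨c, hc, hρ⟩ := exists_norm_one_add_inv_le hπ
  refine ⟨1, 0, memHInftyZero_of_bounds (C := 2 + c) (D := (Real.cos ω)⁻¹ ^ 2 + 1 + c) ?_ one_pos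
    one_pos (by positivity) (by positivity) (fun z hz _ => ?_) (fun z hz h1 => ?_)⟩
  · have h1 := differentiableOn_one_add_inv hπ.le
    have h2 : DifferentiableOn ℂ (fun z => Complex.exp (-z)) (openSector ω) := by fun_prop
    exact ((h2.sub (h1.const_mul 1)).sub_const 0)
  · have hne := one_add_ne_zero_of_mem hπ.le hz
    have e : Complex.exp (-z) - 1 * (1 + z)⁻¹ - 0 = (Complex.exp (-z) - 1) + z * (1 + z)⁻¹ := by
      field_simp
      ring
    rw [e, Real.rpow_one, add_mul]
    refine (norm_add_le _ _).trans (add_le_add (norm_exp_neg_sub_le hω hz).2 ?_)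
    rw [norm_mul, mul_comm]
    gcongr
    exact (hρ z hz).trans (div_le_self hc.le (le_add_of_nonneg_right (norm_nonneg z)))
  · have h0 : 0 < ‖z‖ := by linarith
    rw [sub_zero, one_mul, Real.rpow_neg_one]
    refine (norm_sub_le _ _).trans ?_
    rw [add_mul]
    refine add_le_add ?_ ?_
    · rw [← div_eq_mul_inv, le_div_iff₀ h0]
      refine (norm_exp_neg_mul_le hω hz).1.trans ?_
      nlinarith [sq_nonneg ((Real.cos ω)⁻¹ - 1 / 2)]
    · refine (hρ z hz).trans ?_
      rw [div_eq_mul_inv]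
      gcongr
      linarith

theorem memElementary_psiOne (hω : ω < Real.pi / 2) : MemElementary ω psiOne :=
  (memElementary_exp_neg hω).sub (memElementary_const 1)

theorem memElementary_psiTwo (hω : ω < Real.pi) : MemElementary ω psiTwo :=
  memElementary_one_sub_inv.congr fun _ hz =>
    psiTwo_eq (one_add_ne_zero_of_mem hω.le hz)

theorem memHInftyZero_cpow_mul_psiOne (hω : ω < Real.pi / 2) (h0 : 0 < θ) (h1 : θ < 1) :
    MemHInftyZero ω (fun z => z ^ (-(θ : ℂ)) * psiOne z) := by
  have hπ : ω < Real.pi := by linarith [Real.pi_pos]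
  refine memHInftyZero_cpow_mul hπ.le ((memElementary_psiOne hω).differentiableOn hπ.le) h1 h0
    (C := 2) (D := 2) (by norm_num) (by norm_num) (fun z hz _ => ?_) (fun z hz _ => ?_)
  · rw [Real.rpow_one]
    exact (norm_exp_neg_sub_le hω hz).2
  · rw [Real.rpow_zero, mul_one]
    exact (norm_exp_neg_sub_le hω hz).1

theorem memHInftyZero_cpow_mul_psiTwo (hω : ω < Real.pi) (h0 : 0 < θ) (h1 : θ < 1) :
    MemHInftyZero ω (fun z => z ^ (-(θ : ℂ)) * psiTwo z) :=
  (memHInftyZero_cpow_mul_one_sub_inv_pow hω h0 (n := 1) (by simpa using h1)).congr fun z hz => by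
    rw [psiTwo_eq (one_add_ne_zero_of_mem hω.le hz), pow_one]

theorem memHInftyZero_cpow_mul_psiThree (hω : ω < Real.pi) (h0 : -1 < θ) (h1 : θ < 1) :
    MemHInftyZero ω (fun z => z ^ (-(θ : ℂ)) * psiThree z) := by
  obtain ⟨c, hc, hρ⟩ := exists_norm_one_add_inv_le hω
  have hn : ∀ z ∈ openSector ω, ‖psiThree z‖ ≤ ‖z‖ * (c / (1 + ‖z‖)) ^ 2 := by
    intro z hz
    rw [psiThree, norm_mul, ← inv_pow, norm_pow]
    gcongr
    exact hρ z hz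
  refine memHInftyZero_cpow_mul hω.le (memHInftyZero_psiThree hω).1 h1 h0
    (C := c ^ 2) (D := c ^ 2) (by positivity) (by positivity) (fun z hz _ => ?_)
    (fun z hz h1 => ?_)
  · refine (hn z hz).trans ?_
    rw [Real.rpow_one, mul_comm]
    gcongr
    exact div_le_self hc.le (le_add_of_nonneg_right (norm_nonneg z))
  · have h0 : 0 < ‖z‖ := by linarith
    refine (hn z hz).trans ?_
    calc ‖z‖ * (c / (1 + ‖z‖)) ^ 2 ≤ ‖z‖ * (c / ‖z‖) ^ 2 := by
          gcongr
          linarith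
      _ = _ := by
        rw [Real.rpow_neg_one]
        field_simp

theorem memHInftyZero_cpow_mul_psiExp (hω : ω < Real.pi / 2) (h0 : -1 < θ) (h1 : θ < 1) :
    MemHInftyZero ω (fun z => z ^ (-(θ : ℂ)) * psiExp z) := by
  have hπ : ω < Real.pi := by linarith [Real.pi_pos]
  refine memHInftyZero_cpow_mul hπ.le (memHInftyZero_psiExp hω).1 h1 h0
    (C := 1) (D := 2 * (Real.cos ω)⁻¹ ^ 2) zero_le_one (by positivity) (fun z hz _ => ?_)
    (fun z hz h1 => ?_)
  · rw [psiExp, norm_mul, Real.rpow_one, one_mul]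
    exact mul_le_of_le_one_right (norm_nonneg z) (norm_exp_neg_le_one hω hz)
  · have h2 := (norm_exp_neg_mul_le hω hz).2
    have h0 : 0 < ‖z‖ := by linarith
    rw [psiExp, norm_mul, Real.rpow_neg_one, ← div_eq_mul_inv, le_div_iff₀ h0]
    linarith

theorem one_mem_openSector (hω : 0 < ω) : (1 : ℂ) ∈ openSector ω := by
  simpa using ofReal_mem_openSector hω one_pos

theorem exists_psiOne_ne_zero (hω : 0 < ω) : ∃ z ∈ openSector ω, psiOne z ≠ 0 := by
  refine ⟨1, one_mem_openSector hω, fun h => ?_⟩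
  have h1 := congrArg norm (sub_eq_zero.1 h)
  rw [Complex.norm_exp, norm_one] at h1
  simp at h1

theorem exists_psiTwo_ne_zero (hω : 0 < ω) : ∃ z ∈ openSector ω, psiTwo z ≠ 0 :=
  ⟨1, one_mem_openSector hω, by norm_num [psiTwo]⟩

theorem exists_psiThree_ne_zero (hω : 0 < ω) : ∃ z ∈ openSector ω, psiThree z ≠ 0 :=
  ⟨1, one_mem_openSector hω, by norm_num [psiThree]⟩

theorem exists_psiExp_ne_zero (hω : 0 < ω) : ∃ z ∈ openSector ω, psiExp z ≠ 0 :=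
  ⟨1, one_mem_openSector hω, by simp [psiExp]⟩

end SpecialFunctions

/-! ### Laplace transforms and the generator of a bounded holomorphic semigroup -/

section Laplace

variable {E : Type*} [NormedAddCommGroup E] [NormedSpace ℂ E]

/-- The Laplace transform of `f` at `l`. It is used for bounded `f` and `Re l > 0`, where the
integral converges absolutely. -/
noncomputable def laplace (f : ℝ → E) (l : ℂ) : E :=
  ∫ t in Ioi (0 : ℝ), Complex.exp (-(l * t)) • f t

theorem norm_exp_neg_mul_ofReal (l : ℂ) (t : ℝ) :
    ‖Complex.exp (-(l * t))‖ = Real.exp (-l.re * t) := by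
  rw [Complex.norm_exp]
  simp

variable {f : ℝ → E} {M : ℝ} {l : ℂ}

theorem norm_laplace_integrand_le (hb : ∀ t : ℝ, 0 < t → ‖f t‖ ≤ M) (l : ℂ) {t : ℝ} (ht : 0 < t) :
    ‖Complex.exp (-(l * t)) • f t‖ ≤ Real.exp (-l.re * t) * M := by
  rw [norm_smul, norm_exp_neg_mul_ofReal]
  exact mul_le_mul_of_nonneg_left (hb t ht) (Real.exp_pos _).le

theorem aestronglyMeasurable_laplace_integrand (hf : ContinuousOn f (Ioi 0)) (l : ℂ) :
    AEStronglyMeasurable (fun t : ℝ => Complex.exp (-(l * t)) • f t)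
      (volume.restrict (Ioi (0 : ℝ))) :=
  (ContinuousOn.smul (by fun_prop) hf).aestronglyMeasurable measurableSet_Ioi

theorem integrableOn_laplace (hf : ContinuousOn f (Ioi 0)) (hb : ∀ t : ℝ, 0 < t → ‖f t‖ ≤ M)
    (hl : 0 < l.re) : IntegrableOn (fun t : ℝ => Complex.exp (-(l * t)) • f t) (Ioi (0 : ℝ)) := by
  refine Integrable.mono' ((integrableOn_exp_mul_Ioi (neg_neg_of_pos hl) 0).mul_const M)
    (aestronglyMeasurable_laplace_integrand hf l) ?_
  filter_upwards [ae_restrict_mem measurableSet_Ioi] with t ht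
  exact norm_laplace_integrand_le hb l ht

theorem norm_laplace_le (hb : ∀ t : ℝ, 0 < t → ‖f t‖ ≤ M) (hl : 0 < l.re) :
    ‖laplace f l‖ ≤ M / l.re := by
  have h := norm_integral_le_of_norm_le
    ((integrableOn_exp_mul_Ioi (neg_neg_of_pos hl) 0).mul_const M)
    (f := fun t : ℝ => Complex.exp (-(l * t)) • f t)
    ((ae_restrict_mem measurableSet_Ioi).mono fun t ht => norm_laplace_integrand_le hb l ht)
  refine h.trans_eq ?_
  rw [integral_mul_const, integral_exp_mul_Ioi (neg_neg_of_pos hl)]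
  simp
  field_simp

theorem differentiableOn_laplace (hf : ContinuousOn f (Ioi 0))
    (hb : ∀ t : ℝ, 0 < t → ‖f t‖ ≤ M) : DifferentiableOn ℂ (laplace f) {l | 0 < l.re} := by
  intro l hl
  have hl : 0 < l.re := hl
  refine DifferentiableAt.differentiableWithinAt ?_
  have hc : 0 < l.re / 2 := half_pos hl
  have hs : {w : ℂ | l.re / 2 < w.re} ∈ 𝓝 l :=
    (isOpen_lt continuous_const Complex.continuous_re).mem_nhds (half_lt_self hl)
  have hbd : IntegrableOn (fun t : ℝ => (t * Real.exp (-(l.re / 2) * t)) * M) (Ioi (0 : ℝ)) := by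
    have h1 := integrableOn_rpow_mul_exp_neg_mul_rpow (s := 1) (p := 1) (by norm_num) one_pos hc
    simp only [Real.rpow_one] at h1
    exact h1.mul_const M
  refine (hasDerivAt_integral_of_dominated_loc_of_deriv_le
    (F' := fun l (t : ℝ) => (Complex.exp (-(l * t)) * (-t)) • f t) hs
    (Eventually.of_forall fun w => aestronglyMeasurable_laplace_integrand hf w)
    (integrableOn_laplace hf hb hl) ?_ ?_ hbd ?_).2.differentiableAt
  · exact (ContinuousOn.smul (by fun_prop) hf).aestronglyMeasurable measurableSet_Ioi
  · filter_upwards [ae_restrict_mem measurableSet_Ioi] with t ht w hw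
    have ht : 0 < t := ht
    have hw : l.re / 2 < w.re := hw
    rw [norm_smul, norm_mul, norm_exp_neg_mul_ofReal, norm_neg, Complex.norm_real,
      Real.norm_of_nonneg ht.le, mul_comm (Real.exp _)]
    refine mul_le_mul ?_ (hb t ht) (norm_nonneg _) (by positivity)
    gcongr
  · refine Eventually.of_forall fun t w _ => ?_
    have h1 : HasDerivAt (fun w : ℂ => -(w * t)) (-(t : ℂ)) w := by
      simpa using ((hasDerivAt_id w).mul_const (t : ℂ)).fun_neg
    exact h1.cexp.smul_const (f t)

/-- Holomorphic functions on the right half-plane that agree far out on a ray agree. -/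
theorem eqOn_rightHalfPlane [CompleteSpace E] {g h : ℂ → E} {a : ℂ} (ha : 0 < a.re) {L : ℝ}
    (hg : DifferentiableOn ℂ g {l | 0 < l.re}) (hh : DifferentiableOn ℂ h {l | 0 < l.re})
    (hgh : ∀ r : ℝ, L < r → g (r * a) = h (r * a)) : EqOn g h {l | 0 < l.re} := by
  have ho : IsOpen {l : ℂ | 0 < l.re} := isOpen_lt continuous_const Complex.continuous_re
  have hconn : IsPreconnected {l : ℂ | 0 < l.re} :=
    (convex_halfSpace_re_gt 0).isPreconnected
  have ha0 : a ≠ 0 := by rintro rfl; simp at ha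
  set r₀ : ℝ := |L| + 1 with hr₀
  have hr0 : 0 < r₀ := by positivity
  have hmem : (r₀ : ℂ) * a ∈ {l : ℂ | 0 < l.re} := by
    simp only [mem_ofPred_eq, Complex.re_ofReal_mul]
    positivity
  refine (hg.analyticOnNhd ho).eqOn_of_preconnected_of_frequently_eq (hh.analyticOnNhd ho)
    hconn hmem ?_
  have ht : Tendsto (fun n : ℕ => (((r₀ + 1 / ((n : ℝ) + 1) : ℝ)) : ℂ) * a) atTop
      (𝓝[≠] ((r₀ : ℂ) * a)) := by
    refine tendsto_nhdsWithin_iff.2 ⟨?_, Eventually.of_forall fun n => ?_⟩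
    · have := (tendsto_one_div_add_atTop_nhds_zero_nat (𝕜 := ℝ)).const_add r₀
      rw [add_zero] at this
      exact ((Complex.continuous_ofReal.tendsto _).comp this).mul_const a
    · have : (0 : ℝ) < 1 / ((n : ℝ) + 1) := by positivity
      simp only [mem_compl_iff, mem_singleton_iff, mul_eq_mul_right_iff, ha0, or_false,
        Complex.ofReal_inj]
      linarith
  refine ht.frequently (Frequently.of_forall fun n => hgh _ ?_)
  have : (0 : ℝ) < 1 / ((n : ℝ) + 1) := by positivity
  linarith [le_abs_self L]

/-- The function `t e^{-κt}` decays at both ends of the half-line, in the coordinate `t = e^r`. -/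
theorem mul_exp_neg_mul_le {κ : ℝ} (hκ : 0 < κ) (r : ℝ) :
    Real.exp r * Real.exp (-(κ * Real.exp r)) ≤ (1 + 2 / κ ^ 2) * Real.exp (-(1 * |r|)) := by
  have hr := Real.exp_pos r
  rw [one_mul, add_mul, one_mul]
  rcases le_total 0 r with h | h
  · rw [abs_of_nonneg h]
    have h1 := Real.quadratic_le_exp_of_nonneg (x := κ * Real.exp r) (by positivity)
    have h2 : Real.exp (-(κ * Real.exp r)) ≤ 2 / (κ ^ 2 * Real.exp r ^ 2) := by
      rw [Real.exp_neg, inv_eq_one_div, div_le_div_iff₀ (Real.exp_pos _) (by positivity)]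
      nlinarith [mul_pos hκ hr]
    calc _ ≤ Real.exp r * (2 / (κ ^ 2 * Real.exp r ^ 2)) := by gcongr
      _ = 2 / κ ^ 2 * Real.exp (-r) := by
        rw [Real.exp_neg]
        field_simp
      _ ≤ _ := le_add_of_nonneg_left (Real.exp_pos _).le
  · rw [abs_of_nonpos h, neg_neg]
    have h1 : Real.exp (-(κ * Real.exp r)) ≤ 1 := by
      rw [Real.exp_le_one_iff]
      have := mul_pos hκ hr
      linarith
    calc _ ≤ Real.exp r * 1 := by gcongr
      _ ≤ _ := by
        rw [mul_one]
        exact le_add_of_nonneg_right (by positivity)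

/-- Rotation of the ray of integration in a Laplace integral. -/
theorem laplace_rotate {F : ℂ → E} {δ φ : ℝ} (hδ : δ ≤ Real.pi / 2)
    (hF : DifferentiableOn ℂ F (openSector δ)) (hM : ∀ z ∈ openSector δ, ‖F z‖ ≤ M)
    (hφ : |φ| < δ) {r : ℝ} (hr : 0 < r) :
    Complex.exp (φ * Complex.I) • laplace (fun t => F (t * Complex.exp (φ * Complex.I)))
      (r * Complex.exp (φ * Complex.I)) = laplace (fun t : ℝ => F t) r := by
  have hπ : δ ≤ Real.pi := by linarith [Real.pi_pos]
  have hδ0 : 0 < δ := (abs_nonneg _).trans_lt hφ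
  have hM0 : 0 ≤ M := (norm_nonneg _).trans (hM 1 (one_mem_openSector hδ0))
  set H : ℂ → E := fun w => (Complex.exp w * Complex.exp (-(r * Complex.exp w))) • F (Complex.exp w)
    with hH
  have e : ∀ φ : ℝ, lineInt φ H = Complex.exp (φ * Complex.I) •
      laplace (fun t => F (t * Complex.exp (φ * Complex.I))) (r * Complex.exp (φ * Complex.I)) := by
    intro φ
    rw [laplace, integral_comp_exp_univ, ← integral_smul, lineInt]
    refine integral_congr_ae (Eventually.of_forall fun u => ?_)
    simp only [hH]
    have e1 : Complex.exp ((u : ℂ) + φ * Complex.I) =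
        (Real.exp u : ℝ) * Complex.exp (φ * Complex.I) := by
      rw [Complex.exp_add, Complex.ofReal_exp]
    rw [e1, ← Complex.coe_smul, smul_smul, smul_smul]
    congr 1
    rw [show (r : ℂ) * ((Real.exp u : ℝ) * Complex.exp (φ * Complex.I)) =
      r * Complex.exp (φ * Complex.I) * (Real.exp u : ℝ) by ring]
    ring
  have hrot : ∀ a b : ℝ, a ≤ b → |a| ≤ |φ| → |b| ≤ |φ| → lineInt a H = lineInt b H := by
    intro a b hab ha hb
    have hκ : 0 < Real.cos |φ| := Real.cos_pos_of_mem_Ioo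
      ⟨by linarith [abs_nonneg φ, Real.pi_pos], by linarith⟩
    have him : ∀ w : ℂ, a ≤ w.im → w.im ≤ b → |w.im| ≤ |φ| := fun w h1 h2 =>
      (abs_le_max_abs_abs h1 h2).trans (max_le ha hb)
    refine lineInt_eq (α := 1) (N := 0) (C := (1 + 2 / (r * Real.cos |φ|) ^ 2) * M) hab one_pos
      (fun w h1 h2 => ?_) (fun w h1 h2 _ => ?_)
    · have hd : DifferentiableAt ℂ (fun w => F (Complex.exp w)) w :=
        (hF.differentiableAt ((isOpen_openSector hπ).mem_nhds
          (exp_mem_openSector hπ ((him w h1 h2).trans_lt hφ)))).comp w (by fun_prop)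
      exact DifferentiableAt.smul (by fun_prop) hd
    · have hw := him w h1 h2
      have hFw := hM _ (exp_mem_openSector hπ (hw.trans_lt hφ))
      simp only [hH]
      rw [norm_smul, norm_mul, Complex.norm_exp, Complex.norm_exp]
      have hcos : Real.cos |φ| ≤ Real.cos w.im := by
        rw [← Real.cos_abs w.im]
        exact Real.cos_le_cos_of_nonneg_of_le_pi (abs_nonneg _) (by linarith) hw
      have h3 : (-(r * Complex.exp w)).re ≤ -(r * Real.cos |φ| * Real.exp w.re) := by
        rw [Complex.neg_re, Complex.re_ofReal_mul, Complex.exp_re]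
        have := mul_le_mul_of_nonneg_left hcos (mul_pos hr (Real.exp_pos w.re)).le
        linarith
      calc _ ≤ Real.exp w.re * Real.exp (-(r * Real.cos |φ| * Real.exp w.re)) * M := by gcongr
        _ ≤ ((1 + 2 / (r * Real.cos |φ|) ^ 2) * Real.exp (-(1 * |w.re|))) * M := by
          exact mul_le_mul_of_nonneg_right (mul_exp_neg_mul_le (mul_pos hr hκ) _) hM0
        _ = _ := by ring
  have e0 := e 0
  simp only [Complex.ofReal_zero, zero_mul, Complex.exp_zero, mul_one, one_smul] at e0
  rw [← e φ, ← e0]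
  rcases le_total 0 φ with h | h
  · exact (hrot 0 φ h (by simp) le_rfl).symm
  · exact hrot φ 0 h le_rfl (by simp)

end Laplace

section Generator

variable {X : Type*} [NormedAddCommGroup X] [NormedSpace ℂ X] {A B : X →ₗ.[ℂ] X}
  {T : ℝ → X →L[ℂ] X}

/-- The two resolvent identities with a resolvent at some point characterize the resolvent. -/
theorem IsOpResolvent.of_resolvent_identity {l₀ l : ℂ} {R G : X →L[ℂ] X}
    (h : IsOpResolvent B l₀ R) (h1 : G = R + (l₀ - l) • (R * G))
    (h2 : G = R + (l₀ - l) • (G * R)) : IsOpResolvent B l G := by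
  constructor
  · intro x
    obtain ⟨hm, e⟩ := h.1 (x + (l₀ - l) • G x)
    have hG : R (x + (l₀ - l) • G x) = G x := by
      conv_rhs => rw [h1]
      simp [mul_apply_eq_comp]
    have hm' : G x ∈ B.domain := hG ▸ hm
    have e' : (⟨R (x + (l₀ - l) • G x), hm⟩ : B.domain) = ⟨G x, hm'⟩ := Subtype.ext hG
    rw [e', hG] at e
    refine ⟨hm', ?_⟩
    have e3 : B ⟨G x, hm'⟩ = l₀ • G x - (x + (l₀ - l) • G x) := by
      rw [← e]; abel
    rw [e3, sub_smul]
    abel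
  · intro x
    have e := h.2 x
    have h3 := congrArg (fun S : X →L[ℂ] X => S (l₀ • (x : X) - B x)) h2
    simp only [add_apply, smul_apply, mul_apply_eq_comp, e] at h3
    have e4 : l • (x : X) - B x = (l₀ • (x : X) - B x) - (l₀ - l) • (x : X) := by
      rw [sub_smul]; abel
    rw [e4, map_sub, map_smul, h3]
    abel

/-- The Laplace transform along each ray of the sector is the resolvent of the generator on a
rotated half-plane. It is so far out on a ray by the definition of the generator, and the resolvent
identities with one fixed resolvent persist by analytic continuation. -/
theorem IsBoundedHolomorphicSemigroup.exists_isOpResolvent [CompleteSpace X]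
    (hT : IsBoundedHolomorphicSemigroup T) (hg : IsGeneratorOf B T) :
    (∃ δ M : ℝ, 0 < δ ∧ δ ≤ Real.pi / 2 ∧ ∀ φ : ℝ, |φ| < δ → ∀ l : ℂ,
      0 < (l * Complex.exp (φ * Complex.I)).re → ∃ G : X →L[ℂ] X, IsOpResolvent B l G ∧
        ‖G‖ ≤ M / (l * Complex.exp (φ * Complex.I)).re) ∧
    ∀ r : ℝ, 0 < r → IsOpResolvent B r (laplace T r) := by
  obtain ⟨δ, F, hδ0, hδ, hF, ⟨M, hM⟩, hFT⟩ := hT.extension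
  obtain ⟨L, hL⟩ := hg
  have hπ : δ ≤ Real.pi := by linarith [Real.pi_pos]
  have hFT' : ∀ l : ℂ, laplace T l = laplace (fun t : ℝ => F t) l := fun l =>
    setIntegral_congr_fun measurableSet_Ioi fun t ht => by simp only [hFT t ht]
  have hFc : ∀ φ : ℝ, |φ| < δ →
      ContinuousOn (fun t : ℝ => F (t * Complex.exp (φ * Complex.I))) (Ioi 0) ∧
      ∀ t : ℝ, 0 < t → ‖F (t * Complex.exp (φ * Complex.I))‖ ≤ M := by
    intro φ hφ
    have hmem : ∀ t : ℝ, 0 < t → (t : ℂ) * Complex.exp (φ * Complex.I) ∈ openSector δ :=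
      fun t ht => mul_mem_openSector ht (exp_mem_openSector hπ (by simpa using hφ))
    exact ⟨hF.continuousOn.comp (by fun_prop) hmem, fun t ht => hM _ (hmem t ht)⟩
  have hF0 : ContinuousOn (fun t : ℝ => F t) (Ioi 0) ∧ ∀ t : ℝ, 0 < t → ‖F t‖ ≤ M := by
    have := hFc 0 (by simpa using hδ0)
    simpa using this
  -- the resolvent at large real points
  have hres : ∀ r : ℝ, L < r → 0 < r → IsOpResolvent B r (laplace (fun t : ℝ => F t) r) := by
    intro r hLr hr
    have h1 := opResolvent_spec (hL r hLr).1
    have h2 : opResolvent B r = laplace (fun t : ℝ => F t) r := by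
      ext x
      rw [(hL r hLr).2 x, laplace, ContinuousLinearMap.integral_apply
        (integrableOn_laplace hF0.1 hF0.2 (by simpa using hr))]
      refine setIntegral_congr_fun measurableSet_Ioi fun t ht => ?_
      simp only [smul_apply, hFT t ht, neg_mul]
    rwa [h2] at h1
  set r₀ : ℝ := |L| + 1
  have hr₀ : 0 < r₀ := by positivity
  have hLr₀ : L < r₀ := by have := le_abs_self L; linarith
  set R := laplace (fun t : ℝ => F t) r₀
  have hR : IsOpResolvent B r₀ R := hres r₀ hLr₀ hr₀
  have hmain : ∀ φ : ℝ, |φ| < δ → ∀ l : ℂ, 0 < (l * Complex.exp (φ * Complex.I)).re →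
      IsOpResolvent B l (Complex.exp (φ * Complex.I) •
        laplace (fun t => F (t * Complex.exp (φ * Complex.I)))
          (l * Complex.exp (φ * Complex.I))) := by
    intro φ hφ l hl
    obtain ⟨hc, hb⟩ := hFc φ hφ
    set a := Complex.exp (φ * Complex.I) with ha
    have ha0 : a ≠ 0 := Complex.exp_ne_zero _
    have har : 0 < a.re := by
      rw [ha, Complex.exp_ofReal_mul_I_re]
      rw [abs_lt] at hφ
      exact Real.cos_pos_of_mem_Ioo ⟨by linarith, by linarith⟩
    set G : ℂ → X →L[ℂ] X := fun m => a • laplace (fun t => F (t * a)) m with hG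
    have hGd : DifferentiableOn ℂ G {m | 0 < m.re} :=
      (differentiableOn_laplace hc hb).const_smul a
    have hGr : ∀ r : ℝ, max L 0 < r → IsOpResolvent B r (G (r * a)) := by
      intro r hr
      have hr0 : 0 < r := (le_max_right _ _).trans_lt hr
      have := laplace_rotate hδ hF hM hφ hr0
      rw [hG]
      simp only []
      rw [this]
      exact hres r ((le_max_left _ _).trans_lt hr) hr0
    have hid : ∀ r : ℝ, max L 0 < r → G (r * a) - R = ((r₀ : ℂ) - r) • (G (r * a) * R) ∧
        R * G (r * a) = G (r * a) * R := by
      intro r hr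
      have h1 := hGr r hr
      have h2 := opResolvent_sub (A := B) ⟨_, h1⟩ ⟨_, hR⟩
      have h3 := opResolvent_comm (A := B) ⟨_, hR⟩ ⟨_, h1⟩
      rw [h1.eq, hR.eq] at h2 h3
      exact ⟨h2, h3⟩
    have hlin : DifferentiableOn ℂ (fun m : ℂ => (r₀ : ℂ) - m * a⁻¹) {m | 0 < m.re} := by fun_prop
    have hsub : ∀ r : ℝ, (r : ℂ) * a * a⁻¹ = r := fun r => mul_inv_cancel_right₀ ha0 _
    have e1 := eqOn_rightHalfPlane (L := max L 0) har hGd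
      (h := fun m => R + ((r₀ : ℂ) - m * a⁻¹) • (R * G m))
      ((differentiableOn_const R).add (hlin.smul ((differentiableOn_const R).mul hGd)))
      (fun r hr => by
        rw [hsub, (hid r hr).2, ← (hid r hr).1]; abel)
    have e2 := eqOn_rightHalfPlane (L := max L 0) har hGd
      (h := fun m => R + ((r₀ : ℂ) - m * a⁻¹) • (G m * R))
      ((differentiableOn_const R).add (hlin.smul (hGd.mul (differentiableOn_const R))))
      (fun r hr => by
        rw [hsub, ← (hid r hr).1]; abel)
    have hl' : l * a * a⁻¹ = l := mul_inv_cancel_right₀ ha0 _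
    have e1' := e1 (x := l * a) hl
    have e2' := e2 (x := l * a) hl
    simp only [hl'] at e1' e2'
    exact hR.of_resolvent_identity e1' e2'
  refine ⟨⟨δ, M, hδ0, hδ, fun φ hφ l hl => ⟨_, hmain φ hφ l hl, ?_⟩⟩, fun r hr => ?_⟩
  · rw [norm_smul, Complex.norm_exp_ofReal_mul_I, one_mul]
    exact norm_laplace_le (hFc φ hφ).2 hl
  · have h := hmain 0 (by simpa using hδ0) r (by simpa using hr)
    rw [hFT']
    simpa using h

theorem norm_mul_neg_cos_le {b : ℝ} {z : ℂ} {φ m : ℝ} (hm : m ≤ Real.pi)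
    (hb : |b - Real.pi| ≤ m) (hz : z.arg + φ = b ∨ z.arg + φ = -b) :
    Real.cos m * ‖z‖ ≤ (-z * Complex.exp (φ * Complex.I)).re := by
  have e : -z * Complex.exp (φ * Complex.I) =
      ((-‖z‖ : ℝ) : ℂ) * Complex.exp ((z.arg + φ : ℝ) * Complex.I) := by
    conv_lhs => rw [← Complex.norm_mul_exp_arg_mul_I z]
    push_cast
    rw [add_mul, Complex.exp_add]
    ring
  have hcos : Real.cos (z.arg + φ) = -Real.cos |b - Real.pi| := by
    rw [Real.cos_abs, Real.cos_sub_pi, neg_neg]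
    rcases hz with h | h
    · rw [h]
    · rw [h, Real.cos_neg]
  rw [e, Complex.re_ofReal_mul, Complex.exp_ofReal_mul_I_re, hcos, neg_mul_neg, mul_comm]
  gcongr
  exact Real.cos_le_cos_of_nonneg_of_le_pi (abs_nonneg _) hm hb

/-- The generator property forces the sectoriality angle below `π/2`. -/
theorem IsBoundedHolomorphicSemigroup.sectorialityAngle_lt [CompleteSpace X]
    (hT : IsBoundedHolomorphicSemigroup T) (hg : IsGeneratorOf (-A) T) :
    sectorialityAngle A < Real.pi / 2 := by
  obtain ⟨⟨δ, M, hδ0, hδ, hres⟩, _⟩ := hT.exists_isOpResolvent hg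
  have hπ := Real.pi_pos
  -- rotation by `±δ/2` moves `-z` into a proper subsector of the right half-plane
  have key : ∀ ω' : ℝ, Real.pi / 2 - δ / 2 ≤ ω' → ∀ z : ℂ, z ≠ 0 → ω' < |z.arg| →
      ∃ φ : ℝ, |φ| < δ ∧ Real.cos (max (Real.pi - δ / 2 - ω') (δ / 2)) * ‖z‖ ≤
        (-z * Complex.exp (φ * Complex.I)).re := by
    intro ω' hω' z hz hzω
    have h1 : |z.arg| ≤ Real.pi := Complex.abs_arg_le_pi z
    have hb : |(|z.arg| + δ / 2 - Real.pi)| ≤ max (Real.pi - δ / 2 - ω') (δ / 2) := by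
      rw [abs_le]
      constructor
      · have := le_max_left (Real.pi - δ / 2 - ω') (δ / 2)
        linarith
      · have := le_max_right (Real.pi - δ / 2 - ω') (δ / 2)
        linarith
    have hm : max (Real.pi - δ / 2 - ω') (δ / 2) ≤ Real.pi := max_le (by linarith) (by linarith)
    rcases le_total 0 z.arg with h | h
    · exact ⟨δ / 2, by rw [abs_of_pos (by linarith)]; linarith, norm_mul_neg_cos_le hm hb
        (Or.inl (by rw [abs_of_nonneg h]))⟩
    · exact ⟨-(δ / 2), by rw [abs_neg, abs_of_pos (by linarith)]; linarith,
        norm_mul_neg_cos_le hm hb (Or.inr (by rw [abs_of_nonpos h]; ring))⟩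
  have hcos : ∀ ω' : ℝ, Real.pi / 2 - δ / 2 < ω' →
      0 < Real.cos (max (Real.pi - δ / 2 - ω') (δ / 2)) := fun ω' h =>
    Real.cos_pos_of_mem_Ioo ⟨by
      have := le_max_right (Real.pi - δ / 2 - ω') (δ / 2)
      linarith, max_lt (by linarith) (by linarith)⟩
  have hA : IsSectorialOfAngle A (Real.pi / 2 - δ / 2) := by
    have hspec : ∀ ω' : ℝ, Real.pi / 2 - δ / 2 < ω' → ∀ z : ℂ, z ≠ 0 → ω' < |z.arg| →
        z ∈ opResolventSet A ∧ ‖z • opResolvent A z‖ ≤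
          |M| / Real.cos (max (Real.pi - δ / 2 - ω') (δ / 2)) := by
      intro ω' hω' z hz hzω
      obtain ⟨φ, hφ, hre⟩ := key ω' hω'.le z hz hzω
      have hz0 : 0 < ‖z‖ := norm_pos_iff.2 hz
      have hc := hcos ω' hω'
      have hpos := (mul_pos hc hz0).trans_le hre
      obtain ⟨G, hG, hGn⟩ := hres φ hφ (-z) hpos
      have hG' := isOpResolvent_neg hG
      rw [neg_neg] at hG'
      refine ⟨⟨_, hG'⟩, ?_⟩
      rw [hG'.eq, norm_smul, norm_neg]
      calc ‖z‖ * ‖G‖ ≤ ‖z‖ * (M / (-z * Complex.exp (φ * Complex.I)).re) := by gcongr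
        _ ≤ ‖z‖ * (|M| / (Real.cos (max (Real.pi - δ / 2 - ω') (δ / 2)) * ‖z‖)) := by
            gcongr
            exact le_abs_self M
        _ = _ := by field_simp
    refine ⟨by linarith, by linarith, fun z hz hzω => ?_, fun ω' hω' _ => ⟨_, fun z hz hzω =>
      (hspec ω' hω' z hz hzω).2⟩⟩
    obtain ⟨ω', h1, h2⟩ := exists_between hzω
    exact (hspec ω' h1 z hz h2).1
  have hbdd : BddBelow {ω₀ : ℝ | IsSectorialOfAngle A ω₀} := ⟨0, fun _ h => h.1⟩
  exact (csInf_le hbdd hA).trans_lt (by linarith)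

end Generator

/-! ### The semigroup as the functional calculus of the exponential function -/

section Uniqueness

variable {X : Type*} [NormedAddCommGroup X] [NormedSpace ℂ X]

/-- Two operator families that solve the same initial value problem after multiplication by an
injective operator `J` agree: `r ↦ E(t - r) J T(r) J` is constant on `(0, t)`. -/
theorem eq_of_hasDerivAt_mul {T E : ℝ → X →L[ℂ] X} {J : X →L[ℂ] X}
    (hJ : ∀ x, J x = 0 → x = 0)
    (hTd : ∀ s, 0 < s → HasDerivAt (fun s => T s * J) (T s * J - T s) s)
    (hEd : ∀ s, 0 < s → HasDerivAt (fun s => E s * J) (E s * J - E s) s)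
    (hT0 : Tendsto (fun s => T s * J) (𝓝[>] 0) (𝓝 J))
    (hE0 : Tendsto (fun s => E s * J) (𝓝[>] 0) (𝓝 J))
    (hTc : ∀ s, 0 < s → T s * J = J * T s) (hEc : ∀ s, 0 < s → E s * J = J * E s)
    {t : ℝ} (ht : 0 < t) : T t = E t := by
  set W : ℝ → X →L[ℂ] X := fun r => (E (t - r) * J) * (T r * J) with hW
  have hWd : ∀ r ∈ Ioo 0 t, HasDerivAt W 0 r := by
    intro r hr
    have h1 := (hEd (t - r) (sub_pos.2 hr.2)).scomp r ((hasDerivAt_id r).const_sub t)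
    have h2 := h1.mul (hTd r hr.1)
    refine h2.congr_deriv ?_
    simp only [Function.comp_apply, neg_smul, one_smul]
    have h3 := hTc r hr.1
    have h4 : E (t - r) * J * T r = E (t - r) * (T r * J) := by rw [mul_assoc, ← h3]
    rw [mul_sub, neg_mul, sub_mul, h4]
    abel
  obtain ⟨c, hc⟩ := isOpen_Ioo.exists_is_const_of_deriv_eq_zero (𝕜 := ℝ) isPreconnected_Ioo
    (fun r hr => (hWd r hr).differentiableAt.differentiableWithinAt)
    (fun r hr => (hWd r hr).deriv)
  have hmem0 : Ioo 0 t ∈ 𝓝[>] (0 : ℝ) := Ioo_mem_nhdsGT ht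
  have hmemt : Ioo 0 t ∈ 𝓝[<] t := Ioo_mem_nhdsLT ht
  have hsub : Tendsto (fun r => t - r) (𝓝[<] t) (𝓝[>] 0) := by
    refine tendsto_nhdsWithin_iff.2 ⟨?_, ?_⟩
    · have : Tendsto (fun r => t - r) (𝓝 t) (𝓝 (t - t)) :=
          (continuous_const.sub continuous_id).tendsto t
      rw [sub_self] at this
      exact this.mono_left nhdsWithin_le_nhds
    · filter_upwards [self_mem_nhdsWithin] with r hr
      exact sub_pos.2 (show r < t from hr)
  have hl0 : Tendsto W (𝓝[>] 0) (𝓝 (E t * J * J)) := by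
    refine Tendsto.mul ?_ hT0
    have h1 : Tendsto (fun r => t - r) (𝓝[>] 0) (𝓝 t) := by
      have : Tendsto (fun r => t - r) (𝓝 0) (𝓝 (t - 0)) :=
          (continuous_const.sub continuous_id).tendsto 0
      rw [sub_zero] at this
      exact this.mono_left nhdsWithin_le_nhds
    exact (hEd t ht).continuousAt.tendsto.comp h1
  have hlt : Tendsto W (𝓝[<] t) (𝓝 (J * (T t * J))) :=
    (hE0.comp hsub).mul ((hTd t ht).continuousAt.tendsto.mono_left nhdsWithin_le_nhds)
  have e0 : E t * J * J = c := tendsto_nhds_unique hl0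
    (tendsto_const_nhds.congr' (by filter_upwards [hmem0] with r hr; exact (hc r hr).symm))
  have et : J * (T t * J) = c := tendsto_nhds_unique hlt
    (tendsto_const_nhds.congr' (by filter_upwards [hmemt] with r hr; exact (hc r hr).symm))
  -- the two one-sided limits of the constant function `W`
  have h3 : J * (J * T t) = J * (J * E t) := by
    rw [← hTc t ht, et, ← e0, hEc t ht, mul_assoc, hEc t ht]
  ext x
  have h4 := congrArg (fun S : X →L[ℂ] X => S x) h3
  simp only [mul_apply_eq_comp] at h4
  have h5 : J (J (T t x - E t x)) = 0 := by rw [map_sub, map_sub, h4, sub_self]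
  exact sub_eq_zero.1 (hJ _ (hJ _ h5))

variable {T : ℝ → X →L[ℂ] X}

theorem IsBoundedHolomorphicSemigroup.continuousOn_norm (hT : IsBoundedHolomorphicSemigroup T) :
    ContinuousOn T (Ioi 0) ∧ ∃ M : ℝ, ∀ t : ℝ, 0 < t → ‖T t‖ ≤ M := by
  obtain ⟨δ, F, hδ0, hδ, hF, ⟨M, hM⟩, hFT⟩ := hT.extension
  have hmem : ∀ t : ℝ, 0 < t → (t : ℂ) ∈ openSector δ := fun t ht => ofReal_mem_openSector hδ0 ht
  refine ⟨?_, M, fun t ht => by rw [← hFT t ht]; exact hM _ (hmem t ht)⟩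
  exact (hF.continuousOn.comp (by fun_prop) hmem).congr fun t ht => (hFT t ht).symm

variable [CompleteSpace X]

/-- With `J = (1 + A)⁻¹` the Laplace transform at `1`, the semigroup law expresses `T(s) J` through
an integral over `(0, s)`. This gives continuity at `0` and differentiability in operator norm. -/
theorem IsBoundedHolomorphicSemigroup.mul_laplace (hT : IsBoundedHolomorphicSemigroup T)
    {s : ℝ} (hs : 0 < s) :
    T s * laplace T 1 = Complex.exp s •
      (laplace T 1 - ∫ t in (0 : ℝ)..s, Complex.exp (-(1 * t)) • T t) ∧
    T s * laplace T 1 = laplace T 1 * T s := by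
  obtain ⟨hc, M, hM⟩ := hT.continuousOn_norm
  have hi : IntegrableOn (fun t : ℝ => Complex.exp (-((1 : ℂ) * t)) • T t) (Ioi (0 : ℝ)) :=
    integrableOn_laplace hc hM (by simp)
  have h1 : T s * laplace T 1 =
      ∫ r in Ioi (0 : ℝ), Complex.exp (-((1 : ℂ) * r)) • (T s * T r) := by
    have := (ContinuousLinearMap.mul ℂ (X →L[ℂ] X) (T s)).integral_comp_comm hi
    simp only [map_smul, ContinuousLinearMap.mul_apply'] at this
    exact this.symm
  have h2 : laplace T 1 * T s =
      ∫ r in Ioi (0 : ℝ), Complex.exp (-((1 : ℂ) * r)) • (T r * T s) := by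
    have := ((ContinuousLinearMap.mul ℂ (X →L[ℂ] X)).flip (T s)).integral_comp_comm hi
    simp only [map_smul, ContinuousLinearMap.flip_apply, ContinuousLinearMap.mul_apply'] at this
    exact this.symm
  have hadd : ∀ r : ℝ, 0 < r → T s * T r = T (s + r) := fun r hr => (hT.add s r hs hr).symm
  constructor
  · have hsplit := intervalIntegral.integral_Ioi_sub_Ioi hi hs.le
    rw [h1, ← hsplit, laplace, sub_sub_cancel, ← integral_smul]
    have hpre := (measurePreserving_add_left volume s).setIntegral_preimage_emb
      (measurableEmbedding_addLeft s)
      (fun r : ℝ => Complex.exp s • (Complex.exp (-((1 : ℂ) * r)) • T r)) (Ioi s)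
    have hset : (fun r => s + r) ⁻¹' Ioi s = Ioi 0 := by
      ext r; simp
    rw [hset] at hpre
    rw [← hpre]
    refine setIntegral_congr_fun measurableSet_Ioi fun r hr => ?_
    rw [hadd r hr, smul_smul, ← Complex.exp_add]
    congr 2
    push_cast
    ring
  · rw [h1, h2]
    refine setIntegral_congr_fun measurableSet_Ioi fun r hr => ?_
    rw [hadd r hr, add_comm, hT.add r s hr hs]
    rfl

/-- The initial value problem for `T(s) J`: its derivative is `-A J T(s) = T(s) J - T(s)`. -/
theorem IsBoundedHolomorphicSemigroup.hasDerivAt_mul_laplace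
    (hT : IsBoundedHolomorphicSemigroup T) :
    (∀ s, 0 < s → HasDerivAt (fun s => T s * laplace T 1) (T s * laplace T 1 - T s) s) ∧
      Tendsto (fun s => T s * laplace T 1) (𝓝[>] 0) (𝓝 (laplace T 1)) := by
  obtain ⟨hc, M, hM⟩ := hT.continuousOn_norm
  set g : ℝ → X →L[ℂ] X := fun t => Complex.exp (-((1 : ℂ) * t)) • T t with hg
  have hgc : ContinuousOn g (Ioi 0) := by
    have h1 : ContinuousOn (fun t : ℝ => Complex.exp (-((1 : ℂ) * t))) (Ioi 0) := by fun_prop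
    exact h1.smul hc
  have hi : IntegrableOn g (Ioi (0 : ℝ)) := integrableOn_laplace hc hM (by simp)
  have hgM : ∀ t : ℝ, 0 < t → ‖g t‖ ≤ |M| := fun t ht => by
    refine (norm_laplace_integrand_le hM 1 ht).trans ?_
    have h1 : Real.exp (-(1 : ℂ).re * t) ≤ 1 := by
      rw [Real.exp_le_one_iff]; simp [ht.le]
    calc _ ≤ Real.exp (-(1 : ℂ).re * t) * |M| := by gcongr; exact le_abs_self M
      _ ≤ 1 * |M| := by gcongr
      _ = _ := one_mul _
  constructor
  · intro s hs
    have hii : IntervalIntegrable g volume 0 s :=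
      (intervalIntegrable_iff_integrableOn_Ioc_of_le hs.le).2 (hi.mono_set Ioc_subset_Ioi_self)
    have hd := intervalIntegral.integral_hasDerivAt_right hii
      (hgc.stronglyMeasurableAtFilter isOpen_Ioi s hs) (hgc.continuousAt (Ioi_mem_nhds hs))
    have hexp : HasDerivAt (fun s : ℝ => Complex.exp s) (Complex.exp s) s :=
      (Complex.hasDerivAt_exp (s : ℂ)).comp_ofReal
    have h1 := hexp.smul (hd.const_sub (laplace T 1))
    have h2 : HasDerivAt (fun s => T s * laplace T 1)
        (Complex.exp s • -g s + Complex.exp s • (laplace T 1 - ∫ t in (0 : ℝ)..s, g t)) s := by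
      refine h1.congr_of_eventuallyEq ?_
      filter_upwards [Ioi_mem_nhds hs] with r hr
      exact (hT.mul_laplace hr).1
    refine h2.congr_deriv ?_
    rw [← (hT.mul_laplace hs).1]
    have : Complex.exp s • -g s = -T s := by
      simp only [hg, smul_neg, smul_smul, ← Complex.exp_add]
      simp
    rw [this]
    abel
  · have hint : Tendsto (fun s => ∫ t in (0 : ℝ)..s, g t) (𝓝[>] 0) (𝓝 0) := by
      refine squeeze_zero_norm' (a := fun s => |M| * |s|) ?_ ?_
      · filter_upwards [self_mem_nhdsWithin] with s hs
        have := intervalIntegral.norm_integral_le_of_norm_le_const (a := 0) (b := s) (f := g)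
          (C := |M|) (fun t ht => by
            rw [uIoc_of_le (le_of_lt hs)] at ht
            exact hgM t ht.1)
        simpa using this
      · have : Tendsto (fun s : ℝ => |M| * |s|) (𝓝 0) (𝓝 (|M| * |0|)) :=
          (continuous_const.mul continuous_abs).tendsto 0
        rw [abs_zero, mul_zero] at this
        exact this.mono_left nhdsWithin_le_nhds
    have hexp : Tendsto (fun s : ℝ => Complex.exp s) (𝓝[>] 0) (𝓝 1) := by
      have : Tendsto (fun s : ℝ => Complex.exp s) (𝓝 0) (𝓝 (Complex.exp (0 : ℝ))) :=
        (Complex.continuous_exp.comp Complex.continuous_ofReal).tendsto 0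
      rw [Complex.ofReal_zero, Complex.exp_zero] at this
      exact this.mono_left nhdsWithin_le_nhds
    have h1 := hexp.smul (hint.const_sub (laplace T 1))
    rw [sub_zero, one_smul] at h1
    refine h1.congr' ?_
    filter_upwards [self_mem_nhdsWithin] with s hs
    exact (hT.mul_laplace hs).1.symm

end Uniqueness

section ExponentialCalculus

variable {X : Type*} [NormedAddCommGroup X] [NormedSpace ℂ X] [CompleteSpace X]
  {A : X →ₗ.[ℂ] X} {ω : ℝ}

theorem memElementary_exp_neg_mul (hω : ω < Real.pi / 2) {s : ℝ} (hs : 0 < s) :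
    MemElementary ω (fun z => Complex.exp (-(s * z))) :=
  (memElementary_exp_neg hω).dilate (by linarith [Real.pi_pos]) hs

theorem norm_exp_neg_ofReal_mul_le (hω : ω < Real.pi / 2) {s : ℝ} (hs : 0 < s) {z : ℂ}
    (hz : z ∈ openSector ω) :
    ‖Complex.exp (-(s * z))‖ ≤ Real.exp (-(Real.cos ω * s * ‖z‖)) := by
  refine (norm_exp_neg_le hω.le (mul_mem_openSector hs hz)).trans_eq ?_
  rw [norm_mul, Complex.norm_real, Real.norm_of_nonneg hs.le, mul_assoc]

theorem hasDerivAt_exp_neg_mul (z : ℂ) (s : ℝ) :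
    HasDerivAt (fun s : ℝ => Complex.exp (-(s * z))) (Complex.exp (-(s * z)) * -z) s := by
  have h1 : HasDerivAt (fun s : ℂ => -(s * z)) (-z) (s : ℂ) := by
    simpa using ((hasDerivAt_id (s : ℂ)).mul_const z).fun_neg
  exact h1.cexp.comp_ofReal

theorem norm_exp_sub_exp_neg_mul_le (hω : ω < Real.pi / 2) {s h : ℝ} (hs : 0 < s)
    (hh : |h| ≤ s / 2) {z : ℂ} (hz : z ∈ openSector ω) :
    ‖Complex.exp (-((s + h : ℝ) * z)) - Complex.exp (-(s * z))‖ ≤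
      ‖z‖ * Real.exp (-(Real.cos ω * (s / 2) * ‖z‖)) * |h| := by
  have hκ := cos_pos_of_mem hω hz
  rw [abs_le] at hh
  have := Convex.norm_image_sub_le_of_norm_hasDerivWithin_le (s := Icc (s / 2) (2 * s))
    (f := fun s : ℝ => Complex.exp (-(s * z))) (x := s) (y := s + h)
    (C := ‖z‖ * Real.exp (-(Real.cos ω * (s / 2) * ‖z‖)))
    (fun r _ => (hasDerivAt_exp_neg_mul z r).hasDerivWithinAt) (fun r hr => ?_) (convex_Icc _ _)
    ⟨by linarith, by linarith⟩ ⟨by linarith, by linarith⟩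
  · simpa using this
  · rw [norm_mul, norm_neg, mul_comm]
    have hr0 : 0 < r := by linarith [hr.1]
    have h1 := norm_exp_neg_ofReal_mul_le hω hr0 hz
    have h2 : Real.exp (-(Real.cos ω * r * ‖z‖)) ≤ Real.exp (-(Real.cos ω * (s / 2) * ‖z‖)) := by
      gcongr
      exact hr.1
    gcongr
    exact h1.trans h2

theorem memHInftyZero_exp_neg_mul_sub_mul (hω : ω < Real.pi / 2) {s : ℝ} (hs : 0 < s) :
    MemHInftyZero ω (fun z => (Complex.exp (-(s * z)) - 1) * (1 + z)⁻¹) ∧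
    ∃ c : ℝ, 0 < c ∧ ∀ s : ℝ, 0 < s → s ≤ 1 → ∀ w : ℂ, |w.im| < ω →
      ‖(Complex.exp (-(s * Complex.exp w)) - 1) * (1 + Complex.exp w)⁻¹‖ ≤
        c * Real.exp (-(1 * |w.re|)) := by
  have hπ : ω < Real.pi := by linarith [Real.pi_pos]
  obtain ⟨c, hc, hρ⟩ := exists_norm_one_add_inv_le hπ
  have hbound : ∀ s : ℝ, 0 < s → ∀ z ∈ openSector ω,
      ‖(Complex.exp (-(s * z)) - 1) * (1 + z)⁻¹‖ ≤ 2 * c * s * ‖z‖ ∧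
      ‖(Complex.exp (-(s * z)) - 1) * (1 + z)⁻¹‖ ≤ 2 * c * ‖z‖⁻¹ := by
    intro s hs z hz
    have hz0 : 0 < ‖z‖ := norm_pos_iff.2 hz.1
    obtain ⟨h1, h2⟩ := norm_exp_neg_sub_le hω (mul_mem_openSector hs hz)
    rw [norm_mul, Complex.norm_real, Real.norm_of_nonneg hs.le] at h2
    have h3 : ‖(1 + z)⁻¹‖ ≤ c := (hρ z hz).trans (div_le_self hc.le (by linarith))
    have h4 : ‖(1 + z)⁻¹‖ ≤ c * ‖z‖⁻¹ := by
      refine (hρ z hz).trans ?_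
      rw [div_eq_mul_inv]
      gcongr
      linarith
    rw [norm_mul]
    constructor
    · calc _ ≤ (2 * (s * ‖z‖)) * c := by gcongr
        _ = _ := by ring
    · calc _ ≤ 2 * (c * ‖z‖⁻¹) := by gcongr
        _ = _ := by ring
  refine ⟨memHInftyZero_of_bounds (C := 2 * c * s) (D := 2 * c) ?_ one_pos one_pos (by positivity)
    (by positivity) (fun z hz _ => ?_) (fun z hz _ => ?_), 2 * c, by positivity, ?_⟩
  · exact DifferentiableOn.mul (by fun_prop) (differentiableOn_one_add_inv hπ.le)
  · rw [Real.rpow_one]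
    exact (hbound s hs z hz).1
  · rw [Real.rpow_neg_one]
    exact (hbound s hs z hz).2
  · intro s hs hs1 w hw
    obtain ⟨h1, h2⟩ := hbound s hs _ (exp_mem_openSector hπ.le hw)
    rw [Complex.norm_exp] at h1 h2
    rw [one_mul]
    rcases le_total 0 w.re with h | h
    · rw [abs_of_nonneg h, Real.exp_neg]
      exact h2
    · rw [abs_of_nonpos h, neg_neg]
      refine h1.trans ?_
      have := Real.exp_pos w.re
      calc 2 * c * s * Real.exp w.re ≤ 2 * c * 1 * Real.exp w.re := by gcongr
        _ = _ := by rw [mul_one]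

namespace CalcAngle

/-- `e^{-sA} J → J` as `s → 0`. -/
theorem tendsto_calc_exp_neg_mul (H : CalcAngle A ω) (hω : ω < Real.pi / 2) :
    Tendsto (fun s : ℝ => elementaryCalc A ω (fun z => Complex.exp (-(s * z))) * unitResolvent A)
      (𝓝[>] 0) (𝓝 (unitResolvent A)) := by
  obtain ⟨c, hc, hb⟩ := (memHInftyZero_exp_neg_mul_sub_mul hω one_pos).2
  have hm := fun (s : ℝ) (hs : 0 < s) => (memHInftyZero_exp_neg_mul_sub_mul hω hs).1
  have hlim := H.tendsto_hCalc (l := 𝓝[>] (0 : ℝ))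
    (F := fun (s : ℝ) z => (Complex.exp (-(s * z)) - 1) * (1 + z)⁻¹) (f := fun _ => 0)
    (k := fun u => c * Real.exp (-(1 * |u|))) ((integrable_exp_neg_mul_abs one_pos).const_mul _)
    (by filter_upwards [self_mem_nhdsWithin] with s hs; exact (hm s hs).1)
    (by
      filter_upwards [Ioc_mem_nhdsGT (zero_lt_one' ℝ)] with s hs w hw
      exact hb s hs.1 hs.2 w hw)
    (fun z _ => by
      have : Continuous (fun s : ℝ => (Complex.exp (-(s * z)) - 1) * (1 + z)⁻¹) := by fun_prop
      have h2 := this.tendsto 0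
      simp only [Complex.ofReal_zero, zero_mul, neg_zero, Complex.exp_zero, sub_self] at h2
      exact h2.mono_left nhdsWithin_le_nhds)
  have h0 : hCalc A (midAngle A ω) (fun _ => 0) = 0 := by
    rw [H.hCalc_congr' (g := fun z => (0 : ℂ) * 0) (fun z _ => by ring), hCalc_const_mul, zero_smul]
  rw [h0] at hlim
  have h2 := hlim.add_const (unitResolvent A)
  rw [zero_add] at h2
  refine h2.congr' ?_
  filter_upwards [self_mem_nhdsWithin] with s hs
  have hs : 0 < s := hs
  have he := memElementary_exp_neg_mul hω hs
  rw [← H.calc_of_memHInftyZero (hm s hs), H.calc_mul (he.sub (memElementary_const 1))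
    memElementary_one_add_inv, H.calc_sub he (memElementary_const 1), H.calc_const,
    H.calc_one_add_inv, one_smul, sub_mul, one_mul, sub_add_cancel]

/-- The functions `e^{-sA} J` satisfy the same differential equation as `T(s) J`. -/
theorem hasDerivAt_calc_exp_neg_mul (H : CalcAngle A ω) (hω : ω < Real.pi / 2) {s : ℝ}
    (hs : 0 < s) :
    HasDerivAt (fun s : ℝ => elementaryCalc A ω (fun z => Complex.exp (-(s * z))) *
      unitResolvent A) (elementaryCalc A ω (fun z => Complex.exp (-(s * z))) * unitResolvent A -
        elementaryCalc A ω (fun z => Complex.exp (-(s * z)))) s := by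
  have hπ := H.lt_pi
  obtain ⟨c, hc, hρ⟩ := exists_norm_one_add_inv_le hπ
  have hκ : 0 < Real.cos ω := cos_pos_of_mem hω (one_mem_openSector H.pos)
  have he := fun (r : ℝ) (hr : 0 < r) => memElementary_exp_neg_mul hω hr
  have hρm := memElementary_one_add_inv (ω := ω)
  set κ := Real.cos ω * (s / 2) with hκd
  have hκ' : 0 < κ := by positivity
  set F : ℝ → ℂ → ℂ := fun h z =>
    ((h⁻¹ : ℝ) : ℂ) * ((Complex.exp (-((s + h : ℝ) * z)) - Complex.exp (-(s * z))) * (1 + z)⁻¹)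
    with hF
  have hnear : ∀ᶠ h : ℝ in 𝓝[≠] 0, h ≠ 0 ∧ |h| ≤ s / 2 := by
    refine (eventually_mem_nhdsWithin (a := (0 : ℝ)) (s := {0}ᶜ)).and ?_
    have : Metric.closedBall (0 : ℝ) (s / 2) ∈ 𝓝[≠] (0 : ℝ) :=
      nhdsWithin_le_nhds (Metric.closedBall_mem_nhds _ (by positivity))
    filter_upwards [this] with h hh
    simpa using hh
  have hFE : ∀ h : ℝ, |h| ≤ s / 2 → MemElementary ω (F h) := fun h hh => by
    have : 0 < s + h := by rw [abs_le] at hh; linarith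
    exact (((he _ this).sub (he s hs)).mul hρm hπ).const_mul _
  have hFb : ∀ h : ℝ, h ≠ 0 → |h| ≤ s / 2 → ∀ w : ℂ, |w.im| < ω →
      ‖F h (Complex.exp w)‖ ≤ c * (1 + 2 / κ ^ 2) * Real.exp (-(1 * |w.re|)) := by
    intro h h0 hh w hw
    have hz := exp_mem_openSector hπ.le hw
    have h1 := norm_exp_sub_exp_neg_mul_le hω hs hh hz
    have h2 : ‖(1 + Complex.exp w)⁻¹‖ ≤ c :=
      (hρ _ hz).trans (div_le_self hc.le (le_add_of_nonneg_right (norm_nonneg _)))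
    rw [Complex.norm_exp] at h1
    simp only [hF]
    rw [norm_mul, norm_mul, Complex.norm_real, norm_inv, Real.norm_eq_abs]
    have h3 := mul_exp_neg_mul_le hκ' w.re
    have h4 : 0 < |h| := abs_pos.2 h0
    calc _ ≤ |h|⁻¹ * (Real.exp w.re * Real.exp (-(κ * Real.exp w.re)) * |h| * c) := by gcongr
      _ = c * (Real.exp w.re * Real.exp (-(κ * Real.exp w.re))) := by field_simp
      _ ≤ c * ((1 + 2 / κ ^ 2) * Real.exp (-(1 * |w.re|))) := by gcongr
      _ = _ := by ring
  have hFm : ∀ h : ℝ, h ≠ 0 → |h| ≤ s / 2 → MemHInftyZero ω (F h) := fun h h0 hh =>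
    memHInftyZero_of_exp_bound ((hFE h hh).differentiableOn hπ.le) one_pos (hFb h h0 hh)
  set G : ℂ → ℂ := fun z => Complex.exp (-(s * z)) * -z * (1 + z)⁻¹ with hG
  have hGm : MemHInftyZero ω G := by
    have h1 := (((memHInftyZero_psiExp hω).dilate hs).const_mul (-(s : ℂ)⁻¹))
    refine (hρm.mul_memHInftyZero h1 hπ).congr fun z _ => ?_
    have : (s : ℂ) ≠ 0 := by exact_mod_cast hs.ne'
    simp only [hG, psiExp]
    field_simp
  have hlim := H.tendsto_hCalc (l := 𝓝[≠] (0 : ℝ)) (F := F) (f := G)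
    (k := fun u => c * (1 + 2 / κ ^ 2) * Real.exp (-(1 * |u|)))
    ((integrable_exp_neg_mul_abs one_pos).const_mul _)
    (hnear.mono fun h hh => (hFm h hh.1 hh.2).1) (hnear.mono fun h hh => hFb h hh.1 hh.2)
    (fun z _ => by
      have h1 := hasDerivAt_iff_tendsto_slope_zero.1 (hasDerivAt_exp_neg_mul z s)
      refine (h1.mul_const ((1 + z)⁻¹)).congr fun h => ?_
      simp only [hF, Complex.real_smul]
      ring)
  rw [hasDerivAt_iff_tendsto_slope_zero]
  have hval : hCalc A (midAngle A ω) G = elementaryCalc A ω (fun z => Complex.exp (-(s * z))) *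
      unitResolvent A - elementaryCalc A ω (fun z => Complex.exp (-(s * z))) := by
    rw [← H.calc_of_memHInftyZero hGm, ← H.calc_one_add_inv, ← H.calc_mul (he s hs) hρm,
      ← H.calc_sub ((he s hs).mul hρm hπ) (he s hs)]
    refine H.calc_congr hGm.memElementary fun z hz => ?_
    have := one_add_ne_zero_of_mem hπ.le hz
    simp only [hG]
    field_simp
    ring
  rw [← hval]
  refine hlim.congr' (hnear.mono fun h hh => ?_)
  have hpos : 0 < s + h := by have := abs_le.1 hh.2; linarith
  rw [← H.calc_of_memHInftyZero (hFm h hh.1 hh.2), hF]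
  simp only []
  rw [H.calc_const_mul (((he _ hpos).sub (he s hs)).mul hρm hπ),
    H.calc_mul ((he _ hpos).sub (he s hs)) hρm, H.calc_sub (he _ hpos) (he s hs),
    H.calc_one_add_inv, sub_mul, Complex.coe_smul]

/-- The semigroup generated by `-A` is given by the functional calculus: `T(t) = e^{-tA}`. -/
theorem semigroup_eq_calc (H : CalcAngle A ω) (hω : ω < Real.pi / 2) {T : ℝ → X →L[ℂ] X}
    (hT : IsBoundedHolomorphicSemigroup T) (hg : IsGeneratorOf (-A) T) {t : ℝ} (ht : 0 < t) :
    T t = elementaryCalc A ω (fun z => Complex.exp (-(t * z))) := by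
  have hJ : laplace T 1 = unitResolvent A := by
    have h1 := (hT.exists_isOpResolvent hg).2 1 one_pos
    rw [Complex.ofReal_one] at h1
    exact h1.eq.symm
  obtain ⟨h1, h2⟩ := hT.hasDerivAt_mul_laplace
  rw [hJ] at h1 h2
  refine eq_of_hasDerivAt_mul (J := unitResolvent A)
    (E := fun t => elementaryCalc A ω (fun z => Complex.exp (-(t * z))))
    (fun x hx => H.unitResolvent_injective hx) h1
    (fun s hs => H.hasDerivAt_calc_exp_neg_mul hω hs) h2 (H.tendsto_calc_exp_neg_mul hω)
    (fun s hs => by rw [← hJ]; exact (hT.mul_laplace hs).2) (fun s hs => ?_) ht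
  have := H.calc_comm (memElementary_exp_neg_mul hω hs) memElementary_one_add_inv
  rwa [H.calc_one_add_inv] at this

/-- `A T(t) x = t⁻¹ ψ(tA) x` with `ψ(z) = z e^{-z}`. -/
theorem applyOp_semigroup (H : CalcAngle A ω) (hω : ω < Real.pi / 2) {T : ℝ → X →L[ℂ] X}
    (hT : IsBoundedHolomorphicSemigroup T) (hg : IsGeneratorOf (-A) T) {t : ℝ} (ht : 0 < t)
    (x : X) : applyOp A (T t x) = (t : ℂ)⁻¹ • elementaryCalc ((t : ℂ) • A) ω psiExp x := by
  have hψ := memHInftyZero_psiExp hω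
  have hm : MemElementary ω (fun z => z * Complex.exp (-(t * z))) := by
    refine ((hψ.dilate ht).const_mul (t : ℂ)⁻¹).memElementary.congr fun z _ => ?_
    have : (t : ℂ) ≠ 0 := by exact_mod_cast ht.ne'
    simp only [psiExp]
    field_simp
  obtain ⟨h, e⟩ := H.apply_calc (memElementary_exp_neg_mul hω ht) hm x
  rw [H.semigroup_eq_calc hω hT hg ht, applyOp, dif_pos h, e,
    H.calc_smul hψ.memElementary ht, ← smul_apply,
    ← H.calc_const_mul (hψ.dilate ht).memElementary]
  congr 1
  refine H.calc_congr hm fun z _ => ?_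
  have : (t : ℂ) ≠ 0 := by exact_mod_cast ht.ne'
  simp only [psiExp]
  field_simp

theorem homogeneousSeminorm_eq (H : CalcAngle A ω) (hω : ω < Real.pi / 2) {T : ℝ → X →L[ℂ] X}
    (hT : IsBoundedHolomorphicSemigroup T) (hg : IsGeneratorOf (-A) T) {p : ℝ≥0∞} (hp : 1 ≤ p)
    (μ : ℝ) : homogeneousSeminorm A T p μ = calcSeminorm A ω p μ psiExp := by
  ext x
  exact weightedNorm_congr hp μ fun t ht => by rw [H.applyOp_semigroup hω hT hg ht]

end CalcAngle

end ExponentialCalculus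

/-! ### Equivalence of seminorms and the `K`-functional -/

section Seminorms

theorem EquivSeminorms.lt_top_iff {X : Type*} {N M : X → ℝ≥0∞} (h : EquivSeminorms N M) (x : X) :
    N x < ∞ ↔ M x < ∞ := by
  obtain ⟨C, _, h⟩ := h
  exact ⟨fun hN => (h x).2.trans_lt (ENNReal.mul_lt_top ENNReal.coe_lt_top hN),
    fun hM => (h x).1.trans_lt (ENNReal.mul_lt_top ENNReal.coe_lt_top hM)⟩

theorem eLpNorm_exp_neg_mul_abs_lt_top {p : ℝ≥0∞} (hp : 1 ≤ p) {β : ℝ} (hβ : 0 < β) :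
    eLpNorm (fun u : ℝ => Real.exp (-(β * |u|))) p volume < ∞ := by
  by_cases hpt : p = ∞
  · subst hpt
    refine (memLp_top_of_bound (by fun_prop) 1 (Eventually.of_forall fun u => ?_)).2
    rw [Real.norm_of_nonneg (Real.exp_pos _).le, Real.exp_le_one_iff]
    have := mul_nonneg hβ.le (abs_nonneg u)
    linarith
  · have h0 : p ≠ 0 := (zero_lt_one.trans_le hp).ne'
    have hpos : 0 < p.toReal := ENNReal.toReal_pos h0 hpt
    rw [eLpNorm_lt_top_iff_lintegral_rpow_enorm_lt_top h0 hpt]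
    have e : ∀ u : ℝ, ‖Real.exp (-(β * |u|))‖ₑ ^ p.toReal =
        ENNReal.ofReal (Real.exp (-(β * p.toReal * |u|))) := fun u => by
      rw [Real.enorm_eq_ofReal (Real.exp_pos _).le, ENNReal.ofReal_rpow_of_pos (Real.exp_pos _),
        ← Real.exp_mul]
      congr 2
      ring
    simp only [e]
    exact (integrable_exp_neg_mul_abs (mul_pos hβ hpos)).lintegral_lt_top

theorem eLpNorm_lt_top_of_le_exp {E : Type*} [NormedAddCommGroup E] {p : ℝ≥0∞} (hp : 1 ≤ p)
    {β C : ℝ} (hβ : 0 < β) {f : ℝ → E} (h : ∀ u, ‖f u‖ ≤ C * Real.exp (-(β * |u|))) :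
    eLpNorm f p volume < ∞ := by
  refine (eLpNorm_le_mul_eLpNorm_of_ae_le_mul (g := fun u : ℝ => Real.exp (-(β * |u|))) (c := C)
    (Eventually.of_forall fun u => ?_) p).trans_lt
    (ENNReal.mul_lt_top ENNReal.ofReal_lt_top (eLpNorm_exp_neg_mul_abs_lt_top hp hβ))
  rw [Real.norm_of_nonneg (Real.exp_pos _).le]
  exact h u

variable {X : Type*} [NormedAddCommGroup X] [NormedSpace ℂ X] {A : X →ₗ.[ℂ] X} {ω : ℝ}
  {p : ℝ≥0∞} {T : ℝ → X →L[ℂ] X}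

theorem kFunctional_le {t : ℝ} (ht : 0 ≤ t) (x : X) (z : A.domain) :
    kFunctional A t x ≤ ‖x - (z : X)‖ + t * (‖(z : X)‖ + ‖A z‖) :=
  ciInf_le ⟨0, by rintro _ ⟨z, rfl⟩; positivity⟩ z

theorem kFunctional_nonneg {t : ℝ} (ht : 0 ≤ t) (x : X) : 0 ≤ kFunctional A t x :=
  Real.iInf_nonneg fun z => by positivity

namespace CalcAngle

/-- The `K`-functional is comparable to `‖x - J_t x‖`, `J_t = (1 + tA)⁻¹`, up to the term
`min(1, t) ‖x‖`, which comes from the inhomogeneous part of the graph norm. -/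
theorem exists_kFunctional_bounds (H : CalcAngle A ω) :
    ∃ M : ℝ, 0 < M ∧ ∀ (x : X) (u : ℝ),
      ‖x - unitResolvent ((Real.exp u : ℂ) • A) x‖ ≤ M * kFunctional A (Real.exp u) x ∧
      kFunctional A (Real.exp u) x ≤ 2 * ‖x - unitResolvent ((Real.exp u : ℂ) • A) x‖ +
        M * ‖x‖ * min 1 (Real.exp u) := by
  obtain ⟨M, hM, hJ⟩ := H.norm_unitResolvent_le
  refine ⟨1 + M, by positivity, fun x u => ?_⟩
  have ht := Real.exp_pos u
  set J := unitResolvent ((Real.exp u : ℂ) • A) with hJd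
  have hJx : ∀ y, ‖J y‖ ≤ M * ‖y‖ := fun y => J.le_of_opNorm_le (hJ u) y
  constructor
  · rw [kFunctional, Real.mul_iInf_of_nonneg (by positivity)]
    refine le_ciInf fun z => ?_
    have e : x - J x = (x - z) - J (x - z) + (Real.exp u : ℂ) • J (A z) := by
      rw [H.dilate_unitResolvent_sub u z, map_sub]
      abel
    rw [e]
    have h1 := hJx (x - z)
    have h2 := hJx (A z)
    have h3 : ‖(Real.exp u : ℂ) • J (A z)‖ ≤ Real.exp u * (M * ‖A z‖) := by
      rw [norm_smul, Complex.norm_real, Real.norm_of_nonneg ht.le]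
      gcongr
    have h4 := norm_add_le ((x - z) - J (x - z)) ((Real.exp u : ℂ) • J (A z))
    have h5 := norm_sub_le (x - z) (J (x - z))
    have h6 : 0 ≤ Real.exp u * ((1 + M) * ‖(z : X)‖ + ‖A z‖) := by positivity
    nlinarith
  · set z : A.domain := ⟨J x, H.dilate_unitResolvent_mem u x⟩ with hz
    have h1 := kFunctional_le ht.le x z
    have h2 := kFunctional_le (A := A) ht.le x 0
    have h3 : Real.exp u * ‖A z‖ = ‖x - J x‖ := by
      have h4 := (H.smul ht).apply_unitResolvent x
      have h5 : (Real.exp u : ℂ) • A z = x - J x := h4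
      rw [← h5, norm_smul, Complex.norm_real, Real.norm_of_nonneg ht.le]
    have h4 : ‖(z : X)‖ ≤ M * ‖x‖ := hJx x
    simp only [ZeroMemClass.coe_zero, LinearPMap.map_zero, norm_zero, add_zero, mul_zero, sub_zero]
      at h2
    have h7 := norm_nonneg (x - J x)
    have h8 := norm_nonneg x
    rcases le_total 1 (Real.exp u) with h | h
    · rw [min_eq_left h]
      nlinarith
    · rw [min_eq_right h]
      have h5 : ‖x - (z : X)‖ = ‖x - J x‖ := rfl
      rw [h5, mul_add, h3] at h1
      have h6 : Real.exp u * ‖(z : X)‖ ≤ Real.exp u * (M * ‖x‖) := by gcongr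
      nlinarith [mul_nonneg ht.le h8]

/-- The kernel and the range of a sectorial operator intersect trivially. -/
theorem eq_zero_of_mem_range (H : CalcAngle A ω) {x : X} (hx : x ∈ opRange A)
    (hJ : unitResolvent A x = x) : x = 0 := by
  have hD : x ∈ A.domain := hJ ▸ H.unitResolvent_mem x
  have hA : A ⟨x, hD⟩ = 0 := by
    have h1 := H.apply_unitResolvent x
    have h2 : (⟨unitResolvent A x, H.unitResolvent_mem x⟩ : A.domain) = ⟨x, hD⟩ := Subtype.ext hJ
    rw [h2, hJ, sub_self] at h1
    exact h1
  have h1 := H.tendsto_unitResolvent_atTop_of_mem_range hx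
  refine tendsto_nhds_unique (tendsto_const_nhds.congr fun v => ?_) h1
  have h2 := H.dilate_unitResolvent_sub v ⟨x, hD⟩
  rw [hA, map_zero, smul_zero] at h2
  exact sub_eq_zero.1 h2.symm

variable [CompleteSpace X]

theorem calc_psiTwo_dilate (H : CalcAngle A ω) (u : ℝ) :
    elementaryCalc A ω (fun z => psiTwo ((Real.exp u : ℝ) * z)) =
      1 - unitResolvent ((Real.exp u : ℂ) • A) := by
  have h := H.calc_one_sub_inv_pow u 1
  rw [pow_one] at h
  rw [← h]
  refine H.calc_congr ((memElementary_psiTwo H.lt_pi).dilate H.lt_pi (Real.exp_pos u))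
    fun z hz => ?_
  rw [psiTwo_eq (one_add_ne_zero_of_mem H.lt_pi.le (mul_mem_openSector (Real.exp_pos u) hz)),
    pow_one]

/-- The space of the `K`-method is the space of the function `ψ₂`. The weighted norm of `min(1, t)`
is finite exactly because `0 < θ < 1`. -/
theorem kSpace_eq (H : CalcAngle A ω) (hp : 1 ≤ p) {μ : ℝ} (h0 : 0 < thetaOf p μ)
    (h1 : thetaOf p μ < 1) : kSpace A p μ = calcSpace A ω p μ psiTwo := by
  obtain ⟨M, hM, hb⟩ := H.exists_kFunctional_bounds
  have hψ := memElementary_psiTwo H.lt_pi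
  set θ := thetaOf p μ with hθ
  ext x
  change weightedNorm p μ _ < ∞ ↔ calcSeminorm A ω p μ psiTwo x < ∞
  rw [weightedNorm_eq hp, H.calcSeminorm_eq_calcOrbit hp μ hψ, ← hθ]
  have hexp : ∀ u : ℝ, Real.exp ((1 - θ) * u) * (Real.exp u)⁻¹ = Real.exp (-(θ * u)) := fun u => by
    rw [← Real.exp_neg, ← Real.exp_add]
    ring_nf
  have hK : ∀ u : ℝ, ‖Real.exp ((1 - θ) * u) * ((Real.exp u)⁻¹ * kFunctional A (Real.exp u) x)‖ =
      Real.exp (-(θ * u)) * kFunctional A (Real.exp u) x := fun u => by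
    rw [← mul_assoc, hexp, Real.norm_of_nonneg]
    exact mul_nonneg (Real.exp_pos _).le (kFunctional_nonneg (Real.exp_pos u).le x)
  have hO : ∀ u : ℝ, ‖calcOrbit A ω θ psiTwo x u‖ =
      Real.exp (-(θ * u)) * ‖x - unitResolvent ((Real.exp u : ℂ) • A) x‖ := fun u => by
    rw [calcOrbit, norm_smul, Complex.norm_real, Real.norm_of_nonneg (Real.exp_pos _).le,
      H.calc_psiTwo_dilate]
    rfl
  constructor
  · intro h
    refine (eLpNorm_le_mul_eLpNorm_of_ae_le_mul (c := M) (Eventually.of_forall fun u => ?_)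
      p).trans_lt (ENNReal.mul_lt_top ENNReal.ofReal_lt_top h)
    rw [hK, hO, mul_left_comm]
    exact mul_le_mul_of_nonneg_left (hb x u).1 (Real.exp_pos _).le
  · intro h
    set m : ℝ → ℝ := fun u => Real.exp (-(θ * u)) * (M * ‖x‖ * min 1 (Real.exp u)) with hm
    have hβ : 0 < min θ (1 - θ) := lt_min h0 (sub_pos.2 h1)
    have hmb : ∀ u, ‖m u‖ ≤ M * ‖x‖ * Real.exp (-(min θ (1 - θ) * |u|)) := by
      intro u
      have hmin : 0 < min 1 (Real.exp u) := lt_min one_pos (Real.exp_pos u)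
      rw [Real.norm_of_nonneg (by positivity), hm]
      simp only []
      rw [mul_left_comm]
      gcongr
      rcases le_total 0 u with hu | hu
      · rw [min_eq_left (Real.one_le_exp hu), mul_one, abs_of_nonneg hu]
        gcongr
        exact min_le_left _ _
      · rw [min_eq_right (Real.exp_le_one_iff.2 hu), abs_of_nonpos hu, ← Real.exp_add]
        gcongr
        have := mul_le_mul_of_nonneg_right (min_le_right θ (1 - θ)) (neg_nonneg.2 hu)
        nlinarith
    have hmt : eLpNorm m p volume < ∞ := eLpNorm_lt_top_of_le_exp hp hβ hmb
    have hOc := H.continuous_calcOrbit hψ θ x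
    have hsum : eLpNorm (fun u => 2 * ‖calcOrbit A ω θ psiTwo x u‖ + m u) p volume < ∞ := by
      refine (eLpNorm_add_le (by fun_prop) (by fun_prop) hp).trans_lt
        (ENNReal.add_lt_top.2 ⟨?_, hmt⟩)
      refine (eLpNorm_le_mul_eLpNorm_of_ae_le_mul (c := 2)
        (g := calcOrbit A ω θ psiTwo x) (Eventually.of_forall fun u => ?_) p).trans_lt
        (ENNReal.mul_lt_top ENNReal.ofReal_lt_top h)
      rw [norm_mul, norm_norm]
      norm_num
    refine (eLpNorm_mono_real fun u => ?_).trans_lt hsum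
    rw [hK, hO, hm]
    have := mul_le_mul_of_nonneg_left (hb x u).2 (Real.exp_pos (-(θ * u))).le
    linarith

/-- For `θ = 0` and `p = ∞` the seminorms are finite everywhere. -/
theorem calcSpace_top_eq_univ (H : CalcAngle A ω) {ψ : ℂ → ℂ} (hψ : MemElementary ω ψ) :
    calcSpace A ω ∞ 1 ψ = univ := by
  obtain ⟨K, hK, hb⟩ := H.exists_norm_calc_dilate_le hψ
  refine eq_univ_of_forall fun x => ?_
  change calcSeminorm A ω ∞ 1 ψ x < ∞
  rw [H.calcSeminorm_eq_calcOrbit le_top 1 hψ, thetaOf_top_one]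
  refine (memLp_top_of_bound (H.continuous_calcOrbit hψ 0 x).aestronglyMeasurable (K * ‖x‖)
    (Eventually.of_forall fun u => ?_)).2
  rw [calcOrbit, zero_mul, neg_zero, Real.exp_zero, Complex.ofReal_one, one_smul]
  exact ContinuousLinearMap.le_of_opNorm_le _ (hb u) x

/-! ### The limiting parameter `θ = 0` -/

/-- For `t ≥ 1` the norms `‖ψ₂(tA) x‖` are bounded below by a multiple of `‖ψ₂(A) x‖`, as `ψ₂` is a
multiple of `ψ₂(t ·)` in the calculus, with a bounded factor. -/
theorem exists_norm_sub_unitResolvent_le (H : CalcAngle A ω) :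
    ∃ C : ℝ, 0 < C ∧ ∀ (x : X) (u : ℝ), 0 ≤ u →
      ‖x - unitResolvent A x‖ ≤ C * ‖x - unitResolvent ((Real.exp u : ℂ) • A) x‖ := by
  set J := unitResolvent A with hJ
  refine ⟨‖J‖ + ‖(1 : X →L[ℂ] X) - J‖ + 1, by positivity, fun x u hu => ?_⟩
  have ht := Real.exp_pos u
  have htu : 1 ≤ Real.exp u := Real.one_le_exp hu
  have hρ := memElementary_one_add_inv (ω := ω)
  have hρu := memElementary_dilate_inv H.lt_pi ht
  have h1 := memElementary_const (ω := ω) 1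
  have key : (1 : X →L[ℂ] X) - J = ((Real.exp u : ℂ)⁻¹ • J + (1 - J)) *
      (1 - unitResolvent ((Real.exp u : ℂ) • A)) := by
    rw [hJ, ← H.calc_dilate_inv ht, ← H.calc_one_add_inv, ← one_smul ℂ (1 : X →L[ℂ] X),
      ← H.calc_const, ← H.calc_const_mul hρ, ← H.calc_sub h1 hρ, ← H.calc_sub h1 hρu,
      ← H.calc_add (hρ.const_mul _) (h1.sub hρ),
      ← H.calc_mul ((hρ.const_mul _).add (h1.sub hρ)) (h1.sub hρu)]
    refine H.calc_congr (h1.sub hρ) fun z hz => ?_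
    have e1 := one_add_ne_zero_of_mem H.lt_pi.le hz
    have e2 := one_add_ne_zero_of_mem H.lt_pi.le (mul_mem_openSector ht hz)
    have e3 : ((Real.exp u : ℝ) : ℂ) ≠ 0 := by exact_mod_cast ht.ne'
    generalize ((Real.exp u : ℝ) : ℂ) = t at e2 e3
    have e4 : 1 - (1 + t * z)⁻¹ = t * z * (1 + t * z)⁻¹ := by
      rw [eq_mul_inv_iff_mul_eq₀ e2, sub_mul, inv_mul_cancel₀ e2]; ring
    have e5 : 1 - (1 + z)⁻¹ = z * (1 + z)⁻¹ := by
      rw [eq_mul_inv_iff_mul_eq₀ e1, sub_mul, inv_mul_cancel₀ e1]; ring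
    have e6 : t⁻¹ * (1 + z)⁻¹ + z * (1 + z)⁻¹ = t⁻¹ * (1 + t * z) * (1 + z)⁻¹ := by
      rw [mul_add, ← mul_assoc, inv_mul_cancel₀ e3]; ring
    simp only [e4, e5, e6]
    calc z * (1 + z)⁻¹ = (t⁻¹ * t) * ((1 + t * z) * (1 + t * z)⁻¹) * (z * (1 + z)⁻¹) := by
          rw [inv_mul_cancel₀ e3, mul_inv_cancel₀ e2, one_mul, one_mul]
      _ = _ := by ring
  have h2 := congrArg (fun S : X →L[ℂ] X => S x) key
  simp only [sub_apply, mul_apply_eq_comp, one_apply_eq_self] at h2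
  rw [h2]
  refine ContinuousLinearMap.le_of_opNorm_le _ ?_ _
  refine (norm_add_le _ _).trans ?_
  rw [norm_smul, norm_inv, Complex.norm_real, Real.norm_of_nonneg ht.le]
  have h3 : (Real.exp u)⁻¹ * ‖J‖ ≤ ‖J‖ :=
    mul_le_of_le_one_left (norm_nonneg _) (inv_le_one_of_one_le₀ htu)
  linarith

/-- For `θ = 0` and `p < ∞` the seminorm of `ψ₂` is finite only at the kernel of `A`, since
`‖ψ₂(tA) x‖` does not tend to zero as `t → ∞` off the kernel and the measure is `dt/t`. -/
theorem unitResolvent_eq_of_psiTwo (H : CalcAngle A ω) (hp : 1 ≤ p) (hpt : p ≠ ∞) {x : X}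
    (hx : calcSeminorm A ω p (p.toReal - 1) psiTwo x < ∞) : unitResolvent A x = x := by
  obtain ⟨C, hC, hb⟩ := H.exists_norm_sub_unitResolvent_le
  have h0 : p ≠ 0 := (zero_lt_one.trans_le hp).ne'
  have hpos : 0 < p.toReal := ENNReal.toReal_pos h0 hpt
  by_contra hne
  rw [H.calcSeminorm_eq_calcOrbit hp _ (memElementary_psiTwo H.lt_pi), thetaOf_sub_one hp hpt,
    eLpNorm_lt_top_iff_lintegral_rpow_enorm_lt_top h0 hpt] at hx
  refine hx.ne (top_le_iff.1 ?_)
  have hc : 0 < ‖x - unitResolvent A x‖ := norm_pos_iff.2 (sub_ne_zero.2 (Ne.symm hne))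
  calc (∞ : ℝ≥0∞) = ∫⁻ _ in Ioi (0 : ℝ), ENNReal.ofReal (C⁻¹ * ‖x - unitResolvent A x‖) ^
      p.toReal := by
        rw [setLIntegral_const, Real.volume_Ioi, ENNReal.mul_top]
        have h1 : 0 < ENNReal.ofReal (C⁻¹ * ‖x - unitResolvent A x‖) :=
          ENNReal.ofReal_pos.2 (by positivity)
        exact (ENNReal.rpow_pos h1 ENNReal.ofReal_ne_top).ne'
    _ ≤ ∫⁻ u in Ioi (0 : ℝ), ‖calcOrbit A ω 0 psiTwo x u‖ₑ ^ p.toReal := by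
        refine setLIntegral_mono' measurableSet_Ioi fun u hu => ?_
        refine ENNReal.rpow_le_rpow ?_ hpos.le
        rw [← ofReal_norm]
        refine ENNReal.ofReal_le_ofReal ?_
        rw [inv_mul_le_iff₀ hC, calcOrbit, zero_mul, neg_zero, Real.exp_zero, Complex.ofReal_one,
          one_smul, H.calc_psiTwo_dilate]
        exact hb x u (le_of_lt hu)
    _ ≤ _ := setLIntegral_le_lintegral _ _

/-- The resolvent as an average of the semigroup, in the exponential coordinate. -/
theorem unitResolvent_eq_integral (hT : IsBoundedHolomorphicSemigroup T)
    (hg : IsGeneratorOf (-A) T) (u : ℝ) (x : X) :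
    Integrable (fun v : ℝ => (Real.exp (v - u) * Real.exp (-Real.exp (v - u))) •
      (x - T (Real.exp v) x)) ∧
    ∫ v : ℝ, (Real.exp (v - u) * Real.exp (-Real.exp (v - u))) • (x - T (Real.exp v) x) =
      x - unitResolvent ((Real.exp u : ℂ) • A) x := by
  obtain ⟨hc, M, hM⟩ := hT.continuousOn_norm
  set k : ℝ → ℝ := fun v => Real.exp (v - u) * Real.exp (-Real.exp (v - u)) with hk
  have hki : Integrable k := by
    have h1 : Integrable (fun r : ℝ => Real.exp r * Real.exp (-Real.exp r)) := by
      refine Integrable.mono' ((integrable_exp_neg_mul_abs one_pos).const_mul (1 + 2 / 1 ^ 2))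
        (by fun_prop) (Eventually.of_forall fun r => ?_)
      rw [Real.norm_of_nonneg (by positivity)]
      have := mul_exp_neg_mul_le one_pos r
      rwa [one_mul] at this
    exact h1.comp_sub_right u
  have hk1 : ∫ v, k v = 1 := by
    have h1 := integral_comp_exp_univ (fun r : ℝ => Real.exp (-r))
    rw [integral_exp_neg_Ioi_zero] at h1
    rw [hk, integral_sub_right_eq_self (fun r : ℝ => Real.exp r * Real.exp (-Real.exp r)), h1]
    rfl
  have hTc : Continuous (fun v : ℝ => T (Real.exp v) x) :=
    (hc.comp_continuous Real.continuous_exp (fun v => Real.exp_pos v)).clm_apply continuous_const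
  have hTi : Integrable (fun v => k v • T (Real.exp v) x) := by
    refine Integrable.mono' (hki.mul_const (M * ‖x‖))
      ((show Continuous k by simp only [hk]; fun_prop).smul hTc).aestronglyMeasurable
      (Eventually.of_forall fun v => ?_)
    rw [norm_smul, Real.norm_of_nonneg (by simp only [hk]; positivity)]
    refine mul_le_mul_of_nonneg_left ?_ (by simp only [hk]; positivity)
    exact (T (Real.exp v)).le_of_opNorm_le (hM _ (Real.exp_pos v)) x
  have hJ : unitResolvent ((Real.exp u : ℂ) • A) x = ∫ v, k v • T (Real.exp v) x := by
    have h1 := (hT.exists_isOpResolvent hg).2 (Real.exp (-u)) (Real.exp_pos _)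
    have ht : ((Real.exp u : ℝ) : ℂ) ≠ 0 := by exact_mod_cast (Real.exp_pos u).ne'
    have h2 : IsOpResolvent (((Real.exp u : ℝ) : ℂ) • (-A)) 1
        (((Real.exp u : ℝ) : ℂ)⁻¹ • laplace T (Real.exp (-u) : ℝ)) := by
      refine isOpResolvent_smul ht ?_
      rwa [one_div, ← Complex.ofReal_inv, ← Real.exp_neg]
    have h3 : ((Real.exp u : ℝ) : ℂ) • (-A) = -(((Real.exp u : ℝ) : ℂ) • A) := by
      refine LinearPMap.ext rfl fun y h1 h2 => ?_
      simp only [LinearPMap.smul_apply, LinearPMap.neg_apply, smul_neg]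
    rw [h3] at h2
    rw [unitResolvent, h2.eq, smul_apply, laplace, integral_comp_exp_univ,
      ContinuousLinearMap.integral_apply, ← integral_smul]
    · refine integral_congr_ae (Eventually.of_forall fun v => ?_)
      simp only [smul_apply, hk]
      rw [← Complex.coe_smul, ← Complex.coe_smul, smul_smul, smul_smul, ← Complex.ofReal_inv,
        ← Real.exp_neg]
      congr 1
      have h4 : Real.exp (v - u) = Real.exp (-u) * Real.exp v := by
        rw [← Real.exp_add]; ring_nf
      rw [h4]
      push_cast
      ring
    · have hTn : Continuous (fun v : ℝ => T (Real.exp v)) :=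
        hc.comp_continuous Real.continuous_exp (fun v => Real.exp_pos v)
      have hc2 : Continuous (fun v : ℝ => Real.exp v •
          (Complex.exp (-(((Real.exp (-u) : ℝ) : ℂ) * (Real.exp v : ℝ))) • T (Real.exp v))) := by
        exact Real.continuous_exp.smul ((by fun_prop : Continuous fun v : ℝ =>
          Complex.exp (-(((Real.exp (-u) : ℝ) : ℂ) * (Real.exp v : ℝ)))).smul hTn)
      refine Integrable.mono' (((integrable_exp_neg_mul_abs one_pos).const_mul
        (1 + 2 / Real.exp (-u) ^ 2)).mul_const M) hc2.aestronglyMeasurable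
        (Eventually.of_forall fun v => ?_)
      rw [norm_smul, norm_smul, ← mul_assoc, Real.norm_of_nonneg (Real.exp_pos _).le,
        ← Complex.ofReal_mul, ← Complex.ofReal_neg, ← Complex.ofReal_exp, Complex.norm_real,
        Real.norm_of_nonneg (Real.exp_pos _).le]
      exact mul_le_mul (mul_exp_neg_mul_le (Real.exp_pos _) v) (hM _ (Real.exp_pos v))
        (norm_nonneg _) (by positivity)
  simp only [smul_sub]
  have hxi := hki.smul_const x
  refine ⟨hxi.sub hTi, ?_⟩
  rw [integral_sub hxi hTi, integral_smul_const, hk1, one_smul, hJ]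

/-- For `θ = 0` the seminorm of `ψ₂` is dominated by that of `ψ₁`: the resolvent is an average of
the semigroup, so `ψ₂(tA)` is a multiplicative convolution of `ψ₁(sA)`. -/
theorem calcSeminorm_psiTwo_lt_top_of_psiOne (H : CalcAngle A ω) (hω : ω < Real.pi / 2)
    (hT : IsBoundedHolomorphicSemigroup T) (hg : IsGeneratorOf (-A) T) (hp : 1 ≤ p) {μ : ℝ}
    (hθ : thetaOf p μ = 0) {x : X} (hx : calcSeminorm A ω p μ psiOne x < ∞) :
    calcSeminorm A ω p μ psiTwo x < ∞ := by
  have hψ := memElementary_psiOne hω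
  rw [H.calcSeminorm_eq_calcOrbit hp _ (memElementary_psiTwo H.lt_pi), hθ]
  rw [H.calcSeminorm_eq_calcOrbit hp _ hψ, hθ] at hx
  set k : ℝ → ℝ := fun y => Real.exp (-y) * Real.exp (-Real.exp (-y)) with hk
  have hkm : Measurable (fun y => ENNReal.ofReal (k y)) := by fun_prop
  have hki : ∫⁻ y, ENNReal.ofReal (k y) < ∞ := by
    refine (lintegral_mono fun y => ENNReal.ofReal_le_ofReal ?_).trans_lt
      ((integrable_exp_neg_mul_abs one_pos).const_mul (1 + 2 / 1 ^ 2)).lintegral_lt_top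
    have := mul_exp_neg_mul_le one_pos (-y)
    rwa [one_mul, abs_neg] at this
  refine (eLpNorm_le_of_le_convolution hp hkm (fun _ => ENNReal.ofReal_ne_top)
    (H.measurable_enorm_calcOrbit hψ 0 x) fun u => ?_).trans_lt (ENNReal.mul_lt_top hki hx)
  have h1 := (unitResolvent_eq_integral hT hg u x).2
  rw [calcOrbit, zero_mul, neg_zero, Real.exp_zero, Complex.ofReal_one, one_smul,
    H.calc_psiTwo_dilate, sub_apply, one_apply_eq_self, ← h1]
  refine (enorm_integral_le_lintegral_enorm _).trans_eq (lintegral_congr fun v => ?_)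
  rw [enorm_smul, Real.enorm_eq_ofReal (by positivity), calcOrbit, zero_mul, neg_zero,
    Real.exp_zero, Complex.ofReal_one, one_smul, hk]
  simp only [neg_sub]
  congr 1
  have he := memElementary_exp_neg_mul hω (Real.exp_pos v)
  have h2 : elementaryCalc A ω (fun z => psiOne ((Real.exp v : ℝ) * z)) = T (Real.exp v) - 1 := by
    rw [H.semigroup_eq_calc hω hT hg (Real.exp_pos v), ← one_smul ℂ (1 : X →L[ℂ] X),
      ← H.calc_const, ← H.calc_sub he (memElementary_const 1)]
    rfl
  rw [h2, sub_apply, one_apply_eq_self, ← enorm_neg, neg_sub]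

/-- If `A ≠ 0`, some point outside the kernel of `A` has a finite seminorm for `ψ₃`. It is of the
form `ψ₃(A) y`, where almost orthogonality gives decay of `ψ₃(tA) ψ₃(A) y` at both ends. -/
theorem exists_psiThree_lt_top (H : CalcAngle A ω) (hp : 1 ≤ p) {μ : ℝ} (hθ : thetaOf p μ = 0)
    {y : A.domain} (hy : A y ≠ 0) :
    ∃ x : X, calcSeminorm A ω p μ psiThree x < ∞ ∧ unitResolvent A x ≠ x := by
  have hψ := memHInftyZero_psiThree H.lt_pi
  refine ⟨elementaryCalc A ω psiThree y, ?_, fun h => hy ?_⟩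
  · obtain ⟨C, α, hC, hα, hb⟩ := hψ.exp_bound H.lt_pi.le
    have hb' : ∀ w : ℂ, |w.im| < ω → ‖psiThree (Complex.exp w)‖ ≤
        C * Real.exp (0 * w.re) * Real.exp (-(α * |w.re|)) := fun w hw => by
      simpa using hb w hw
    have hb'' : ∀ w : ℂ, |w.im| < ω → ‖psiThree (Complex.exp w)‖ ≤
        C * Real.exp (-(0 * w.re)) * Real.exp (-(α * |w.re|)) := fun w hw => by
      simpa using hb w hw
    obtain ⟨K, hK, hker⟩ := H.norm_calc_mul_dilate_le hα hC.le hψ.memElementary hψ hb' hb''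
    rw [H.calcSeminorm_eq_calcOrbit hp _ hψ.memElementary, hθ]
    refine eLpNorm_lt_top_of_le_exp hp (half_pos hα) (C := K * ‖(y : X)‖) fun u => ?_
    rw [calcOrbit, zero_mul, neg_zero, Real.exp_zero, Complex.ofReal_one, one_smul]
    have h1 := hker u 0
    simp only [Real.exp_zero, Complex.ofReal_one, one_mul, zero_mul, mul_one, sub_zero] at h1
    rw [H.calc_mul (hψ.memElementary.dilate H.lt_pi (Real.exp_pos u)) hψ.memElementary] at h1
    refine (ContinuousLinearMap.le_of_opNorm_le _ h1 (y : X)).trans_eq ?_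
    ring
  -- if `J ψ₃(A) y = ψ₃(A) y`, then `J(A y) = A y`, as `ψ₃(A) y = J² A y` and `J` is injective; but
  -- the kernel and the range of `A` meet only in `0`
  · set J := unitResolvent A with hJ
    have hyJ : J (A y) = y - J y := by
      have := H.unitResolvent_apply y
      rw [map_add] at this
      exact eq_sub_of_add_eq' this
    rw [H.calc_psiThree, ← hJ] at h
    simp only [sub_apply, mul_apply_eq_comp] at h
    have h2 : J y - J (J y) = J (J (A y)) := by rw [hyJ, map_sub]
    rw [h2] at h
    have h3 : J (J (J (A y) - A y)) = 0 := by
      rw [map_sub, map_sub, h, sub_self]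
    have h4 := H.unitResolvent_injective (H.unitResolvent_injective h3)
    exact H.eq_zero_of_mem_range ⟨y, rfl⟩ (sub_eq_zero.1 h4)

end CalcAngle

end Seminorms

/-! ### Equivalent seminorms for semigroup generators -/

theorem proposition2p18 {X : Type*} [NormedAddCommGroup X] [NormedSpace ℂ X] [CompleteSpace X]
    (A : X →ₗ.[ℂ] X) (hA : IsSectorialOp A) :
    -- (i)
    (∀ (p : ℝ≥0∞) (μ ω : ℝ) (ψ γ : ℂ → ℂ), 1 ≤ p →
      sectorialityAngle A < ω → ω < Real.pi →
      MemElementary ω ψ → MemElementary ω γ →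
      (∃ z ∈ openSector ω, ψ z ≠ 0) → (∃ z ∈ openSector ω, γ z ≠ 0) →
      MemHInftyZero ω (fun z => z ^ (-(thetaOf p μ : ℂ)) * ψ z) →
      MemHInftyZero ω (fun z => z ^ (-(thetaOf p μ : ℂ)) * γ z) →
      (MemHInftyZero ω ψ ∨ McIntoshCondition A ω p μ ψ) →
      (MemHInftyZero ω γ ∨ McIntoshCondition A ω p μ γ) →
      EquivSeminorms (calcSeminorm A ω p μ ψ) (calcSeminorm A ω p μ γ)) ∧
    ∀ T : ℝ → X →L[ℂ] X, IsBoundedHolomorphicSemigroup T → IsGeneratorOf (-A) T →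
      -- the functions below are considered on sectors of half-angle in a nonempty interval
      sectorialityAngle A < Real.pi / 2 ∧
      ∀ ω : ℝ, sectorialityAngle A < ω → ω < Real.pi / 2 →
        -- (ii)
        (∀ (p : ℝ≥0∞) (θ : ℝ), 1 ≤ p → 0 < θ → θ < 1 →
          ∀ ψ ∈ ({psiOne, psiTwo, psiThree} : Set (ℂ → ℂ)),
            EquivSeminorms (calcSeminorm A ω p (muOf p θ) ψ)
              (homogeneousSeminorm A T p (muOf p θ)) ∧
            kSpace A p (muOf p θ) = calcSpace A ω p (muOf p θ) ψ) ∧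
        (calcSpace A ω ∞ 1 psiTwo = univ ∧ calcSpace A ω ∞ 1 psiExp = univ) ∧
        -- (iii)
        ((∃ y : A.domain, A y ≠ 0) →
          ∀ p : ℝ≥0∞, 1 ≤ p → p ≠ ∞ →
            EquivSeminorms (calcSeminorm A ω p (p.toReal - 1) psiThree)
              (homogeneousSeminorm A T p (p.toReal - 1)) ∧
            ∀ ψ ∈ ({psiOne, psiTwo} : Set (ℂ → ℂ)),
              ¬ EquivSeminorms (calcSeminorm A ω p (p.toReal - 1) ψ)
                (calcSeminorm A ω p (p.toReal - 1) psiThree) ∧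
              ¬ EquivSeminorms (calcSeminorm A ω p (p.toReal - 1) ψ)
                (homogeneousSeminorm A T p (p.toReal - 1))) := by
  refine ⟨fun p μ ω ψ γ hp hlt hπ hψ hγ hψ0 hγ0 hψθ hγθ hψc hγc =>
    (CalcAngle.mk hA hlt hπ).equivSeminorms hp μ hψ hγ hψ0 hγ0 hψθ hγθ
      (McIntoshCondition.trichotomy hψθ hψc) (McIntoshCondition.trichotomy hγθ hγc),
    fun T hT hg => ⟨hT.sectorialityAngle_lt hg, fun ω hlt hω => ?_⟩⟩
  have hπ : ω < Real.pi := by linarith [Real.pi_pos]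
  have H : CalcAngle A ω := ⟨hA, hlt, hπ⟩
  refine ⟨fun p θ hp h0 h1 => ?_, ⟨H.calcSpace_top_eq_univ (memElementary_psiTwo hπ),
    H.calcSpace_top_eq_univ (memHInftyZero_psiExp hω).memElementary⟩, fun ⟨y, hy⟩ p hp hpt => ?_⟩
  · have hθ := thetaOf_muOf hp θ
    -- every admissible function is compared with `z e^{-z}`, which represents the semigroup
    have key : ∀ ψ ∈ ({psiOne, psiTwo, psiThree} : Set (ℂ → ℂ)),
        EquivSeminorms (calcSeminorm A ω p (muOf p θ) ψ)
          (calcSeminorm A ω p (muOf p θ) psiExp) := by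
      intro ψ hψ
      obtain ⟨hE, hne, hz⟩ : MemElementary ω ψ ∧ (∃ z ∈ openSector ω, ψ z ≠ 0) ∧
          MemHInftyZero ω (fun z => z ^ (-(θ : ℂ)) * ψ z) := by
        rcases hψ with rfl | rfl | rfl
        · exact ⟨memElementary_psiOne hω, exists_psiOne_ne_zero H.pos,
            memHInftyZero_cpow_mul_psiOne hω h0 h1⟩
        · exact ⟨memElementary_psiTwo hπ, exists_psiTwo_ne_zero H.pos,
            memHInftyZero_cpow_mul_psiTwo hπ h0 h1⟩
        · exact ⟨(memHInftyZero_psiThree hπ).memElementary, exists_psiThree_ne_zero H.pos,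
            memHInftyZero_cpow_mul_psiThree hπ (by linarith) h1⟩
      refine H.equivSeminorms hp _ hE (memHInftyZero_psiExp hω).memElementary hne
        (exists_psiExp_ne_zero H.pos) ?_ ?_ (Or.inr (Or.inl ?_)) (Or.inr (Or.inl ?_))
      all_goals rw [hθ]
      exacts [hz, memHInftyZero_cpow_mul_psiExp hω (by linarith) h1, h0, h0]
    intro ψ hψ
    rw [H.homogeneousSeminorm_eq hω hT hg hp]
    refine ⟨key ψ hψ, ?_⟩
    rw [H.kSpace_eq hp (by rwa [hθ]) (by rwa [hθ])]
    ext x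
    exact ((key psiTwo (by simp)).lt_top_iff x).trans ((key ψ hψ).lt_top_iff x).symm
  · have hθ := thetaOf_sub_one hp hpt
    rw [H.homogeneousSeminorm_eq hω hT hg hp]
    have key : EquivSeminorms (calcSeminorm A ω p (p.toReal - 1) psiThree)
        (calcSeminorm A ω p (p.toReal - 1) psiExp) := by
      refine H.equivSeminorms hp _ (memHInftyZero_psiThree hπ).memElementary
        (memHInftyZero_psiExp hω).memElementary (exists_psiThree_ne_zero H.pos)
        (exists_psiExp_ne_zero H.pos) ?_ ?_ (Or.inl (memHInftyZero_psiThree hπ))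
        (Or.inl (memHInftyZero_psiExp hω))
      all_goals rw [hθ]
      exacts [memHInftyZero_cpow_mul_psiThree hπ (by norm_num) one_pos,
        memHInftyZero_cpow_mul_psiExp hω (by norm_num) one_pos]
    refine ⟨key, ?_⟩
    obtain ⟨x, hx, hne⟩ := H.exists_psiThree_lt_top hp hθ hy
    have hne' : ∀ ψ ∈ ({psiOne, psiTwo} : Set (ℂ → ℂ)),
        ¬ calcSeminorm A ω p (p.toReal - 1) ψ x < ∞ := by
      rintro ψ (rfl | rfl) h
      · exact hne (H.unitResolvent_eq_of_psiTwo hp hpt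
          (H.calcSeminorm_psiTwo_lt_top_of_psiOne hω hT hg hp hθ h))
      · exact hne (H.unitResolvent_eq_of_psiTwo hp hpt h)
    exact fun ψ hψ => ⟨fun h => hne' ψ hψ ((h.lt_top_iff x).2 hx),
      fun h => hne' ψ hψ ((h.lt_top_iff x).2 ((key.lt_top_iff x).1 hx))⟩
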